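/- Let $M$ be a compact oriented smooth $4$-manifold with (possibly empty) boundary, and let $(V,\eta)\to M$ be a Minkowski bundle, i.e. an oriented rank-$4$ vector bundle with a fibre metric of signature $(3,1)$ and structure group $SO(3,1)$; let $\mathrm{tr}\colon\Lambda^4V\to\mathbb R$ be the map taking the value $1$ on oriented orthonormal frames. Let $\mathfrak g=\mathfrak{so}(3,1)\cong\Lambda^2\mathbb R^{3,1}$, where $p\wedge q$ acts by $u\mapsto\eta(q,u)p-\eta(p,u)q$, with the normalised Killing form $\langle\alpha,v\wedge w\rangle=-\eta(\alpha v,w)$, and let $\star\colon\mathfrak g\to\mathfrak g$ be the Hodge star, determined by $\langle\star\alpha,\beta\rangle=\mathrm{tr}[\alpha\wedge\beta]$. Let $T\in\mathrm{Aut}(\mathfrak g)$ be an automorphism of $\mathfrak g$ as a $\mathfrak g$-module (a bijective linear map commuting with the adjoint action) and $\beta\in\mathbb R$ such that $\mathrm{id}+\beta T$ is invertible. The fields are $e\in\Omega^1(M;V)$, an $\eta$-compatible connection $A$ with curvature $F_A$, and $\tau\in\Omega^2(M;V)$. Quadratic generalised Holst theory (qgH) has the action $$S_{T,\beta}(e,A,\tau)=\int_M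 \tfrac12\langle(\mathrm{id}+\beta T)^{-1}F_A, e\wedge e\rangle-\eta(\tau,d_Ae)-\tfrac12(1+\beta)\,\eta(\tau,\tau),$$ and half-shell Palatini–Cartan theory has the action $S_{PC}(e,A,\tau)=\int_M \tfrac12\mathrm{tr}[F_A\wedge e\wedge e]-\eta(\tau,d_Ae)$. For a Lagrangian density $L$ of this kind write $\delta L=\mathrm{el}+d\theta$, where $\mathrm{el}$ and $\theta$ are $C^\infty(M)$-linear in the variation of the fields; set $\tilde\alpha=\int_{\partial M}\theta$ and $\tilde\varpi=\delta\tilde\alpha$. The *geometric phase space* (space of classical boundary fields) is the quotient of the space of fields by the null distribution of $\tilde\varpi$ (two fields being identified if they are joined by a finite chain of smooth curves tangent to $\ker\tilde\varpi$, traversed in either direction). Its *Cauchy data* are the points represented by a field with $\mathrm{el}=0$ in a neighbourhood of $\partial M$. An isomorphism of geometric phase spaces is a bijection induced by a diffeomorphism $\Psi$ of the spaces of fields that leaves $e$ unchanged; it is symplectic if $\Psi^*\tilde\varpi'=\tilde\varpi$ and conformally symplectic with factor $k$ if $k\,\Psi^*\tilde\varpi'=\tilde\varpi$. Then, for $\beta=-1$: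 1. $\star$ is invertible, $T=\mathrm{id}-\star^{-1}$ is an automorphism of the $\mathfrak g$-module $\mathfrak g$, and for this $T$ one has $S_{T,-1}=S_{PC}$ on all fields. 2. For every automorphism $T\neq\mathrm{id}$ of the $\mathfrak g$-module $\mathfrak g$, $\mathrm{id}-T$ is invertible, and the geometric phase space of qgH theory with $\beta=-1$ is symplectically isomorphic to that of half-shell Palatini–Cartan theory. 3. If, moreover, $T$ is not a real multiple of $\mathrm{id}$, then the two theories have the same degrees of freedom: there is an isomorphism of their geometric phase spaces, conformally symplectic with some constant factor $k\neq0$, that maps the Cauchy data of qgH theory onto the Cauchy data of half-shell Palatini–Cartan theory. -/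

import Mathlib

open scoped Manifold ContDiff Topology
open Bundle Set

/-! ## Minkowski space and the Lie algebra `𝔰𝔬(3,1)` -/

namespace QGH

noncomputable section

/-- The underlying vector space `ℝ⁴` of Minkowski space. -/
abbrev Mink : Type := Fin 4 → ℝ

/-- The signs `(-1, 1, 1, 1)` of the Minkowski metric. -/
def sgn : Fin 4 → ℝ := ![-1, 1, 1, 1]

/-- The Minkowski metric `η` of signature `(3,1)`. -/
def minkowskiForm : LinearMap.BilinForm ℝ Mink := Matrix.toBilin' (Matrix.diagonal sgn)

/-- The Lie algebra `𝔤 = 𝔰𝔬(3,1)` of `η`-skew endomorphisms of Minkowski space. -/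
abbrev so31 : Submodule ℝ (Module.End ℝ Mink) := minkowskiForm.skewAdjointSubmodule

/-- The Lie bracket (commutator) of `𝔰𝔬(3,1)`. -/
def bracket (X Y : so31) : so31 :=
  ⟨⁅(X : Module.End ℝ Mink), (Y : Module.End ℝ Mink)⁆,
    LinearMap.BilinForm.isSkewAdjoint_bracket _ X.2 Y.2⟩

/-- Deformation automorphisms: the automorphisms of `𝔤 = 𝔰𝔬(3,1)` as a `𝔤`-module, that is, the
bijective linear maps that commute with the adjoint action. -/
def IsDeformation (T : Module.End ℝ so31) : Prop :=
  Function.Bijective T ∧ ∀ X Y : so31, T (bracket X Y) = bracket X (T Y)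

theorem minkowskiForm_apply (u v : Mink) : minkowskiForm u v = ∑ i, sgn i * u i * v i := by
  simp [minkowskiForm, Matrix.toBilin'_apply, Matrix.diagonal_apply, mul_comm, mul_left_comm]

theorem sgn_mul_self (i : Fin 4) : sgn i * sgn i = 1 := by
  fin_cases i <;> simp [sgn]

/-- The scalar `tr[α ∧ v ∧ w]` for `α ∈ 𝔰𝔬(3,1) ≅ ⋀² ℝ⁴` and `v, w ∈ ℝ⁴`, where
`tr : ⋀⁴ ℝ⁴ → ℝ` takes the value `1` on the standard basis. An element `α` of `𝔰𝔬(3,1)`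
corresponds to the bivector `½ ∑ᵢ ηⁱⁱ α(bᵢ) ∧ bᵢ`; that is, `p ∧ q` acts by
`u ↦ η(q, u) p - η(p, u) q`. -/
def traceModel (α : Module.End ℝ Mink) (v w : Mink) : ℝ :=
  (1 / 2) * ∑ i, sgn i * Matrix.detRowAlternating ![α (Pi.single i 1), Pi.single i 1, v, w]

/-- The normalised Killing form `⟨α, v ∧ w⟩ = -η(α v, w)`, paired with the bivector `v ∧ w`. On
`𝔰𝔬(3,1)` it is the form `⟨α, β⟩ = -½ Tr(α β)`. -/
def killingModel (α : Module.End ℝ Mink) (v w : Mink) : ℝ := -minkowskiForm (α v) w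

theorem traceModel_add (α β : Module.End ℝ Mink) (v w : Mink) :
    traceModel (α + β) v w = traceModel α v w + traceModel β v w := by
  have h : ∀ i : Fin 4, Matrix.detRowAlternating
      ![(α + β) (Pi.single i 1), Pi.single i 1, v, w] =
      Matrix.detRowAlternating ![α (Pi.single i 1), (Pi.single i 1 : Mink), v, w] +
      Matrix.detRowAlternating ![β (Pi.single i 1), (Pi.single i 1 : Mink), v, w] :=
    fun i => (Matrix.detRowAlternating (n := Fin 4) (R := ℝ)).map_vecCons_add
      ![(Pi.single i 1 : Mink), v, w] (α (Pi.single i 1)) (β (Pi.single i 1))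
  simp only [traceModel, h, mul_add, Finset.sum_add_distrib]

theorem traceModel_smul (c : ℝ) (α : Module.End ℝ Mink) (v w : Mink) :
    traceModel (c • α) v w = c * traceModel α v w := by
  have h : ∀ i : Fin 4, Matrix.detRowAlternating
      ![(c • α) (Pi.single i 1), Pi.single i 1, v, w] =
      c * Matrix.detRowAlternating ![α (Pi.single i 1), (Pi.single i 1 : Mink), v, w] :=
    fun i => (Matrix.detRowAlternating (n := Fin 4) (R := ℝ)).map_vecCons_smul
      ![(Pi.single i 1 : Mink), v, w] c (α (Pi.single i 1))
  simp only [traceModel, h, Finset.mul_sum]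
  exact Finset.sum_congr rfl fun i _ => by ring

theorem traceModel_swap (α : Module.End ℝ Mink) (v w : Mink) :
    traceModel α v w = -traceModel α w v := by
  have h : ∀ i : Fin 4, Matrix.detRowAlternating ![α (Pi.single i 1), Pi.single i 1, v, w] =
      -Matrix.detRowAlternating ![α (Pi.single i 1), (Pi.single i 1 : Mink), w, v] := by
    intro i
    rw [← (Matrix.detRowAlternating (n := Fin 4) (R := ℝ)).map_swap _
      (show (2 : Fin 4) ≠ 3 by decide)]
    congr 1
    ext j : 1
    fin_cases j <;> rfl
  simp only [traceModel, h, mul_neg, Finset.sum_neg_distrib]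

theorem update_two (a b v w : Mink) : ![a, b, v, w] = Function.update ![a, b, 0, w] 2 v := by
  ext i : 1
  fin_cases i <;> rfl

theorem traceModel_add_left (α : Module.End ℝ Mink) (v v' w : Mink) :
    traceModel α (v + v') w = traceModel α v w + traceModel α v' w := by
  have h : ∀ i : Fin 4, Matrix.detRowAlternating ![α (Pi.single i 1), Pi.single i 1, v + v', w] =
      Matrix.detRowAlternating ![α (Pi.single i 1), (Pi.single i 1 : Mink), v, w] +
      Matrix.detRowAlternating ![α (Pi.single i 1), (Pi.single i 1 : Mink), v', w] := by
    intro i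
    rw [update_two _ _ (v + v') w, update_two _ _ v w, update_two _ _ v' w]
    exact Matrix.detRowAlternating.map_update_add _ 2 v v'
  simp only [traceModel, h, mul_add, Finset.sum_add_distrib]

theorem traceModel_smul_left (c : ℝ) (α : Module.End ℝ Mink) (v w : Mink) :
    traceModel α (c • v) w = c * traceModel α v w := by
  have h : ∀ i : Fin 4, Matrix.detRowAlternating ![α (Pi.single i 1), Pi.single i 1, c • v, w] =
      c * Matrix.detRowAlternating ![α (Pi.single i 1), (Pi.single i 1 : Mink), v, w] := by
    intro i
    rw [update_two _ _ (c • v) w, update_two _ _ v w]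
    exact Matrix.detRowAlternating.map_update_smul _ 2 c v
  simp only [traceModel, h, Finset.mul_sum]
  exact Finset.sum_congr rfl fun i _ => by ring

/-- The internal Hodge star of `α`, as an endomorphism of Minkowski space. -/
def starEnd (α : Module.End ℝ Mink) : Module.End ℝ Mink where
  toFun v j := -(sgn j * traceModel α v (Pi.single j 1))
  map_add' v v' := by
    ext j
    simp only [traceModel_add_left, Pi.add_apply]
    ring
  map_smul' c v := by
    ext j
    simp only [traceModel_smul_left, Pi.smul_apply, smul_eq_mul, RingHom.id_apply]
    ring

/-- The Hodge star satisfies `⟨⋆α, v ∧ w⟩ = tr[α ∧ v ∧ w]`. -/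
theorem killingModel_starEnd (α : Module.End ℝ Mink) (v w : Mink) :
    killingModel (starEnd α) v w = traceModel α v w := by
  have hw : traceModel α v w = ∑ j, w j * traceModel α v (Pi.single j 1) := by
    let f : Mink →ₗ[ℝ] ℝ :=
      { toFun := fun w => traceModel α v w
        map_add' := fun a b => by
          rw [traceModel_swap, traceModel_add_left, traceModel_swap α a, traceModel_swap α b]
          ring
        map_smul' := fun c a => by
          rw [traceModel_swap, traceModel_smul_left, traceModel_swap α a]
          simp }
    have := LinearMap.pi_apply_eq_sum_univ f w
    simp only [smul_eq_mul] at this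
    refine this.trans (Finset.sum_congr rfl fun j _ => ?_)
    have hj : (fun i => if j = i then (1 : ℝ) else 0) = Pi.single j 1 := by
      ext i
      simp [Pi.single_apply, eq_comm]
    rw [hj]
    rfl
  rw [hw, killingModel, minkowskiForm_apply, ← Finset.sum_neg_distrib]
  refine Finset.sum_congr rfl fun j _ => ?_
  change -(sgn j * -(sgn j * traceModel α v (Pi.single j 1)) * w j) = _
  linear_combination (w j * traceModel α v (Pi.single j 1)) * sgn_mul_self j

theorem minkowskiForm_symm (u v : Mink) : minkowskiForm u v = minkowskiForm v u := by
  simp only [minkowskiForm_apply]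
  exact Finset.sum_congr rfl fun i _ => by ring

theorem starEnd_mem (α : Module.End ℝ Mink) : starEnd α ∈ so31 := by
  rw [LinearMap.mem_skewAdjointSubmodule]
  intro v w
  have h1 := killingModel_starEnd α v w
  have h2 := killingModel_starEnd α w v
  have h3 := traceModel_swap α v w
  rw [killingModel] at h1 h2
  have h4 := minkowskiForm_symm v (starEnd α w)
  change minkowskiForm (starEnd α v) w = minkowskiForm v (-(starEnd α w))
  rw [map_neg]
  linarith

/-- The internal Hodge star `⋆ : 𝔤 → 𝔤` on `𝔤 = 𝔰𝔬(3,1) ≅ ⋀² ℝ⁴`, in indices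
`(⋆α)ᵃᵇ = ½ εᵃᵇ_{cd} αᶜᵈ`. -/
def star : Module.End ℝ so31 where
  toFun α := ⟨starEnd α, starEnd_mem α⟩
  map_add' α β := by
    ext v j
    simp [starEnd, traceModel_add]
    ring
  map_smul' c α := by
    ext v j
    simp [starEnd, traceModel_smul]
    ring

/-- The deformation `id - ⋆⁻¹`. -/
def starDeformation : Module.End ℝ so31 := 1 + (-1 : ℝ) • Ring.inverse star

/-! ## Differential forms in charts, integration -/

section Forms

variable {n : ℕ} {H : Type*} [TopologicalSpace H]
  (I : ModelWithCorners ℝ (EuclideanSpace ℝ (Fin n)) H)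
  {M : Type*} [TopologicalSpace M] [ChartedSpace H M]

/-- The expression of a form `α` in the chart at `c`, evaluated at the point with coordinates `y`
on the constant vector fields `v`. A form is regarded as a function of a point and of a tuple of
tangent vectors at that point. -/
def chartRep {k : ℕ} (α : ∀ x : M, (Fin k → TangentSpace I x) → ℝ) (c : M)
    (y : EuclideanSpace ℝ (Fin n)) (v : Fin k → EuclideanSpace ℝ (Fin n)) : ℝ :=
  α ((extChartAt I c).symm y) fun i =>
    mfderivWithin 𝓘(ℝ, EuclideanSpace ℝ (Fin n)) I (extChartAt I c).symm (range I) y (v i)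

/-- A form is smooth if its coefficients in every chart are smooth. -/
def IsSmoothForm {k : ℕ} (α : ∀ x : M, TangentSpace I x [⋀^Fin k]→ₗ[ℝ] ℝ) : Prop :=
  ∀ (c : M) (v : Fin k → EuclideanSpace ℝ (Fin n)),
    ContDiffOn ℝ ∞ (fun y => chartRep I (fun x => α x) c y v) (extChartAt I c).target

/-- The exterior derivative `(dα)_x(v₀, …, v_k) = ∑ᵢ (-1)ⁱ ∂_{vᵢ} α(v₀, …, v̂ᵢ, …, v_k)`, computed in
the chart at `x`, through which `TangentSpace I x` is identified with the model space. -/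
def extDer {k : ℕ} (α : ∀ x : M, TangentSpace I x [⋀^Fin k]→ₗ[ℝ] ℝ) (x : M)
    (v : Fin (k + 1) → TangentSpace I x) : ℝ :=
  ∑ i : Fin (k + 1), (-1 : ℝ) ^ (i : ℕ) *
    fderivWithin ℝ (fun y => chartRep I (fun x => α x) x y fun j => v (i.succAbove j)) (range I)
      (extChartAt I x x) (v i)

variable (M) in
/-- A smooth partition of unity subordinate to the chart domains. -/
def chartPartition [IsManifold I ∞ M] [CompactSpace M] [T2Space M] :
    SmoothPartitionOfUnity M I M univ :=
  Classical.choose (SmoothPartitionOfUnity.exists_isSubordinate_chartAt_source I M)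

/-- The integral over the compact `n`-manifold `M` of the `n`-form `α`, for the orientation in
which a basis `b` of a tangent space is positive if and only if `o x b > 0`. -/
def integral [IsManifold I ∞ M] [CompactSpace M] [T2Space M]
    (o α : ∀ x : M, (Fin n → TangentSpace I x) → ℝ) : ℝ :=
  ∑ᶠ c : M, ∫ y in (extChartAt I c).target,
    chartPartition I M c ((extChartAt I c).symm y) *
      (SignType.sign (chartRep I o c y fun i => EuclideanSpace.single i 1) : ℝ) *
      chartRep I α c y fun i => EuclideanSpace.single i 1

end Forms

/-- An orientation of the 4-manifold with boundary `M`, given by a smooth nowhere vanishing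
4-form. -/
structure OrientationForm (M : Type*) [TopologicalSpace M]
    [ChartedSpace (EuclideanHalfSpace 4) M] where
  form : ∀ x : M, TangentSpace (𝓡∂ 4) x [⋀^Fin 4]→ₗ[ℝ] ℝ
  smooth : IsSmoothForm (𝓡∂ 4) form
  ne_zero : ∀ x, form x ≠ 0

/-- A realisation of the boundary of `M` as a 3-manifold `N`: an injective immersion of `N` which is
a homeomorphism onto `∂M`. -/
structure BoundaryInclusion (M N : Type*) [TopologicalSpace M]
    [ChartedSpace (EuclideanHalfSpace 4) M] [TopologicalSpace N]
    [ChartedSpace (EuclideanSpace ℝ (Fin 3)) N] where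
  incl : N → M
  contMDiff : ContMDiff (𝓡 3) (𝓡∂ 4) ∞ incl
  isEmbedding : Topology.IsEmbedding incl
  immersion : ∀ p, Function.Injective (mfderiv (𝓡 3) (𝓡∂ 4) incl p)
  range_eq : range incl = (𝓡∂ 4).boundary M

section Boundary

variable {M N : Type*} [TopologicalSpace M] [ChartedSpace (EuclideanHalfSpace 4) M]
  [TopologicalSpace N] [ChartedSpace (EuclideanSpace ℝ (Fin 3)) N]

/-- The boundary orientation: `(v₁, v₂, v₃)` is positive if `(ν, v₁, v₂, v₃)` is, where `ν` is an
outward pointing vector. In the chart at a boundary point, `M` is the set where the coordinate with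
index `0` is nonnegative, so minus the corresponding coordinate vector is outward pointing. -/
def boundaryOrientation (o : OrientationForm M) (b : BoundaryInclusion M N) (p : N)
    (v : Fin 3 → TangentSpace (𝓡 3) p) : ℝ :=
  let ν : EuclideanSpace ℝ (Fin 4) := -EuclideanSpace.single 0 1
  o.form (b.incl p) (Fin.cons (α := fun _ => TangentSpace (𝓡∂ 4) (b.incl p)) ν
    fun i => mfderiv (𝓡 3) (𝓡∂ 4) b.incl p (v i))

/-- The integral `∫_{∂M} α` of (the pullback to `∂M` of) a 3-form on `M`. -/
def boundaryIntegral [IsManifold (𝓡 3) ∞ N] [CompactSpace N] [T2Space N] (o : OrientationForm M)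
    (b : BoundaryInclusion M N) (α : ∀ x : M, TangentSpace (𝓡∂ 4) x [⋀^Fin 3]→ₗ[ℝ] ℝ) : ℝ :=
  integral (𝓡 3) (boundaryOrientation o b)
    fun p v => α (b.incl p) fun i => mfderiv (𝓡 3) (𝓡∂ 4) b.incl p (v i)

end Boundary

/-! ## Minkowski bundles, connections and fields -/

section Fields

variable {M : Type*} [TopologicalSpace M] [ChartedSpace (EuclideanHalfSpace 4) M]
  (V : M → Type*) [TopologicalSpace (TotalSpace Mink V)] [∀ x, AddCommGroup (V x)]
  [∀ x, Module ℝ (V x)] [∀ x, TopologicalSpace (V x)] [FiberBundle Mink V]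

/-- A Minkowski bundle: a rank 4 vector bundle `V` with a fibre metric `η` and a fibrewise volume
form that admits smooth local oriented orthonormal frames. These frames are the local sections of
the associated principal `SO(3,1)`-bundle `P`. -/
structure MinkowskiBundle where
  η : ∀ x, LinearMap.BilinForm ℝ (V x)
  vol : ∀ x, V x [⋀^Fin 4]→ₗ[ℝ] ℝ
  exists_frame : ∀ x₀ : M, ∃ U ∈ 𝓝 x₀, ∃ b : Fin 4 → ∀ x, V x,
    (∀ i, ContMDiffOn (𝓡∂ 4) ((𝓡∂ 4).prod 𝓘(ℝ, Mink)) ∞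
      (fun x => (⟨x, b i x⟩ : TotalSpace Mink V)) U) ∧
    ∀ x ∈ U, (∀ i j, η x (b i x) (b j x) = if i = j then sgn i else 0) ∧
      vol x (fun i => b i x) = 1

variable {V}

namespace MinkowskiBundle

variable (P : MinkowskiBundle V)

theorem exists_frameAt (x : M) : ∃ b : Fin 4 → V x,
    (∀ i j, P.η x (b i) (b j) = if i = j then sgn i else 0) ∧ P.vol x b = 1 := by
  obtain ⟨U, hU, b, -, hb⟩ := P.exists_frame x
  exact ⟨fun i => b i x, hb x (mem_of_mem_nhds hU)⟩

/-- A chosen oriented orthonormal basis of the fibre over `x`. -/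
def frameVec (x : M) : Fin 4 → V x := Classical.choose (P.exists_frameAt x)

theorem η_frameVec (x : M) (i j : Fin 4) :
    P.η x (P.frameVec x i) (P.frameVec x j) = if i = j then sgn i else 0 :=
  (Classical.choose_spec (P.exists_frameAt x)).1 i j

variable [VectorBundle ℝ Mink V]

/-- The oriented isometry from Minkowski space to the fibre over `x` given by the chosen basis. -/
def frame (x : M) : Mink ≃ₗ[ℝ] V x :=
  let e : V x ≃ₗ[ℝ] Mink := ((trivializationAt Mink V x).continuousLinearEquivAt ℝ x
    (FiberBundle.mem_baseSet_trivializationAt' x)).toLinearEquiv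
  haveI : FiniteDimensional ℝ (V x) := e.symm.finiteDimensional
  let f : Mink →ₗ[ℝ] V x := Fintype.linearCombination ℝ (P.frameVec x)
  have hf : Function.Injective f := by
    rw [← LinearMap.ker_eq_bot, LinearMap.ker_eq_bot']
    intro u hu
    ext i
    have h : P.η x (P.frameVec x i) (f u) = 0 := by rw [hu, map_zero]
    simp only [f, Fintype.linearCombination_apply, map_sum, map_smul, P.η_frameVec,
      smul_eq_mul, mul_ite, mul_zero, Finset.sum_ite_eq, Finset.mem_univ, if_true] at h
    have hs : sgn i ≠ 0 := fun h0 => by simpa [h0] using sgn_mul_self i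
    simpa [hs] using h
  LinearEquiv.ofBijective f ⟨hf, (LinearMap.injective_iff_surjective_of_finrank_eq_finrank
    e.finrank_eq.symm).1 hf⟩

end MinkowskiBundle

/-- A principal connection on `P`, that is, a smooth covariant derivative on `V` for which `η` is
parallel. -/
structure Connection [∀ x, IsTopologicalAddGroup (V x)] [∀ x, ContinuousSMul ℝ (V x)]
    [IsManifold (𝓡∂ 4) ∞ M] [VectorBundle ℝ Mink V]
    (P : MinkowskiBundle V) where
  cov : CovariantDerivative (𝓡∂ 4) Mink V
  smooth : cov.ContMDiffCovariantDerivative ∞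
  metric : ∀ (σ σ' : ∀ x, V x) (x : M),
    MDifferentiableAt (𝓡∂ 4) ((𝓡∂ 4).prod 𝓘(ℝ, Mink))
      (fun y => (⟨y, σ y⟩ : TotalSpace Mink V)) x →
    MDifferentiableAt (𝓡∂ 4) ((𝓡∂ 4).prod 𝓘(ℝ, Mink))
      (fun y => (⟨y, σ' y⟩ : TotalSpace Mink V)) x →
    ∀ u : TangentSpace (𝓡∂ 4) x,
      mfderiv (𝓡∂ 4) 𝓘(ℝ, ℝ) (fun y => P.η y (σ y) (σ' y)) x u =
        P.η x (cov σ x u) (σ' x) + P.η x (σ x) (cov σ' x u)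

end Fields

section Theories

variable {M : Type*} [TopologicalSpace M] [ChartedSpace (EuclideanHalfSpace 4) M]
  [IsManifold (𝓡∂ 4) ∞ M]
  {V : M → Type*} [TopologicalSpace (TotalSpace Mink V)] [∀ x, AddCommGroup (V x)]
  [∀ x, Module ℝ (V x)] [∀ x, TopologicalSpace (V x)] [∀ x, IsTopologicalAddGroup (V x)]
  [∀ x, ContinuousSMul ℝ (V x)] [FiberBundle Mink V] [VectorBundle ℝ Mink V]
  [ContMDiffVectorBundle ∞ Mink V (𝓡∂ 4)]

/-- The model tangent space of a 4-manifold. -/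
abbrev E4 : Type := EuclideanSpace ℝ (Fin 4)

/-- Smooth triples consisting of a `V`-valued 1-form, an `End V`-valued 1-form and a `V`-valued
bilinear form on `TM`. -/
abbrev PreField (V : M → Type*) [TopologicalSpace (TotalSpace Mink V)] [∀ x, AddCommGroup (V x)]
    [∀ x, Module ℝ (V x)] [∀ x, TopologicalSpace (V x)] [∀ x, IsTopologicalAddGroup (V x)]
    [∀ x, ContinuousSMul ℝ (V x)] [FiberBundle Mink V] [VectorBundle ℝ Mink V]
    [ContMDiffVectorBundle ∞ Mink V (𝓡∂ 4)] : Type _ :=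
  Cₛ^∞⟮𝓡∂ 4; E4 →L[ℝ] Mink, fun x : M => TangentSpace (𝓡∂ 4) x →L[ℝ] V x⟯ ×
  Cₛ^∞⟮𝓡∂ 4; Mink →L[ℝ] E4 →L[ℝ] Mink, fun x : M => V x →L[ℝ] TangentSpace (𝓡∂ 4) x →L[ℝ] V x⟯ ×
  Cₛ^∞⟮𝓡∂ 4; E4 →L[ℝ] E4 →L[ℝ] Mink,
    fun x : M => TangentSpace (𝓡∂ 4) x →L[ℝ] TangentSpace (𝓡∂ 4) x →L[ℝ] V x⟯

/-- The triples `(e, a, τ)` in which `a` takes values in `η`-skew endomorphisms and `τ` is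
alternating. -/
def fieldSubmodule (P : MinkowskiBundle V) : Submodule ℝ (PreField V) where
  carrier := {φ | (∀ x s t u, P.η x (φ.2.1 x s u) t + P.η x s (φ.2.1 x t u) = 0) ∧
    ∀ x u, φ.2.2 x u u = 0}
  add_mem' {φ ψ} hφ hψ := by
    refine ⟨fun x s t u => ?_, fun x u => ?_⟩
    · have h1 := hφ.1 x s t u
      have h2 := hψ.1 x s t u
      simp only [Prod.snd_add, Prod.fst_add, ContMDiffSection.coe_add, Pi.add_apply,
        add_apply, map_add, LinearMap.add_apply]
      linarith
    · have h1 := hφ.2 x u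
      have h2 := hψ.2 x u
      simp [h1, h2]
  zero_mem' := by
    refine ⟨fun x s t u => ?_, fun x u => ?_⟩ <;> simp
  smul_mem' c φ hφ := by
    refine ⟨fun x s t u => ?_, fun x u => ?_⟩
    · have h1 := hφ.1 x s t u
      simp only [Prod.smul_snd, Prod.smul_fst, ContMDiffSection.coe_smul, Pi.smul_apply,
        smul_apply, map_smul, LinearMap.smul_apply, smul_eq_mul]
      rw [← mul_add, h1, mul_zero]
    · have h1 := hφ.2 x u
      simp [h1]

/-- The space of fields `(e, A, τ)`, with `e ∈ Ω¹(M; V)`, `A` a principal connection and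
`τ ∈ Ω²(M; V)`. Connections form an affine space over `Ω¹(M; 𝔰𝔬(V))`; once an origin `A₀` is fixed,
`A = A₀ + a` is given by the 1-form `a`. The space of fields is thereby a real vector space, and its
elements also serve as tangent vectors (variations of fields). -/
def FieldSpace (P : MinkowskiBundle V) : Type _ := fieldSubmodule P

instance fieldSpaceAddCommMonoid (P : MinkowskiBundle V) : AddCommMonoid (FieldSpace P) :=
  (fieldSubmodule P).addCommMonoid

instance fieldSpaceModule (P : MinkowskiBundle V) : Module ℝ (FieldSpace P) :=
  (fieldSubmodule P).module

variable {P : MinkowskiBundle V}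

namespace FieldSpace

/-- The coframe `e`. -/
def e (φ : FieldSpace P) (x : M) : TangentSpace (𝓡∂ 4) x →L[ℝ] V x := φ.1.1 x

/-- The 1-form `a = A - A₀`; the argument in `V x` comes first. -/
def a (φ : FieldSpace P) (x : M) : V x →L[ℝ] TangentSpace (𝓡∂ 4) x →L[ℝ] V x := φ.1.2.1 x

/-- The 2-form `τ`. -/
def τ (φ : FieldSpace P) (x : M) :
    TangentSpace (𝓡∂ 4) x →L[ℝ] TangentSpace (𝓡∂ 4) x →L[ℝ] V x := φ.1.2.2 x

/-- The covariant derivative of the connection `A = A₀ + a`. -/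
def cov (A₀ : Connection P) (φ : FieldSpace P) : CovariantDerivative (𝓡∂ 4) Mink V :=
  A₀.cov.addOneForm φ.a

end FieldSpace

/-- A local extension of a tangent vector to a vector field that is smooth near its base point. -/
def extendT {x : M} (u : TangentSpace (𝓡∂ 4) x) : ∀ y : M, TangentSpace (𝓡∂ 4) y :=
  FiberBundle.extend E4 u

/-- A local extension of a vector in a fibre of `V` to a section smooth near its base point. -/
def extendV {x : M} (s : V x) : ∀ y : M, V y := FiberBundle.extend Mink s

/-- The torsion `(d_A e)(u, v) = ∇_u(e(v)) - ∇_v(e(u)) - e([u, v])`. -/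
def torsion (A₀ : Connection P) (φ : FieldSpace P) (x : M) (u v : TangentSpace (𝓡∂ 4) x) : V x :=
  φ.cov A₀ (fun y => φ.e y (extendT v y)) x u - φ.cov A₀ (fun y => φ.e y (extendT u y)) x v -
    φ.e x (VectorField.mlieBracket (𝓡∂ 4) (extendT u) (extendT v) x)

/-- The curvature `F_A(u, v) s = ∇_u ∇_v s - ∇_v ∇_u s - ∇_{[u, v]} s`. -/
def curvature (A₀ : Connection P) (φ : FieldSpace P) (x : M) (u v : TangentSpace (𝓡∂ 4) x)
    (s : V x) : V x :=
  φ.cov A₀ (fun y => φ.cov A₀ (extendV s) y (extendT v y)) x u -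
    φ.cov A₀ (fun y => φ.cov A₀ (extendV s) y (extendT u y)) x v -
    φ.cov A₀ (extendV s) x (VectorField.mlieBracket (𝓡∂ 4) (extendT u) (extendT v) x)

/-- The curvature `F_A(u, v)` expressed in the oriented orthonormal frame at `x`. -/
def curvatureEnd (A₀ : Connection P) (φ : FieldSpace P) (x : M) (u v : TangentSpace (𝓡∂ 4) x) :
    Module.End ℝ Mink :=
  (Pi.basisFun ℝ (Fin 4)).constr ℝ fun i =>
    (P.frame x).symm (curvature A₀ φ x u v (P.frame x (Pi.single i 1)))

/-- The coframe `e` expressed in the oriented orthonormal frame at `x`. -/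
def coframe (φ : FieldSpace P) (x : M) (u : TangentSpace (𝓡∂ 4) x) : Mink :=
  (P.frame x).symm (φ.e x u)

open Classical in
/-- The action of a linear operator `S` of `𝔤` on elements of `𝔤 ⊆ End(ℝ⁴)`, extended by zero. -/
def applyOp (S : Module.End ℝ so31) (α : Module.End ℝ Mink) : Module.End ℝ Mink :=
  if h : α ∈ so31 then S ⟨α, h⟩ else 0

/-- The wedge product of two 2-forms, combined with a pairing of their values:
`p u₁ u₂ u₃ u₄` is the pairing of the values of the 2-forms on `(u₁, u₂)` and on `(u₃, u₄)`. -/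
def wedge {W : Type*} (p : W → W → W → W → ℝ) (v : Fin 4 → W) : ℝ :=
  (1 / 4) * ∑ σ : Equiv.Perm (Fin 4),
    ((Equiv.Perm.sign σ : ℤ) : ℝ) * p (v (σ 0)) (v (σ 1)) (v (σ 2)) (v (σ 3))

/-- The 4-form `⟨S F_A, e ∧ e⟩`, where `(e ∧ e)(u, v) = e(u) ∧ e(v) - e(v) ∧ e(u)`. -/
def killingTerm (S : Module.End ℝ so31) (A₀ : Connection P) (φ : FieldSpace P) (x : M) :
    (Fin 4 → TangentSpace (𝓡∂ 4) x) → ℝ :=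
  wedge fun u₁ u₂ u₃ u₄ =>
    killingModel (applyOp S (curvatureEnd A₀ φ x u₁ u₂)) (coframe φ x u₃) (coframe φ x u₄) -
    killingModel (applyOp S (curvatureEnd A₀ φ x u₁ u₂)) (coframe φ x u₄) (coframe φ x u₃)

/-- The 4-form `tr[F_A ∧ e ∧ e]`. -/
def traceTerm (A₀ : Connection P) (φ : FieldSpace P) (x : M) :
    (Fin 4 → TangentSpace (𝓡∂ 4) x) → ℝ :=
  wedge fun u₁ u₂ u₃ u₄ =>
    traceModel (curvatureEnd A₀ φ x u₁ u₂) (coframe φ x u₃) (coframe φ x u₄) -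
    traceModel (curvatureEnd A₀ φ x u₁ u₂) (coframe φ x u₄) (coframe φ x u₃)

/-- The 4-form `η(τ, d_A e)`. -/
def torsionTerm (A₀ : Connection P) (φ : FieldSpace P) (x : M) :
    (Fin 4 → TangentSpace (𝓡∂ 4) x) → ℝ :=
  wedge fun u₁ u₂ u₃ u₄ => P.η x (φ.τ x u₁ u₂) (torsion A₀ φ x u₃ u₄)

/-- The 4-form `η(τ, τ)`. -/
def quadraticTerm (φ : FieldSpace P) (x : M) : (Fin 4 → TangentSpace (𝓡∂ 4) x) → ℝ :=
  wedge fun u₁ u₂ u₃ u₄ => P.η x (φ.τ x u₁ u₂) (φ.τ x u₃ u₄)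

/-- The Lagrangian density of quadratic generalised Holst theory,
`½⟨(id + βT)⁻¹ F_A, e ∧ e⟩ - η(τ, d_A e) - ½(1 + β) η(τ, τ)`. -/
def qgHLagrangian (A₀ : Connection P) (T : Module.End ℝ so31) (β : ℝ) (φ : FieldSpace P) (x : M)
    (v : Fin 4 → TangentSpace (𝓡∂ 4) x) : ℝ :=
  (1 / 2) * killingTerm (Ring.inverse (1 + β • T)) A₀ φ x v - torsionTerm A₀ φ x v -
    (1 + β) / 2 * quadraticTerm φ x v

/-- The Lagrangian density of half-shell Palatini–Cartan theory,
`½ tr[F_A ∧ e ∧ e] - η(τ, d_A e)`. -/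
def halfShellLagrangian (A₀ : Connection P) (φ : FieldSpace P) (x : M)
    (v : Fin 4 → TangentSpace (𝓡∂ 4) x) : ℝ :=
  (1 / 2) * traceTerm A₀ φ x v - torsionTerm A₀ φ x v

/-- The action functional `∫_M L` of a Lagrangian density `L`. -/
def action [CompactSpace M] [T2Space M] (o : OrientationForm M)
    (L : FieldSpace P → ∀ x : M, (Fin 4 → TangentSpace (𝓡∂ 4) x) → ℝ) (φ : FieldSpace P) : ℝ :=
  integral (𝓡∂ 4) (fun x v => o.form x v) (L φ)

/-! ## Variational calculus and boundary data -/

/-- The variation `X` vanishes at the point `x`. -/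
def VanishesAt (X : FieldSpace P) (x : M) : Prop := X.e x = 0 ∧ X.a x = 0 ∧ X.τ x = 0

/-- The Euler–Lagrange form `el` and the boundary form `θ` of a first order Lagrangian density `L`:
`δL = el + dθ`, where the value of `el φ X` and of `θ φ X` at a point depends linearly on the value
of the variation `X` at that point. These requirements determine `el` and `θ` uniquely. -/
structure VariationalData
    (L : FieldSpace P → ∀ x : M, (Fin 4 → TangentSpace (𝓡∂ 4) x) → ℝ) where
  el : FieldSpace P → FieldSpace P →ₗ[ℝ] ∀ x : M, TangentSpace (𝓡∂ 4) x [⋀^Fin 4]→ₗ[ℝ] ℝ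
  θ : FieldSpace P → FieldSpace P →ₗ[ℝ] ∀ x : M, TangentSpace (𝓡∂ 4) x [⋀^Fin 3]→ₗ[ℝ] ℝ
  el_local : ∀ φ X x, VanishesAt X x → el φ X x = 0
  θ_local : ∀ φ X x, VanishesAt X x → θ φ X x = 0
  θ_smooth : ∀ φ X, IsSmoothForm (𝓡∂ 4) (θ φ X)
  variation : ∀ (φ X : FieldSpace P) (x : M) (v : Fin 4 → TangentSpace (𝓡∂ 4) x),
    HasDerivAt (fun s : ℝ => L (φ + s • X) x v) (el φ X x v + extDer (𝓡∂ 4) (θ φ X) x v) 0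

/-- A family of fields depending smoothly on a real parameter, jointly with the point of `M`. -/
def IsSmoothCurve (c : ℝ → FieldSpace P) : Prop :=
  ContMDiff (𝓘(ℝ, ℝ).prod (𝓡∂ 4)) ((𝓡∂ 4).prod 𝓘(ℝ, E4 →L[ℝ] Mink)) ∞
    (fun p : ℝ × M => (⟨p.2, (c p.1).e p.2⟩ :
      TotalSpace (E4 →L[ℝ] Mink) fun x : M => TangentSpace (𝓡∂ 4) x →L[ℝ] V x)) ∧
  ContMDiff (𝓘(ℝ, ℝ).prod (𝓡∂ 4)) ((𝓡∂ 4).prod 𝓘(ℝ, Mink →L[ℝ] E4 →L[ℝ] Mink)) ∞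
    (fun p : ℝ × M => (⟨p.2, (c p.1).a p.2⟩ :
      TotalSpace (Mink →L[ℝ] E4 →L[ℝ] Mink)
        fun x : M => V x →L[ℝ] TangentSpace (𝓡∂ 4) x →L[ℝ] V x)) ∧
  ContMDiff (𝓘(ℝ, ℝ).prod (𝓡∂ 4)) ((𝓡∂ 4).prod 𝓘(ℝ, E4 →L[ℝ] E4 →L[ℝ] Mink)) ∞
    (fun p : ℝ × M => (⟨p.2, (c p.1).τ p.2⟩ :
      TotalSpace (E4 →L[ℝ] E4 →L[ℝ] Mink)
        fun x : M => TangentSpace (𝓡∂ 4) x →L[ℝ] TangentSpace (𝓡∂ 4) x →L[ℝ] V x))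

/-- The curve of fields `c` has velocity `X` at the parameter `s`. -/
def HasVelocity (c : ℝ → FieldSpace P) (s : ℝ) (X : FieldSpace P) : Prop :=
  ∀ (x : M) (u v : TangentSpace (𝓡∂ 4) x) (t : V x),
    HasDerivAt (fun r => (c r).e x u) (X.e x u) s ∧
    HasDerivAt (fun r => (c r).a x t u) (X.a x t u) s ∧
    HasDerivAt (fun r => (c r).τ x u v) (X.τ x u v) s

/-- A map between spaces of fields is smooth if it maps smooth curves to smooth curves. -/
def IsSmoothMap (Ψ : FieldSpace P → FieldSpace P) : Prop :=
  ∀ c, IsSmoothCurve c → IsSmoothCurve (Ψ ∘ c)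

/-- `D` is the tangent map of `Ψ`. -/
def IsTangentMap (Ψ : FieldSpace P → FieldSpace P)
    (D : FieldSpace P → FieldSpace P → FieldSpace P) : Prop :=
  ∀ c s X, IsSmoothCurve c → HasVelocity c s X → HasVelocity (Ψ ∘ c) s (D (c s) X)

/-- Two fields lie on the same leaf of the null distribution of the two-form `ϖ` if they are joined
by a smooth curve whose velocity lies in the kernel of `ϖ`. -/
def LeafRel (ϖ : FieldSpace P → FieldSpace P → FieldSpace P → ℝ) (φ φ' : FieldSpace P) : Prop :=
  ∃ c : ℝ → FieldSpace P, IsSmoothCurve c ∧ c 0 = φ ∧ c 1 = φ' ∧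
    ∀ s, ∃ X, HasVelocity c s X ∧ ∀ Y, ϖ (c s) X Y = 0

/-- The geometric phase space (space of classical boundary fields): the quotient by the null
distribution of the pre-symplectic two-form `ϖ`. When `ϖ` is the pull-back of the two-form on
pre-boundary fields (germs of fields at the boundary), fields with the same germ at the boundary lie
on the same leaf, so that this is also the quotient of the space of pre-boundary fields. -/
def PhaseSpace (ϖ : FieldSpace P → FieldSpace P → FieldSpace P → ℝ) : Type _ :=
  Quot (LeafRel ϖ)

/-- The point of the geometric phase space that is represented by the field `φ`. -/
def PhaseSpace.mk (ϖ : FieldSpace P → FieldSpace P → FieldSpace P → ℝ) (φ : FieldSpace P) :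
    PhaseSpace ϖ := Quot.mk _ φ

/-- An isomorphism of geometric phase spaces that is conformally symplectic with constant factor
`k` (symplectic for `k = 1`): it is induced by a diffeomorphism `Ψ` of the spaces of fields such
that `ϖ = k Ψ^* ϖ'` and that leaves the coframe `e` unchanged (so that `Ψ` restricts to the fields
with nondegenerate `e`). -/
def IsPhaseSpaceIso (ϖ ϖ' : FieldSpace P → FieldSpace P → FieldSpace P → ℝ) (k : ℝ)
    (Φ : PhaseSpace ϖ ≃ PhaseSpace ϖ') : Prop :=
  ∃ (Ψ : FieldSpace P ≃ FieldSpace P) (D : FieldSpace P → FieldSpace P → FieldSpace P),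
    IsSmoothMap Ψ ∧ IsSmoothMap Ψ.symm ∧ IsTangentMap Ψ D ∧ (∀ φ x, (Ψ φ).e x = φ.e x) ∧
    (∀ φ, Φ (PhaseSpace.mk ϖ φ) = PhaseSpace.mk ϖ' (Ψ φ)) ∧
    ∀ φ X Y, ϖ φ X Y = k * ϖ' (Ψ φ) (D φ X) (D φ Y)

namespace VariationalData

variable {L : FieldSpace P → ∀ x : M, (Fin 4 → TangentSpace (𝓡∂ 4) x) → ℝ}
  {N : Type*} [TopologicalSpace N] [ChartedSpace (EuclideanSpace ℝ (Fin 3)) N]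
  [IsManifold (𝓡 3) ∞ N] [CompactSpace N] [T2Space N]

/-- The boundary one-form `α̃_φ(X) = ∫_{∂M} θ_φ(X)`. -/
def boundaryOneForm (D : VariationalData L) (o : OrientationForm M) (b : BoundaryInclusion M N)
    (φ X : FieldSpace P) : ℝ :=
  boundaryIntegral o b (D.θ φ X)

/-- The pre-boundary two-form `ϖ̃ = δα̃`. -/
def twoForm (D : VariationalData L) (o : OrientationForm M) (b : BoundaryInclusion M N)
    (φ X Y : FieldSpace P) : ℝ :=
  deriv (fun s : ℝ => D.boundaryOneForm o b (φ + s • X) Y) 0 -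
    deriv (fun s : ℝ => D.boundaryOneForm o b (φ + s • Y) X) 0

/-- The Cauchy data: the boundary configurations that extend to a solution of the Euler–Lagrange
equations in a neighbourhood of the boundary. -/
def cauchyData (D : VariationalData L) (o : OrientationForm M) (b : BoundaryInclusion M N) :
    Set (PhaseSpace (D.twoForm o b)) :=
  {q | ∃ φ : FieldSpace P, PhaseSpace.mk _ φ = q ∧ ∃ U : Set M, IsOpen U ∧ (𝓡∂ 4).boundary M ⊆ U ∧
    ∀ x ∈ U, ∀ X, D.el φ X x = 0}

end VariationalData

end Theories

end

end QGH

/-! For β = -1 the term in η(τ, τ) disappears, so the theories differ only in the invariant pairing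
of the curvature with e ∧ e. An operator commuting with the adjoint action is determined by its
value on one rotation R, because its kernel is an ideal of a simple algebra; that value centralises
R, and the centraliser is spanned by R and ⋆R. Hence the commutant is {c + d⋆}
(`exists_eq_add_smul_star`). As ⋆² = -1 in signature (3,1), it is a copy of ℂ: every nonzero element
is invertible, and (id - T)⁻¹ = c + d⋆ with (c, d) ≠ 0, where d ≠ 0 if T is not real
(`IsDeformation.inverse_one_sub`). Both theories are therefore cases of one Lagrangian, `holst c d`;
half-shell Palatini–Cartan theory is `holst 0 1`, and T = id - ⋆⁻¹ also gives (0, 1), which proves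
the first claim.

Integration by parts (`Jet.alt4_dlag`) yields θ = ½⟨δa, e ∧ e⟩ - ½ η(τ, δe) in the normalisation of
full alternating sums, with ⟨ , ⟩ the pairing of parameters c, d. Thus the two-form ϖ̃ is the
boundary integral of the antisymmetrisation of ⟨δ₂a, e ∧ δ₁e⟩ - ½ η(δ₁τ, δ₂e)
(`twoForm_variationalData`). It depends neither on a nor on derivatives.

For the second claim, the pairing (c, d) of α equals the pairing (0, 1) of dα - c⋆α (`pairC_mix`).
The linear map a ↦ da - c⋆a, with e and τ fixed, is inverted like a complex number and intertwines
the two-forms pointwise (`symplForm_mix`). It acts on A - A₀ and not on the curvature, so it says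
nothing about solutions.

For the third claim, a different map is used: e and A are kept and τ becomes (τ - c d_A e)/d. The
Killing part of the pairing is, up to sign, η(δa e, δe), which also occurs in the variation of the
torsion; the new τ absorbs it. What is left over is the exterior derivative of the 2-form -c η(δ₁e,
δ₂e) (`symplForm_shift`), and Stokes' theorem on the closed boundary removes it. So the map is
conformal with factor k = d. In both theories the equation of τ says that the torsion vanishes
(`torsion_eq_zero`). Near the boundary the c-terms of the field equations are then multiples of the
torsion or of F_A ∧ e, and the latter is zero by the first Bianchi identity (`IsGood.bianchi`).
Hence the Euler–Lagrange forms agree up to the factor d (`elForm_shift`), and Cauchy data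
correspond.

A diffeomorphism of the spaces of fields with invertible tangent maps that respects the two-forms up
to a nonzero factor maps leaves to leaves in both directions, and so descends to the quotients
(`exists_phaseSpaceIso`). The remaining work is to express torsion, curvature and forms by
components in local frames and charts, to prove smoothness, and to prove Stokes' theorem with the
given definition of the integral. -/

namespace QGH

noncomputable section

set_option linter.unusedSectionVars false
set_option maxSynthPendingDepth 3
set_option synthInstance.maxHeartbeats 200000

/-! ## The Lie algebra `𝔰𝔬(3,1)` in coordinates -/

/-- The matrix entry `α(bⱼ)ᵢ`. -/
def entry (α : Module.End ℝ Mink) (i j : Fin 4) : ℝ := α (Pi.single j 1) i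

theorem apply_eq_sum_entry (α : Module.End ℝ Mink) (v : Mink) (i : Fin 4) :
    α v i = ∑ j, v j * entry α i j := by
  have h := LinearMap.pi_apply_eq_sum_univ α v
  have hj : ∀ j : Fin 4, (fun i => if j = i then (1 : ℝ) else 0) = Pi.single j 1 := by
    intro j
    ext i
    simp [Pi.single_apply, eq_comm]
  rw [h, Finset.sum_apply]
  refine Finset.sum_congr rfl fun j _ => ?_
  rw [hj]
  rfl

theorem end_ext_entry {α β : Module.End ℝ Mink} (h : ∀ i j, entry α i j = entry β i j) :
    α = β := by
  ext v i
  simp only [LinearMap.comp_apply, apply_eq_sum_entry, h]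

theorem mem_so31_iff (α : Module.End ℝ Mink) :
    α ∈ so31 ↔ ∀ v w, minkowskiForm (α v) w + minkowskiForm v (α w) = 0 := by
  rw [LinearMap.mem_skewAdjointSubmodule]
  refine forall_congr' fun v => forall_congr' fun w => ?_
  change minkowskiForm (α v) w = minkowskiForm v (-(α w)) ↔ _
  rw [map_neg, eq_neg_iff_add_eq_zero]

theorem minkowskiForm_single (v : Mink) (i : Fin 4) :
    minkowskiForm v (Pi.single i 1) = sgn i * v i := by
  simp [minkowskiForm_apply, Pi.single_apply]

theorem mem_so31_iff_entry (α : Module.End ℝ Mink) :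
    α ∈ so31 ↔ ∀ i j, sgn i * entry α i j + sgn j * entry α j i = 0 := by
  rw [mem_so31_iff]
  constructor
  · intro h i j
    have := h (Pi.single j 1) (Pi.single i 1)
    rw [minkowskiForm_single, minkowskiForm_symm, minkowskiForm_single] at this
    exact this
  · intro h v w
    simp only [minkowskiForm_apply, apply_eq_sum_entry]
    simp only [Finset.mul_sum, Finset.sum_mul]
    rw [Finset.sum_comm, ← Finset.sum_add_distrib]
    refine Finset.sum_eq_zero fun i _ => ?_
    rw [← Finset.sum_add_distrib]
    refine Finset.sum_eq_zero fun j _ => ?_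
    linear_combination (v i * w j) * h i j

@[simp] theorem sgn_zero : sgn 0 = -1 := rfl
@[simp] theorem sgn_one : sgn 1 = 1 := rfl
@[simp] theorem sgn_two : sgn 2 = 1 := rfl
@[simp] theorem sgn_three : sgn 3 = 1 := rfl

section Entries

variable {α : Module.End ℝ Mink} (h : α ∈ so31)
include h

theorem entry_diag (i : Fin 4) : entry α i i = 0 := by
  have := (mem_so31_iff_entry α).1 h i i
  fin_cases i <;> simp at this ⊢ <;> linarith

theorem entry_10 : entry α 1 0 = entry α 0 1 := by
  have := (mem_so31_iff_entry α).1 h 0 1; simp at this; linarith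
theorem entry_20 : entry α 2 0 = entry α 0 2 := by
  have := (mem_so31_iff_entry α).1 h 0 2; simp at this; linarith
theorem entry_30 : entry α 3 0 = entry α 0 3 := by
  have := (mem_so31_iff_entry α).1 h 0 3; simp at this; linarith
theorem entry_21 : entry α 2 1 = -entry α 1 2 := by
  have := (mem_so31_iff_entry α).1 h 1 2; simp at this; linarith
theorem entry_31 : entry α 3 1 = -entry α 1 3 := by
  have := (mem_so31_iff_entry α).1 h 1 3; simp at this; linarith
theorem entry_32 : entry α 3 2 = -entry α 2 3 := by
  have := (mem_so31_iff_entry α).1 h 2 3; simp at this; linarith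

end Entries

/-- With the determinant multiplied out, every statement about the Hodge star becomes a polynomial
identity in the six independent entries of a skew endomorphism. -/
theorem det_four (r0 r1 r2 r3 : Mink) : Matrix.detRowAlternating ![r0, r1, r2, r3] =
    r0 0 * (r1 1 * (r2 2 * r3 3 - r2 3 * r3 2) - r1 2 * (r2 1 * r3 3 - r2 3 * r3 1)
      + r1 3 * (r2 1 * r3 2 - r2 2 * r3 1))
    - r0 1 * (r1 0 * (r2 2 * r3 3 - r2 3 * r3 2) - r1 2 * (r2 0 * r3 3 - r2 3 * r3 0)
      + r1 3 * (r2 0 * r3 2 - r2 2 * r3 0))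
    + r0 2 * (r1 0 * (r2 1 * r3 3 - r2 3 * r3 1) - r1 1 * (r2 0 * r3 3 - r2 3 * r3 0)
      + r1 3 * (r2 0 * r3 1 - r2 1 * r3 0))
    - r0 3 * (r1 0 * (r2 1 * r3 2 - r2 2 * r3 1) - r1 1 * (r2 0 * r3 2 - r2 2 * r3 0)
      + r1 2 * (r2 0 * r3 1 - r2 1 * r3 0)) := by
  change Matrix.det (Matrix.of ![r0, r1, r2, r3]) = _
  rw [Matrix.det_succ_row_zero]
  simp [Fin.sum_univ_succ, Matrix.det_fin_three, Fin.succAbove]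
  ring

theorem traceModel_eq {α : Module.End ℝ Mink} (h : α ∈ so31) (v w : Mink) :
    traceModel α v w =
      entry α 0 1 * (v 2 * w 3 - v 3 * w 2) + entry α 0 2 * (v 3 * w 1 - v 1 * w 3) +
      entry α 0 3 * (v 1 * w 2 - v 2 * w 1) + entry α 2 3 * (v 0 * w 1 - v 1 * w 0) -
      entry α 1 3 * (v 0 * w 2 - v 2 * w 0) + entry α 1 2 * (v 0 * w 3 - v 3 * w 0) := by
  have e : ∀ i j, α (Pi.single j 1) i = entry α i j := fun _ _ => rfl
  simp only [traceModel, det_four, Fin.sum_univ_four, e, sgn_zero, sgn_one, sgn_two, sgn_three]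
  simp only [Pi.single_apply, entry_diag h, entry_10 h, entry_20 h, entry_30 h, entry_21 h,
    entry_31 h, entry_32 h]
  simp
  ring

theorem entry_starEnd (α : Module.End ℝ Mink) (i j : Fin 4) :
    entry (starEnd α) i j = -(sgn i * traceModel α (Pi.single j 1) (Pi.single i 1)) := rfl

theorem entry_mul (α β : Module.End ℝ Mink) (i j : Fin 4) :
    entry (α * β) i j = ∑ k, entry α i k * entry β k j := by
  change α (β (Pi.single j 1)) i = _
  rw [apply_eq_sum_entry]
  exact Finset.sum_congr rfl fun k _ => mul_comm _ _

theorem entry_add (α β : Module.End ℝ Mink) (i j : Fin 4) :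
    entry (α + β) i j = entry α i j + entry β i j := rfl
theorem entry_sub (α β : Module.End ℝ Mink) (i j : Fin 4) :
    entry (α - β) i j = entry α i j - entry β i j := rfl
theorem entry_smul (c : ℝ) (α : Module.End ℝ Mink) (i j : Fin 4) :
    entry (c • α) i j = c * entry α i j := rfl
theorem entry_neg (α : Module.End ℝ Mink) (i j : Fin 4) :
    entry (-α) i j = -entry α i j := rfl

section Star

variable {α : Module.End ℝ Mink} (h : α ∈ so31)
include h

theorem entry_star_01 : entry (starEnd α) 0 1 = -entry α 2 3 := by
  rw [entry_starEnd, traceModel_eq h]; simp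
theorem entry_star_02 : entry (starEnd α) 0 2 = entry α 1 3 := by
  rw [entry_starEnd, traceModel_eq h]; simp
theorem entry_star_03 : entry (starEnd α) 0 3 = -entry α 1 2 := by
  rw [entry_starEnd, traceModel_eq h]; simp
theorem entry_star_12 : entry (starEnd α) 1 2 = entry α 0 3 := by
  rw [entry_starEnd, traceModel_eq h]; simp
theorem entry_star_13 : entry (starEnd α) 1 3 = -entry α 0 2 := by
  rw [entry_starEnd, traceModel_eq h]; simp
theorem entry_star_23 : entry (starEnd α) 2 3 = entry α 0 1 := by
  rw [entry_starEnd, traceModel_eq h]; simp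

end Star

theorem so31_ext {α β : Module.End ℝ Mink} (hα : α ∈ so31) (hβ : β ∈ so31)
    (h01 : entry α 0 1 = entry β 0 1) (h02 : entry α 0 2 = entry β 0 2)
    (h03 : entry α 0 3 = entry β 0 3) (h12 : entry α 1 2 = entry β 1 2)
    (h13 : entry α 1 3 = entry β 1 3) (h23 : entry α 2 3 = entry β 2 3) : α = β := by
  refine end_ext_entry fun i j => ?_
  fin_cases i <;> fin_cases j <;>
    simp [entry_diag, hα, hβ, entry_10, entry_20, entry_30, entry_21, entry_31, entry_32,
      h01, h02, h03, h12, h13, h23]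

theorem star_coe (α : so31) : ((star α : so31) : Module.End ℝ Mink) = starEnd α := rfl

/-- The star exchanges boosts and rotations, and the Lorentzian signature leaves one net sign. So ⋆
is a complex structure on 𝔤, on which all invertibility statements rest. -/
theorem star_mul_star : star * star = (-1 : ℝ) • (1 : Module.End ℝ so31) := by
  ext1 α
  apply Subtype.ext
  have h1 := starEnd_mem (α : Module.End ℝ Mink)
  change starEnd (starEnd (α : Module.End ℝ Mink)) = (-1 : ℝ) • (α : Module.End ℝ Mink)
  apply so31_ext (starEnd_mem _) (so31.smul_mem _ α.2) <;>
    simp [entry_neg, entry_star_01, entry_star_02, entry_star_03, entry_star_12, entry_star_13,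
      entry_star_23, h1, α.2]

theorem bracket_coe (X Y : so31) : ((bracket X Y : so31) : Module.End ℝ Mink) =
    (X : Module.End ℝ Mink) * (Y : Module.End ℝ Mink) -
      (Y : Module.End ℝ Mink) * (X : Module.End ℝ Mink) := rfl

/-- Conceptually, ⋆ is built from η and the volume form, both invariant under 𝔰𝔬(3,1). The proof
compares the six entries. -/
theorem star_bracket (X Y : so31) : star (bracket X Y) = bracket X (star Y) := by
  apply Subtype.ext
  have hb := (bracket X Y).2
  have hX := X.2
  have hY := Y.2
  have hs := (star Y).2
  rw [star_coe] at hs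
  apply so31_ext (star (bracket X Y)).2 (bracket X (star Y)).2 <;>
  · rw [star_coe]
    simp only [entry_star_01 hb, entry_star_02 hb, entry_star_03 hb, entry_star_12 hb,
      entry_star_13 hb, entry_star_23 hb]
    simp only [bracket_coe, star_coe, entry_sub, entry_mul, Fin.sum_univ_four,
      entry_diag hs, entry_10 hs, entry_20 hs, entry_21 hs, entry_31 hs, entry_32 hs,
      entry_diag hX, entry_10 hX, entry_20 hX, entry_21 hX, entry_31 hX, entry_32 hX,
      entry_diag hY, entry_10 hY, entry_20 hY, entry_21 hY, entry_31 hY, entry_32 hY,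
      entry_star_01 hY, entry_star_02 hY, entry_star_03 hY, entry_star_12 hY, entry_star_13 hY,
      entry_star_23 hY]
    ring

/-- The element of `𝔰𝔬(3,1)` with prescribed entries above the diagonal. -/
def ofEntries (a01 a02 a03 a12 a13 a23 : ℝ) : so31 :=
  ⟨Matrix.toLin' !![0, a01, a02, a03; a01, 0, a12, a13; a02, -a12, 0, a23; a03, -a13, -a23, 0], by
    rw [mem_so31_iff_entry]
    intro i j
    simp only [entry, Matrix.toLin'_apply, Matrix.mulVec_single_one]
    fin_cases i <;> fin_cases j <;> simp⟩

theorem entry_ofEntries (a01 a02 a03 a12 a13 a23 : ℝ) (i j : Fin 4) :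
    entry (ofEntries a01 a02 a03 a12 a13 a23 : Module.End ℝ Mink) i j =
      (!![0, a01, a02, a03; a01, 0, a12, a13; a02, -a12, 0, a23; a03, -a13, -a23, 0] :
        Matrix (Fin 4) (Fin 4) ℝ) i j := by
  simp [entry, ofEntries]

theorem eq_ofEntries (α : so31) : α = ofEntries (entry α 0 1) (entry α 0 2) (entry α 0 3)
    (entry α 1 2) (entry α 1 3) (entry α 2 3) := by
  apply Subtype.ext
  apply so31_ext α.2 (Subtype.mem _) <;> simp [entry_ofEntries]

theorem bracket_ofEntries (a01 a02 a03 a12 a13 a23 b01 b02 b03 b12 b13 b23 : ℝ) :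
    bracket (ofEntries a01 a02 a03 a12 a13 a23) (ofEntries b01 b02 b03 b12 b13 b23) =
    ofEntries (-(a02 * b12) - a03 * b13 + b02 * a12 + b03 * a13)
      (a01 * b12 - a03 * b23 - b01 * a12 + b03 * a23)
      (a01 * b13 + a02 * b23 - b01 * a13 - b02 * a23)
      (a01 * b02 - a13 * b23 - b01 * a02 + b13 * a23)
      (a01 * b03 + a12 * b23 - b01 * a03 - b12 * a23)
      (a02 * b03 - a12 * b13 - b02 * a03 + b12 * a13) := by
  apply Subtype.ext
  apply so31_ext (Subtype.mem _) (Subtype.mem _) <;>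
  · simp [bracket_coe, entry_sub, entry_mul, entry_ofEntries, Fin.sum_univ_four]
    try ring

theorem bracket_self (X : so31) : bracket X X = 0 := by
  apply Subtype.ext
  simp [bracket_coe]

theorem bracket_add_right (X Y Z : so31) : bracket X (Y + Z) = bracket X Y + bracket X Z := by
  apply Subtype.ext
  simp only [bracket_coe, Submodule.coe_add, mul_add, add_mul]
  abel

theorem bracket_smul_right (X Y : so31) (c : ℝ) : bracket X (c • Y) = c • bracket X Y := by
  apply Subtype.ext
  simp [bracket_coe, smul_sub]

theorem bracket_zero_right (X : so31) : bracket X 0 = 0 := by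
  apply Subtype.ext
  simp [bracket_coe]

/-- An operator commuting with the adjoint action that kills one rotation vanishes. -/
theorem eq_zero_of_commute (T : Module.End ℝ so31)
    (hT : ∀ X Y : so31, T (bracket X Y) = bracket X (T Y))
    (h : T (ofEntries 0 0 0 0 0 1) = 0) : T = 0 := by
  -- The kernel of `T` is stable under every ad X, hence an ideal. Starting from the rotation in the
  -- (2,3)-plane, five brackets reach the other basis elements.
  have key : ∀ X Y Z : so31, T Y = 0 → bracket X Y = Z → T Z = 0 := by
    intro X Y Z hY hZ
    rw [← hZ, hT, hY, bracket_zero_right]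
  have h13 : T (ofEntries 0 0 0 0 1 0) = 0 :=
    key (ofEntries 0 0 0 1 0 0) _ _ h (by rw [bracket_ofEntries]; congr 1 <;> simp)
  have h03 : T (ofEntries 0 0 1 0 0 0) = 0 :=
    key (ofEntries 0 1 0 0 0 0) _ _ h (by rw [bracket_ofEntries]; congr 1 <;> simp)
  have h12 : T (ofEntries 0 0 0 1 0 0) = 0 :=
    key (ofEntries 0 0 0 0 (-1) 0) _ _ h (by rw [bracket_ofEntries]; congr 1 <;> simp)
  have h02 : T (ofEntries 0 1 0 0 0 0) = 0 :=
    key (ofEntries 0 0 (-1) 0 0 0) _ _ h (by rw [bracket_ofEntries]; congr 1 <;> simp)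
  have h01 : T (ofEntries 1 0 0 0 0 0) = 0 :=
    key (ofEntries 0 (-1) 0 0 0 0) _ _ h12 (by rw [bracket_ofEntries]; congr 1 <;> simp)
  ext1 α
  have hα : α = entry α 0 1 • ofEntries 1 0 0 0 0 0 + entry α 0 2 • ofEntries 0 1 0 0 0 0 +
      entry α 0 3 • ofEntries 0 0 1 0 0 0 + entry α 1 2 • ofEntries 0 0 0 1 0 0 +
      entry α 1 3 • ofEntries 0 0 0 0 1 0 + entry α 2 3 • ofEntries 0 0 0 0 0 1 := by
    apply Subtype.ext
    apply so31_ext α.2 (Subtype.mem _) <;>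
      simp [entry_add, entry_smul, entry_ofEntries]
  rw [hα]
  simp [h01, h02, h03, h12, h13, h]

/-- The commutant of the adjoint action is spanned by the identity and the Hodge star. -/
theorem exists_eq_add_smul_star (T : Module.End ℝ so31)
    (hT : ∀ X Y : so31, T (bracket X Y) = bracket X (T Y)) :
    ∃ c d : ℝ, T = c • (1 : Module.End ℝ so31) + d • star := by
  set R : so31 := ofEntries 0 0 0 0 0 1 with hR
  -- From [R, R] = 0 it follows that T R centralises R. In coordinates this kills the entries 02,
  -- 03, 12 and 13, which leaves the span of R and ⋆R.
  have h0 : bracket R (T R) = 0 := by rw [← hT, bracket_self, map_zero]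
  have hTR := eq_ofEntries (T R)
  rw [hTR, hR, bracket_ofEntries] at h0
  have he : ∀ i j, entry ((0 : so31) : Module.End ℝ Mink) i j = 0 := fun _ _ => rfl
  have e02 := congrArg (fun X : so31 => entry X 0 2) h0
  have e03 := congrArg (fun X : so31 => entry X 0 3) h0
  have e12 := congrArg (fun X : so31 => entry X 1 2) h0
  have e13 := congrArg (fun X : so31 => entry X 1 3) h0
  simp only [entry_ofEntries, he] at e02 e03 e12 e13
  simp at e02 e03 e12 e13
  rw [← hR] at e02 e03 e12 e13
  -- The minus sign appears because ⋆R has entry -1 at (0,1). With these coefficients the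
  -- combination agrees with `T` at R, and `eq_zero_of_commute` applies to the difference.
  refine ⟨entry (T R) 2 3, -entry (T R) 0 1, ?_⟩
  have hz : T + (-1 : ℝ) • (entry (T R) 2 3 • (1 : Module.End ℝ so31) +
      -entry (T R) 0 1 • star) = 0 := by
   apply eq_zero_of_commute
   · intro X Y
     simp only [LinearMap.add_apply, LinearMap.smul_apply, Module.End.one_apply,
       hT, star_bracket, bracket_add_right, bracket_smul_right]
   · rw [← hR]
     apply Subtype.ext
     apply so31_ext (Subtype.mem _) (Subtype.mem _) <;>
       simp only [LinearMap.add_apply, LinearMap.smul_apply,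
         Module.End.one_apply, Submodule.coe_add, Submodule.coe_smul,
         entry_add, entry_smul, star_coe, entry_star_01 R.2, entry_star_02 R.2, entry_star_03 R.2,
         entry_star_12 R.2, entry_star_13 R.2, entry_star_23 R.2, he] <;>
       simp only [hR, entry_ofEntries] <;> simp <;> rw [← hR] <;> linarith
  ext1 X
  have := LinearMap.congr_fun hz X
  rw [LinearMap.add_apply, LinearMap.smul_apply, LinearMap.zero_apply] at this
  set Y := (entry (T R) 2 3 • (1 : Module.End ℝ so31) + -entry (T R) 0 1 • star) X
  calc T X = (T X + (-1 : ℝ) • Y) + Y := by module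
    _ = Y := by rw [this, zero_add]

theorem add_smul_star_mul (c d c' d' : ℝ) :
    (c • (1 : Module.End ℝ so31) + d • star) * (c' • (1 : Module.End ℝ so31) + d' • star) =
      (c * c' - d * d') • (1 : Module.End ℝ so31) + (c * d' + d * c') • star := by
  simp only [add_mul, mul_add, smul_mul_smul_comm, one_mul, mul_one, star_mul_star]
  module

/-- This is the inverse (c - di)/(c² + d²) of the complex number c + di, transported along i ↦ ⋆. -/
theorem inverse_add_smul_star (c d : ℝ) (h : c ≠ 0 ∨ d ≠ 0) :
    IsUnit (c • (1 : Module.End ℝ so31) + d • star) ∧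
    Ring.inverse (c • (1 : Module.End ℝ so31) + d • star) =
      (c / (c ^ 2 + d ^ 2)) • (1 : Module.End ℝ so31) + (-d / (c ^ 2 + d ^ 2)) • star := by
  have hn : c ^ 2 + d ^ 2 ≠ 0 := by
    rcases h with h | h
    · have := pow_pos (abs_pos.2 h) 2; rw [sq_abs] at this; nlinarith [sq_nonneg d]
    · have := pow_pos (abs_pos.2 h) 2; rw [sq_abs] at this; nlinarith [sq_nonneg c]
  let u : (Module.End ℝ so31)ˣ :=
    { val := c • (1 : Module.End ℝ so31) + d • star
      inv := (c / (c ^ 2 + d ^ 2)) • (1 : Module.End ℝ so31) + (-d / (c ^ 2 + d ^ 2)) • star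
      val_inv := by
        rw [add_smul_star_mul]
        have h1 : c * (c / (c ^ 2 + d ^ 2)) - d * (-d / (c ^ 2 + d ^ 2)) = 1 := by
          field_simp; ring
        have h2 : c * (-d / (c ^ 2 + d ^ 2)) + d * (c / (c ^ 2 + d ^ 2)) = 0 := by
          field_simp; ring
        rw [h1, h2]; simp
      inv_val := by
        rw [add_smul_star_mul]
        have h1 : (c / (c ^ 2 + d ^ 2)) * c - (-d / (c ^ 2 + d ^ 2)) * d = 1 := by
          field_simp; ring
        have h2 : (c / (c ^ 2 + d ^ 2)) * d + (-d / (c ^ 2 + d ^ 2)) * c = 0 := by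
          field_simp; ring
        rw [h1, h2]; simp }
  exact ⟨u.isUnit, Ring.inverse_unit u⟩

theorem star_eq : star = (0 : ℝ) • (1 : Module.End ℝ so31) + (1 : ℝ) • star := by simp

theorem isUnit_star : IsUnit star := by
  rw [star_eq]; exact (inverse_add_smul_star 0 1 (Or.inr one_ne_zero)).1

theorem inverse_star : Ring.inverse star = (-1 : ℝ) • star := by
  have := (inverse_add_smul_star 0 1 (Or.inr one_ne_zero)).2
  rw [← star_eq] at this
  rw [this]; simp

theorem starDeformation_eq :
    starDeformation = (1 : ℝ) • (1 : Module.End ℝ so31) + (1 : ℝ) • star := by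
  rw [starDeformation, inverse_star]; simp [smul_smul]

theorem isDeformation_starDeformation : IsDeformation starDeformation := by
  refine ⟨?_, fun X Y => ?_⟩
  · rw [← Module.End.isUnit_iff, starDeformation_eq]
    exact (inverse_add_smul_star 1 1 (Or.inr one_ne_zero)).1
  · simp only [starDeformation_eq, LinearMap.add_apply, LinearMap.smul_apply, Module.End.one_apply,
      star_bracket, bracket_add_right, bracket_smul_right]

/-- Since ⋆⁻¹ = -⋆, the deformation is 1 + ⋆ and the operator to be inverted is -⋆. Its inverse is
⋆, which turns the Killing pairing into the trace. -/
theorem inverse_one_sub_starDeformation :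
    Ring.inverse ((1 : Module.End ℝ so31) + (-1 : ℝ) • starDeformation) = star := by
  have h : (1 : Module.End ℝ so31) + (-1 : ℝ) • starDeformation =
      (0 : ℝ) • (1 : Module.End ℝ so31) + (-1 : ℝ) • star := by
    rw [starDeformation_eq]; module
  rw [h, (inverse_add_smul_star 0 (-1) (Or.inr (by norm_num))).2]
  simp

/-- For a deformation `T ≠ id` the operator `(id - T)⁻¹` is a combination `c + d ⋆`, with `d ≠ 0`
unless `T` is real. -/
theorem IsDeformation.inverse_one_sub {T : Module.End ℝ so31} (hT : IsDeformation T)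
    (h1 : T ≠ 1) :
    IsUnit ((1 : Module.End ℝ so31) + (-1 : ℝ) • T) ∧
    ∃ c d : ℝ, (c ≠ 0 ∨ d ≠ 0) ∧
      Ring.inverse ((1 : Module.End ℝ so31) + (-1 : ℝ) • T) =
        c • (1 : Module.End ℝ so31) + d • star ∧
      ((∀ r : ℝ, T ≠ r • (1 : Module.End ℝ so31)) → d ≠ 0) := by
  -- With T = a + b⋆ the operator is (1 - a) - b⋆. It vanishes only for T = 1, and the ⋆-coefficient
  -- of its inverse is b/((1 - a)² + b²), which is zero exactly when T is real.
  obtain ⟨a, b, hab⟩ := exists_eq_add_smul_star T hT.2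
  have he : (1 : Module.End ℝ so31) + (-1 : ℝ) • T =
      (1 - a) • (1 : Module.End ℝ so31) + (-b) • star := by
    rw [hab]; module
  have hne : 1 - a ≠ 0 ∨ -b ≠ 0 := by
    by_contra! h
    apply h1
    rw [hab, neg_eq_zero.1 h.2, ← sub_eq_zero.1 h.1]
    simp
  have hn : (1 - a) ^ 2 + (-b) ^ 2 ≠ 0 := by
    rcases hne with h | h
    · have := pow_pos (abs_pos.2 h) 2; rw [sq_abs] at this; nlinarith [sq_nonneg (-b)]
    · have := pow_pos (abs_pos.2 h) 2; rw [sq_abs] at this; nlinarith [sq_nonneg (1 - a)]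
  rw [he]
  obtain ⟨hu, hi⟩ := inverse_add_smul_star (1 - a) (-b) hne
  refine ⟨hu, _, _, ?_, hi, ?_⟩
  · rcases hne with h | h
    · exact Or.inl (div_ne_zero h hn)
    · exact Or.inr (div_ne_zero (neg_ne_zero.2 h) hn)
  · intro hr
    refine div_ne_zero (neg_ne_zero.2 fun hb => hr a ?_) hn
    rw [hab, neg_eq_zero.1 hb]
    simp

/-! ## The invariant pairings -/

/-- The combination `c ⟨α, v ∧ w⟩ + d tr[α ∧ v ∧ w]` of the invariant pairings. -/
def pairing (c d : ℝ) (α : Module.End ℝ Mink) (v w : Mink) : ℝ :=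
  c * killingModel α v w + d * traceModel α v w

/-- Through this identity the deformation enters the Lagrangian only by the two numbers c and d.
Membership in 𝔤 is needed because `applyOp` has the junk value 0 elsewhere. -/
theorem killingModel_applyOp {c d : ℝ} {α : Module.End ℝ Mink} (h : α ∈ so31) (v w : Mink) :
    killingModel (applyOp (c • (1 : Module.End ℝ so31) + d • star) α) v w = pairing c d α v w := by
  rw [pairing, ← killingModel_starEnd, applyOp, dif_pos h]
  simp only [killingModel, LinearMap.add_apply, LinearMap.smul_apply, Module.End.one_apply,
    Submodule.coe_add, Submodule.coe_smul, star_coe, map_add, map_smul, smul_eq_mul]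
  ring

variable {c d : ℝ}

theorem pairing_add (α β : Module.End ℝ Mink) (v w : Mink) :
    pairing c d (α + β) v w = pairing c d α v w + pairing c d β v w := by
  simp only [pairing, traceModel_add, killingModel, LinearMap.add_apply, map_add]; ring

theorem pairing_smul (r : ℝ) (α : Module.End ℝ Mink) (v w : Mink) :
    pairing c d (r • α) v w = r * pairing c d α v w := by
  simp only [pairing, traceModel_smul, killingModel, LinearMap.smul_apply, map_smul, smul_eq_mul]
  ring

theorem pairing_add_left (α : Module.End ℝ Mink) (v v' w : Mink) :
    pairing c d α (v + v') w = pairing c d α v w + pairing c d α v' w := by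
  simp only [pairing, traceModel_add_left, killingModel, LinearMap.add_apply, map_add]; ring

theorem pairing_smul_left (r : ℝ) (α : Module.End ℝ Mink) (v w : Mink) :
    pairing c d α (r • v) w = r * pairing c d α v w := by
  simp only [pairing, traceModel_smul_left, killingModel, LinearMap.smul_apply, map_smul,
    smul_eq_mul]
  ring

theorem pairing_add_right (α : Module.End ℝ Mink) (v w w' : Mink) :
    pairing c d α v (w + w') = pairing c d α v w + pairing c d α v w' := by
  simp only [pairing, traceModel_swap α v, traceModel_add_left, killingModel, map_add]; ring

theorem pairing_smul_right (r : ℝ) (α : Module.End ℝ Mink) (v w : Mink) :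
    pairing c d α v (r • w) = r * pairing c d α v w := by
  simp only [pairing, traceModel_swap α v, traceModel_smul_left, killingModel, map_smul,
    smul_eq_mul]
  ring

/-- The trace part is antisymmetric for every endomorphism; only the Killing part uses that α is
skew. -/
theorem pairing_swap {α : Module.End ℝ Mink} (h : α ∈ so31) (v w : Mink) :
    pairing c d α v w = -pairing c d α w v := by
  have := (mem_so31_iff α).1 h v w
  rw [minkowskiForm_symm v] at this
  simp only [pairing, traceModel_swap α v, killingModel]
  linear_combination (-c) * this

/-- Infinitesimal invariance of the pairing. -/
theorem pairing_bracket {A α : Module.End ℝ Mink} (hA : A ∈ so31) (h : α ∈ so31) (v w : Mink) :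
    pairing c d (A * α - α * A) v w =
      -pairing c d α (A v) w - pairing c d α v (A w) := by
  have hb : A * α - α * A ∈ so31 := (bracket ⟨A, hA⟩ ⟨α, h⟩).2
  have hk : killingModel (A * α - α * A) v w =
      -killingModel α (A v) w - killingModel α v (A w) := by
    have hk := (mem_so31_iff A).1 hA (α v) w
    simp only [killingModel, LinearMap.sub_apply, Module.End.mul_apply, map_sub]
    linear_combination -hk
  have ht : traceModel (A * α - α * A) v w =
      -traceModel α (A v) w - traceModel α v (A w) := by
    simp only [traceModel_eq hb, traceModel_eq h]
    simp only [entry_sub, entry_mul, apply_eq_sum_entry A, Fin.sum_univ_four, entry_diag h,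
      entry_10 h, entry_20 h, entry_21 h, entry_31 h, entry_32 h, entry_diag hA,
      entry_10 hA, entry_20 hA, entry_30 hA, entry_21 hA, entry_31 hA, entry_32 hA]
    ring
  rw [pairing, hk, ht, pairing, pairing]
  ring

/-- A linear isometry of Minkowski space satisfies `∑ᵢ ηⁱⁱ g(bᵢ) ⊗ g(bᵢ) = ∑ᵢ ηⁱⁱ bᵢ ⊗ bᵢ`. -/
theorem sum_sgn_isometry {g : Module.End ℝ Mink}
    (hη : ∀ u v, minkowskiForm (g u) (g v) = minkowskiForm u v)
    (B : Mink →ₗ[ℝ] Mink →ₗ[ℝ] ℝ) :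
    ∑ i, sgn i * B (g (Pi.single i 1)) (g (Pi.single i 1)) =
      ∑ i, sgn i * B (Pi.single i 1) (Pi.single i 1) := by
  set G : Matrix (Fin 4) (Fin 4) ℝ := Matrix.of (entry g) with hG
  set S : Matrix (Fin 4) (Fin 4) ℝ := Matrix.diagonal sgn with hS
  have hSS : S * S = 1 := by
    rw [hS, Matrix.diagonal_mul_diagonal, ← Matrix.diagonal_one]
    congr 1
    ext i
    exact sgn_mul_self i
  have h1 : G.transpose * S * G = S := by
    ext i j
    have := hη (Pi.single i 1) (Pi.single j 1)
    rw [minkowskiForm_single, minkowskiForm_apply] at this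
    rw [Matrix.mul_apply]
    simp only [hS, Matrix.mul_diagonal, Matrix.transpose_apply, hG, Matrix.of_apply,
      Matrix.diagonal_apply]
    calc _ = ∑ k, sgn k * g (Pi.single i 1) k * g (Pi.single j 1) k :=
          Finset.sum_congr rfl fun k _ => by simp only [entry]; ring
      _ = _ := by rw [this]; simp only [Pi.single_apply]; grind
  have h2 : (S * G.transpose * S) * G = 1 := by
    rw [mul_assoc, mul_assoc, ← mul_assoc G.transpose, h1, hSS]
  -- A one-sided inverse of a square matrix is two-sided. This passes from the invariance of η on
  -- vectors to the invariance of the inverse metric.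
  have h3 : G * (S * G.transpose * S) = 1 := mul_eq_one_comm.1 h2
  have h4 : G * S * G.transpose = S := by
    calc G * S * G.transpose = G * (S * G.transpose * S) * S := by
          simp only [mul_assoc, hSS, mul_one]
      _ = S := by rw [h3, one_mul]
  have hexp : ∀ i, g (Pi.single i 1) = ∑ k, G k i • (Pi.single k 1 : Mink) := by
    intro i
    ext l
    simp [hG, entry, Finset.sum_apply, Pi.single_apply]
  have hB : ∀ i, B (g (Pi.single i 1)) (g (Pi.single i 1)) =
      ∑ k, ∑ l, G k i * G l i * B (Pi.single k 1) (Pi.single l 1) := by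
    intro i
    rw [hexp]
    simp only [map_sum, map_smul, LinearMap.sum_apply, LinearMap.smul_apply, smul_eq_mul,
      Finset.mul_sum]
    rw [Finset.sum_comm]
    exact Finset.sum_congr rfl fun k _ => Finset.sum_congr rfl fun l _ => by ring
  have h5 : ∀ k l, ∑ i, sgn i * (G k i * G l i) = if k = l then sgn k else 0 := by
    intro k l
    have := congrFun (congrFun h4 k) l
    rw [Matrix.mul_apply] at this
    simp only [hS, Matrix.mul_diagonal, Matrix.transpose_apply, Matrix.diagonal_apply] at this
    rw [← this]
    exact Finset.sum_congr rfl fun i _ => by ring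
  calc _ = ∑ k, ∑ l, (∑ i, sgn i * (G k i * G l i)) * B (Pi.single k 1) (Pi.single l 1) := by
        simp only [hB, Finset.mul_sum, Finset.sum_mul]
        rw [Finset.sum_comm]
        refine Finset.sum_congr rfl fun k _ => ?_
        rw [Finset.sum_comm]
        exact Finset.sum_congr rfl fun l _ => Finset.sum_congr rfl fun i _ => by ring
    _ = _ := by simp [h5]

/-- The bilinear form `(x, y) ↦ det (α x, y, v, w)`. -/
def detForm (α : Module.End ℝ Mink) (v w : Mink) : Mink →ₗ[ℝ] Mink →ₗ[ℝ] ℝ :=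
  LinearMap.mk₂ ℝ (fun x y => Matrix.detRowAlternating ![α x, y, v, w])
    (fun x x' y => by rw [det_four, det_four, det_four]; simp only [map_add, Pi.add_apply]; ring)
    (fun r x y => by
      rw [det_four, det_four]; simp only [map_smul, Pi.smul_apply, smul_eq_mul]; ring)
    (fun x y y' => by rw [det_four, det_four, det_four]; simp only [Pi.add_apply]; ring)
    (fun r x y => by rw [det_four, det_four]; simp only [Pi.smul_apply, smul_eq_mul]; ring)

/-- Invariance of the pairing under oriented isometries. -/
theorem pairing_conj {c d : ℝ} {g : Mink ≃ₗ[ℝ] Mink}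
    (hη : ∀ u v, minkowskiForm (g u) (g v) = minkowskiForm u v)
    (hdet : ∀ m : Fin 4 → Mink, Matrix.detRowAlternating (fun i => g (m i)) =
      Matrix.detRowAlternating m)
    {α β : Module.End ℝ Mink} (hαβ : ∀ v, β (g v) = g (α v)) (v w : Mink) :
    pairing c d β (g v) (g w) = pairing c d α v w := by
  have ht : traceModel β (g v) (g w) = traceModel α v w := by
    -- The trace contracts a determinant with the inverse metric, so the basis bᵢ in the sum may be
    -- replaced by g(bᵢ); then g factors out of the determinant.
    have h := sum_sgn_isometry (g := g.toLinearMap) hη (detForm β (g v) (g w))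
    simp only [traceModel]
    congr 1
    refine h.symm.trans (Finset.sum_congr rfl fun i _ => ?_)
    congr 1
    change Matrix.detRowAlternating ![β (g (Pi.single i 1)), g (Pi.single i 1), g v, g w] = _
    rw [hαβ]
    refine (congrArg _ ?_).trans (hdet ![α (Pi.single i 1), Pi.single i 1, v, w])
    ext k : 1
    fin_cases k <;> rfl
  rw [pairing, pairing, ht, killingModel, killingModel, hαβ, hη]

/-! ## Alternating sums -/

section Alt

variable {n : ℕ} {W : Type*}

/-- The alternating sum of `q` over all permutations of its arguments. -/
def altSum (q : (Fin n → W) → ℝ) (v : Fin n → W) : ℝ :=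
  ∑ σ : Equiv.Perm (Fin n), ((Equiv.Perm.sign σ : ℤ) : ℝ) * q fun i => v (σ i)

theorem altSum_add (q q' : (Fin n → W) → ℝ) (v : Fin n → W) :
    altSum (fun v => q v + q' v) v = altSum q v + altSum q' v := by
  simp only [altSum, mul_add, Finset.sum_add_distrib]

theorem altSum_sub (q q' : (Fin n → W) → ℝ) (v : Fin n → W) :
    altSum (fun v => q v - q' v) v = altSum q v - altSum q' v := by
  simp only [altSum, mul_sub, Finset.sum_sub_distrib]

theorem altSum_mul (r : ℝ) (q : (Fin n → W) → ℝ) (v : Fin n → W) :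
    altSum (fun v => r * q v) v = r * altSum q v := by
  simp only [altSum, Finset.mul_sum]
  exact Finset.sum_congr rfl fun _ _ => by ring

theorem altSum_neg (q : (Fin n → W) → ℝ) (v : Fin n → W) :
    altSum (fun v => -q v) v = -altSum q v := by
  simp only [altSum, mul_neg, Finset.sum_neg_distrib]

/-- Reindexing by σ ↦ σρ changes the sign by that of ρ, whose square is 1. -/
theorem altSum_perm (ρ : Equiv.Perm (Fin n)) (q : (Fin n → W) → ℝ) (v : Fin n → W) :
    altSum (fun v => q fun i => v (ρ i)) v = ((Equiv.Perm.sign ρ : ℤ) : ℝ) * altSum q v := by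
  have hs : (((Equiv.Perm.sign ρ : ℤ) : ℝ)) * ((Equiv.Perm.sign ρ : ℤ) : ℝ) = 1 := by
    exact_mod_cast congrArg (Int.cast : ℤ → ℝ) (Int.units_coe_mul_self (Equiv.Perm.sign ρ))
  simp only [altSum, Finset.mul_sum]
  refine Fintype.sum_equiv (Equiv.mulRight ρ) _ _ fun σ => ?_
  simp only [Equiv.coe_mulRight, Equiv.Perm.sign_mul, Units.val_mul, Int.cast_mul,
    Equiv.Perm.mul_apply]
  linear_combination (-(((Equiv.Perm.sign σ : ℤ) : ℝ) * q fun i => v (σ (ρ i)))) * hs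

theorem altSum_swap {i j : Fin n} (hij : i ≠ j) (q : (Fin n → W) → ℝ) (v : Fin n → W) :
    altSum (fun v => q fun k => v (Equiv.swap i j k)) v = -altSum q v := by
  rw [altSum_perm, Equiv.Perm.sign_swap hij]
  simp

/-- Expansion of an alternating sum along the first argument. -/
theorem altSum_succ (q : W → (Fin n → W) → ℝ) (v : Fin (n + 1) → W) :
    altSum (fun v => q (v 0) fun j => v j.succ) v =
      ∑ i : Fin (n + 1), (-1 : ℝ) ^ (i : ℕ) * altSum (q (v i)) fun j => v (i.succAbove j) := by
  -- A permutation is determined by the image i of 0 and by the permutation induced on the other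
  -- letters: `ρ` sends 0 to i and j + 1 to `i.succAbove (e j)`. The cycle that moves i into place
  -- has sign (-1)^i.
  let ρ : Fin (n + 1) × Equiv.Perm (Fin n) → Equiv.Perm (Fin (n + 1)) := fun p =>
    p.1.cycleRange.symm * Equiv.Perm.decomposeFin.symm (0, p.2)
  have h0 : ∀ p, ρ p 0 = p.1 := by
    intro p
    simp [ρ, Equiv.Perm.mul_apply]
  have hsucc : ∀ p j, ρ p (Fin.succ j) = p.1.succAbove (p.2 j) := by
    intro p j
    simp [ρ, Equiv.Perm.mul_apply]
  have hinj : Function.Injective ρ := by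
    rintro ⟨i, e⟩ ⟨i', e'⟩ h
    have hi : i = i' :=
      (h0 (i, e)).symm.trans ((congrArg (fun σ => σ 0) h).trans (h0 (i', e')))
    subst hi
    refine Prod.ext rfl (Equiv.ext fun j => ?_)
    have := hsucc (i, e) j
    rw [h, hsucc (i, e') j] at this
    exact (Fin.succAbove_right_injective this).symm
  have hbij : Function.Bijective ρ := by
    rw [Fintype.bijective_iff_injective_and_card]
    refine ⟨hinj, ?_⟩
    rw [Fintype.card_prod, Fintype.card_fin, Fintype.card_perm, Fintype.card_perm,
      Fintype.card_fin, Fintype.card_fin, Nat.factorial_succ]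
  simp only [altSum, Finset.mul_sum]
  rw [← Fintype.sum_prod_type']
  refine (Fintype.sum_bijective ρ hbij _ _ fun p => ?_).symm
  have hsign : ((Equiv.Perm.sign (ρ p) : ℤ) : ℝ) =
      (-1 : ℝ) ^ (p.1 : ℕ) * ((Equiv.Perm.sign p.2 : ℤ) : ℝ) := by
    have h1 : Equiv.Perm.sign (ρ p) = (-1) ^ (p.1 : ℕ) * Equiv.Perm.sign p.2 := by
      simp [ρ, Equiv.Perm.sign_mul, Fin.sign_cycleRange]
    rw [h1]
    simp
  rw [h0, hsign, mul_assoc]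
  simp only [hsucc]

end Alt

theorem wedge_eq_altSum {W : Type*} (p : W → W → W → W → ℝ) (v : Fin 4 → W) :
    wedge p v = (1 / 4) * altSum (fun v => p (v 0) (v 1) (v 2) (v 3)) v := rfl

section Multilinear

variable {E : Type*} [AddCommGroup E] [Module ℝ E]

theorem alternatization_eq_altSum {n : ℕ} (m : MultilinearMap ℝ (fun _ : Fin n => E) ℝ)
    (v : Fin n → E) : MultilinearMap.alternatization m v = altSum (fun v => m v) v := by
  rw [MultilinearMap.alternatization_apply, altSum]
  refine Finset.sum_congr rfl fun σ _ => ?_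
  rw [MultilinearMap.domDomCongr_apply, Units.smul_def, zsmul_eq_mul]

end Multilinear

set_option linter.style.haveILetI false

/-! ## Smoothness of sections of bundles of linear maps -/

section HomBundle

variable {EQ HQ Q : Type*} [NormedAddCommGroup EQ] [NormedSpace ℝ EQ] [TopologicalSpace HQ]
  {IQ : ModelWithCorners ℝ EQ HQ} [TopologicalSpace Q] [ChartedSpace HQ Q]

/-- The filter at `insert q₀ s` also records the equality at q₀, so one eventual statement suffices
even if q₀ is not in s. -/
theorem _root_.ContMDiffWithinAt.congr_of_eventuallyEq_insert {E' H' M' : Type*}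
    [NormedAddCommGroup E'] [NormedSpace ℝ E'] [TopologicalSpace H'] {I' : ModelWithCorners ℝ E' H'}
    [TopologicalSpace M'] [ChartedSpace H' M'] {f g : Q → M'} {s : Set Q} {q₀ : Q}
    (h : ContMDiffWithinAt IQ I' ∞ f s q₀) (hfg : g =ᶠ[𝓝[insert q₀ s] q₀] f) :
    ContMDiffWithinAt IQ I' ∞ g s q₀ :=
  h.congr_of_eventuallyEq (hfg.filter_mono (nhdsWithin_mono _ (subset_insert _ _)))
    (hfg.self_of_nhdsWithin (mem_insert _ _))

/-- The source is finite-dimensional, so a linear map is the finite sum of its values on a basis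
times the dual basis, and this sum depends smoothly on those values. -/
theorem contMDiffWithinAt_clm_of_apply {F G : Type*} [NormedAddCommGroup F] [NormedSpace ℝ F]
    [FiniteDimensional ℝ F] [NormedAddCommGroup G] [NormedSpace ℝ G]
    {f : Q → F →L[ℝ] G} {s : Set Q} {q₀ : Q}
    (h : ∀ w, ContMDiffWithinAt IQ 𝓘(ℝ, G) ∞ (fun q => f q w) s q₀) :
    ContMDiffWithinAt IQ 𝓘(ℝ, F →L[ℝ] G) ∞ f s q₀ := by
  let b := Module.finBasis ℝ F
  let r : Fin (Module.finrank ℝ F) → G →L[ℝ] F →L[ℝ] G := fun i =>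
    ContinuousLinearMap.smulRightL ℝ F G (LinearMap.toContinuousLinearMap (b.coord i))
  have hf : f = fun q => ∑ i, r i (f q (b i)) := by
    ext q w
    simp only [sum_apply, r, ContinuousLinearMap.smulRightL_apply_apply]
    conv_lhs => rw [← b.sum_repr w, map_sum]
    simp
  rw [hf]
  refine ContMDiffWithinAt.sum fun i _ => ?_
  exact (r i).contMDiff.contMDiffAt.comp_contMDiffWithinAt q₀ (h (b i))

theorem contDiffWithinAt_clm_of_apply {X F G : Type*} [NormedAddCommGroup X] [NormedSpace ℝ X]
    [NormedAddCommGroup F] [NormedSpace ℝ F]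
    [FiniteDimensional ℝ F] [NormedAddCommGroup G] [NormedSpace ℝ G]
    {f : X → F →L[ℝ] G} {s : Set X} {q₀ : X}
    (h : ∀ w, ContDiffWithinAt ℝ ∞ (fun q => f q w) s q₀) :
    ContDiffWithinAt ℝ ∞ f s q₀ := by
  rw [← contMDiffWithinAt_iff_contDiffWithinAt]
  exact contMDiffWithinAt_clm_of_apply fun w => contMDiffWithinAt_iff_contDiffWithinAt.2 (h w)

variable {EB HB M : Type*} [NormedAddCommGroup EB] [NormedSpace ℝ EB] [TopologicalSpace HB]
  {IB : ModelWithCorners ℝ EB HB} [TopologicalSpace M] [ChartedSpace HB M]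
  {F₁ F₂ : Type*} [NormedAddCommGroup F₁] [NormedSpace ℝ F₁] [FiniteDimensional ℝ F₁]
  [NormedAddCommGroup F₂] [NormedSpace ℝ F₂]
  {E₁ E₂ : M → Type*} [TopologicalSpace (TotalSpace F₁ E₁)] [∀ x, AddCommGroup (E₁ x)]
  [∀ x, Module ℝ (E₁ x)] [∀ x, TopologicalSpace (E₁ x)] [FiberBundle F₁ E₁] [VectorBundle ℝ F₁ E₁]
  [TopologicalSpace (TotalSpace F₂ E₂)] [∀ x, AddCommGroup (E₂ x)]
  [∀ x, Module ℝ (E₂ x)] [∀ x, TopologicalSpace (E₂ x)] [FiberBundle F₂ E₂] [VectorBundle ℝ F₂ E₂]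
  [∀ x, IsTopologicalAddGroup (E₂ x)] [∀ x, ContinuousSMul ℝ (E₂ x)]

/-- A family of bundle maps is smooth if its values on all locally constant sections are. -/
theorem contMDiffWithinAt_hom_of_apply {p : Q → M} {ϕ : ∀ q, E₁ (p q) →L[ℝ] E₂ (p q)} {s : Set Q}
    {q₀ : Q} (hp : ContMDiffWithinAt IQ IB ∞ p s q₀)
    (h : ∀ w : F₁, ContMDiffWithinAt IQ (IB.prod 𝓘(ℝ, F₂)) ∞
      (fun q => (⟨p q, ϕ q ((trivializationAt F₁ E₁ (p q₀)).symm (p q) w)⟩ : TotalSpace F₂ E₂))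
      s q₀) :
    ContMDiffWithinAt IQ (IB.prod 𝓘(ℝ, F₁ →L[ℝ] F₂)) ∞
      (fun q => (⟨p q, ϕ q⟩ : TotalSpace (F₁ →L[ℝ] F₂) fun x => E₁ x →L[ℝ] E₂ x)) s q₀ := by
  rw [contMDiffWithinAt_hom_bundle]
  refine ⟨hp, contMDiffWithinAt_clm_of_apply fun w => ?_⟩
  have hw := (contMDiffWithinAt_totalSpace.1 (h w)).2
  have hb : (trivializationAt F₁ E₁ (p q₀)).baseSet ∩ (trivializationAt F₂ E₂ (p q₀)).baseSet ∈
      𝓝 (p q₀) :=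
    ((trivializationAt F₁ E₁ (p q₀)).open_baseSet.inter
      (trivializationAt F₂ E₂ (p q₀)).open_baseSet).mem_nhds
      ⟨FiberBundle.mem_baseSet_trivializationAt' _, FiberBundle.mem_baseSet_trivializationAt' _⟩
  have hc : ContinuousWithinAt p (insert q₀ s) q₀ := hp.continuousWithinAt.insert
  refine ContMDiffWithinAt.congr_of_eventuallyEq_insert hw ?_
  filter_upwards [hc hb] with q hq
  simp only [ContinuousLinearMap.inCoordinates, ContinuousLinearMap.comp_apply]
  rw [Trivialization.continuousLinearMapAt_apply, Trivialization.linearMapAt_apply, if_pos hq.2,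
    Trivialization.symmL_apply _ hq.1]

end HomBundle

/-! ## Local orthonormal frames -/

section Frames

variable {M : Type*} [TopologicalSpace M] [ChartedSpace (EuclideanHalfSpace 4) M]
  [IsManifold (𝓡∂ 4) ∞ M]
  {V : M → Type*} [TopologicalSpace (TotalSpace Mink V)] [∀ x, AddCommGroup (V x)]
  [∀ x, Module ℝ (V x)] [∀ x, TopologicalSpace (V x)] [∀ x, IsTopologicalAddGroup (V x)]
  [∀ x, ContinuousSMul ℝ (V x)] [FiberBundle Mink V] [VectorBundle ℝ Mink V]
  [ContMDiffVectorBundle ∞ Mink V (𝓡∂ 4)]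

/-- A family of smooth sections that is an oriented orthonormal frame over an open set. -/
structure LocalFrame (P : MinkowskiBundle V) where
  U : Set M
  isOpen : IsOpen U
  b : Fin 4 → ∀ x, V x
  smooth : ∀ i, ContMDiff (𝓡∂ 4) ((𝓡∂ 4).prod 𝓘(ℝ, Mink)) ∞
    (fun x => (⟨x, b i x⟩ : TotalSpace Mink V))
  η_eq : ∀ x ∈ U, ∀ i j, P.η x (b i x) (b j x) = if i = j then sgn i else 0
  vol_eq : ∀ x ∈ U, P.vol x (fun i => b i x) = 1

variable {P : MinkowskiBundle V}

-- A bump function equal to 1 near x₀ extends the local frame by zero to global smooth sections, to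
-- which a covariant derivative can be applied. Orthonormality survives only where the bump function
-- is 1; that region is the set `U`.
variable (P) in
theorem exists_localFrame [T2Space M] (x₀ : M) : ∃ f : LocalFrame P, x₀ ∈ f.U := by
  obtain ⟨U₀, hU₀, b₀, hb₀, h⟩ := P.exists_frame x₀
  obtain ⟨χ, -, hχ⟩ := (SmoothBumpFunction.nhds_basis_tsupport (I := 𝓡∂ 4) x₀).mem_iff.1
    (interior_mem_nhds.2 hU₀)
  obtain ⟨W, hW1, hW, hxW⟩ := mem_nhds_iff.1
    (Filter.inter_mem χ.eventuallyEq_one (interior_mem_nhds.2 hU₀))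
  have hW' : ∀ x ∈ W, ∀ i, χ x • b₀ i x = b₀ i x := by
    intro x hx i
    have : χ x = 1 := (hW1 hx).1
    rw [this, one_smul]
  refine ⟨⟨W, hW, fun i x => χ x • b₀ i x, fun i => ?_, fun x hx i j => ?_, fun x hx => ?_⟩, hxW⟩
  · exact ContMDiffOn.smul_section_of_tsupport (u := interior U₀) (ψ := χ) (s := b₀ i)
      χ.contMDiff.contMDiffOn isOpen_interior hχ ((hb₀ i).mono interior_subset)
  · rw [hW' x hx, hW' x hx]
    exact (h x (interior_subset (hW1 hx).2)).1 i j
  · simp only [hW' x hx]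
    exact (h x (interior_subset (hW1 hx).2)).2

theorem finrank_fibre (x : M) : Module.finrank ℝ Mink = Module.finrank ℝ (V x) :=
  (((trivializationAt Mink V x).continuousLinearEquivAt ℝ x
    (FiberBundle.mem_baseSet_trivializationAt' x)).toLinearEquiv.finrank_eq).symm

theorem finiteDimensional_fibre (x : M) : FiniteDimensional ℝ (V x) :=
  ((trivializationAt Mink V x).continuousLinearEquivAt ℝ x
    (FiberBundle.mem_baseSet_trivializationAt' x)).toLinearEquiv.symm.finiteDimensional

namespace LocalFrame

variable (f : LocalFrame P)

/-- The components of a vector with respect to the frame. -/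
def coord (x : M) : V x →ₗ[ℝ] Mink := LinearMap.pi fun i => sgn i • P.η x (f.b i x)

/-- The vector with given components. -/
def lift (x : M) : Mink →ₗ[ℝ] V x := Fintype.linearCombination ℝ fun i => f.b i x

theorem coord_apply (x : M) (s : V x) (i : Fin 4) :
    f.coord x s i = sgn i * P.η x (f.b i x) s := rfl

theorem lift_apply (x : M) (v : Mink) : f.lift x v = ∑ i, v i • f.b i x := by
  simp [lift, Fintype.linearCombination_apply]

theorem lift_single (x : M) (i : Fin 4) : f.lift x (Pi.single i 1) = f.b i x := by
  simp [lift]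

variable {f}

theorem coord_lift {x : M} (hx : x ∈ f.U) (v : Mink) : f.coord x (f.lift x v) = v := by
  ext i
  simp only [coord_apply, lift_apply, map_sum, map_smul, f.η_eq x hx, smul_eq_mul, mul_ite,
    mul_zero, Finset.sum_ite_eq, Finset.mem_univ, if_true]
  linear_combination v i * sgn_mul_self i

theorem lift_coord {x : M} (hx : x ∈ f.U) (s : V x) : f.lift x (f.coord x s) = s := by
  haveI := finiteDimensional_fibre (V := V) x
  have hinj : Function.Injective (f.lift x) :=
    Function.LeftInverse.injective (coord_lift hx)
  have hsurj := (LinearMap.injective_iff_surjective_of_finrank_eq_finrank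
    (finrank_fibre (V := V) x)).1 hinj
  obtain ⟨v, rfl⟩ := hsurj s
  rw [coord_lift hx]

theorem η_lift {x : M} (hx : x ∈ f.U) (u v : Mink) :
    P.η x (f.lift x u) (f.lift x v) = minkowskiForm u v := by
  simp only [lift_apply, map_sum, map_smul, LinearMap.sum_apply, LinearMap.smul_apply,
    f.η_eq x hx, smul_eq_mul, minkowskiForm_apply]
  refine Finset.sum_congr rfl fun i _ => ?_
  simp [mul_comm, mul_left_comm]

theorem η_eq_coord {x : M} (hx : x ∈ f.U) (s t : V x) :
    P.η x s t = minkowskiForm (f.coord x s) (f.coord x t) := by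
  rw [← η_lift hx, lift_coord hx, lift_coord hx]

theorem coord_injective {x : M} (hx : x ∈ f.U) : Function.Injective (f.coord x) :=
  Function.LeftInverse.injective (lift_coord hx)

/-- A top-degree alternating form is a multiple of the determinant, and the factor is its value on
the basis. -/
theorem vol_comp_eq_det {x : M} {h : Mink →ₗ[ℝ] V x}
    (hv : P.vol x (fun i => h (Pi.single i 1)) = 1) (m : Fin 4 → Mink) :
    P.vol x (fun i => h (m i)) = Matrix.detRowAlternating m := by
  have h1 := AlternatingMap.eq_smul_basis_det (Pi.basisFun ℝ (Fin 4)) ((P.vol x).compLinearMap h)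
  have h2 : (P.vol x).compLinearMap h (Pi.basisFun ℝ (Fin 4)) = 1 := by
    rw [AlternatingMap.compLinearMap_apply]
    simpa using hv
  rw [h2, one_smul, Pi.basisFun_det] at h1
  have h3 := congrArg (fun w : Mink [⋀^Fin 4]→ₗ[ℝ] ℝ => w m) h1
  simpa using h3

theorem frame_apply (x : M) (v : Mink) : P.frame x v = ∑ i, v i • P.frameVec x i := by
  change Fintype.linearCombination ℝ (P.frameVec x) v = _
  rw [Fintype.linearCombination_apply]

theorem η_frame (x : M) (u v : Mink) :
    P.η x (P.frame x u) (P.frame x v) = minkowskiForm u v := by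
  simp only [frame_apply, map_sum, map_smul, LinearMap.sum_apply, LinearMap.smul_apply,
    P.η_frameVec, smul_eq_mul, minkowskiForm_apply]
  refine Finset.sum_congr rfl fun i _ => ?_
  simp [mul_comm, mul_left_comm]

theorem vol_frame (x : M) (m : Fin 4 → Mink) :
    P.vol x (fun i => P.frame x (m i)) = Matrix.detRowAlternating m := by
  refine vol_comp_eq_det (h := (P.frame x).toLinearMap) ?_ m
  have : ∀ i, P.frame x (Pi.single i 1) = P.frameVec x i := by
    intro i
    rw [frame_apply]
    simp [Pi.single_apply]
  simp only [LinearEquiv.coe_coe, this]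
  exact (Classical.choose_spec (P.exists_frameAt x)).2

theorem vol_lift {x : M} (hx : x ∈ f.U) (m : Fin 4 → Mink) :
    P.vol x (fun i => f.lift x (m i)) = Matrix.detRowAlternating m := by
  refine vol_comp_eq_det ?_ m
  simp only [lift_single]
  exact f.vol_eq x hx

/-- The transition map from a local frame to the chosen frame of a fibre. -/
def toFrame (f : LocalFrame P) {x : M} (hx : x ∈ f.U) : Mink ≃ₗ[ℝ] Mink :=
  let h : Mink ≃ₗ[ℝ] V x :=
    { f.lift x with
      invFun := f.coord x
      left_inv := coord_lift hx
      right_inv := lift_coord hx }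
  h.trans (P.frame x).symm

theorem toFrame_coord {x : M} (hx : x ∈ f.U) (s : V x) :
    f.toFrame hx (f.coord x s) = (P.frame x).symm s := by
  change (P.frame x).symm (f.lift x (f.coord x s)) = _
  rw [lift_coord hx]

theorem frame_toFrame {x : M} (hx : x ∈ f.U) (v : Mink) :
    P.frame x (f.toFrame hx v) = f.lift x v := by
  change P.frame x ((P.frame x).symm (f.lift x v)) = _
  simp

/-- Both frames are oriented and orthonormal, so the transition map preserves η and, by
`det_toFrame`, the determinant, as `pairing_conj` requires. The frame `P.frame x` is chosen point by
point with no smoothness in x; smoothness is argued in local frames and the values are transferred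
through this map. -/
theorem minkowskiForm_toFrame {x : M} (hx : x ∈ f.U) (u v : Mink) :
    minkowskiForm (f.toFrame hx u) (f.toFrame hx v) = minkowskiForm u v := by
  rw [← η_frame (P := P) x, frame_toFrame, frame_toFrame, η_lift hx]

theorem det_toFrame {x : M} (hx : x ∈ f.U) (m : Fin 4 → Mink) :
    Matrix.detRowAlternating (fun i => f.toFrame hx (m i)) = Matrix.detRowAlternating m := by
  rw [← vol_frame (P := P) x]
  simp only [frame_toFrame]
  exact vol_lift hx m

/-- The pairing computed in the chosen frame of a fibre agrees with the one computed in a local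
frame. -/
theorem pairing_frame {c d : ℝ} {x : M} (hx : x ∈ f.U) {α β : Module.End ℝ Mink}
    {L : V x → V x} (hβ : ∀ v, β v = (P.frame x).symm (L (P.frame x v)))
    (hα : ∀ v, α v = f.coord x (L (f.lift x v))) (s t : V x) :
    pairing c d β ((P.frame x).symm s) ((P.frame x).symm t) =
      pairing c d α (f.coord x s) (f.coord x t) := by
  rw [← toFrame_coord hx, ← toFrame_coord hx]
  refine pairing_conj (minkowskiForm_toFrame hx) (det_toFrame hx) (fun v => ?_) _ _
  rw [hβ, hα, toFrame_coord hx, frame_toFrame]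

end LocalFrame

section Smoothness

variable {EQ HQ Q : Type*} [NormedAddCommGroup EQ] [NormedSpace ℝ EQ] [TopologicalSpace HQ]
  {IQ : ModelWithCorners ℝ EQ HQ} [TopologicalSpace Q] [ChartedSpace HQ Q]
  (f : LocalFrame P)

/-- The components of a smooth family of vectors are smooth. -/
theorem contMDiffWithinAt_coord {p : Q → M} {σ : ∀ q, V (p q)} {s : Set Q} {q₀ : Q}
    (hq : p q₀ ∈ f.U)
    (h : ContMDiffWithinAt IQ ((𝓡∂ 4).prod 𝓘(ℝ, Mink)) ∞
      (fun q => (⟨p q, σ q⟩ : TotalSpace Mink V)) s q₀) :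
    ContMDiffWithinAt IQ 𝓘(ℝ, Mink) ∞ (fun q => f.coord (p q) (σ q)) s q₀ := by
  set e := trivializationAt Mink V (p q₀) with he
  obtain ⟨hp, ht⟩ := contMDiffWithinAt_totalSpace.1 h
  -- `B q` is the frame read in a trivialisation of the bundle. It is smooth and invertible, and the
  -- components are its inverse applied to the trivialised vector; inversion is smooth at units. No
  -- smoothness of η is assumed, it is encoded in the frames.
  let B : Q → Mink →L[ℝ] Mink := fun q => LinearMap.toContinuousLinearMap
    (Fintype.linearCombination ℝ fun i => (e ⟨p q, f.b i (p q)⟩).2)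
  have hBsm : ContMDiffWithinAt IQ 𝓘(ℝ, Mink →L[ℝ] Mink) ∞ B s q₀ := by
    refine contMDiffWithinAt_clm_of_apply fun w => ?_
    simp only [B, LinearMap.coe_toContinuousLinearMap', Fintype.linearCombination_apply]
    refine ContMDiffWithinAt.sum fun i _ => ?_
    have := (f.smooth i).contMDiffAt (x := p q₀)
    have h2 := this.comp_contMDiffWithinAt q₀ hp
    exact (w i • ContinuousLinearMap.id ℝ Mink).contMDiff.contMDiffAt.comp_contMDiffWithinAt q₀
      (contMDiffWithinAt_totalSpace.1 h2).2
  have hev : ∀ᶠ q in 𝓝[insert q₀ s] q₀, p q ∈ e.baseSet ∩ f.U := by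
    have hc : ContinuousWithinAt p (insert q₀ s) q₀ := hp.continuousWithinAt.insert
    exact hc ((e.open_baseSet.inter f.isOpen).mem_nhds
      ⟨FiberBundle.mem_baseSet_trivializationAt' _, hq⟩)
  have hB : ∀ q, p q ∈ e.baseSet ∩ f.U → ∀ v, B q v = (e ⟨p q, f.lift (p q) v⟩).2 := by
    intro q hq v
    have h1 := map_sum (e.linearMapAt ℝ (p q)) (fun i => v i • f.b i (p q)) Finset.univ
    rw [← f.lift_apply] at h1
    simp only [map_smul] at h1
    rw [e.linearMapAt_apply, if_pos hq.1] at h1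
    simp only [B, LinearMap.coe_toContinuousLinearMap', Fintype.linearCombination_apply]
    rw [h1]
    refine Finset.sum_congr rfl fun i _ => ?_
    rw [e.linearMapAt_apply, if_pos hq.1]
  have hunit : ∀ q, p q ∈ e.baseSet ∩ f.U → IsUnit (B q) := by
    intro q hq
    have hinj : Function.Injective (B q) := by
      intro v w hvw
      rw [hB q hq, hB q hq] at hvw
      have h3 : f.lift (p q) v = f.lift (p q) w := by
        have := (e.continuousLinearEquivAt ℝ (p q) hq.1).injective
        exact this hvw
      rw [← LocalFrame.coord_lift hq.2 v, h3, LocalFrame.coord_lift hq.2 w]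
    have hker : (B q).ker = ⊥ := LinearMap.ker_eq_bot.2 hinj
    have hinj' : Function.Injective (B q : Mink →ₗ[ℝ] Mink) := hinj
    let E : Mink ≃L[ℝ] Mink := (LinearEquiv.ofInjectiveEndo (B q : Mink →ₗ[ℝ] Mink)
      hinj').toContinuousLinearEquiv
    have hE : (E : Mink →L[ℝ] Mink) = B q := by
      ext v
      rfl
    rw [← hE]
    exact ⟨ContinuousLinearEquiv.toUnit E, rfl⟩
  have hq₀ : p q₀ ∈ e.baseSet ∩ f.U := ⟨FiberBundle.mem_baseSet_trivializationAt' _, hq⟩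
  have hinv : ContMDiffWithinAt IQ 𝓘(ℝ, Mink →L[ℝ] Mink) ∞ (fun q => Ring.inverse (B q)) s q₀ := by
    obtain ⟨u, hu⟩ := hunit q₀ hq₀
    have h1 : ContDiffAt ℝ ∞ Ring.inverse (B q₀) := by
      rw [← hu]
      exact contDiffAt_ringInverse ℝ u
    exact h1.contMDiffAt.comp_contMDiffWithinAt q₀ hBsm
  have hfin := hinv.clm_apply ht
  refine ContMDiffWithinAt.congr_of_eventuallyEq_insert hfin ?_
  filter_upwards [hev] with q hq
  have h4 : (e ⟨p q, σ q⟩).2 = B q (f.coord (p q) (σ q)) := by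
    rw [hB q hq, LocalFrame.lift_coord hq.2]
  rw [h4, ← mul_apply_eq_comp, Ring.inverse_mul_cancel _ (hunit q hq)]
  rfl

/-- A family of vectors with smooth components is smooth. -/
theorem contMDiffWithinAt_of_coord {p : Q → M} {σ : ∀ q, V (p q)} {s : Set Q} {q₀ : Q}
    (hq : p q₀ ∈ f.U) (hp : ContMDiffWithinAt IQ (𝓡∂ 4) ∞ p s q₀)
    (h : ContMDiffWithinAt IQ 𝓘(ℝ, Mink) ∞ (fun q => f.coord (p q) (σ q)) s q₀) :
    ContMDiffWithinAt IQ ((𝓡∂ 4).prod 𝓘(ℝ, Mink)) ∞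
      (fun q => (⟨p q, σ q⟩ : TotalSpace Mink V)) s q₀ := by
  rw [contMDiffWithinAt_totalSpace]
  refine ⟨hp, ?_⟩
  set e := trivializationAt Mink V (p q₀) with he
  have hev : ∀ᶠ q in 𝓝[insert q₀ s] q₀, p q ∈ e.baseSet ∩ f.U := by
    have hc : ContinuousWithinAt p (insert q₀ s) q₀ := hp.continuousWithinAt.insert
    exact hc ((e.open_baseSet.inter f.isOpen).mem_nhds
      ⟨FiberBundle.mem_baseSet_trivializationAt' _, hq⟩)
  have hsum : ContMDiffWithinAt IQ 𝓘(ℝ, Mink) ∞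
      (fun q => ∑ i, f.coord (p q) (σ q) i • (e ⟨p q, f.b i (p q)⟩).2) s q₀ := by
    refine ContMDiffWithinAt.sum fun i _ => ?_
    have h1 : ContMDiffWithinAt IQ 𝓘(ℝ, ℝ) ∞ (fun q => f.coord (p q) (σ q) i) s q₀ :=
      (ContinuousLinearMap.proj (R := ℝ) (φ := fun _ : Fin 4 => ℝ)
        i).contMDiff.contMDiffAt.comp_contMDiffWithinAt q₀ h
    have := (f.smooth i).contMDiffAt (x := p q₀)
    have h2 := this.comp_contMDiffWithinAt q₀ hp
    have h3 : ContMDiffWithinAt IQ 𝓘(ℝ, Mink) ∞ (fun q => (e ⟨p q, f.b i (p q)⟩).2) s q₀ :=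
      (contMDiffWithinAt_totalSpace.1 h2).2
    exact h1.smul h3
  refine ContMDiffWithinAt.congr_of_eventuallyEq_insert hsum ?_
  filter_upwards [hev] with q hq
  have h1 := map_sum (e.linearMapAt ℝ (p q)) (fun i => f.coord (p q) (σ q) i • f.b i (p q))
    Finset.univ
  rw [← f.lift_apply, LocalFrame.lift_coord hq.2] at h1
  simp only [map_smul] at h1
  rw [e.linearMapAt_apply, if_pos hq.1] at h1
  refine h1.trans ?_
  refine Finset.sum_congr rfl fun i _ => ?_
  rw [e.linearMapAt_apply, if_pos hq.1]

end Smoothness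

end Frames

/-! ### Charts of a manifold with boundary and their coordinate vector fields. -/

section Components

variable {M : Type*} [TopologicalSpace M] [ChartedSpace (EuclideanHalfSpace 4) M]
  [IsManifold (𝓡∂ 4) ∞ M]

/-- The half space in which charts of a 4-manifold with boundary take values. -/
abbrev halfSpace : Set E4 := range (𝓡∂ 4)

/-- The point with given coordinates in the chart at `c`. -/
def pt (c : M) (y : E4) : M := (extChartAt (𝓡∂ 4) c).symm y

/-- The coordinate vector fields of the chart at `c`. -/
def tv (c x : M) : E4 →L[ℝ] TangentSpace (𝓡∂ 4) x :=
  (trivializationAt E4 (TangentSpace (𝓡∂ 4) : M → Type _) c).symmL ℝ x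

theorem pt_mem_source {c : M} {y : E4} (hy : y ∈ (extChartAt (𝓡∂ 4) c).target) :
    pt c y ∈ (chartAt (EuclideanHalfSpace 4) c).source := by
  have := (extChartAt (𝓡∂ 4) c).map_target hy
  rwa [extChartAt_source] at this

theorem extChartAt_pt {c : M} {y : E4} (hy : y ∈ (extChartAt (𝓡∂ 4) c).target) :
    extChartAt (𝓡∂ 4) c (pt c y) = y := (extChartAt (𝓡∂ 4) c).right_inv hy

theorem pt_extChartAt {c x : M} (hx : x ∈ (chartAt (EuclideanHalfSpace 4) c).source) :
    pt c (extChartAt (𝓡∂ 4) c x) = x := 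
  (extChartAt (𝓡∂ 4) c).left_inv (by rwa [extChartAt_source])

theorem pt_self (x : M) : pt x (extChartAt (𝓡∂ 4) x x) = x := extChartAt_to_inv x

theorem mfderivWithin_symm {c : M} {y : E4} (hy : y ∈ (extChartAt (𝓡∂ 4) c).target) :
    mfderivWithin 𝓘(ℝ, E4) (𝓡∂ 4) (extChartAt (𝓡∂ 4) c).symm (range (𝓡∂ 4)) y =
      tv c (pt c y) := by
  have h := TangentBundle.symmL_trivializationAt (I := 𝓡∂ 4) (pt_mem_source hy)
  rw [extChartAt_pt hy] at h
  exact h.symm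

/-- The tangent space at x is identified with the model space through the chart at x, so at the
centre of its own chart the coordinate vectors are the standard ones. -/
theorem tv_self (x : M) (u : E4) : tv x x u = u := by
  have h := TangentBundle.symmL_trivializationAt_eq_core (I := 𝓡∂ 4) (b₀ := x) (b := x)
    (mem_chart_source _ x)
  rw [tv, h]
  exact (tangentBundleCore (𝓡∂ 4) M).coordChange_self (achart _ x) x (mem_chart_source _ x) u

theorem mem_baseSet_iff {c x : M} :
    x ∈ (trivializationAt E4 (TangentSpace (𝓡∂ 4) : M → Type _) c).baseSet ↔
      x ∈ (chartAt (EuclideanHalfSpace 4) c).source := by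
  rw [TangentBundle.trivializationAt_baseSet]

theorem tv_eq_symm {c x : M} (hx : x ∈ (chartAt (EuclideanHalfSpace 4) c).source) (u : E4) :
    tv c x u = (trivializationAt E4 (TangentSpace (𝓡∂ 4) : M → Type _) c).symm x u :=
  Trivialization.symmL_apply _ (mem_baseSet_iff.2 hx) u

/-- The extension of a tangent vector has constant coefficients in the chart at its base point. This
is why the brackets in the definitions of torsion and curvature vanish. -/
theorem extendT_eq {x₀ x : M} (hx : x ∈ (chartAt (EuclideanHalfSpace 4) x₀).source)
    (u : TangentSpace (𝓡∂ 4) x₀) : extendT u x = tv x₀ x u := by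
  have h1 : extendT u x = (trivializationAt E4 (TangentSpace (𝓡∂ 4) : M → Type _) x₀).symm x
      ((trivializationAt E4 (TangentSpace (𝓡∂ 4) : M → Type _) x₀) ⟨x₀, u⟩).2 := rfl
  have h2 : extendT u x₀ = u := FiberBundle.extend_apply_self E4 u
  have h3 : extendT u x₀ = tv x₀ x₀
      ((trivializationAt E4 (TangentSpace (𝓡∂ 4) : M → Type _) x₀) ⟨x₀, u⟩).2 := by
    rw [tv_eq_symm (mem_chart_source _ x₀)]; rfl
  rw [h2, tv_self] at h3
  rw [h1]
  exact (congrArg _ h3.symm).trans (tv_eq_symm hx _).symm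

theorem pt_contMDiffWithinAt {X : Type*} [NormedAddCommGroup X] [NormedSpace ℝ X] {c : M}
    {g : X → E4} {s : Set X} {q : X} (hg : ContDiffWithinAt ℝ ∞ g s q) (hs : MapsTo g s halfSpace)
    (hq : g q ∈ (extChartAt (𝓡∂ 4) c).target) :
    ContMDiffWithinAt 𝓘(ℝ, X) (𝓡∂ 4) ∞ (fun q => pt c (g q)) s q := by
  have h1 := contMDiffWithinAt_extChartAt_symm_range (n := ∞) (I := 𝓡∂ 4) c hq
  exact h1.comp q hg.contMDiffWithinAt hs

theorem tv_contMDiffWithinAt {EQ HQ Q : Type*} [NormedAddCommGroup EQ] [NormedSpace ℝ EQ]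
    [TopologicalSpace HQ] {IQ : ModelWithCorners ℝ EQ HQ} [TopologicalSpace Q] [ChartedSpace HQ Q]
    {c : M} {p : Q → M} {s : Set Q} {q : Q} (hp : ContMDiffWithinAt IQ (𝓡∂ 4) ∞ p s q)
    (hq : p q ∈ (chartAt (EuclideanHalfSpace 4) c).source) (u : E4) :
    ContMDiffWithinAt IQ ((𝓡∂ 4).prod 𝓘(ℝ, E4)) ∞
      (fun q => (⟨p q, tv c (p q) u⟩ : TotalSpace E4 (TangentSpace (𝓡∂ 4) : M → Type _))) s q := by
  set e := trivializationAt E4 (TangentSpace (𝓡∂ 4) : M → Type _) c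
  have h1 : ContMDiffWithinAt IQ ((𝓡∂ 4).prod 𝓘(ℝ, E4)) ∞ (fun q => (p q, u)) s q :=
    hp.prodMk contMDiffWithinAt_const
  have h2 : ContMDiffAt ((𝓡∂ 4).prod 𝓘(ℝ, E4)) ((𝓡∂ 4).prod 𝓘(ℝ, E4)) ∞
      e.toOpenPartialHomeomorph.symm (p q, u) := by
    refine (Trivialization.contMDiffOn_symm e).contMDiffAt (e.open_target.mem_nhds ?_)
    rw [e.mem_target]
    exact mem_baseSet_iff.2 hq
  have h3 := h2.comp_contMDiffWithinAt q h1
  refine h3.congr_of_eventuallyEq_insert ?_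
  have hc : ContinuousWithinAt p (insert q s) q := hp.continuousWithinAt.insert
  filter_upwards [hc ((chartAt (EuclideanHalfSpace 4) c).open_source.mem_nhds hq)] with q' hq'
  rw [tv_eq_symm hq', e.mk_symm (mem_baseSet_iff.2 hq')]
  rfl

/-- The derivative of a function in a coordinate direction. -/
theorem mfderiv_tv {W : Type*} [NormedAddCommGroup W] [NormedSpace ℝ W] {g : M → W} {c x : M}
    (hx : x ∈ (chartAt (EuclideanHalfSpace 4) c).source)
    (hg : MDifferentiableAt (𝓡∂ 4) 𝓘(ℝ, W) g x) (u : E4) :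
    mfderiv (𝓡∂ 4) 𝓘(ℝ, W) g x (tv c x u) =
      fderivWithin ℝ (fun y => g (pt c y)) halfSpace (extChartAt (𝓡∂ 4) c x) u := by
  obtain ⟨y, hy, rfl⟩ : ∃ y ∈ (extChartAt (𝓡∂ 4) c).target, x = pt c y :=
    ⟨extChartAt (𝓡∂ 4) c x, (extChartAt (𝓡∂ 4) c).map_source (by rwa [extChartAt_source]),
      (pt_extChartAt hx).symm⟩
  rw [extChartAt_pt hy, ← mfderivWithin_symm hy, ← mfderivWithin_eq_fderivWithin]
  have hyr : y ∈ halfSpace := extChartAt_target_subset_range c hy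
  have h := mfderiv_comp_mfderivWithin y (I := 𝓘(ℝ, E4)) (I' := 𝓡∂ 4) (I'' := 𝓘(ℝ, W)) (g := g)
    (f := (extChartAt (𝓡∂ 4) c).symm) (s := halfSpace) hg
    (mdifferentiableWithinAt_extChartAt_symm hy)
    ((𝓡∂ 4).uniqueDiffOn.uniqueMDiffOn y hyr)
  exact (congrArg (fun L => L u) h).symm

theorem uniqueDiffOn_halfSpace : UniqueDiffOn ℝ halfSpace := (𝓡∂ 4).uniqueDiffOn

theorem extChartAt_mem_halfSpace (c x : M) : extChartAt (𝓡∂ 4) c x ∈ halfSpace := by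
  rw [extChartAt_coe]; exact mem_range_self _

/-- Near a point with coordinates in the chart, points of the half space have coordinates in a
given neighbourhood. -/
theorem eventually_pt {c : M} {y : E4} (hy : y ∈ (extChartAt (𝓡∂ 4) c).target) {U : Set M}
    (hU : IsOpen U) (hyU : pt c y ∈ U) :
    ∀ᶠ y' in 𝓝[halfSpace] y, y' ∈ (extChartAt (𝓡∂ 4) c).target ∧ pt c y' ∈ U := by
  have h1 := extChartAt_target_mem_nhdsWithin_of_mem (I := 𝓡∂ 4) hy
  have hc : ContinuousWithinAt (pt c) halfSpace y :=
    (pt_contMDiffWithinAt (contDiffWithinAt_id) (mapsTo_id _) hy).continuousWithinAt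
  exact (Filter.eventually_of_mem h1 fun _ h => h).and (hc (hU.mem_nhds hyU))

end Components

/-! ### Components of fields in a local frame and a chart. -/

section FieldComponents

variable {M : Type*} [TopologicalSpace M] [ChartedSpace (EuclideanHalfSpace 4) M]
  [IsManifold (𝓡∂ 4) ∞ M]
  {V : M → Type*} [TopologicalSpace (TotalSpace Mink V)] [∀ x, AddCommGroup (V x)]
  [∀ x, Module ℝ (V x)] [∀ x, TopologicalSpace (V x)] [∀ x, IsTopologicalAddGroup (V x)]
  [∀ x, ContinuousSMul ℝ (V x)] [FiberBundle Mink V] [VectorBundle ℝ Mink V]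
  [ContMDiffVectorBundle ∞ Mink V (𝓡∂ 4)] {P : MinkowskiBundle V}

/-- A bilinear map between finite-dimensional spaces as a continuous bilinear map. -/
def toCLM₂ {E F G : Type*} [NormedAddCommGroup E] [NormedSpace ℝ E] [FiniteDimensional ℝ E]
    [NormedAddCommGroup F] [NormedSpace ℝ F] [FiniteDimensional ℝ F] [NormedAddCommGroup G]
    [NormedSpace ℝ G] (B : E →ₗ[ℝ] F →ₗ[ℝ] G) : E →L[ℝ] F →L[ℝ] G :=
  LinearMap.toContinuousLinearMap
    ((LinearMap.toContinuousLinearMap : (F →ₗ[ℝ] G) ≃ₗ[ℝ] (F →L[ℝ] G)).toLinearMap ∘ₗ B)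

namespace FieldSpace

variable (f : LocalFrame P) (c : M) (φ ψ : FieldSpace P) (r : ℝ) (x : M)

@[simp] theorem add_e : (φ + ψ).e x = φ.e x + ψ.e x := rfl
@[simp] theorem add_a : (φ + ψ).a x = φ.a x + ψ.a x := rfl
@[simp] theorem add_τ : (φ + ψ).τ x = φ.τ x + ψ.τ x := rfl
@[simp] theorem smul_e : (r • φ).e x = r • φ.e x := rfl
@[simp] theorem smul_a : (r • φ).a x = r • φ.a x := rfl
@[simp] theorem smul_τ : (r • φ).τ x = r • φ.τ x := rfl

/-- The components of the coframe. -/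
def eC : E4 →L[ℝ] Mink :=
  LinearMap.toContinuousLinearMap (f.coord x ∘ₗ (φ.e x).toLinearMap ∘ₗ (tv c x).toLinearMap)

/-- The components of the 1-form `A - A₀`. -/
def aC : E4 →L[ℝ] Mink →L[ℝ] Mink :=
  toCLM₂ (LinearMap.mk₂ ℝ (fun u s => f.coord x (φ.a x (f.lift x s) (tv c x u)))
    (fun u u' s => by simp) (fun r u s => by simp) (fun u s s' => by simp) (fun r u s => by simp))

/-- The components of the 2-form `τ`. -/
def τC : E4 →L[ℝ] E4 →L[ℝ] Mink :=
  toCLM₂ (LinearMap.mk₂ ℝ (fun u v => f.coord x (φ.τ x (tv c x u) (tv c x v)))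
    (fun u u' s => by simp) (fun r u s => by simp) (fun u s s' => by simp) (fun r u s => by simp))

theorem eC_apply (u : E4) : φ.eC f c x u = f.coord x (φ.e x (tv c x u)) := rfl
theorem aC_apply (u : E4) (s : Mink) :
    φ.aC f c x u s = f.coord x (φ.a x (f.lift x s) (tv c x u)) := rfl
theorem τC_apply (u v : E4) : φ.τC f c x u v = f.coord x (φ.τ x (tv c x u) (tv c x v)) := rfl

theorem eC_add : (φ + ψ).eC f c x = φ.eC f c x + ψ.eC f c x := by
  ext1 u; simp [eC_apply]
theorem aC_add : (φ + ψ).aC f c x = φ.aC f c x + ψ.aC f c x := by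
  ext1 u; ext1 v; simp [aC_apply]
theorem τC_add : (φ + ψ).τC f c x = φ.τC f c x + ψ.τC f c x := by
  ext1 u; ext1 v; simp [τC_apply]
theorem eC_smul : (r • φ).eC f c x = r • φ.eC f c x := by
  ext1 u; simp [eC_apply]
theorem aC_smul : (r • φ).aC f c x = r • φ.aC f c x := by
  ext1 u; ext1 v; simp [aC_apply]
theorem τC_smul : (r • φ).τC f c x = r • φ.τC f c x := by
  ext1 u; ext1 v; simp [τC_apply]

variable {f c x}

theorem aC_mem_so31 (hx : x ∈ f.U) (u : E4) :
    ((φ.aC f c x u : Mink →L[ℝ] Mink) : Module.End ℝ Mink) ∈ so31 := by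
  rw [mem_so31_iff]
  intro v w
  have h := φ.2.1 x (f.lift x v) (f.lift x w) (tv c x u)
  rw [LocalFrame.η_eq_coord hx, LocalFrame.η_eq_coord hx, LocalFrame.coord_lift hx,
    LocalFrame.coord_lift hx] at h
  exact h

end FieldSpace

/-! ### Smoothness of the components -/

/-- Through constant curves, smoothness of the components of one field is a special case of
smoothness along curves of fields. -/
theorem isSmoothCurve_const (φ : FieldSpace P) : IsSmoothCurve fun _ => φ := by
  have h2 : ContMDiff (𝓘(ℝ, ℝ).prod (𝓡∂ 4)) (𝓡∂ 4) ∞ (fun p : ℝ × M => p.2) := contMDiff_snd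
  exact ⟨φ.1.1.contMDiff.comp h2, φ.1.2.1.contMDiff.comp h2, φ.1.2.2.contMDiff.comp h2⟩

variable {f : LocalFrame P} {c : M}

theorem lift_contMDiffWithinAt {EQ HQ Q : Type*} [NormedAddCommGroup EQ] [NormedSpace ℝ EQ]
    [TopologicalSpace HQ] {IQ : ModelWithCorners ℝ EQ HQ} [TopologicalSpace Q] [ChartedSpace HQ Q]
    {p : Q → M} {s : Set Q} {q : Q} (hp : ContMDiffWithinAt IQ (𝓡∂ 4) ∞ p s q)
    (hq : p q ∈ f.U) (v : Mink) :
    ContMDiffWithinAt IQ ((𝓡∂ 4).prod 𝓘(ℝ, Mink)) ∞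
      (fun q => (⟨p q, f.lift (p q) v⟩ : TotalSpace Mink V)) s q := by
  refine contMDiffWithinAt_of_coord f hq hp ?_
  have h1 : ContMDiffWithinAt IQ 𝓘(ℝ, Mink) ∞ (fun _ => v) s q := contMDiffWithinAt_const
  refine h1.congr_of_eventuallyEq_insert ?_
  have hc : ContinuousWithinAt p (insert q s) q := hp.continuousWithinAt.insert
  filter_upwards [hc (f.isOpen.mem_nhds hq)] with q' hq'
  exact LocalFrame.coord_lift hq' v

section Curve

variable {EQ HQ Q : Type*} [NormedAddCommGroup EQ] [NormedSpace ℝ EQ]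
    [TopologicalSpace HQ] {IQ : ModelWithCorners ℝ EQ HQ} [TopologicalSpace Q] [ChartedSpace HQ Q]
    {p : Q → M} {t : Q → ℝ} {s : Set Q} {q : Q}
    {γ : ℝ → FieldSpace P} (hγ : IsSmoothCurve γ)
    (ht : ContMDiffWithinAt IQ 𝓘(ℝ, ℝ) ∞ t s q)
    (hp : ContMDiffWithinAt IQ (𝓡∂ 4) ∞ p s q) (hU : p q ∈ f.U)
    (hc : p q ∈ (chartAt (EuclideanHalfSpace 4) c).source)
include hγ ht hp hU hc

theorem eC_contMDiffWithinAt : ContMDiffWithinAt IQ 𝓘(ℝ, E4 →L[ℝ] Mink) ∞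
    (fun q => (γ (t q)).eC f c (p q)) s q := by
  refine contMDiffWithinAt_clm_of_apply fun u => ?_
  have h1 := (hγ.1.contMDiffAt (x := (t q, p q))).comp_contMDiffWithinAt q (ht.prodMk hp)
  exact contMDiffWithinAt_coord f hU (h1.clm_bundle_apply (tv_contMDiffWithinAt hp hc u))

theorem aC_contMDiffWithinAt : ContMDiffWithinAt IQ 𝓘(ℝ, E4 →L[ℝ] Mink →L[ℝ] Mink) ∞
    (fun q => (γ (t q)).aC f c (p q)) s q := by
  refine contMDiffWithinAt_clm_of_apply fun u => contMDiffWithinAt_clm_of_apply fun v => ?_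
  have h1 := (hγ.2.1.contMDiffAt (x := (t q, p q))).comp_contMDiffWithinAt q (ht.prodMk hp)
  exact contMDiffWithinAt_coord f hU ((h1.clm_bundle_apply
    (lift_contMDiffWithinAt hp hU v)).clm_bundle_apply (tv_contMDiffWithinAt hp hc u))

theorem τC_contMDiffWithinAt : ContMDiffWithinAt IQ 𝓘(ℝ, E4 →L[ℝ] E4 →L[ℝ] Mink) ∞
    (fun q => (γ (t q)).τC f c (p q)) s q := by
  refine contMDiffWithinAt_clm_of_apply fun u => contMDiffWithinAt_clm_of_apply fun v => ?_
  have h1 := (hγ.2.2.contMDiffAt (x := (t q, p q))).comp_contMDiffWithinAt q (ht.prodMk hp)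
  exact contMDiffWithinAt_coord f hU ((h1.clm_bundle_apply
    (tv_contMDiffWithinAt hp hc u)).clm_bundle_apply (tv_contMDiffWithinAt hp hc v))

end Curve

section Single

variable (φ : FieldSpace P) {y : E4} (hy : y ∈ (extChartAt (𝓡∂ 4) c).target) (hU : pt c y ∈ f.U)
include hy hU

theorem eC_contDiffWithinAt :
    ContDiffWithinAt ℝ ∞ (fun y => φ.eC f c (pt c y)) halfSpace y :=
  (eC_contMDiffWithinAt (isSmoothCurve_const φ) (t := fun _ => 0) contMDiffWithinAt_const
    (pt_contMDiffWithinAt contDiffWithinAt_id (mapsTo_id _) hy) hU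
    (pt_mem_source hy)).contDiffWithinAt

theorem aC_contDiffWithinAt :
    ContDiffWithinAt ℝ ∞ (fun y => φ.aC f c (pt c y)) halfSpace y :=
  (aC_contMDiffWithinAt (isSmoothCurve_const φ) (t := fun _ => 0) contMDiffWithinAt_const
    (pt_contMDiffWithinAt contDiffWithinAt_id (mapsTo_id _) hy) hU
    (pt_mem_source hy)).contDiffWithinAt

theorem τC_contDiffWithinAt :
    ContDiffWithinAt ℝ ∞ (fun y => φ.τC f c (pt c y)) halfSpace y :=
  (τC_contMDiffWithinAt (isSmoothCurve_const φ) (t := fun _ => 0) contMDiffWithinAt_const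
    (pt_contMDiffWithinAt contDiffWithinAt_id (mapsTo_id _) hy) hU
    (pt_mem_source hy)).contDiffWithinAt

end Single

end FieldComponents

theorem lieBracketWithin_const {E : Type*} [NormedAddCommGroup E] [NormedSpace ℝ E] (u v : E)
    (s : Set E) (y : E) :
    VectorField.lieBracketWithin ℝ (fun _ => u) (fun _ => v) s y = 0 := by
  simp [VectorField.lieBracketWithin_eq]

/-! ### The covariant derivative in a local frame. -/

section Cov

variable {M : Type*} [TopologicalSpace M] [ChartedSpace (EuclideanHalfSpace 4) M]
  [IsManifold (𝓡∂ 4) ∞ M]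
  {V : M → Type*} [TopologicalSpace (TotalSpace Mink V)] [∀ x, AddCommGroup (V x)]
  [∀ x, Module ℝ (V x)] [∀ x, TopologicalSpace (V x)] [∀ x, IsTopologicalAddGroup (V x)]
  [∀ x, ContinuousSMul ℝ (V x)] [FiberBundle Mink V] [VectorBundle ℝ Mink V]
  [ContMDiffVectorBundle ∞ Mink V (𝓡∂ 4)] {P : MinkowskiBundle V}

/-- The point with coordinates `y` in the chart at `c` lies in the domain of the frame `f`. -/
def IsGood (f : LocalFrame P) (c : M) (y : E4) : Prop :=
  y ∈ (extChartAt (𝓡∂ 4) c).target ∧ pt c y ∈ f.U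

theorem IsGood.eventually {f : LocalFrame P} {c : M} {y : E4} (h : IsGood f c y) :
    ∀ᶠ y' in 𝓝[halfSpace] y, IsGood f c y' := eventually_pt h.1 f.isOpen h.2

theorem IsGood.mem {f : LocalFrame P} {c : M} {y : E4} (h : IsGood f c y) : y ∈ halfSpace :=
  extChartAt_target_subset_range c h.1

theorem IsGood.mem_source {f : LocalFrame P} {c : M} {y : E4} (h : IsGood f c y) :
    pt c y ∈ (chartAt (EuclideanHalfSpace 4) c).source := pt_mem_source h.1

theorem isGood_self {f : LocalFrame P} {x : M} (hx : x ∈ f.U) :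
    IsGood f x (extChartAt (𝓡∂ 4) x x) :=
  ⟨mem_extChartAt_target x, by rwa [pt_self]⟩

theorem IsGood.of_mem {f : LocalFrame P} {c x : M} (hx : x ∈ f.U)
    (hc : x ∈ (chartAt (EuclideanHalfSpace 4) c).source) :
    IsGood f c (extChartAt (𝓡∂ 4) c x) :=
  ⟨(extChartAt (𝓡∂ 4) c).map_source (by rwa [extChartAt_source]), by rwa [pt_extChartAt hc]⟩

variable (A₀ : Connection P) (φ : FieldSpace P) (f : LocalFrame P) (c x : M)

/-- The components of the reference connection. -/
def baseC : E4 →L[ℝ] Mink →L[ℝ] Mink :=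
  toCLM₂ (LinearMap.mk₂ ℝ
    (fun u s => ∑ i, s i • f.coord x (A₀.cov (f.b i) x (tv c x u)))
    (fun u u' s => by simp [Finset.sum_add_distrib])
    (fun r u s => by simp [Finset.smul_sum, smul_comm r])
    (fun u s s' => by simp [Finset.sum_add_distrib, add_smul])
    (fun r u s => by simp [Finset.smul_sum, mul_smul]))

theorem baseC_apply (u : E4) (s : Mink) :
    baseC A₀ f c x u s = ∑ i, s i • f.coord x (A₀.cov (f.b i) x (tv c x u)) := rfl

/-- The components of the connection. -/
def connC : E4 →L[ℝ] Mink →L[ℝ] Mink := baseC A₀ f c x + φ.aC f c x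

theorem connC_apply (u : E4) (s : Mink) :
    connC A₀ φ f c x u s = baseC A₀ f c x u s + φ.aC f c x u s := rfl

variable {A₀ φ f c x}

/-- The frame sections are globally smooth by construction, so the smoothness of the connection
applies to them directly. -/
theorem cov_frame_contMDiff (i : Fin 4) :
    ContMDiff (𝓡∂ 4) ((𝓡∂ 4).prod 𝓘(ℝ, E4 →L[ℝ] Mink)) ∞ (fun x => (⟨x, A₀.cov (f.b i) x⟩ :
      TotalSpace (E4 →L[ℝ] Mink) fun x : M => TangentSpace (𝓡∂ 4) x →L[ℝ] V x)) := by
  have h : ContMDiffOn (𝓡∂ 4) ((𝓡∂ 4).prod 𝓘(ℝ, Mink)) (∞ + 1)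
      (fun x => (⟨x, f.b i x⟩ : TotalSpace Mink V)) univ := (f.smooth i).contMDiffOn
  exact contMDiffOn_univ.1 (A₀.smooth.contMDiff.contMDiff h)

theorem baseC_contMDiffAt (hx : x ∈ f.U) (hc : x ∈ (chartAt (EuclideanHalfSpace 4) c).source) :
    ContMDiffAt (𝓡∂ 4) 𝓘(ℝ, E4 →L[ℝ] Mink →L[ℝ] Mink) ∞ (fun x => baseC A₀ f c x) x := by
  refine contMDiffWithinAt_clm_of_apply fun u => contMDiffWithinAt_clm_of_apply fun s => ?_
  simp only [baseC_apply]
  refine ContMDiffWithinAt.sum fun i _ => ?_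
  have h1 : ContMDiffWithinAt (𝓡∂ 4) ((𝓡∂ 4).prod 𝓘(ℝ, Mink)) ∞
      (fun x => (⟨x, A₀.cov (f.b i) x (tv c x u)⟩ : TotalSpace Mink V)) univ x :=
    ((cov_frame_contMDiff (A₀ := A₀) i).contMDiffAt).clm_bundle_apply
      (tv_contMDiffWithinAt (p := id) contMDiffWithinAt_id hc u)
  have h2 := contMDiffWithinAt_coord f (p := id) hx h1
  exact (contMDiffWithinAt_const (I' := 𝓘(ℝ, ℝ)) (c := s i)).smul h2

theorem IsGood.baseC_contDiffWithinAt {y : E4} (h : IsGood f c y) :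
    ContDiffWithinAt ℝ ∞ (fun y => baseC A₀ f c (pt c y)) halfSpace y :=
  ((baseC_contMDiffAt h.2 h.mem_source).comp_contMDiffWithinAt y
    (pt_contMDiffWithinAt contDiffWithinAt_id (mapsTo_id _) h.1)).contDiffWithinAt

theorem IsGood.connC_contDiffWithinAt {y : E4} (h : IsGood f c y) :
    ContDiffWithinAt ℝ ∞ (fun y => connC A₀ φ f c (pt c y)) halfSpace y :=
  h.baseC_contDiffWithinAt.add (aC_contDiffWithinAt φ h.1 h.2)

/-- Differentiate η(bᵢ, bⱼ), which is constant near x, and use that η is parallel. -/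
theorem baseC_mem_so31 (hx : x ∈ f.U) (u : E4) :
    ((baseC A₀ f c x u : Mink →L[ℝ] Mink) : Module.End ℝ Mink) ∈ so31 := by
  have hb : ∀ i j, P.η x (A₀.cov (f.b i) x (tv c x u)) (f.b j x) +
      P.η x (f.b i x) (A₀.cov (f.b j) x (tv c x u)) = 0 := by
    intro i j
    rw [← A₀.metric (f.b i) (f.b j) x
      ((f.smooth i).contMDiffAt.mdifferentiableAt (by simp))
      ((f.smooth j).contMDiffAt.mdifferentiableAt (by simp))]
    have : (fun y => P.η y (f.b i y) (f.b j y)) =ᶠ[𝓝 x] fun _ => if i = j then sgn i else 0 := by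
      filter_upwards [f.isOpen.mem_nhds hx] with y hy using f.η_eq y hy i j
    rw [this.mfderiv_eq, mfderiv_const]
    rfl
  have hk : ∀ i j, minkowskiForm (f.coord x (A₀.cov (f.b i) x (tv c x u))) (Pi.single j 1) +
      minkowskiForm (Pi.single i 1) (f.coord x (A₀.cov (f.b j) x (tv c x u))) = 0 := by
    intro i j
    have h := hb i j
    rw [← f.lift_single, ← f.lift_single, LocalFrame.η_eq_coord hx, LocalFrame.η_eq_coord hx,
      LocalFrame.coord_lift hx, LocalFrame.coord_lift hx] at h
    exact h
  have hs : ∀ s : Mink, s = ∑ i, s i • (Pi.single i 1 : Mink) := fun s => by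
    ext j; simp [Finset.sum_apply, Pi.single_apply]
  rw [mem_so31_iff]
  intro v w
  change minkowskiForm (baseC A₀ f c x u v) w + minkowskiForm v (baseC A₀ f c x u w) = 0
  rw [baseC_apply, baseC_apply]
  conv_lhs => enter [1]; rw [hs w]
  conv_lhs => enter [2, 1]; rw [hs v]
  simp only [map_sum, map_smul, LinearMap.sum_apply, LinearMap.smul_apply, smul_eq_mul]
  rw [← Finset.sum_add_distrib]
  refine Finset.sum_eq_zero fun i _ => ?_
  rw [← mul_add, ← Finset.sum_add_distrib]
  refine mul_eq_zero_of_right _ <| Finset.sum_eq_zero fun j _ => ?_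
  linear_combination v j * hk j i

theorem connC_mem_so31 (hx : x ∈ f.U) (u : E4) :
    ((connC A₀ φ f c x u : Mink →L[ℝ] Mink) : Module.End ℝ Mink) ∈ so31 :=
  so31.add_mem (baseC_mem_so31 (A₀ := A₀) (c := c) hx u) (φ.aC_mem_so31 (c := c) hx u)

/-- The covariant derivative in components. -/
theorem coord_cov {σ : ∀ x, V x} (hx : x ∈ f.U)
    (hc : x ∈ (chartAt (EuclideanHalfSpace 4) c).source)
    (hσ : ContMDiffAt (𝓡∂ 4) ((𝓡∂ 4).prod 𝓘(ℝ, Mink)) ∞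
      (fun x => (⟨x, σ x⟩ : TotalSpace Mink V)) x) (u : E4) :
    f.coord x (φ.cov A₀ σ x (tv c x u)) =
      fderivWithin ℝ (fun y => f.coord (pt c y) (σ (pt c y))) halfSpace (extChartAt (𝓡∂ 4) c x) u +
        connC A₀ φ f c x u (f.coord x (σ x)) := by
  have hcoord : ContMDiffAt (𝓡∂ 4) 𝓘(ℝ, Mink) ∞ (fun x => f.coord x (σ x)) x :=
    contMDiffWithinAt_coord f (p := id) hx hσ
  have hi : ∀ i, ContMDiffAt (𝓡∂ 4) 𝓘(ℝ, ℝ) ∞ (fun x => f.coord x (σ x) i) x := fun i =>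
    (ContinuousLinearMap.proj (R := ℝ) (φ := fun _ : Fin 4 => ℝ)
        i).contMDiff.contMDiffAt.comp x hcoord
  let g : Fin 4 → M → ℝ := fun i x => f.coord x (σ x) i
  have hb : ∀ i, MDifferentiableAt (𝓡∂ 4) ((𝓡∂ 4).prod 𝓘(ℝ, Mink))
      (fun x => (⟨x, f.b i x⟩ : TotalSpace Mink V)) x := fun i =>
    (f.smooth i).contMDiffAt.mdifferentiableAt (by simp)
  have hg : ∀ i, MDifferentiableAt (𝓡∂ 4) 𝓘(ℝ, ℝ) (g i) x := fun i =>
    (hi i).mdifferentiableAt (by simp)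
  have hgb : ∀ i, MDifferentiableAt (𝓡∂ 4) ((𝓡∂ 4).prod 𝓘(ℝ, Mink))
      (fun x => (⟨x, (g i • f.b i) x⟩ : TotalSpace Mink V)) x := fun i =>
    (hg i).smul_section (hb i)
  -- A covariant derivative is local, so near x the section may be replaced by its frame expansion,
  -- to which additivity and the Leibniz rule apply.
  have hsum : ∀ᶠ x' in 𝓝 x, σ x' = (g 0 • f.b 0 + g 1 • f.b 1 + g 2 • f.b 2 + g 3 • f.b 3) x' := by
    filter_upwards [f.isOpen.mem_nhds hx] with x' hx'
    conv_lhs => rw [← LocalFrame.lift_coord hx' (σ x'), f.lift_apply]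
    simp [Fin.sum_univ_four, g]
  have h01 := mdifferentiableAt_add_section (hgb 0) (hgb 1)
  have h012 := mdifferentiableAt_add_section h01 (hgb 2)
  have h0123 := mdifferentiableAt_add_section h012 (hgb 3)
  have hcov := A₀.cov.isCovariantDerivativeOnUniv
  have h1 : A₀.cov σ x = ∑ i, (g i x • A₀.cov (f.b i) x +
      (mvfderiv (𝓡∂ 4) (g i) x).smulRight (f.b i x)) := by
    refine (hcov.congr_of_eventuallyEq (hσ.mdifferentiableAt (by simp)) h0123 Filter.univ_mem
      hsum).trans ?_
    rw [hcov.add h012 (hgb 3), hcov.add h01 (hgb 2), hcov.add (hgb 0) (hgb 1)]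
    simp only [hcov.leibniz (hb _) (hg _), Fin.sum_univ_four]
  have h2 : ∀ i, mvfderiv (𝓡∂ 4) (g i) x (tv c x u) =
      fderivWithin ℝ (fun y => f.coord (pt c y) (σ (pt c y))) halfSpace
        (extChartAt (𝓡∂ 4) c x) u i := by
    intro i
    have h3 := mfderiv_tv hc (hg i) u
    refine h3.trans ?_
    have hd : DifferentiableWithinAt ℝ (fun y => f.coord (pt c y) (σ (pt c y))) halfSpace
        (extChartAt (𝓡∂ 4) c x) := by
      have hgood := IsGood.of_mem hx hc
      have h4 := pt_contMDiffWithinAt (contDiffWithinAt_id (n := ∞) (s := halfSpace))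
        (mapsTo_id _) hgood.1
      have h5 : ContMDiffAt (𝓡∂ 4) 𝓘(ℝ, Mink) ∞ (fun x => f.coord x (σ x))
        (pt c (extChartAt (𝓡∂ 4) c x)) := by rwa [pt_extChartAt hc]
      exact (h5.comp_contMDiffWithinAt _ h4).contDiffWithinAt.differentiableWithinAt (by simp)
    have h6 := (ContinuousLinearMap.proj (R := ℝ) (φ := fun _ : Fin 4 => ℝ)
        i).hasFDerivAt.comp_hasFDerivWithinAt _ hd.hasFDerivWithinAt
    exact congrArg (fun L => L u)
      (h6.fderivWithin (uniqueDiffOn_halfSpace _ (extChartAt_mem_halfSpace c x)))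
  change f.coord x (A₀.cov σ x (tv c x u) + φ.a x (σ x) (tv c x u)) = _
  rw [map_add, connC_apply, FieldSpace.aC_apply, LocalFrame.lift_coord hx, h1, ← add_assoc]
  congr 1
  rw [baseC_apply]
  simp only [sum_apply, add_apply, smul_apply, ContinuousLinearMap.smulRight_apply, map_sum,
    map_add, map_smul, Finset.sum_add_distrib, h2]
  rw [add_comm]
  congr 1
  conv_lhs => enter [2, i, 2]; rw [← f.lift_single, LocalFrame.coord_lift hx]
  ext j
  simp [Finset.sum_apply, Pi.single_apply]

theorem symm_contMDiffAt {x₀ : M} (hx : x ∈ (trivializationAt Mink V x₀).baseSet) (w : Mink) :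
    ContMDiffAt (𝓡∂ 4) ((𝓡∂ 4).prod 𝓘(ℝ, Mink)) ∞
      (fun x => (⟨x, (trivializationAt Mink V x₀).symm x w⟩ : TotalSpace Mink V)) x := by
  set e := trivializationAt Mink V x₀
  have h1 : ContMDiffAt (𝓡∂ 4) ((𝓡∂ 4).prod 𝓘(ℝ, Mink)) ∞ (fun q => (q, w)) x :=
    contMDiffAt_id.prodMk contMDiffAt_const
  have h2 : ContMDiffAt ((𝓡∂ 4).prod 𝓘(ℝ, Mink)) ((𝓡∂ 4).prod 𝓘(ℝ, Mink)) ∞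
      e.toOpenPartialHomeomorph.symm (x, w) := by
    refine (Trivialization.contMDiffOn_symm e).contMDiffAt (e.open_target.mem_nhds ?_)
    rw [e.mem_target]
    exact hx
  refine (h2.comp x h1).congr_of_eventuallyEq ?_
  filter_upwards [e.open_baseSet.mem_nhds hx] with q' hq'
  rw [e.mk_symm hq']
  rfl

theorem eventually_extendV_contMDiffAt (s : V x) : ∀ᶠ x' in 𝓝 x,
    ContMDiffAt (𝓡∂ 4) ((𝓡∂ 4).prod 𝓘(ℝ, Mink)) ∞
      (fun x => (⟨x, extendV s x⟩ : TotalSpace Mink V)) x' := by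
  filter_upwards [(trivializationAt Mink V x).open_baseSet.mem_nhds
    (FiberBundle.mem_baseSet_trivializationAt' x)] with x' hx'
  exact symm_contMDiffAt hx' _

/-- In the chart at x both extensions are constant vector fields, and these commute. -/
theorem mlieBracket_extendT (u v : TangentSpace (𝓡∂ 4) x) :
    VectorField.mlieBracket (𝓡∂ 4) (extendT u) (extendT v) x = 0 := by
  rw [VectorField.mlieBracket, VectorField.mlieBracketWithin_apply]
  have h : ∀ u : TangentSpace (𝓡∂ 4) x, ∀ᶠ y in 𝓝[halfSpace] (extChartAt (𝓡∂ 4) x x),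
      VectorField.mpullbackWithin 𝓘(ℝ, E4) (𝓡∂ 4) (extChartAt (𝓡∂ 4) x).symm (extendT u)
        (range (𝓡∂ 4)) y = u := by
    intro u
    filter_upwards [extChartAt_target_mem_nhdsWithin (I := 𝓡∂ 4) x] with y hy
    rw [VectorField.mpullbackWithin_apply]
    have h2 : extendT u ((extChartAt (𝓡∂ 4) x).symm y) =
        mfderivWithin 𝓘(ℝ, E4) (𝓡∂ 4) (extChartAt (𝓡∂ 4) x).symm (range (𝓡∂ 4)) y u := by
      rw [mfderivWithin_symm hy]
      exact extendT_eq (pt_mem_source hy) u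
    rw [h2]
    exact (isInvertible_mfderivWithin_extChartAt_symm hy).inverse_apply_eq.2 rfl
  rw [preimage_univ, univ_inter]
  have h3 : VectorField.lieBracketWithin ℝ
      (VectorField.mpullbackWithin 𝓘(ℝ, E4) (𝓡∂ 4) (extChartAt (𝓡∂ 4) x).symm (extendT u)
        (range (𝓡∂ 4)))
      (VectorField.mpullbackWithin 𝓘(ℝ, E4) (𝓡∂ 4) (extChartAt (𝓡∂ 4) x).symm (extendT v)
        (range (𝓡∂ 4))) (range (𝓡∂ 4)) (extChartAt (𝓡∂ 4) x x) = 0 := by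
    have hm := extChartAt_mem_halfSpace x x
    have h4 := lieBracketWithin_const (E := E4) u v (range (𝓡∂ 4)) (extChartAt (𝓡∂ 4) x x)
    refine Eq.trans ?_ h4
    exact Filter.EventuallyEq.lieBracketWithin_vectorField_eq_of_mem (h u) (h v) hm
  exact (congrArg _ h3).trans (map_zero _)

end Cov

section Calculus

variable {E F G : Type*} [NormedAddCommGroup E] [NormedSpace ℝ E] [NormedAddCommGroup F]
  [NormedSpace ℝ F] [NormedAddCommGroup G] [NormedSpace ℝ G] {s : Set E} {y : E}

theorem fderivWithin_apply_const {L : E → F →L[ℝ] G} (hL : DifferentiableWithinAt ℝ L s y)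
    (hs : UniqueDiffWithinAt ℝ s y) (u : E) (v : F) :
    fderivWithin ℝ (fun y => L y v) s y u = fderivWithin ℝ L s y u v := by
  rw [fderivWithin_clm_apply hs hL (differentiableWithinAt_const v)]
  simp

/-- A linear constraint that holds near a point passes to the derivative. It is applied to skewness
of the connection components. -/
theorem map_fderivWithin_eq_zero {L : E → F} (hL : DifferentiableWithinAt ℝ L s y)
    (hs : UniqueDiffWithinAt ℝ s y) (hy : y ∈ s) (ℓ : F →L[ℝ] G)
    (h : ∀ᶠ y' in 𝓝[s] y, ℓ (L y') = 0) (u : E) : ℓ (fderivWithin ℝ L s y u) = 0 := by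
  have h1 := (ℓ.hasFDerivAt.comp_hasFDerivWithinAt y hL.hasFDerivWithinAt).fderivWithin hs
  have h2 : fderivWithin ℝ (ℓ ∘ L) s y = fderivWithin ℝ (fun _ => 0) s y :=
    Filter.EventuallyEq.fderivWithin_eq_of_mem h hy
  rw [h1, fderivWithin_fun_const] at h2
  exact congrArg (fun L => L u) h2

end Calculus

/-! ### Torsion and curvature in components. -/

section Components

variable {M : Type*} [TopologicalSpace M] [ChartedSpace (EuclideanHalfSpace 4) M]
  [IsManifold (𝓡∂ 4) ∞ M]
  {V : M → Type*} [TopologicalSpace (TotalSpace Mink V)] [∀ x, AddCommGroup (V x)]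
  [∀ x, Module ℝ (V x)] [∀ x, TopologicalSpace (V x)] [∀ x, IsTopologicalAddGroup (V x)]
  [∀ x, ContinuousSMul ℝ (V x)] [FiberBundle Mink V] [VectorBundle ℝ Mink V]
  [ContMDiffVectorBundle ∞ Mink V (𝓡∂ 4)] {P : MinkowskiBundle V}

theorem unique_halfSpace {y : E4} (hy : y ∈ halfSpace) : UniqueDiffWithinAt ℝ halfSpace y :=
  uniqueDiffOn_halfSpace y hy

theorem mem_closure_interior_halfSpace {y : E4} (hy : y ∈ halfSpace) :
    y ∈ closure (interior halfSpace) := (𝓡∂ 4).range_subset_closure_interior hy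

/-- The half space lies in the closure of its interior, so symmetry of second derivatives extends to
boundary points. -/
theorem sndDeriv_symm {W : Type*} [NormedAddCommGroup W] [NormedSpace ℝ W] {g : E4 → W} {y : E4}
    (hy : y ∈ halfSpace) (hg : ContDiffWithinAt ℝ ∞ g halfSpace y) (u v : E4) :
    fderivWithin ℝ (fderivWithin ℝ g halfSpace) halfSpace y u v =
      fderivWithin ℝ (fderivWithin ℝ g halfSpace) halfSpace y v u :=
  hg.isSymmSndFDerivWithinAt (by simp only [minSmoothness_of_isRCLikeNormedField]; exact WithTop.coe_le_coe.2 le_top) uniqueDiffOn_halfSpace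
    (mem_closure_interior_halfSpace hy) hy u v

variable (A₀ : Connection P) (φ ψ X : FieldSpace P) (f : LocalFrame P) (c x : M) (y : E4)

/-- The first derivatives of the components of the coframe. -/
def deC : E4 →L[ℝ] E4 →L[ℝ] Mink := fderivWithin ℝ (fun y => φ.eC f c (pt c y)) halfSpace y

/-- The first derivatives of the components of `A - A₀`. -/
def daC : E4 →L[ℝ] E4 →L[ℝ] Mink →L[ℝ] Mink :=
  fderivWithin ℝ (fun y => φ.aC f c (pt c y)) halfSpace y

/-- The first derivatives of the components of `τ`. -/
def dτC : E4 →L[ℝ] E4 →L[ℝ] E4 →L[ℝ] Mink :=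
  fderivWithin ℝ (fun y => φ.τC f c (pt c y)) halfSpace y

/-- The first derivatives of the components of the connection. -/
def dconnC : E4 →L[ℝ] E4 →L[ℝ] Mink →L[ℝ] Mink :=
  fderivWithin ℝ (fun y => connC A₀ φ f c (pt c y)) halfSpace y

/-- The components of the torsion. -/
def torC (u v : E4) : Mink :=
  deC φ f c y u v - deC φ f c y v u + connC A₀ φ f c (pt c y) u (φ.eC f c (pt c y) v) -
    connC A₀ φ f c (pt c y) v (φ.eC f c (pt c y) u)

/-- The components of the curvature. -/
def curC (u v : E4) : Mink →L[ℝ] Mink :=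
  dconnC A₀ φ f c y u v - dconnC A₀ φ f c y v u +
    connC A₀ φ f c (pt c y) u * connC A₀ φ f c (pt c y) v -
    connC A₀ φ f c (pt c y) v * connC A₀ φ f c (pt c y) u

variable {A₀ φ ψ X f c x y}

theorem IsGood.deC_eq (h : IsGood f c y) (u v : E4) :
    fderivWithin ℝ (fun y => φ.eC f c (pt c y) v) halfSpace y u = deC φ f c y u v :=
  fderivWithin_apply_const ((eC_contDiffWithinAt φ h.1 h.2).differentiableWithinAt (by simp))
    (unique_halfSpace h.mem) u v

theorem coord_pt {x' : M} (hx' : x' ∈ (chartAt (EuclideanHalfSpace 4) c).source)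
    (σ : ∀ x, V x) : f.coord (pt c (extChartAt (𝓡∂ 4) c x')) (σ (pt c (extChartAt (𝓡∂ 4) c x'))) =
      f.coord x' (σ x') :=
  congrArg (fun z => f.coord z (σ z)) (pt_extChartAt hx')

theorem extendT_contMDiffAt (u : TangentSpace (𝓡∂ 4) x) :
    ContMDiffAt (𝓡∂ 4) ((𝓡∂ 4).prod 𝓘(ℝ, E4)) ∞
      (fun q => (⟨q, extendT u q⟩ : TotalSpace E4 (TangentSpace (𝓡∂ 4) : M → Type _))) x := by
  refine (tv_contMDiffWithinAt (c := x) (p := id) contMDiffWithinAt_id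
    (mem_chart_source _ x) (u : E4)).contMDiffAt Filter.univ_mem |>.congr_of_eventuallyEq ?_
  filter_upwards [(chartAt (EuclideanHalfSpace 4) x).open_source.mem_nhds
    (mem_chart_source _ x)] with x' hx'
  rw [extendT_eq hx' u]
  rfl

/-- The bracket term is zero, and what remains is the formula de + A ∧ e at the centre of the chart
at x. -/
theorem coord_torsion (hx : x ∈ f.U) (u v : TangentSpace (𝓡∂ 4) x) :
    f.coord x (torsion A₀ φ x u v) = torC A₀ φ f x (extChartAt (𝓡∂ 4) x x) u v := by
  have hg := isGood_self hx
  have key : ∀ u v : TangentSpace (𝓡∂ 4) x,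
      f.coord x (φ.cov A₀ (fun y => φ.e y (extendT v y)) x u) =
      deC φ f x (extChartAt (𝓡∂ 4) x x) u v + connC A₀ φ f x x u (φ.eC f x x v) := by
    intro u v
    have hσ : ContMDiffAt (𝓡∂ 4) ((𝓡∂ 4).prod 𝓘(ℝ, Mink)) ∞
        (fun y => (⟨y, φ.e y (extendT v y)⟩ : TotalSpace Mink V)) x :=
      (φ.1.1.contMDiff.contMDiffAt).clm_bundle_apply (extendT_contMDiffAt v)
    have h1 := coord_cov (φ := φ) (A₀ := A₀) hx (mem_chart_source _ x) hσ (u : E4)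
    have h2 : tv x x (u : E4) = u := tv_self x u
    rw [h2] at h1
    refine h1.trans ?_
    have h3 : ∀ x' ∈ (chartAt (EuclideanHalfSpace 4) x).source,
        f.coord x' (φ.e x' (extendT v x')) = φ.eC f x x' (v : E4) := by
      intro x' hx'
      rw [extendT_eq hx' v]
      rfl
    rw [h3 x (mem_chart_source _ x)]
    congr 1
    refine Eq.trans ?_ (hg.deC_eq (u : E4) (v : E4))
    refine congrArg (fun L : E4 →L[ℝ] Mink => L u) (Filter.EventuallyEq.fderivWithin_eq_of_mem ?_ hg.mem)
    filter_upwards [hg.eventually] with y' hy'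
    exact h3 _ hy'.mem_source
  have htor : ∀ u v : E4, torC A₀ φ f x (extChartAt (𝓡∂ 4) x x) u v =
      (deC φ f x (extChartAt (𝓡∂ 4) x x) u v + connC A₀ φ f x x u (φ.eC f x x v)) -
      (deC φ f x (extChartAt (𝓡∂ 4) x x) v u + connC A₀ φ f x x v (φ.eC f x x u)) := by
    intro u v
    rw [torC, pt_self]
    abel
  rw [torsion, mlieBracket_extendT, map_zero, sub_zero, map_sub, key, key]
  exact (htor u v).symm

theorem IsGood.differentiable_connC (h : IsGood f c y) :
    DifferentiableWithinAt ℝ (fun y => connC A₀ φ f c (pt c y)) halfSpace y :=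
  h.connC_contDiffWithinAt.differentiableWithinAt (by simp)

/-- The second derivatives of the extended section cancel by symmetry and the terms with one
derivative cancel in pairs. This leaves dA + [A, A] acting on the value of the section at x. -/
theorem coord_curvature (hx : x ∈ f.U) (u v : TangentSpace (𝓡∂ 4) x) (s : V x) :
    f.coord x (curvature A₀ φ x u v s) =
      curC A₀ φ f x (extChartAt (𝓡∂ 4) x x) u v (f.coord x s) := by
  have hg := isGood_self hx
  have hxs := mem_chart_source (EuclideanHalfSpace 4) x
  set y₀ := extChartAt (𝓡∂ 4) x x with hy₀
  let S : E4 → Mink := fun y => f.coord (pt x y) (extendV s (pt x y))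
  have hev : ∀ᶠ x' in 𝓝 x, x' ∈ f.U ∧ x' ∈ (chartAt (EuclideanHalfSpace 4) x).source ∧
      ContMDiffAt (𝓡∂ 4) ((𝓡∂ 4).prod 𝓘(ℝ, Mink)) ∞
      (fun x => (⟨x, extendV s x⟩ : TotalSpace Mink V)) x' := by
    filter_upwards [f.isOpen.mem_nhds hx, (chartAt (EuclideanHalfSpace 4) x).open_source.mem_nhds
      hxs, eventually_extendV_contMDiffAt s] with x' h1 h2 h3 using ⟨h1, h2, h3⟩
  have hS : ContDiffWithinAt ℝ ∞ S halfSpace y₀ := by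
    have h1 : ContMDiffAt (𝓡∂ 4) 𝓘(ℝ, Mink) ∞ (fun x => f.coord x (extendV s x)) (pt x y₀) := by
      rw [hy₀, pt_self]
      exact contMDiffWithinAt_coord f (p := id) hx hev.self_of_nhds.2.2
    exact (h1.comp_contMDiffWithinAt y₀ (pt_contMDiffWithinAt contDiffWithinAt_id (mapsTo_id _)
      hg.1)).contDiffWithinAt
  have hdS : ContDiffWithinAt ℝ ∞ (fderivWithin ℝ S halfSpace) halfSpace y₀ :=
    hS.fderivWithin_right uniqueDiffOn_halfSpace (by simp) hg.mem
  have hself : extendV s x = s := FiberBundle.extend_apply_self Mink s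
  have hS0 : S y₀ = f.coord x s := by
    refine (coord_pt (mem_chart_source _ x) (extendV s)).trans ?_
    rw [hself]
  -- `R v` is the covariant derivative along the constant field v in coordinates. It has to be known
  -- near x, and not only at x, in order to be differentiated again.
  let R : E4 → E4 → Mink := fun v y =>
    fderivWithin ℝ S halfSpace y v + connC A₀ φ f x (pt x y) v (S y)
  have hR : ∀ v, ContDiffWithinAt ℝ ∞ (R v) halfSpace y₀ := fun v =>
    (hdS.clm_apply contDiffWithinAt_const).add
      ((hg.connC_contDiffWithinAt.clm_apply contDiffWithinAt_const).clm_apply hS)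
  have hfirst : ∀ v : TangentSpace (𝓡∂ 4) x, ∀ᶠ x' in 𝓝 x,
      f.coord x' (φ.cov A₀ (extendV s) x' (extendT v x')) = R v (extChartAt (𝓡∂ 4) x x') := by
    intro v
    filter_upwards [hev] with x' hx'
    rw [extendT_eq hx'.2.1 v]
    refine (coord_cov hx'.1 hx'.2.1 hx'.2.2 (v : E4)).trans ?_
    have hS' : S (extChartAt (𝓡∂ 4) x x') = f.coord x' (extendV s x') := coord_pt hx'.2.1 _
    simp only [R, hS', pt_extChartAt hx'.2.1]
    rfl
  have key : ∀ u v : TangentSpace (𝓡∂ 4) x,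
      f.coord x (φ.cov A₀ (fun y => φ.cov A₀ (extendV s) y (extendT v y)) x u) =
      fderivWithin ℝ (fderivWithin ℝ S halfSpace) halfSpace y₀ u v +
        dconnC A₀ φ f x y₀ u v (S y₀) + connC A₀ φ f x x v (fderivWithin ℝ S halfSpace y₀ u) +
        connC A₀ φ f x x u (fderivWithin ℝ S halfSpace y₀ v + connC A₀ φ f x x v (S y₀)) := by
    intro u v
    have hσc : ContMDiffAt (𝓡∂ 4) 𝓘(ℝ, Mink) ∞
        (fun y => f.coord y (φ.cov A₀ (extendV s) y (extendT v y))) x := by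
      have h1 : ContMDiffAt (𝓡∂ 4) 𝓘(ℝ, Mink) ∞ (fun x' => R v (extChartAt (𝓡∂ 4) x x')) x := by
        have h2 := contMDiffAt_extChartAt (I := 𝓡∂ 4) (n := ∞) (x := x)
        exact (hR v).contMDiffWithinAt.comp (t := halfSpace) (s := univ) x
          h2.contMDiffWithinAt (fun x' _ => extChartAt_mem_halfSpace x x')
      exact h1.congr_of_eventuallyEq (hfirst v)
    have hσ : ContMDiffAt (𝓡∂ 4) ((𝓡∂ 4).prod 𝓘(ℝ, Mink)) ∞
        (fun y => (⟨y, φ.cov A₀ (extendV s) y (extendT v y)⟩ : TotalSpace Mink V)) x :=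
      contMDiffWithinAt_of_coord f (p := id) hx contMDiffWithinAt_id hσc
    have h1 := coord_cov (φ := φ) (A₀ := A₀) hx hxs hσ (u : E4)
    have h2 : tv x x (u : E4) = u := tv_self x u
    rw [h2] at h1
    refine h1.trans ?_
    rw [(hfirst v).self_of_nhds]
    have h3 : fderivWithin ℝ (fun y => f.coord (pt x y) (φ.cov A₀ (extendV s) (pt x y)
        (extendT v (pt x y)))) halfSpace y₀ = fderivWithin ℝ (R v) halfSpace y₀ := by
      refine Filter.EventuallyEq.fderivWithin_eq_of_mem ?_ hg.mem
      have hc := (pt_contMDiffWithinAt (c := x) (contDiffWithinAt_id (n := ∞) (s := halfSpace))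
        (mapsTo_id _) hg.1).continuousWithinAt
      have h4 : ∀ᶠ x' in 𝓝 (pt x y₀), f.coord x' (φ.cov A₀ (extendV s) x' (extendT v x')) =
          R v (extChartAt (𝓡∂ 4) x x') := by rw [hy₀, pt_self]; exact hfirst v
      filter_upwards [hc h4, hg.eventually] with y' h5 h6
      have h7 : f.coord (pt x y') (φ.cov A₀ (extendV s) (pt x y') (extendT v (pt x y'))) =
          R v (extChartAt (𝓡∂ 4) x (pt x y')) := h5
      rw [h7, extChartAt_pt h6.1]
    have hdd := hdS.differentiableWithinAt (by simp)
    have hS1 := hS.differentiableWithinAt (by simp)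
    have h5 : ∀ u v : E4, fderivWithin ℝ (R v) halfSpace y₀ u =
        fderivWithin ℝ (fderivWithin ℝ S halfSpace) halfSpace y₀ u v +
        dconnC A₀ φ f x y₀ u v (S y₀) + connC A₀ φ f x x v (fderivWithin ℝ S halfSpace y₀ u) := by
      intro u v
      have hcv : DifferentiableWithinAt ℝ (fun y => connC A₀ φ f x (pt x y) v) halfSpace y₀ :=
        hg.differentiable_connC.clm_apply (differentiableWithinAt_const _)
      have huniq := unique_halfSpace hg.mem
      simp only [R]
      rw [fderivWithin_fun_add huniq (hdd.clm_apply (differentiableWithinAt_const _))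
        (hcv.clm_apply hS1), add_apply, fderivWithin_apply_const hdd huniq,
        fderivWithin_clm_apply huniq hcv hS1, add_assoc]
      congr 1
      rw [add_apply, add_comm, ContinuousLinearMap.flip_apply,
        fderivWithin_apply_const hg.differentiable_connC huniq]
      simp only [ContinuousLinearMap.comp_apply, hy₀, pt_self]
      rfl
    have h6 : R v y₀ = fderivWithin ℝ S halfSpace y₀ v + connC A₀ φ f x x v (S y₀) := by
      simp only [R, hy₀, pt_self]
    rw [← hy₀, h3, h6]
    exact congrArg (· + _) (h5 u v)
  have hcur : ∀ u v : E4, curC A₀ φ f x y₀ u v (f.coord x s) =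
      (fderivWithin ℝ (fderivWithin ℝ S halfSpace) halfSpace y₀ u v +
        dconnC A₀ φ f x y₀ u v (S y₀) + connC A₀ φ f x x v (fderivWithin ℝ S halfSpace y₀ u) +
        connC A₀ φ f x x u (fderivWithin ℝ S halfSpace y₀ v + connC A₀ φ f x x v (S y₀))) -
      (fderivWithin ℝ (fderivWithin ℝ S halfSpace) halfSpace y₀ v u +
        dconnC A₀ φ f x y₀ v u (S y₀) + connC A₀ φ f x x u (fderivWithin ℝ S halfSpace y₀ v) +
        connC A₀ φ f x x v (fderivWithin ℝ S halfSpace y₀ u + connC A₀ φ f x x u (S y₀))) := by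
    intro u v
    rw [sndDeriv_symm hg.mem hS v u, curC, hS0, hy₀, pt_self]
    simp only [map_add, add_apply, sub_apply, mul_apply_eq_comp]
    abel
  rw [curvature, mlieBracket_extendT, map_zero, sub_zero, map_sub, key, key]
  exact (hcur u v).symm

/-- Derivatives of skew matrices are skew, and so are commutators of skew matrices. -/
theorem IsGood.curC_mem_so31 (h : IsGood f c y) (u v : E4) :
    ((curC A₀ φ f c y u v : Mink →L[ℝ] Mink) : Module.End ℝ Mink) ∈ so31 := by
  have hd : ∀ u v : E4, ∀ s t : Mink, minkowskiForm (dconnC A₀ φ f c y u v s) t +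
      minkowskiForm s (dconnC A₀ φ f c y u v t) = 0 := by
    intro u v s t
    let ℓ : (E4 →L[ℝ] Mink →L[ℝ] Mink) →L[ℝ] ℝ :=
      (LinearMap.toContinuousLinearMap (minkowskiForm.flip t)) ∘L
        (ContinuousLinearMap.apply ℝ Mink s) ∘L (ContinuousLinearMap.apply ℝ (Mink →L[ℝ] Mink) v) +
      (LinearMap.toContinuousLinearMap (minkowskiForm s)) ∘L
        (ContinuousLinearMap.apply ℝ Mink t) ∘L (ContinuousLinearMap.apply ℝ (Mink →L[ℝ] Mink) v)
    refine map_fderivWithin_eq_zero (F := E4 →L[ℝ] Mink →L[ℝ] Mink) (G := ℝ) h.differentiable_connC (unique_halfSpace h.mem) h.mem ℓ ?_ u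
    filter_upwards [h.eventually] with y' hy'
    exact (mem_so31_iff _).1 (connC_mem_so31 (A₀ := A₀) (φ := φ) (c := c) hy'.2 v) s t
  have hA := fun u => (mem_so31_iff _).1 (connC_mem_so31 (A₀ := A₀) (φ := φ) (c := c) h.2 u)
  rw [mem_so31_iff]
  intro s t
  have h1 := hd u v s t
  have h2 := hd v u s t
  have h3 := hA u (connC A₀ φ f c (pt c y) v s) t
  have h4 := hA v s (connC A₀ φ f c (pt c y) u t)
  have h5 := hA v (connC A₀ φ f c (pt c y) u s) t
  have h6 := hA u s (connC A₀ φ f c (pt c y) v t)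
  simp only [ContinuousLinearMap.coe_coe] at h3 h4 h5 h6 ⊢
  simp only [curC, add_apply, sub_apply, mul_apply_eq_comp, map_add, map_sub, LinearMap.add_apply,
    LinearMap.sub_apply]
  linarith

theorem curvature_eq_lift (hx : x ∈ f.U) (u v : TangentSpace (𝓡∂ 4) x) (s : V x) :
    curvature A₀ φ x u v s =
      f.lift x (curC A₀ φ f x (extChartAt (𝓡∂ 4) x x) u v (f.coord x s)) := by
  rw [← coord_curvature hx, LocalFrame.lift_coord hx]

/-- `curvatureEnd` is defined by its values on a basis. Linearity of the curvature in s is not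
visible from its definition by extensions; it comes from the component formula. -/
theorem curvatureEnd_apply [T2Space M] (u v : TangentSpace (𝓡∂ 4) x) (s : Mink) :
    curvatureEnd A₀ φ x u v s = (P.frame x).symm (curvature A₀ φ x u v (P.frame x s)) := by
  obtain ⟨f, hx⟩ := exists_localFrame P x
  let K : Module.End ℝ Mink := (P.frame x).symm.toLinearMap ∘ₗ f.lift x ∘ₗ
    (curC A₀ φ f x (extChartAt (𝓡∂ 4) x x) u v).toLinearMap ∘ₗ f.coord x ∘ₗ (P.frame x).toLinearMap
  have h1 : ∀ s, (P.frame x).symm (curvature A₀ φ x u v (P.frame x s)) = K s := fun s => by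
    rw [curvature_eq_lift hx]; rfl
  rw [h1]
  refine congrArg (fun L : Module.End ℝ Mink => L s) ((Pi.basisFun ℝ (Fin 4)).ext fun i => ?_)
  rw [curvatureEnd, Module.Basis.constr_basis, h1, Pi.basisFun_apply]

theorem curvatureEnd_toFrame [T2Space M] (hx : x ∈ f.U) (u v : TangentSpace (𝓡∂ 4) x) (s : Mink) :
    curvatureEnd A₀ φ x u v (f.toFrame hx s) =
      f.toFrame hx (curC A₀ φ f x (extChartAt (𝓡∂ 4) x x) u v s) := by
  rw [curvatureEnd_apply, LocalFrame.frame_toFrame, curvature_eq_lift hx,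
    LocalFrame.coord_lift hx, ← LocalFrame.toFrame_coord hx, LocalFrame.coord_lift hx]

theorem curvatureEnd_mem_so31 [T2Space M] (u v : TangentSpace (𝓡∂ 4) x) :
    curvatureEnd A₀ φ x u v ∈ so31 := by
  obtain ⟨f, hx⟩ := exists_localFrame P x
  rw [mem_so31_iff]
  intro s t
  obtain ⟨s, rfl⟩ := (f.toFrame hx).surjective s
  obtain ⟨t, rfl⟩ := (f.toFrame hx).surjective t
  rw [curvatureEnd_toFrame, curvatureEnd_toFrame, LocalFrame.minkowskiForm_toFrame,
    LocalFrame.minkowskiForm_toFrame]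
  exact (mem_so31_iff _).1 ((isGood_self hx).curC_mem_so31 (A₀ := A₀) (φ := φ) u v) s t

theorem eC_self (u : TangentSpace (𝓡∂ 4) x) : φ.eC f x x u = f.coord x (φ.e x u) :=
  congrArg (fun u => f.coord x (φ.e x u)) (tv_self x u)

theorem τC_self (u v : TangentSpace (𝓡∂ 4) x) : φ.τC f x x u v = f.coord x (φ.τ x u v) :=
  congrArg₂ (fun u v => f.coord x (φ.τ x u v)) (tv_self x u) (tv_self x v)

theorem aC_self (u : TangentSpace (𝓡∂ 4) x) (s : Mink) :
    φ.aC f x x u s = f.coord x (φ.a x (f.lift x s) u) :=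
  congrArg (fun u => f.coord x (φ.a x (f.lift x s) u)) (tv_self x u)

theorem pairing_curvatureEnd [T2Space M] (c d : ℝ) (hx : x ∈ f.U)
    (u v w w' : TangentSpace (𝓡∂ 4) x) :
    pairing c d (curvatureEnd A₀ φ x u v) (coframe φ x w) (coframe φ x w') =
      pairing c d (curC A₀ φ f x (extChartAt (𝓡∂ 4) x x) u v : Mink →L[ℝ] Mink)
        (φ.eC f x x w) (φ.eC f x x w') := by
  rw [eC_self, eC_self]
  refine LocalFrame.pairing_frame hx (L := curvature A₀ φ x u v) (curvatureEnd_apply u v)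
    (fun s => ?_) _ _
  rw [coord_curvature hx, LocalFrame.coord_lift hx]
  rfl

theorem η_torsion (hx : x ∈ f.U) (u v w w' : TangentSpace (𝓡∂ 4) x) :
    P.η x (φ.τ x u v) (torsion A₀ φ x w w') =
      minkowskiForm (φ.τC f x x u v) (torC A₀ φ f x (extChartAt (𝓡∂ 4) x x) w w') := by
  rw [LocalFrame.η_eq_coord hx, coord_torsion hx, τC_self]

end Components

/-! ### Alternating sums in three and four letters -/

section AltLetters

variable {W : Type*}

/-- The alternating sum of a function of three arguments. -/
def alt3 (g : W → W → W → ℝ) (v : Fin 3 → W) : ℝ := altSum (fun v => g (v 0) (v 1) (v 2)) v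

/-- The alternating sum of a function of four arguments. -/
def alt4 (g : W → W → W → W → ℝ) (v : Fin 4 → W) : ℝ :=
  altSum (fun v => g (v 0) (v 1) (v 2) (v 3)) v

theorem alt3_add (g h : W → W → W → ℝ) (v : Fin 3 → W) :
    alt3 (fun a b c => g a b c + h a b c) v = alt3 g v + alt3 h v := altSum_add _ _ v

theorem alt3_sub (g h : W → W → W → ℝ) (v : Fin 3 → W) :
    alt3 (fun a b c => g a b c - h a b c) v = alt3 g v - alt3 h v := altSum_sub _ _ v

theorem alt3_mul (r : ℝ) (g : W → W → W → ℝ) (v : Fin 3 → W) :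
    alt3 (fun a b c => r * g a b c) v = r * alt3 g v := altSum_mul r _ v

theorem alt3_neg (g : W → W → W → ℝ) (v : Fin 3 → W) :
    alt3 (fun a b c => -g a b c) v = -alt3 g v := altSum_neg _ v

theorem alt3_swap01 (g : W → W → W → ℝ) (v : Fin 3 → W) :
    alt3 (fun a b c => g b a c) v = -alt3 g v :=
  altSum_swap (show (0 : Fin 3) ≠ 1 by decide) (fun v => g (v 0) (v 1) (v 2)) v

theorem alt3_swap12 (g : W → W → W → ℝ) (v : Fin 3 → W) :
    alt3 (fun a b c => g a c b) v = -alt3 g v :=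
  altSum_swap (show (1 : Fin 3) ≠ 2 by decide) (fun v => g (v 0) (v 1) (v 2)) v

theorem alt4_add (g h : W → W → W → W → ℝ) (v : Fin 4 → W) :
    alt4 (fun a b c d => g a b c d + h a b c d) v = alt4 g v + alt4 h v := altSum_add _ _ v

theorem alt4_sub (g h : W → W → W → W → ℝ) (v : Fin 4 → W) :
    alt4 (fun a b c d => g a b c d - h a b c d) v = alt4 g v - alt4 h v := altSum_sub _ _ v

theorem alt4_mul (r : ℝ) (g : W → W → W → W → ℝ) (v : Fin 4 → W) :
    alt4 (fun a b c d => r * g a b c d) v = r * alt4 g v := altSum_mul r _ v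

theorem alt4_neg (g : W → W → W → W → ℝ) (v : Fin 4 → W) :
    alt4 (fun a b c d => -g a b c d) v = -alt4 g v := altSum_neg _ v

theorem alt4_swap01 (g : W → W → W → W → ℝ) (v : Fin 4 → W) :
    alt4 (fun a b c d => g b a c d) v = -alt4 g v :=
  altSum_swap (show (0 : Fin 4) ≠ 1 by decide) (fun v => g (v 0) (v 1) (v 2) (v 3)) v

theorem alt4_swap12 (g : W → W → W → W → ℝ) (v : Fin 4 → W) :
    alt4 (fun a b c d => g a c b d) v = -alt4 g v :=
  altSum_swap (show (1 : Fin 4) ≠ 2 by decide) (fun v => g (v 0) (v 1) (v 2) (v 3)) v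

theorem alt4_swap23 (g : W → W → W → W → ℝ) (v : Fin 4 → W) :
    alt4 (fun a b c d => g a b d c) v = -alt4 g v :=
  altSum_swap (show (2 : Fin 4) ≠ 3 by decide) (fun v => g (v 0) (v 1) (v 2) (v 3)) v

/-- A 3-cycle is even: it is composed of four transpositions here, whose signs cancel. -/
theorem alt4_cycle (g : W → W → W → W → ℝ) (v : Fin 4 → W) :
    alt4 (fun a b c d => g b c a d) v = alt4 g v := by
  rw [alt4_swap12 (fun a b c d => g c b a d) v, alt4_swap01 (fun a b c d => g c a b d) v,
    alt4_swap12 (fun a b c d => g b a c d) v, alt4_swap01 g v]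
  ring

end AltLetters

/-! ### Continuous versions of the pairings -/

/-- The Minkowski form as a continuous bilinear map. -/
def ηC : Mink →L[ℝ] Mink →L[ℝ] ℝ := toCLM₂ minkowskiForm

theorem ηC_apply (u v : Mink) : ηC u v = minkowskiForm u v := rfl

theorem ηC_symm (u v : Mink) : ηC u v = ηC v u := minkowskiForm_symm u v

/-- The pairing as a trilinear map. -/
def pairL (c d : ℝ) : (Mink →L[ℝ] Mink) →ₗ[ℝ] (Mink →L[ℝ] Mink →L[ℝ] ℝ) where
  toFun α := toCLM₂ (LinearMap.mk₂ ℝ (pairing c d (α : Module.End ℝ Mink))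
    (pairing_add_left _) (pairing_smul_left · _) (pairing_add_right _)
    (pairing_smul_right · _))
  map_add' α β := by
    ext1 v; ext1 w
    exact pairing_add _ _ v w
  map_smul' r α := by
    ext1 v; ext1 w
    exact pairing_smul r _ v w

/-- The pairing as a continuous trilinear map. -/
def pairC (c d : ℝ) : (Mink →L[ℝ] Mink) →L[ℝ] Mink →L[ℝ] Mink →L[ℝ] ℝ :=
  LinearMap.toContinuousLinearMap (pairL c d)

theorem pairC_apply (c d : ℝ) (α : Mink →L[ℝ] Mink) (v w : Mink) :
    pairC c d α v w = pairing c d (α : Module.End ℝ Mink) v w := rfl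

/-- The continuous endomorphisms of Minkowski space that are `η`-skew. -/
def IsSkew (α : Mink →L[ℝ] Mink) : Prop := (α : Module.End ℝ Mink) ∈ so31

theorem IsSkew.η {α : Mink →L[ℝ] Mink} (h : IsSkew α) (v w : Mink) :
    ηC (α v) w = -ηC v (α w) := eq_neg_of_add_eq_zero_left ((mem_so31_iff _).1 h v w)

theorem IsSkew.pairC_swap {α : Mink →L[ℝ] Mink} (h : IsSkew α) (c d : ℝ) (v w : Mink) :
    pairC c d α v w = -pairC c d α w v := pairing_swap h v w

theorem IsSkew.pairC_bracket {A α : Mink →L[ℝ] Mink} (hA : IsSkew A) (h : IsSkew α) (c d : ℝ)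
    (v w : Mink) : pairC c d (A * α - α * A) v w =
      -pairC c d α (A v) w - pairC c d α v (A w) := pairing_bracket hA h v w

/-! ### Pointwise algebra of the Lagrangian -/

/-- The components of a field and their first derivatives at a point. -/
@[ext] structure Jet where
  e : E4 →L[ℝ] Mink
  A : E4 →L[ℝ] Mink →L[ℝ] Mink
  τ : E4 →L[ℝ] E4 →L[ℝ] Mink
  de : E4 →L[ℝ] E4 →L[ℝ] Mink
  dA : E4 →L[ℝ] E4 →L[ℝ] Mink →L[ℝ] Mink
  dτ : E4 →L[ℝ] E4 →L[ℝ] E4 →L[ℝ] Mink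

namespace Jet

variable (c d : ℝ) (j X Y : Jet)

/-- Torsion. -/
def tor (u v : E4) : Mink := j.de u v - j.de v u + j.A u (j.e v) - j.A v (j.e u)

/-- Curvature. -/
def cur (u v : E4) : Mink →L[ℝ] Mink :=
  j.dA u v - j.dA v u + j.A u * j.A v - j.A v * j.A u

/-- The variation of the torsion. -/
def dtor (u v : E4) : Mink :=
  X.de u v - X.de v u + (j.A u (X.e v) + X.A u (j.e v)) - (j.A v (X.e u) + X.A v (j.e u))

/-- The variation of the curvature. -/
def dcur (u v : E4) : Mink →L[ℝ] Mink :=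
  X.dA u v - X.dA v u + (X.A u * j.A v + j.A u * X.A v) - (X.A v * j.A u + j.A v * X.A u)

/-- The Lagrangian. -/
def lag (u₁ u₂ u₃ u₄ : E4) : ℝ :=
  (1 / 4) * pairC c d (j.cur u₁ u₂) (j.e u₃) (j.e u₄) - (1 / 4) * ηC (j.τ u₁ u₂) (j.tor u₃ u₄)

/-- The variation of the Lagrangian. -/
def dlag (u₁ u₂ u₃ u₄ : E4) : ℝ :=
  (1 / 4) * (pairC c d (j.dcur X u₁ u₂) (j.e u₃) (j.e u₄) +
    pairC c d (j.cur u₁ u₂) (X.e u₃) (j.e u₄) + pairC c d (j.cur u₁ u₂) (j.e u₃) (X.e u₄)) -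
  (1 / 4) * (ηC (X.τ u₁ u₂) (j.tor u₃ u₄) + ηC (j.τ u₁ u₂) (j.dtor X u₃ u₄))

/-- The Euler–Lagrange form. -/
def el (u₁ u₂ u₃ u₄ : E4) : ℝ :=
  (1 / 2) * pairC c d (X.A u₁) (j.tor u₂ u₃) (j.e u₄) +
  (1 / 2) * pairC c d (j.cur u₁ u₂) (j.e u₃) (X.e u₄) -
  (1 / 4) * ηC (X.τ u₁ u₂) (j.tor u₃ u₄) - (1 / 2) * ηC (j.τ u₁ u₂) (X.A u₃ (j.e u₄)) +
  (1 / 2) * ηC (j.dτ u₁ u₂ u₃ + j.A u₁ (j.τ u₂ u₃)) (X.e u₄)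

/-- The derivative of the boundary form. -/
def dθ (u₁ u₂ u₃ u₄ : E4) : ℝ :=
  (1 / 2) * (pairC c d (X.dA u₁ u₂) (j.e u₃) (j.e u₄) +
    pairC c d (X.A u₂) (j.de u₁ u₃) (j.e u₄) + pairC c d (X.A u₂) (j.e u₃) (j.de u₁ u₄)) -
  (1 / 2) * (ηC (j.dτ u₁ u₂ u₃) (X.e u₄) + ηC (j.τ u₂ u₃) (X.de u₁ u₄))

variable {c d j X Y}

/-- This is the pointwise form of δL = el + dθ. Since δF = d_A δA, invariance of the pairing moves
the connection from δA onto e, so that ⟨δF, e ∧ e⟩ is a derivative plus a term in which δA is paired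
with the torsion. The skewness of A does the same for η(τ, d_A δe). -/
theorem alt4_dlag (hj : ∀ u, IsSkew (j.A u)) (hX : ∀ u, IsSkew (X.A u))
    (hF : ∀ u v, IsSkew (j.cur u v)) (v : Fin 4 → E4) :
    alt4 (j.dlag c d X) v = alt4 (j.el c d X) v + alt4 (j.dθ c d X) v := by
  -- Modulo permutations of the arguments only nine monomials occur. The identities a1 to a14 bring
  -- every term to one of these, the sign being that of the permutation, corrected where the pairing
  -- or η changes sign too.
  let m1 := alt4 (fun x y z w => pairC c d (X.dA x y) (j.e z) (j.e w)) v
  let m2 := alt4 (fun x y z w => pairC c d (X.A y) (j.A x (j.e z)) (j.e w)) v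
  let m3 := alt4 (fun x y z w => pairC c d (X.A y) (j.de x z) (j.e w)) v
  let m4 := alt4 (fun x y z w => pairC c d (j.cur x y) (j.e z) (X.e w)) v
  let m5 := alt4 (fun x y z w => ηC (X.τ x y) (j.tor z w)) v
  let m6 := alt4 (fun x y z w => ηC (j.τ x y) (X.de z w)) v
  let m7 := alt4 (fun x y z w => ηC (j.τ x y) (j.A z (X.e w))) v
  let m8 := alt4 (fun x y z w => ηC (j.τ x y) (X.A z (j.e w))) v
  let m9 := alt4 (fun x y z w => ηC (j.dτ x y z) (X.e w)) v
  have a1 : alt4 (fun x y z w => pairC c d (X.dA y x) (j.e z) (j.e w)) v = -m1 :=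
    alt4_swap01 (fun x y z w => pairC c d (X.dA x y) (j.e z) (j.e w)) v
  have a2 : alt4 (fun x y z w => pairC c d (X.A x) (j.A y (j.e z)) (j.e w)) v = -m2 :=
    alt4_swap01 (fun x y z w => pairC c d (X.A y) (j.A x (j.e z)) (j.e w)) v
  have a3 : alt4 (fun x y z w => pairC c d (X.A y) (j.e z) (j.A x (j.e w))) v = m2 := by
    have h := alt4_swap23 (fun x y z w => pairC c d (X.A y) (j.e z) (j.A x (j.e w))) v
    rw [show (fun x y z w => pairC c d (X.A y) (j.e w) (j.A x (j.e z))) =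
        fun x y z w => -pairC c d (X.A y) (j.A x (j.e z)) (j.e w) from by
      funext x y z w; exact (hX y).pairC_swap c d _ _, alt4_neg] at h
    exact (neg_injective h).symm
  have a4 : alt4 (fun x y z w => pairC c d (X.A x) (j.e z) (j.A y (j.e w))) v = -m2 := by
    rw [← a3]
    exact alt4_swap01 (fun x y z w => pairC c d (X.A y) (j.e z) (j.A x (j.e w))) v
  have a5 : alt4 (fun x y z w => pairC c d (X.A y) (j.e z) (j.de x w)) v = m3 := by
    have h := alt4_swap23 (fun x y z w => pairC c d (X.A y) (j.e z) (j.de x w)) v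
    rw [show (fun x y z w => pairC c d (X.A y) (j.e w) (j.de x z)) =
        fun x y z w => -pairC c d (X.A y) (j.de x z) (j.e w) from by
      funext x y z w; exact (hX y).pairC_swap c d _ _, alt4_neg] at h
    exact (neg_injective h).symm
  have a6 : alt4 (fun x y z w => pairC c d (j.cur x y) (X.e z) (j.e w)) v = m4 := by
    have h := alt4_swap23 (fun x y z w => pairC c d (j.cur x y) (X.e z) (j.e w)) v
    rw [show (fun x y z w => pairC c d (j.cur x y) (X.e w) (j.e z)) =
        fun x y z w => -pairC c d (j.cur x y) (j.e z) (X.e w) from by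
      funext x y z w; exact (hF x y).pairC_swap c d _ _, alt4_neg] at h
    exact (neg_injective h).symm
  have a7 : alt4 (fun x y z w => ηC (j.τ x y) (X.de w z)) v = -m6 :=
    alt4_swap23 (fun x y z w => ηC (j.τ x y) (X.de z w)) v
  have a8 : alt4 (fun x y z w => ηC (j.τ x y) (j.A w (X.e z))) v = -m7 :=
    alt4_swap23 (fun x y z w => ηC (j.τ x y) (j.A z (X.e w))) v
  have a9 : alt4 (fun x y z w => ηC (j.τ x y) (X.A w (j.e z))) v = -m8 :=
    alt4_swap23 (fun x y z w => ηC (j.τ x y) (X.A z (j.e w))) v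
  have a10 : alt4 (fun x y z w => ηC (j.τ y z) (X.de x w)) v = m6 :=
    alt4_cycle (fun x y z w => ηC (j.τ x y) (X.de z w)) v
  have a11 : alt4 (fun x y z w => ηC (j.A x (j.τ y z)) (X.e w)) v = -m7 := by
    rw [show (fun x y z w => ηC (j.A x (j.τ y z)) (X.e w)) =
        fun x y z w => -ηC (j.τ y z) (j.A x (X.e w)) from by
      funext x y z w; exact (hj x).η _ _, alt4_neg]
    exact congrArg _ (alt4_cycle (fun x y z w => ηC (j.τ x y) (j.A z (X.e w))) v)
  have a12 : alt4 (fun x y z w => pairC c d (X.A x) (j.de y z) (j.e w)) v = -m3 :=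
    alt4_swap01 (fun x y z w => pairC c d (X.A y) (j.de x z) (j.e w)) v
  have a13 : alt4 (fun x y z w => pairC c d (X.A x) (j.de z y) (j.e w)) v = m3 := by
    rw [alt4_swap12 (fun x y z w => pairC c d (X.A x) (j.de y z) (j.e w)) v, a12, neg_neg]
  have a14 : alt4 (fun x y z w => pairC c d (X.A x) (j.A z (j.e y)) (j.e w)) v = m2 := by
    rw [alt4_swap12 (fun x y z w => pairC c d (X.A x) (j.A y (j.e z)) (j.e w)) v, a2, neg_neg]
  -- The brackets of A with δA are turned into actions of A on the two legs e by infinitesimal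
  -- invariance of the pairing.
  have e1 : ∀ x y z w, pairC c d (j.dcur X x y) (j.e z) (j.e w) =
      pairC c d (X.dA x y) (j.e z) (j.e w) - pairC c d (X.dA y x) (j.e z) (j.e w) -
      pairC c d (X.A y) (j.A x (j.e z)) (j.e w) - pairC c d (X.A y) (j.e z) (j.A x (j.e w)) +
      pairC c d (X.A x) (j.A y (j.e z)) (j.e w) + pairC c d (X.A x) (j.e z) (j.A y (j.e w)) := by
    intro x y z w
    have h1 := (hj x).pairC_bracket (hX y) c d (j.e z) (j.e w)
    have h2 := (hj y).pairC_bracket (hX x) c d (j.e z) (j.e w)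
    simp only [map_sub, sub_apply] at h1 h2
    simp only [dcur, map_add, map_sub, add_apply, sub_apply]
    linarith
  have e2 : alt4 (j.dlag c d X) v = (1 / 4) * (2 * m1 - 4 * m2 + 2 * m4) -
      (1 / 4) * (m5 + 2 * m6 + 2 * m7 + 2 * m8) := by
    unfold dlag
    simp only [e1, dtor, map_add, map_sub, alt4_add, alt4_sub, alt4_mul, a1, a2, a3, a4, a6, a7,
      a8, a9]
    simp only [m1, m2, m4, m5, m6, m7, m8]
    ring
  have e3 : alt4 (j.el c d X) v = -m3 - m2 + (1 / 2) * m4 - (1 / 4) * m5 - (1 / 2) * m8 +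
      (1 / 2) * m9 - (1 / 2) * m7 := by
    have e4 : ∀ x y z w, pairC c d (X.A x) (j.tor y z) (j.e w) =
        pairC c d (X.A x) (j.de y z) (j.e w) - pairC c d (X.A x) (j.de z y) (j.e w) +
        pairC c d (X.A x) (j.A y (j.e z)) (j.e w) - pairC c d (X.A x) (j.A z (j.e y)) (j.e w) := by
      intro x y z w
      simp only [tor, map_add, map_sub, add_apply, sub_apply]
    unfold el
    simp only [e4, map_add, add_apply, alt4_add, alt4_sub, alt4_mul, a12, a13, a2, a14, a11]
    simp only [m2, m3, m4, m5, m7, m8, m9]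
    ring
  have e5 : alt4 (j.dθ c d X) v = (1 / 2) * (m1 + 2 * m3) - (1 / 2) * (m9 + m6) := by
    unfold dθ
    simp only [alt4_add, alt4_sub, alt4_mul, a5, a10]
    simp only [m1, m3, m6, m9]
    ring
  rw [e2, e3, e5]
  ring

/-- The jet of `φ + s X`. -/
def line (j X : Jet) (s : ℝ) : Jet where
  e := j.e + s • X.e
  A := j.A + s • X.A
  τ := j.τ + s • X.τ
  de := j.de + s • X.de
  dA := j.dA + s • X.dA
  dτ := j.dτ + s • X.dτ

theorem add_zero_smul {F : Type*} [NormedAddCommGroup F] [NormedSpace ℝ F] (a b : F) :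
    a + (0 : ℝ) • b = a := by simp

theorem hasDerivAt_add_smul {F : Type*} [NormedAddCommGroup F] [NormedSpace ℝ F] (a b : F) :
    HasDerivAt (fun s : ℝ => a + s • b) b 0 := by
  simpa using ((hasDerivAt_id (0 : ℝ)).smul_const b).const_add a

theorem line_zero : j.line X 0 = j := by
  have h1 : (j.line X 0).e = j.e := ContinuousLinearMap.ext fun u => add_zero_smul (j.e u) (X.e u)
  have h2 : (j.line X 0).A = j.A := ContinuousLinearMap.ext fun u => add_zero_smul (j.A u) (X.A u)
  have h3 : (j.line X 0).τ = j.τ := ContinuousLinearMap.ext fun u => ContinuousLinearMap.ext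
    fun v => add_zero_smul (j.τ u v) (X.τ u v)
  have h4 : (j.line X 0).de = j.de := ContinuousLinearMap.ext fun u => ContinuousLinearMap.ext
    fun v => add_zero_smul (j.de u v) (X.de u v)
  have h5 : (j.line X 0).dA = j.dA := ContinuousLinearMap.ext fun u => ContinuousLinearMap.ext
    fun v => add_zero_smul (j.dA u v) (X.dA u v)
  have h6 : (j.line X 0).dτ = j.dτ := ContinuousLinearMap.ext fun u => ContinuousLinearMap.ext
    fun v => ContinuousLinearMap.ext fun w => add_zero_smul (j.dτ u v w) (X.dτ u v w)
  exact Jet.ext h1 h2 h3 h4 h5 h6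

theorem hasDerivAt_tor (u v : E4) :
    HasDerivAt (fun s : ℝ => (j.line X s).tor u v) (j.dtor X u v) 0 := by
  have he : ∀ u, HasDerivAt (fun s : ℝ => (j.line X s).e u) (X.e u) 0 := fun u =>
    hasDerivAt_add_smul (j.e u) (X.e u)
  have hA : ∀ u, HasDerivAt (fun s : ℝ => (j.line X s).A u) (X.A u) 0 := fun u =>
    hasDerivAt_add_smul (j.A u) (X.A u)
  have hde : ∀ u v, HasDerivAt (fun s : ℝ => (j.line X s).de u v) (X.de u v) 0 := fun u v =>
    hasDerivAt_add_smul (j.de u v) (X.de u v)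
  have hAe : ∀ u v, HasDerivAt (fun s : ℝ => (j.line X s).A u ((j.line X s).e v))
      (j.A u (X.e v) + X.A u (j.e v)) 0 := by
    intro u v
    have h := (hA u).clm_apply (he v)
    rwa [line_zero, add_comm] at h
  exact (((hde u v).sub (hde v u)).add (hAe u v)).sub (hAe v u)

theorem hasDerivAt_cur (u v : E4) :
    HasDerivAt (fun s : ℝ => (j.line X s).cur u v) (j.dcur X u v) 0 := by
  have hA : ∀ u, HasDerivAt (fun s : ℝ => (j.line X s).A u) (X.A u) 0 := fun u =>
    hasDerivAt_add_smul (j.A u) (X.A u)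
  have hdA : ∀ u v, HasDerivAt (fun s : ℝ => (j.line X s).dA u v) (X.dA u v) 0 := fun u v =>
    hasDerivAt_add_smul (j.dA u v) (X.dA u v)
  have hAA : ∀ u v, HasDerivAt (fun s : ℝ => (j.line X s).A u * (j.line X s).A v)
      (X.A u * j.A v + j.A u * X.A v) 0 := by
    intro u v
    have h := (hA u).mul (hA v)
    rwa [line_zero] at h
  exact (((hdA u v).sub (hdA v u)).add (hAA u v)).sub (hAA v u)

theorem hasDerivAt_lag (u₁ u₂ u₃ u₄ : E4) :
    HasDerivAt (fun s : ℝ => (j.line X s).lag c d u₁ u₂ u₃ u₄) (j.dlag c d X u₁ u₂ u₃ u₄) 0 := by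
  have he : ∀ u, HasDerivAt (fun s : ℝ => (j.line X s).e u) (X.e u) 0 := fun u =>
    hasDerivAt_add_smul (j.e u) (X.e u)
  have hτ : HasDerivAt (fun s : ℝ => (j.line X s).τ u₁ u₂) (X.τ u₁ u₂) 0 :=
    hasDerivAt_add_smul (j.τ u₁ u₂) (X.τ u₁ u₂)
  have h1 := (((pairC c d).hasFDerivAt.comp_hasDerivAt 0 (hasDerivAt_cur (j := j) (X := X) u₁ u₂)).clm_apply
    (he u₃)).clm_apply (he u₄)
  have h2 := (ηC.hasFDerivAt.comp_hasDerivAt 0 hτ).clm_apply (hasDerivAt_tor (j := j) (X := X) u₃ u₄)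
  have h3 := (h1.const_mul (1 / 4)).sub (h2.const_mul (1 / 4))
  simp only [line_zero, Function.comp_def, add_apply] at h3
  exact h3

end Jet

namespace Jet

variable (c d : ℝ) (j X : Jet)

theorem tor_add_left (u u' v : E4) : j.tor (u + u') v = j.tor u v + j.tor u' v := by
  simp only [tor, map_add, add_apply]; abel
theorem tor_add_right (u v v' : E4) : j.tor u (v + v') = j.tor u v + j.tor u v' := by
  simp only [tor, map_add, add_apply]; abel
theorem tor_smul_left (r : ℝ) (u v : E4) : j.tor (r • u) v = r • j.tor u v := by
  simp only [tor, map_smul, smul_apply]; module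
theorem tor_smul_right (r : ℝ) (u v : E4) : j.tor u (r • v) = r • j.tor u v := by
  simp only [tor, map_smul, smul_apply]; module
theorem cur_add_left (u u' v : E4) : j.cur (u + u') v = j.cur u v + j.cur u' v := by
  simp only [cur, map_add, add_apply, add_mul, mul_add]; abel
theorem cur_add_right (u v v' : E4) : j.cur u (v + v') = j.cur u v + j.cur u v' := by
  simp only [cur, map_add, add_apply, add_mul, mul_add]; abel
theorem cur_smul_left (r : ℝ) (u v : E4) : j.cur (r • u) v = r • j.cur u v := by
  simp only [cur, map_smul, smul_apply, smul_mul_assoc, mul_smul_comm]; module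
theorem cur_smul_right (r : ℝ) (u v : E4) : j.cur u (r • v) = r • j.cur u v := by
  simp only [cur, map_smul, smul_apply, smul_mul_assoc, mul_smul_comm]; module
theorem tor_swap (u v : E4) : j.tor u v = -j.tor v u := by
  simp only [tor]; abel

/-- The Euler–Lagrange form as a multilinear map. -/
def elM : MultilinearMap ℝ (fun _ : Fin 4 => E4) ℝ where
  toFun v := j.el c d X (v 0) (v 1) (v 2) (v 3)
  map_update_add' := by
    intro inst v i x y
    -- A multilinear map is additive for an arbitrary decidability instance; replacing it by the
    -- standard one lets `Function.update` compute.
    obtain rfl : inst = instDecidableEqFin 4 := Subsingleton.elim _ _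
    fin_cases i <;> simp [Function.update, el, tor_add_left, tor_add_right, cur_add_left,
      cur_add_right] <;> ring
  map_update_smul' := by
    intro inst v i r x
    obtain rfl : inst = instDecidableEqFin 4 := Subsingleton.elim _ _
    fin_cases i <;> simp [Function.update, el, tor_smul_left, tor_smul_right, cur_smul_left,
      cur_smul_right] <;> ring

end Jet

/-- The trilinear form `⟨A(u), e(v) ∧ e'(w)⟩`. -/
def kM (c d : ℝ) (A : E4 →L[ℝ] Mink →L[ℝ] Mink) (e e' : E4 →L[ℝ] Mink) :
    MultilinearMap ℝ (fun _ : Fin 3 => E4) ℝ where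
  toFun v := pairC c d (A (v 0)) (e (v 1)) (e' (v 2))
  map_update_add' := by
    intro inst v i x y
    obtain rfl : inst = instDecidableEqFin 3 := Subsingleton.elim _ _
    fin_cases i <;> simp [Function.update]
  map_update_smul' := by
    intro inst v i r x
    obtain rfl : inst = instDecidableEqFin 3 := Subsingleton.elim _ _
    fin_cases i <;> simp [Function.update]

/-- The trilinear form `η(τ(u, v), e(w))`. -/
def hM (τ : E4 →L[ℝ] E4 →L[ℝ] Mink) (e : E4 →L[ℝ] Mink) :
    MultilinearMap ℝ (fun _ : Fin 3 => E4) ℝ where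
  toFun v := ηC (τ (v 0) (v 1)) (e (v 2))
  map_update_add' := by
    intro inst v i x y
    obtain rfl : inst = instDecidableEqFin 3 := Subsingleton.elim _ _
    fin_cases i <;> simp [Function.update]
  map_update_smul' := by
    intro inst v i r x
    obtain rfl : inst = instDecidableEqFin 3 := Subsingleton.elim _ _
    fin_cases i <;> simp [Function.update]

theorem altSum_congr {n : ℕ} {W W' : Type*} {q : (Fin n → W) → ℝ} {q' : (Fin n → W') → ℝ}
    {v : Fin n → W} {v' : Fin n → W'}
    (h : ∀ σ : Equiv.Perm (Fin n), q (fun i => v (σ i)) = q' fun i => v' (σ i)) :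
    altSum q v = altSum q' v' :=
  Finset.sum_congr rfl fun σ _ => congrArg _ (h σ)

/-! ### Smoothness and exterior derivative of forms given by alternating sums. -/

section Forms

variable {M : Type*} [TopologicalSpace M] [ChartedSpace (EuclideanHalfSpace 4) M]
  [IsManifold (𝓡∂ 4) ∞ M]

theorem chartRep_eq {k : ℕ} (α : ∀ x : M, (Fin k → TangentSpace (𝓡∂ 4) x) → ℝ) {c : M} {y : E4}
    (hy : y ∈ (extChartAt (𝓡∂ 4) c).target) (v : Fin k → E4) :
    chartRep (𝓡∂ 4) α c y v = α (pt c y) fun i => tv c (pt c y) (v i) := by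
  rw [chartRep]
  simp only [mfderivWithin_symm hy]
  rfl

/-- Smoothness may be tested near each point with a formula depending on that point, which is needed
because formulas in components exist only on the domain of a local frame. -/
theorem isSmoothForm_of_eventually {k : ℕ}
    {α : ∀ x : M, TangentSpace (𝓡∂ 4) x [⋀^Fin k]→ₗ[ℝ] ℝ}
    (h : ∀ (c : M), ∀ y ∈ (extChartAt (𝓡∂ 4) c).target, ∀ v : Fin k → E4,
      ∃ q : E4 → ℝ, ContDiffWithinAt ℝ ∞ q halfSpace y ∧
        ∀ᶠ y' in 𝓝[halfSpace] y, chartRep (𝓡∂ 4) (fun x => α x) c y' v = q y') :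
    IsSmoothForm (𝓡∂ 4) α := by
  intro c v y hy
  obtain ⟨q, hq, hev⟩ := h c y hy v
  have hyr : y ∈ halfSpace := extChartAt_target_subset_range c hy
  exact (hq.congr_of_eventuallyEq_of_mem hev hyr).mono (extChartAt_target_subset_range c)

/-- The exterior derivative of a form given by an alternating sum. -/
theorem extDer_eq_altSum {k : ℕ} {α : ∀ x : M, TangentSpace (𝓡∂ 4) x [⋀^Fin k]→ₗ[ℝ] ℝ} {x : M}
    {q : E4 → (Fin k → E4) → ℝ}
    (h : ∀ᶠ y in 𝓝[halfSpace] (extChartAt (𝓡∂ 4) x x), ∀ v : Fin k → E4,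
      chartRep (𝓡∂ 4) (fun x => α x) x y v = altSum (q y) v)
    (hq : ∀ v, DifferentiableWithinAt ℝ (fun y => q y v) halfSpace (extChartAt (𝓡∂ 4) x x))
    (v : Fin (k + 1) → E4) :
    extDer (𝓡∂ 4) α x v = altSum (fun v => fderivWithin ℝ (fun y => q y fun j => v j.succ) halfSpace
      (extChartAt (𝓡∂ 4) x x) (v 0)) v := by
  have hm := extChartAt_mem_halfSpace x x
  have hu := unique_halfSpace hm
  -- Expanding along the first argument, the direction of differentiation, reproduces the sum over
  -- omitted vectors in the definition of the exterior derivative.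
  rw [altSum_succ (fun u w => fderivWithin ℝ (fun y => q y w) halfSpace
      (extChartAt (𝓡∂ 4) x x) u) v]
  have hdef : extDer (𝓡∂ 4) α x v = ∑ i : Fin (k + 1), (-1 : ℝ) ^ (i : ℕ) *
      (fderivWithin ℝ (fun y => chartRep (𝓡∂ 4) (fun x => α x) x y fun j => v (i.succAbove j))
        (range (𝓡∂ 4)) (extChartAt (𝓡∂ 4) x x) : E4 →L[ℝ] ℝ) (v i) := rfl
  refine hdef.trans (Finset.sum_congr rfl fun i _ => ?_)
  congr 1
  have h1 : fderivWithin ℝ (fun y => chartRep (𝓡∂ 4) (fun x => α x) x y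
        fun j => v (i.succAbove j)) (range (𝓡∂ 4)) (extChartAt (𝓡∂ 4) x x) =
      fderivWithin ℝ (fun y => altSum (q y) fun j => v (i.succAbove j)) halfSpace
        (extChartAt (𝓡∂ 4) x x) := by
    refine Filter.EventuallyEq.fderivWithin_eq_of_mem ?_ hm
    filter_upwards [h] with y hy using hy _
  refine (congrArg (fun L : E4 →L[ℝ] ℝ => L (v i)) h1).trans ?_
  simp only [altSum]
  rw [fderivWithin_fun_sum hu fun σ _ => (hq _).const_mul _, sum_apply]
  refine Finset.sum_congr rfl fun σ _ => ?_
  rw [fderivWithin_const_mul hu (hq _), smul_apply, smul_eq_mul]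

end Forms

/-! ### Jets of fields, and the forms built from invariant pairings. -/

section Fields

variable {M : Type*} [TopologicalSpace M] [ChartedSpace (EuclideanHalfSpace 4) M]
  [IsManifold (𝓡∂ 4) ∞ M]
  {V : M → Type*} [TopologicalSpace (TotalSpace Mink V)] [∀ x, AddCommGroup (V x)]
  [∀ x, Module ℝ (V x)] [∀ x, TopologicalSpace (V x)] [∀ x, IsTopologicalAddGroup (V x)]
  [∀ x, ContinuousSMul ℝ (V x)] [FiberBundle Mink V] [VectorBundle ℝ Mink V]
  [ContMDiffVectorBundle ∞ Mink V (𝓡∂ 4)] {P : MinkowskiBundle V}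

variable (A₀ : Connection P) (φ ψ X Y : FieldSpace P) (f : LocalFrame P) (c x : M) (y : E4)

/-- The components of a field and their first derivatives. -/
def jet : Jet := ⟨φ.eC f c (pt c y), connC A₀ φ f c (pt c y), φ.τC f c (pt c y), deC φ f c y,
  dconnC A₀ φ f c y, dτC φ f c y⟩

/-- The components of a variation and their first derivatives. -/
def vjet : Jet := ⟨X.eC f c (pt c y), X.aC f c (pt c y), X.τC f c (pt c y), deC X f c y,
  daC X f c y, dτC X f c y⟩

variable {A₀ φ ψ X Y f c x y}

theorem IsGood.eC_diff (h : IsGood f c y) :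
    DifferentiableWithinAt ℝ (fun y => φ.eC f c (pt c y)) halfSpace y :=
  (eC_contDiffWithinAt φ h.1 h.2).differentiableWithinAt (by simp)

theorem IsGood.aC_diff (h : IsGood f c y) :
    DifferentiableWithinAt ℝ (fun y => φ.aC f c (pt c y)) halfSpace y :=
  (aC_contDiffWithinAt φ h.1 h.2).differentiableWithinAt (by simp)

theorem IsGood.τC_diff (h : IsGood f c y) :
    DifferentiableWithinAt ℝ (fun y => φ.τC f c (pt c y)) halfSpace y :=
  (τC_contDiffWithinAt φ h.1 h.2).differentiableWithinAt (by simp)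

theorem fderivWithin_add_smul {E F : Type*} [NormedAddCommGroup E] [NormedSpace ℝ E]
    [NormedAddCommGroup F] [NormedSpace ℝ F] {s : Set E} {y : E} {g h : E → F}
    (hs : UniqueDiffWithinAt ℝ s y) (hg : DifferentiableWithinAt ℝ g s y)
    (hh : DifferentiableWithinAt ℝ h s y) (r : ℝ) :
    fderivWithin ℝ (fun y => g y + r • h y) s y = fderivWithin ℝ g s y + r • fderivWithin ℝ h s y := by
  rw [fderivWithin_fun_add hs hg (hh.fun_const_smul r), fderivWithin_fun_const_smul hs hh]

/-- The connection is affine in the field: A₀ contributes to the base point but not to the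
variation. Hence the jet of a variation contains A - A₀ where the jet of a field contains A. -/
theorem IsGood.jet_add_smul (h : IsGood f c y) (r : ℝ) :
    jet A₀ (φ + r • X) f c y = (jet A₀ φ f c y).line (vjet X f c y) r := by
  have hu := unique_halfSpace h.mem
  have he : ∀ x, (φ + r • X).eC f c x = φ.eC f c x + r • X.eC f c x := fun x => by
    rw [FieldSpace.eC_add, FieldSpace.eC_smul]
  have hτ : ∀ x, (φ + r • X).τC f c x = φ.τC f c x + r • X.τC f c x := fun x => by
    rw [FieldSpace.τC_add, FieldSpace.τC_smul]
  have hA : ∀ x, connC A₀ (φ + r • X) f c x = connC A₀ φ f c x + r • X.aC f c x := fun x => by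
    rw [connC, connC, FieldSpace.aC_add, FieldSpace.aC_smul, add_assoc]
  refine Jet.ext (he _) (hA _) (hτ _) ?_ ?_ ?_
  · change fderivWithin ℝ _ halfSpace y = _
    simp only [he]
    exact fderivWithin_add_smul hu h.eC_diff h.eC_diff r
  · change fderivWithin ℝ _ halfSpace y = _
    simp only [hA]
    exact fderivWithin_add_smul hu h.differentiable_connC h.aC_diff r
  · change fderivWithin ℝ _ halfSpace y = _
    simp only [hτ]
    exact fderivWithin_add_smul hu h.τC_diff h.τC_diff r

theorem IsGood.isSkew_conn (h : IsGood f c y) (u : E4) : IsSkew ((jet A₀ φ f c y).A u) :=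
  connC_mem_so31 h.2 u

theorem IsGood.isSkew_aC (h : IsGood f c y) (u : E4) : IsSkew ((vjet X f c y).A u) :=
  X.aC_mem_so31 h.2 u

theorem IsGood.isSkew_cur (h : IsGood f c y) (u v : E4) : IsSkew ((jet A₀ φ f c y).cur u v) :=
  h.curC_mem_so31 u v

variable [T2Space M]

variable (P) in
/-- A chosen local frame around a point. -/
def frameAt (x : M) : LocalFrame P := Classical.choose (exists_localFrame P x)

theorem mem_frameAt (x : M) : x ∈ (frameAt P x).U := Classical.choose_spec (exists_localFrame P x)

/-- The pairing does not depend on the local frame. -/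
theorem pairC_frames {f f' : LocalFrame P} (hf : x ∈ f.U) (hf' : x ∈ f'.U) (r s : ℝ)
    {α α' : Mink →L[ℝ] Mink} {L : V x →ₗ[ℝ] V x} (hα : ∀ v, α v = f.coord x (L (f.lift x v)))
    (hα' : ∀ v, α' v = f'.coord x (L (f'.lift x v))) (v w : V x) :
    pairC r s α (f.coord x v) (f.coord x w) = pairC r s α' (f'.coord x v) (f'.coord x w) := by
  let β : Module.End ℝ Mink := (P.frame x).symm.toLinearMap ∘ₗ L ∘ₗ (P.frame x).toLinearMap
  have hβ : ∀ v, β v = (P.frame x).symm (L (P.frame x v)) := fun v => rfl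
  rw [pairC_apply, pairC_apply, ← LocalFrame.pairing_frame hf hβ hα,
    ← LocalFrame.pairing_frame hf' hβ hα']

theorem ηC_frames {f f' : LocalFrame P} (hf : x ∈ f.U) (hf' : x ∈ f'.U) (v w : V x) :
    ηC (f.coord x v) (f.coord x w) = ηC (f'.coord x v) (f'.coord x w) := by
  rw [ηC_apply, ηC_apply, ← LocalFrame.η_eq_coord hf, ← LocalFrame.η_eq_coord hf']

variable (r s : ℝ)

/-- The 3-form `⟨X_A, e_φ ∧ e_ψ⟩`. -/
def kForm (X φ ψ : FieldSpace P) (x : M) : TangentSpace (𝓡∂ 4) x [⋀^Fin 3]→ₗ[ℝ] ℝ :=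
  (MultilinearMap.alternatization (kM r s (X.aC (frameAt P x) x x) (φ.eC (frameAt P x) x x)
    (ψ.eC (frameAt P x) x x)) : E4 [⋀^Fin 3]→ₗ[ℝ] ℝ)

/-- The 3-form `η(τ_φ, e_X)`. -/
def hForm (φ X : FieldSpace P) (x : M) : TangentSpace (𝓡∂ 4) x [⋀^Fin 3]→ₗ[ℝ] ℝ :=
  (MultilinearMap.alternatization (hM (φ.τC (frameAt P x) x x) (X.eC (frameAt P x) x x)) :
    E4 [⋀^Fin 3]→ₗ[ℝ] ℝ)

/-- The Euler–Lagrange form. -/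
def elForm (A₀ : Connection P) (φ X : FieldSpace P) (x : M) :
    TangentSpace (𝓡∂ 4) x [⋀^Fin 4]→ₗ[ℝ] ℝ :=
  (MultilinearMap.alternatization (Jet.elM r s
    (jet A₀ φ (frameAt P x) x (extChartAt (𝓡∂ 4) x x))
    (vjet X (frameAt P x) x (extChartAt (𝓡∂ 4) x x))) : E4 [⋀^Fin 4]→ₗ[ℝ] ℝ)

variable {r s}

theorem elForm_apply (v : Fin 4 → E4) : elForm r s A₀ φ X x v =
    alt4 (Jet.el r s (jet A₀ φ (frameAt P x) x (extChartAt (𝓡∂ 4) x x))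
      (vjet X (frameAt P x) x (extChartAt (𝓡∂ 4) x x))) v :=
  alternatization_eq_altSum _ v

/-- The form is defined with the frame chosen at x and the chart at x, and these jump from point to
point. By invariance of the pairing, its values can be computed in any frame and chart around x, and
smoothness follows from this. -/
theorem kForm_tv (hx : x ∈ f.U) (v : Fin 3 → E4) :
    kForm r s X φ ψ x (fun i => tv c x (v i)) =
      alt3 (fun a b d => pairC r s (X.aC f c x a) (φ.eC f c x b) (ψ.eC f c x d)) v := by
  refine (alternatization_eq_altSum _ _).trans (altSum_congr fun σ => ?_)
  change pairC r s (X.aC (frameAt P x) x x (tv c x (v (σ 0))))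
    (φ.eC (frameAt P x) x x (tv c x (v (σ 1)))) (ψ.eC (frameAt P x) x x (tv c x (v (σ 2)))) = _
  rw [eC_self, eC_self]
  exact pairC_frames (mem_frameAt x) hx r s
    (L := { toFun := fun w => X.a x w (tv c x (v (σ 0)))
            map_add' := fun w w' => by simp
            map_smul' := fun r w => by simp }) (fun w => aC_self _ w) (fun w => rfl) _ _

theorem hForm_tv (hx : x ∈ f.U) (v : Fin 3 → E4) :
    hForm φ X x (fun i => tv c x (v i)) =
      alt3 (fun a b d => ηC (φ.τC f c x a b) (X.eC f c x d)) v := by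
  refine (alternatization_eq_altSum _ _).trans (altSum_congr fun σ => ?_)
  change ηC (φ.τC (frameAt P x) x x (tv c x (v (σ 0))) (tv c x (v (σ 1))))
    (X.eC (frameAt P x) x x (tv c x (v (σ 2)))) = _
  rw [eC_self, τC_self]
  exact ηC_frames (mem_frameAt x) hx _ _

theorem IsGood.chartRep_kForm (h : IsGood f c y) (v : Fin 3 → E4) :
    chartRep (𝓡∂ 4) (fun x => kForm r s X φ ψ x) c y v =
      altSum (fun v => pairC r s (X.aC f c (pt c y) (v 0)) (φ.eC f c (pt c y) (v 1))
        (ψ.eC f c (pt c y) (v 2))) v := by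
  rw [chartRep_eq _ h.1]
  exact kForm_tv h.2 v

theorem IsGood.chartRep_hForm (h : IsGood f c y) (v : Fin 3 → E4) :
    chartRep (𝓡∂ 4) (fun x => hForm φ X x) c y v =
      altSum (fun v => ηC (φ.τC f c (pt c y) (v 0) (v 1)) (X.eC f c (pt c y) (v 2))) v := by
  rw [chartRep_eq _ h.1]
  exact hForm_tv h.2 v

theorem IsGood.contDiff_k (h : IsGood f c y) (u v w : E4) :
    ContDiffWithinAt ℝ ∞ (fun y => pairC r s (X.aC f c (pt c y) u) (φ.eC f c (pt c y) v)
      (ψ.eC f c (pt c y) w)) halfSpace y := by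
  have h1 := (aC_contDiffWithinAt X h.1 h.2).clm_apply (contDiffWithinAt_const (c := u))
  have h2 := (eC_contDiffWithinAt φ h.1 h.2).clm_apply (contDiffWithinAt_const (c := v))
  have h3 := (eC_contDiffWithinAt ψ h.1 h.2).clm_apply (contDiffWithinAt_const (c := w))
  exact (((pairC r s).contDiff.comp_contDiffWithinAt h1).clm_apply h2).clm_apply h3

theorem IsGood.contDiff_h (h : IsGood f c y) (u v w : E4) :
    ContDiffWithinAt ℝ ∞ (fun y => ηC (φ.τC f c (pt c y) u v) (X.eC f c (pt c y) w))
      halfSpace y := by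
  have h1 := ((τC_contDiffWithinAt φ h.1 h.2).clm_apply (contDiffWithinAt_const (c := u))).clm_apply
    (contDiffWithinAt_const (c := v))
  have h3 := (eC_contDiffWithinAt X h.1 h.2).clm_apply (contDiffWithinAt_const (c := w))
  exact (ηC.contDiff.comp_contDiffWithinAt h1).clm_apply h3

theorem isSmoothForm_kForm : IsSmoothForm (𝓡∂ 4) (kForm (P := P) r s X φ ψ) := by
  refine isSmoothForm_of_eventually fun c y hy v => ?_
  have hg : IsGood (frameAt P (pt c y)) c y := ⟨hy, mem_frameAt _⟩
  refine ⟨_, ?_, hg.eventually.mono fun y' hy' => hy'.chartRep_kForm v⟩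
  exact ContDiffWithinAt.sum fun σ _ => contDiffWithinAt_const.mul (hg.contDiff_k _ _ _)

theorem isSmoothForm_hForm : IsSmoothForm (𝓡∂ 4) (hForm (P := P) φ X) := by
  refine isSmoothForm_of_eventually fun c y hy v => ?_
  have hg : IsGood (frameAt P (pt c y)) c y := ⟨hy, mem_frameAt _⟩
  refine ⟨_, ?_, hg.eventually.mono fun y' hy' => hy'.chartRep_hForm v⟩
  exact ContDiffWithinAt.sum fun σ _ => contDiffWithinAt_const.mul (hg.contDiff_h _ _ _)

end Fields

theorem alt4_eq_zero {W : Type*} {g : W → W → W → W → ℝ} (h : ∀ a b c d, g a b c d = 0)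
    (v : Fin 4 → W) : alt4 g v = 0 := by
  unfold alt4 altSum
  exact Finset.sum_eq_zero fun _ _ => mul_eq_zero_of_right _ (h _ _ _ _)

theorem hasDerivAt_alt4 {W : Type*} {g : ℝ → W → W → W → W → ℝ} {g' : W → W → W → W → ℝ} {t : ℝ}
    (h : ∀ a b c d, HasDerivAt (fun t => g t a b c d) (g' a b c d) t) (v : Fin 4 → W) :
    HasDerivAt (fun t => alt4 (g t) v) (alt4 g' v) t := by
  unfold alt4 altSum
  exact HasDerivAt.fun_sum fun _ _ => (h _ _ _ _).const_mul _

theorem Jet.el_eq_zero {r s : ℝ} {j X : Jet} (he : X.e = 0) (hA : X.A = 0) (hτ : X.τ = 0)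
    {a b c d : E4} : j.el r s X a b c d = 0 := by
  simp [Jet.el, he, hA, hτ]

/-! ### Euler–Lagrange form and boundary form of the Lagrangian. -/

section Variation

variable {M : Type*} [TopologicalSpace M] [ChartedSpace (EuclideanHalfSpace 4) M]
  [IsManifold (𝓡∂ 4) ∞ M]
  {V : M → Type*} [TopologicalSpace (TotalSpace Mink V)] [∀ x, AddCommGroup (V x)]
  [∀ x, Module ℝ (V x)] [∀ x, TopologicalSpace (V x)] [∀ x, IsTopologicalAddGroup (V x)]
  [∀ x, ContinuousSMul ℝ (V x)] [FiberBundle Mink V] [VectorBundle ℝ Mink V]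
  [ContMDiffVectorBundle ∞ Mink V (𝓡∂ 4)] {P : MinkowskiBundle V} [T2Space M]
  {A₀ : Connection P} {φ ψ X Y : FieldSpace P} {f : LocalFrame P} {c x : M} {y : E4} {r s : ℝ}

/-! ### The Lagrangian in components -/

/-- The Lagrangian `½(r ⟨F, e ∧ e⟩ + s tr[F ∧ e ∧ e]) - η(τ, d_A e)`. -/
def holst (r s : ℝ) (A₀ : Connection P) (φ : FieldSpace P) (x : M)
    (v : Fin 4 → TangentSpace (𝓡∂ 4) x) : ℝ :=
  alt4 (fun a b c d => (1 / 4) * pairing r s (curvatureEnd A₀ φ x a b) (coframe φ x c)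
    (coframe φ x d) - (1 / 4) * P.η x (φ.τ x a b) (torsion A₀ φ x c d)) v

theorem holst_eq (hx : x ∈ f.U) (v : Fin 4 → E4) : holst r s A₀ φ x v =
    alt4 (Jet.lag r s (jet A₀ φ f x (extChartAt (𝓡∂ 4) x x))) v := by
  unfold holst alt4
  have key : ∀ a b c d : TangentSpace (𝓡∂ 4) x,
      (1 / 4) * pairing r s (curvatureEnd A₀ φ x a b) (coframe φ x c) (coframe φ x d) -
        (1 / 4) * P.η x (φ.τ x a b) (torsion A₀ φ x c d) =
      Jet.lag r s (jet A₀ φ f x (extChartAt (𝓡∂ 4) x x)) a b c d := by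
    intro a b c d
    rw [pairing_curvatureEnd r s hx, η_torsion hx]
    have e1 : (jet A₀ φ f x (extChartAt (𝓡∂ 4) x x)).e = φ.eC f x x :=
      congrArg (φ.eC f x) (pt_self x)
    have e2 : (jet A₀ φ f x (extChartAt (𝓡∂ 4) x x)).τ = φ.τC f x x :=
      congrArg (φ.τC f x) (pt_self x)
    change _ = 1 / 4 * pairC r s ((jet A₀ φ f x (extChartAt (𝓡∂ 4) x x)).cur a b)
      ((jet A₀ φ f x (extChartAt (𝓡∂ 4) x x)).e c) ((jet A₀ φ f x (extChartAt (𝓡∂ 4) x x)).e d) -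
      1 / 4 * ηC ((jet A₀ φ f x (extChartAt (𝓡∂ 4) x x)).τ a b)
        ((jet A₀ φ f x (extChartAt (𝓡∂ 4) x x)).tor c d)
    rw [e1, e2]
    rfl
  exact altSum_congr fun σ => key _ _ _ _

/-- At β = -1 the coefficient of η(τ, τ) is zero. By skewness the two orders in e ∧ e contribute
equally, and the resulting factor 2 accounts for the constant 1/4 in `holst`. -/
theorem qgHLagrangian_eq {T : Module.End ℝ so31}
    (hT : Ring.inverse ((1 : Module.End ℝ so31) + (-1 : ℝ) • T) = r • 1 + s • star) :
    qgHLagrangian A₀ T (-1) = holst (P := P) r s A₀ := by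
  funext φ x v
  have h : ∀ a b c d : TangentSpace (𝓡∂ 4) x,
      killingModel (applyOp (r • 1 + s • star) (curvatureEnd A₀ φ x a b)) (coframe φ x c)
        (coframe φ x d) - killingModel (applyOp (r • 1 + s • star) (curvatureEnd A₀ φ x a b))
        (coframe φ x d) (coframe φ x c) =
      2 * pairing r s (curvatureEnd A₀ φ x a b) (coframe φ x c) (coframe φ x d) := by
    intro a b c d
    have hm := curvatureEnd_mem_so31 (A₀ := A₀) (φ := φ) a b
    rw [killingModel_applyOp hm, killingModel_applyOp hm, pairing_swap hm (coframe φ x d)]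
    ring
  have h1 : killingTerm (r • 1 + s • star) A₀ φ x v =
      (1 / 2) * alt4 (fun a b c d => pairing r s (curvatureEnd A₀ φ x a b) (coframe φ x c)
        (coframe φ x d)) v := by
    rw [killingTerm, wedge_eq_altSum]
    simp only [h]
    change 1 / 4 * alt4 (fun a b c d => 2 * pairing r s (curvatureEnd A₀ φ x a b) (coframe φ x c)
      (coframe φ x d)) v = _
    rw [alt4_mul]
    ring
  have h2 : torsionTerm A₀ φ x v =
      (1 / 4) * alt4 (fun a b c d => P.η x (φ.τ x a b) (torsion A₀ φ x c d)) v := rfl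
  rw [qgHLagrangian, hT, h1, h2, holst, alt4_sub, alt4_mul, alt4_mul]
  ring

theorem halfShellLagrangian_eq : halfShellLagrangian A₀ = holst (P := P) 0 1 A₀ := by
  funext φ x v
  have h : ∀ a b c d : TangentSpace (𝓡∂ 4) x,
      traceModel (curvatureEnd A₀ φ x a b) (coframe φ x c) (coframe φ x d) -
        traceModel (curvatureEnd A₀ φ x a b) (coframe φ x d) (coframe φ x c) =
      2 * pairing 0 1 (curvatureEnd A₀ φ x a b) (coframe φ x c) (coframe φ x d) := by
    intro a b c d
    rw [pairing, traceModel_swap _ (coframe φ x d)]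
    ring
  have h1 : traceTerm A₀ φ x v =
      (1 / 2) * alt4 (fun a b c d => pairing 0 1 (curvatureEnd A₀ φ x a b) (coframe φ x c)
        (coframe φ x d)) v := by
    rw [traceTerm, wedge_eq_altSum]
    simp only [h]
    change 1 / 4 * alt4 (fun a b c d => 2 * pairing 0 1 (curvatureEnd A₀ φ x a b) (coframe φ x c)
      (coframe φ x d)) v = _
    rw [alt4_mul]
    ring
  have h2 : torsionTerm A₀ φ x v =
      (1 / 4) * alt4 (fun a b c d => P.η x (φ.τ x a b) (torsion A₀ φ x c d)) v := rfl
  rw [halfShellLagrangian, h1, h2, holst, alt4_sub, alt4_mul, alt4_mul]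
  ring

/-! ### Linearity -/

/-- A field that vanishes at a point has vanishing components there. -/
theorem VanishesAt.components (h : VanishesAt X x) :
    X.eC f c x = 0 ∧ X.aC f c x = 0 ∧ X.τC f c x = 0 := by
  refine ⟨?_, ?_, ?_⟩
  · ext1 u
    rw [FieldSpace.eC_apply, h.1]
    exact map_zero _
  · ext1 u; ext1 v
    rw [FieldSpace.aC_apply, h.2.1]
    exact map_zero _
  · ext1 u; ext1 v
    rw [FieldSpace.τC_apply, h.2.2]
    exact map_zero _

theorem alternatization_congr {k : ℕ} {m m' : MultilinearMap ℝ (fun _ : Fin k => E4) ℝ}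
    (h : ∀ v, m v = m' v) : MultilinearMap.alternatization m = MultilinearMap.alternatization m' :=
  congrArg _ (MultilinearMap.ext h)

theorem alternatization_lin {k : ℕ} {m m₁ m₂ : MultilinearMap ℝ (fun _ : Fin k => E4) ℝ}
    {a b : ℝ} (h : ∀ v, m v = a * m₁ v + b * m₂ v) :
    MultilinearMap.alternatization m =
      a • MultilinearMap.alternatization m₁ + b • MultilinearMap.alternatization m₂ := by
  ext v
  simp only [AlternatingMap.add_apply, AlternatingMap.smul_apply, alternatization_eq_altSum, h,
    smul_eq_mul]
  rw [altSum_add (fun v => a * m₁ v), altSum_mul, altSum_mul]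

theorem kForm_lin_left (a b : ℝ) :
    kForm r s (a • X + b • Y) φ ψ x = a • kForm r s X φ ψ x + b • kForm r s Y φ ψ x := by
  refine alternatization_lin fun v => ?_
  simp [kM, FieldSpace.aC_add, FieldSpace.aC_smul]

theorem kForm_lin_middle (a b : ℝ) :
    kForm r s φ (a • X + b • Y) ψ x = a • kForm r s φ X ψ x + b • kForm r s φ Y ψ x := by
  refine alternatization_lin fun v => ?_
  simp [kM, FieldSpace.eC_add, FieldSpace.eC_smul]

theorem kForm_lin_right (a b : ℝ) :
    kForm r s φ ψ (a • X + b • Y) x = a • kForm r s φ ψ X x + b • kForm r s φ ψ Y x := by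
  refine alternatization_lin fun v => ?_
  simp [kM, FieldSpace.eC_add, FieldSpace.eC_smul]

theorem hForm_lin_left (a b : ℝ) :
    hForm (a • X + b • Y) ψ x = a • hForm X ψ x + b • hForm Y ψ x := by
  refine alternatization_lin fun v => ?_
  simp [hM, FieldSpace.τC_add, FieldSpace.τC_smul]

theorem hForm_lin_right (a b : ℝ) :
    hForm ψ (a • X + b • Y) x = a • hForm ψ X x + b • hForm ψ Y x := by
  refine alternatization_lin fun v => ?_
  simp [hM, FieldSpace.eC_add, FieldSpace.eC_smul]

/-- Two signs cancel: one from exchanging two arguments of the alternating sum, one from the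
skewness of the pairing. -/
theorem kForm_swap (X φ ψ : FieldSpace P) : kForm r s X φ ψ x = kForm r s X ψ φ x := by
  refine AlternatingMap.ext fun v => ?_
  refine (alternatization_eq_altSum _ _).trans (Eq.trans ?_ (alternatization_eq_altSum _ _).symm)
  let g : E4 → E4 → E4 → ℝ := fun a b d => pairC r s (X.aC (frameAt P x) x x a)
    (ψ.eC (frameAt P x) x x b) (φ.eC (frameAt P x) x x d)
  let g' : E4 → E4 → E4 → ℝ := fun a b d => pairC r s (X.aC (frameAt P x) x x a)
    (φ.eC (frameAt P x) x x b) (ψ.eC (frameAt P x) x x d)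
  have key : ∀ v : Fin 3 → E4, alt3 g' v = alt3 g v := by
    intro v
    have h := alt3_swap12 g v
    rw [show (fun a b d => g a d b) = fun a b d => -g' a b d from by
      funext a b d
      exact IsSkew.pairC_swap (X.aC_mem_so31 (mem_frameAt x) a) r s _ _, alt3_neg] at h
    exact neg_injective h
  exact key v

theorem elForm_lin (a b : ℝ) :
    elForm r s A₀ φ (a • X + b • Y) x = a • elForm r s A₀ φ X x + b • elForm r s A₀ φ Y x := by
  refine alternatization_lin fun v => ?_
  simp only [Jet.elM, MultilinearMap.coe_mk, Jet.el, vjet, FieldSpace.aC_add, FieldSpace.aC_smul,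
    FieldSpace.eC_add, FieldSpace.eC_smul, FieldSpace.τC_add, FieldSpace.τC_smul, map_add, map_smul,
    add_apply, smul_apply, smul_eq_mul]
  ring

/-! ### The variation of the Lagrangian -/

/-- The boundary form. -/
def thetaForm (r s : ℝ) (φ X : FieldSpace P) (x : M) : TangentSpace (𝓡∂ 4) x [⋀^Fin 3]→ₗ[ℝ] ℝ :=
  (1 / 2 : ℝ) • kForm r s X φ φ x + (-(1 / 2) : ℝ) • hForm φ X x

theorem thetaForm_lin (a b : ℝ) :
    thetaForm r s φ (a • X + b • Y) x = a • thetaForm r s φ X x + b • thetaForm r s φ Y x := by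
  rw [thetaForm, kForm_lin_left, hForm_lin_right, thetaForm, thetaForm]
  module

theorem IsGood.chartRep_thetaForm (h : IsGood f c y) (v : Fin 3 → E4) :
    chartRep (𝓡∂ 4) (fun x => thetaForm r s φ X x) c y v =
      altSum (fun v => (1 / 2) * pairC r s (X.aC f c (pt c y) (v 0)) (φ.eC f c (pt c y) (v 1))
        (φ.eC f c (pt c y) (v 2)) -
        (1 / 2) * ηC (φ.τC f c (pt c y) (v 0) (v 1)) (X.eC f c (pt c y) (v 2))) v := by
  have h1 := h.chartRep_kForm (X := X) (φ := φ) (ψ := φ) (r := r) (s := s) v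
  have h2 := h.chartRep_hForm (X := X) (φ := φ) v
  rw [altSum_sub, altSum_mul, altSum_mul, ← h1, ← h2]
  simp only [chartRep, thetaForm, AlternatingMap.add_apply, AlternatingMap.smul_apply, smul_eq_mul]
  ring

theorem isSmoothForm_thetaForm : IsSmoothForm (𝓡∂ 4) (thetaForm (P := P) r s φ X) := by
  refine isSmoothForm_of_eventually fun c y hy v => ?_
  have hg : IsGood (frameAt P (pt c y)) c y := ⟨hy, mem_frameAt _⟩
  refine ⟨_, ?_, hg.eventually.mono fun y' hy' => hy'.chartRep_thetaForm v⟩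
  exact ContDiffWithinAt.sum fun σ _ => contDiffWithinAt_const.mul
    ((contDiffWithinAt_const.mul (hg.contDiff_k _ _ _)).sub
      (contDiffWithinAt_const.mul (hg.contDiff_h _ _ _)))

theorem IsGood.fderivWithin_k (h : IsGood f c y) (u v w t : E4) :
    fderivWithin ℝ (fun y => pairC r s (X.aC f c (pt c y) u) (φ.eC f c (pt c y) v)
      (ψ.eC f c (pt c y) w)) halfSpace y t =
    pairC r s (daC X f c y t u) (φ.eC f c (pt c y) v) (ψ.eC f c (pt c y) w) +
    pairC r s (X.aC f c (pt c y) u) (deC φ f c y t v) (ψ.eC f c (pt c y) w) +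
    pairC r s (X.aC f c (pt c y) u) (φ.eC f c (pt c y) v) (deC ψ f c y t w) := by
  have hu := unique_halfSpace h.mem
  have h1 := (h.aC_diff (φ := X)).hasFDerivWithinAt.clm_apply
    (hasFDerivWithinAt_const u y halfSpace)
  have h2 := (h.eC_diff (φ := φ)).hasFDerivWithinAt.clm_apply
    (hasFDerivWithinAt_const v y halfSpace)
  have h3 := (h.eC_diff (φ := ψ)).hasFDerivWithinAt.clm_apply
    (hasFDerivWithinAt_const w y halfSpace)
  have h4 := ((((pairC r s).hasFDerivAt.comp_hasFDerivWithinAt y h1).clm_apply h2).clm_apply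
    h3).fderivWithin hu
  refine (congrArg (fun L : E4 →L[ℝ] ℝ => L t) h4).trans ?_
  simp [daC, deC]
  ring

theorem IsGood.fderivWithin_h (h : IsGood f c y) (u v w t : E4) :
    fderivWithin ℝ (fun y => ηC (φ.τC f c (pt c y) u v) (X.eC f c (pt c y) w)) halfSpace y t =
    ηC (dτC φ f c y t u v) (X.eC f c (pt c y) w) +
    ηC (φ.τC f c (pt c y) u v) (deC X f c y t w) := by
  have hu := unique_halfSpace h.mem
  have h1 := ((h.τC_diff (φ := φ)).hasFDerivWithinAt.clm_apply
    (hasFDerivWithinAt_const u y halfSpace)).clm_apply (hasFDerivWithinAt_const v y halfSpace)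
  have h3 := (h.eC_diff (φ := X)).hasFDerivWithinAt.clm_apply
    (hasFDerivWithinAt_const w y halfSpace)
  have h4 := ((ηC.hasFDerivAt.comp_hasFDerivWithinAt y h1).clm_apply h3).fderivWithin hu
  refine (congrArg (fun L : E4 →L[ℝ] ℝ => L t) h4).trans ?_
  simp [dτC, deC]
  ring

theorem extDer_thetaForm (hx : x ∈ f.U) (v : Fin 4 → E4) :
    extDer (𝓡∂ 4) (thetaForm r s φ X) x v =
      alt4 (Jet.dθ r s (jet A₀ φ f x (extChartAt (𝓡∂ 4) x x))
        (vjet X f x (extChartAt (𝓡∂ 4) x x))) v := by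
  have hg := isGood_self hx
  have hd := fun u v w => (hg.contDiff_k (r := r) (s := s) (X := X) (φ := φ) (ψ := φ) u v
    w).differentiableWithinAt (by simp)
  have hd' := fun u v w => (hg.contDiff_h (X := X) (φ := φ) u v w).differentiableWithinAt (by simp)
  rw [extDer_eq_altSum (hg.eventually.mono fun y hy v => hy.chartRep_thetaForm v)
    (fun v => ((hd _ _ _).const_mul _).sub ((hd' _ _ _).const_mul _))]
  refine altSum_congr fun σ => ?_
  have hu := unique_halfSpace hg.mem
  rw [fderivWithin_fun_sub hu ((hd _ _ _).const_mul _) ((hd' _ _ _).const_mul _),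
    fderivWithin_const_mul hu (hd _ _ _), fderivWithin_const_mul hu (hd' _ _ _), sub_apply,
    smul_apply, smul_apply, hg.fderivWithin_k, hg.fderivWithin_h]
  rfl

/-- In components the Lagrangian is a polynomial in the jet, and adding tX moves the jet along a
straight line. The statement is therefore the algebraic identity `Jet.alt4_dlag`. -/
theorem hasDerivAt_holst (v : Fin 4 → TangentSpace (𝓡∂ 4) x) :
    HasDerivAt (fun t : ℝ => holst r s A₀ (φ + t • X) x v)
      (elForm r s A₀ φ X x v + extDer (𝓡∂ 4) (thetaForm r s φ X) x v) 0 := by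
  have hx := mem_frameAt (P := P) x
  have hg := isGood_self hx
  have h1 : ∀ v : Fin 4 → E4, elForm r s A₀ φ X x v + extDer (𝓡∂ 4) (thetaForm r s φ X) x v =
      alt4 (Jet.dlag r s (jet A₀ φ (frameAt P x) x (extChartAt (𝓡∂ 4) x x))
        (vjet X (frameAt P x) x (extChartAt (𝓡∂ 4) x x))) v := by
    intro v
    rw [Jet.alt4_dlag hg.isSkew_conn hg.isSkew_aC hg.isSkew_cur]
    exact congrArg₂ (· + ·) (elForm_apply v) (extDer_thetaForm hx v)
  refine (?_ : HasDerivAt _ _ _).congr_deriv (h1 v).symm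
  have h2 : (fun t : ℝ => holst r s A₀ (φ + t • X) x v) = fun t => alt4 (Jet.lag r s
      ((jet A₀ φ (frameAt P x) x (extChartAt (𝓡∂ 4) x x)).line
        (vjet X (frameAt P x) x (extChartAt (𝓡∂ 4) x x)) t)) v := by
    funext t
    exact (holst_eq hx v).trans (by rw [hg.jet_add_smul])
  rw [h2]
  exact hasDerivAt_alt4 (fun a b c d => Jet.hasDerivAt_lag a b c d) v

/-- The Euler–Lagrange form and the boundary form of the Lagrangian `holst`. -/
def variationalData (A₀ : Connection P)
    {L : FieldSpace P → ∀ x : M, (Fin 4 → TangentSpace (𝓡∂ 4) x) → ℝ}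
    (r s : ℝ) (hL : L = holst r s A₀) : VariationalData L where
  el φ :=
    { toFun := elForm r s A₀ φ
      map_add' := fun X Y => by
        funext x
        simpa using elForm_lin (r := r) (s := s) (A₀ := A₀) (φ := φ) (X := X) (Y := Y) (x := x) 1 1
      map_smul' := fun a X => by
        funext x
        simpa using elForm_lin (r := r) (s := s) (A₀ := A₀) (φ := φ) (X := X) (Y := X) (x := x) a 0 }
  θ φ :=
    { toFun := thetaForm r s φ
      map_add' := fun X Y => by
        funext x
        simpa using thetaForm_lin (r := r) (s := s) (φ := φ) (X := X) (Y := Y) (x := x) 1 1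
      map_smul' := fun a X => by
        funext x
        simpa using thetaForm_lin (r := r) (s := s) (φ := φ) (X := X) (Y := X) (x := x) a 0 }
  el_local φ X x h := by
    refine AlternatingMap.ext fun v => (elForm_apply v).trans ?_
    obtain ⟨h1, h2, h3⟩ := h.components (f := frameAt P x) (c := x)
    refine alt4_eq_zero (fun a b c d => ?_) v
    have e1 : (vjet X (frameAt P x) x (extChartAt (𝓡∂ 4) x x)).e = 0 :=
      (congrArg (X.eC (frameAt P x) x) (pt_self x)).trans h1
    have e2 : (vjet X (frameAt P x) x (extChartAt (𝓡∂ 4) x x)).A = 0 :=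
      (congrArg (X.aC (frameAt P x) x) (pt_self x)).trans h2
    have e3 : (vjet X (frameAt P x) x (extChartAt (𝓡∂ 4) x x)).τ = 0 :=
      (congrArg (X.τC (frameAt P x) x) (pt_self x)).trans h3
    exact Jet.el_eq_zero e1 e2 e3
  θ_local φ X x h := by
    refine AlternatingMap.ext fun v => ?_
    obtain ⟨h1, h2, h3⟩ := h.components (f := frameAt P x) (c := x)
    change (1 / 2 : ℝ) * kForm r s X φ φ x v + (-(1 / 2) : ℝ) * hForm φ X x v = 0
    have h4 : kForm r s X φ φ x v = 0 := (alternatization_eq_altSum _ _).trans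
      (Finset.sum_eq_zero fun σ _ => mul_eq_zero_of_right _ (by simp [kM, h2]))
    have h5 : hForm φ X x v = 0 := (alternatization_eq_altSum _ _).trans
      (Finset.sum_eq_zero fun σ _ => mul_eq_zero_of_right _ (by simp [hM, h1]))
    rw [h4, h5]
    ring
  θ_smooth φ X := isSmoothForm_thetaForm
  variation φ X x v := by
    subst hL
    exact hasDerivAt_holst v

end Variation

open MeasureTheory

/-! ### Integrals of compactly supported functions on open sets -/

section Calculus

variable {E : Type*} [NormedAddCommGroup E] [NormedSpace ℝ E] [FiniteDimensional ℝ E]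
  [MeasurableSpace E] [BorelSpace E] {μ : Measure E} [μ.IsAddHaarMeasure] {U K : Set E}

theorem integrableOn_of_compact {g : E → ℝ} (hU : IsOpen U) (hK : IsCompact K) (hKU : K ⊆ U)
    (hg : ContinuousOn g U) (h0 : ∀ y ∈ U, y ∉ K → g y = 0) : IntegrableOn g U μ :=
  ((hg.mono hKU).integrableOn_compact hK).of_forall_sdiff_eq_zero hU.measurableSet
    fun y hy => h0 y hy.1 hy.2

/-- The integral of a derivative of a compactly supported function vanishes. -/
theorem setIntegral_fderiv_eq_zero {g : E → ℝ} (hU : IsOpen U) (hK : IsCompact K) (hKU : K ⊆ U)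
    (hg : ContDiffOn ℝ 1 g U) (h0 : ∀ y ∈ U, y ∉ K → g y = 0) (v : E) :
    ∫ y in U, fderiv ℝ g y v ∂μ = 0 := by
  -- The extension by zero is of class C¹ on the whole space: near K it equals g, and off K it
  -- vanishes.
  set h : E → ℝ := U.indicator g with hh
  have hzero : ∀ y ∉ K, h y = 0 := fun y hy => by
    by_cases hyU : y ∈ U
    · rw [hh, indicator_of_mem hyU, h0 y hyU hy]
    · rw [hh, indicator_of_notMem hyU]
  have hin : ∀ y ∈ U, h =ᶠ[𝓝 y] g := fun y hy =>
    Filter.eventually_of_mem (hU.mem_nhds hy) fun y' hy' => indicator_of_mem hy' g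
  have hout : ∀ y ∉ K, h =ᶠ[𝓝 y] fun _ => (0 : ℝ) := fun y hy =>
    Filter.eventually_of_mem (hK.isClosed.isOpen_compl.mem_nhds hy) hzero
  have hc : ContDiff ℝ 1 h := by
    rw [contDiff_iff_contDiffAt]
    intro y
    by_cases hy : y ∈ K
    · exact ((hg y (hKU hy)).contDiffAt (hU.mem_nhds (hKU hy))).congr_of_eventuallyEq
        (hin y (hKU hy))
    · exact contDiffAt_const.congr_of_eventuallyEq (hout y hy)
  have hs : HasCompactSupport h := HasCompactSupport.intro hK hzero
  have hf0 : ∀ y ∉ K, fderiv ℝ h y v = 0 := fun y hy => by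
    rw [(hout y hy).fderiv_eq]
    simp
  have h1 : ∫ y in U, fderiv ℝ g y v ∂μ = ∫ y, fderiv ℝ h y v ∂μ := by
    rw [← setIntegral_eq_integral_of_forall_compl_eq_zero (s := U)
      fun y hy => hf0 y fun hyK => hy (hKU hyK)]
    exact setIntegral_congr_fun hU.measurableSet fun y hy => by rw [(hin y hy).fderiv_eq]
  have hi' : Integrable (fun y => fderiv ℝ h y v) μ := by
    refine Continuous.integrable_of_hasCompactSupport
      ((hc.continuous_fderiv (by simp)).clm_apply continuous_const) ?_
    exact HasCompactSupport.intro hK hf0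
  -- Integration by parts against the constant function 1.
  have h2 := integral_mul_fderiv_eq_neg_fderiv_mul_of_integrable (μ := μ) (v := v)
    (f := fun _ : E => (1 : ℝ)) (g := h) (by simp) (by simpa using hi')
    (by simpa using hc.continuous.integrable_of_hasCompactSupport hs)
    (fun _ _ => differentiableAt_const _) (fun _ _ => hc.differentiable (by simp) _)
  simp only [one_mul] at h2
  rw [h1, h2]
  simp

/-- The same with a locally constant weight. -/
theorem setIntegral_mul_fderiv_eq_zero {s g : E → ℝ} (hU : IsOpen U) (hK : IsCompact K)
    (hKU : K ⊆ U) (hs : ∀ y ∈ U, ∀ᶠ y' in 𝓝 y, s y' = s y) (hg : ContDiffOn ℝ 1 g U)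
    (h0 : ∀ y ∈ U, y ∉ K → g y = 0) (v : E) : ∫ y in U, s y * fderiv ℝ g y v ∂μ = 0 := by
  -- Near each point the weight is a constant, so it can be moved under the derivative. The weight
  -- needed is the sign of the orientation form in a chart.
  have hev : ∀ y ∈ U, (fun y' => s y' * g y') =ᶠ[𝓝 y] fun y' => s y * g y' := fun y hy => by
    filter_upwards [hs y hy] with y' hy' using by rw [hy']
  refine Eq.trans ?_ (setIntegral_fderiv_eq_zero (μ := μ) (g := fun y => s y * g y) hU hK hKU ?_ ?_ v)
  · refine setIntegral_congr_fun hU.measurableSet fun y hy => ?_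
    change _ = fderiv ℝ (fun y' => s y' * g y') y v
    rw [(hev y hy).fderiv_eq, fderiv_const_mul
      ((hg.differentiableOn (by simp)).differentiableAt (hU.mem_nhds hy))]
    rfl
  · intro y hy
    exact ((contDiffWithinAt_const.mul (hg y hy)).contDiffAt
      (hU.mem_nhds hy)).congr_of_eventuallyEq (hev y hy) |>.contDiffWithinAt
  · intro y hy hyK
    rw [h0 y hy hyK, mul_zero]

theorem continuousOn_of_eventually_const {s : E → ℝ}
    (hs : ∀ y ∈ U, ∀ᶠ y' in 𝓝 y, s y' = s y) : ContinuousOn s U := fun y hy =>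
  (continuousAt_const.congr ((hs y hy).mono fun _ h => h.symm)).continuousWithinAt

end Calculus

/-! ### Manifolds without boundary -/

section Closed

variable {n : ℕ} {N : Type*} [TopologicalSpace N] [ChartedSpace (EuclideanSpace ℝ (Fin n)) N]
  [IsManifold (𝓡 n) ∞ N]

/-- The change of coordinates from the chart at `c` to the chart at `c'`. -/
def trans (c c' : N) (y : EuclideanSpace ℝ (Fin n)) : EuclideanSpace ℝ (Fin n) :=
  extChartAt (𝓡 n) c' ((extChartAt (𝓡 n) c).symm y)

/-- The coordinates in the chart at `c` of the domain of the chart at `c'`. -/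
def overlap (c c' : N) : Set (EuclideanSpace ℝ (Fin n)) :=
  (extChartAt (𝓡 n) c).target ∩ (extChartAt (𝓡 n) c).symm ⁻¹' (extChartAt (𝓡 n) c').source

theorem isOpen_overlap (c c' : N) : IsOpen (overlap (n := n) c c') :=
  (continuousOn_extChartAt_symm c).isOpen_inter_preimage (isOpen_extChartAt_target c)
    (isOpen_extChartAt_source c')

variable {c c' : N} {y : EuclideanSpace ℝ (Fin n)}

theorem symm_trans (hy : y ∈ overlap c c') :
    (extChartAt (𝓡 n) c').symm (trans c c' y) = (extChartAt (𝓡 n) c).symm y :=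
  (extChartAt (𝓡 n) c').left_inv hy.2

theorem trans_mem (hy : y ∈ overlap c c') : trans c c' y ∈ overlap c' c := by
  refine ⟨(extChartAt (𝓡 n) c').map_source hy.2, ?_⟩
  rw [mem_preimage, symm_trans hy]
  exact (extChartAt (𝓡 n) c).map_target hy.1

theorem trans_trans (hy : y ∈ overlap c c') : trans c' c (trans c c' y) = y := by
  rw [trans, symm_trans hy]
  exact (extChartAt (𝓡 n) c).right_inv hy.1

theorem differentiableAt_trans (hy : y ∈ overlap c c') : DifferentiableAt ℝ (trans c c') y := by
  have h := contDiffWithinAt_ext_coord_change (I := 𝓡 n) (n := ∞) (x := c') (x' := c)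
    (y := y) ?_
  · rw [ModelWithCorners.range_eq_univ, contDiffWithinAt_univ] at h
    exact h.differentiableAt (by simp)
  · rw [PartialEquiv.trans_source, PartialEquiv.symm_source]
    exact hy

theorem mfderiv_symm_trans (hy : y ∈ overlap c c') (v : EuclideanSpace ℝ (Fin n)) :
    (mfderivWithin 𝓘(ℝ, EuclideanSpace ℝ (Fin n)) (𝓡 n) (extChartAt (𝓡 n) c).symm
      (range (𝓡 n)) y v : EuclideanSpace ℝ (Fin n)) =
    mfderivWithin 𝓘(ℝ, EuclideanSpace ℝ (Fin n)) (𝓡 n) (extChartAt (𝓡 n) c').symm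
      (range (𝓡 n)) (trans c c' y) (fderiv ℝ (trans c c') y v) := by
  rw [ModelWithCorners.range_eq_univ, mfderivWithin_univ, mfderivWithin_univ]
  have h1 : (extChartAt (𝓡 n) c).symm =ᶠ[𝓝 y] (extChartAt (𝓡 n) c').symm ∘ trans c c' :=
    Filter.eventually_of_mem ((isOpen_overlap c c').mem_nhds hy) fun y' hy' => (symm_trans hy').symm
  have h2 := h1.mfderiv_eq (I := 𝓘(ℝ, EuclideanSpace ℝ (Fin n))) (I' := 𝓡 n)
  have h3 : MDifferentiableAt 𝓘(ℝ, EuclideanSpace ℝ (Fin n)) (𝓡 n) (extChartAt (𝓡 n) c').symm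
      (trans c c' y) := by
    have := mdifferentiableWithinAt_extChartAt_symm (I := 𝓡 n) (trans_mem hy).1
    rwa [ModelWithCorners.range_eq_univ, mdifferentiableWithinAt_univ] at this
  have h4 := mfderiv_comp y h3 (differentiableAt_trans hy).mdifferentiableAt
  rw [mfderiv_eq_fderiv] at h4
  exact congrArg (fun L => (L v : EuclideanSpace ℝ (Fin n))) (h2.trans h4)

theorem chartRep_trans {k : ℕ} (α : ∀ p : N, (Fin k → TangentSpace (𝓡 n) p) → ℝ)
    (hy : y ∈ overlap c c') (v : Fin k → EuclideanSpace ℝ (Fin n)) :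
    chartRep (𝓡 n) α c y v =
      chartRep (𝓡 n) α c' (trans c c' y) fun i => fderiv ℝ (trans c c') y (v i) := by
  have h : ∀ (α : N → (Fin k → EuclideanSpace ℝ (Fin n)) → ℝ) {p q : N} (_ : p = q)
      {u w : Fin k → EuclideanSpace ℝ (Fin n)} (_ : u = w), α p u = α q w := by
    rintro α p _ rfl u _ rfl; rfl
  exact h α (symm_trans hy).symm (funext fun i => mfderiv_symm_trans hy (v i))

theorem chartRep_eq_zero {k : ℕ} {α : ∀ p : N, TangentSpace (𝓡 n) p [⋀^Fin k]→ₗ[ℝ] ℝ}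
    (h : α ((extChartAt (𝓡 n) c).symm y) = 0) (v : Fin k → EuclideanSpace ℝ (Fin n)) :
    chartRep (𝓡 n) (fun p => α p) c y v = 0 := DFunLike.congr_fun h _

/-- The standard basis, as a family of vectors. -/
def stdVec (n : ℕ) (i : Fin n) : EuclideanSpace ℝ (Fin n) := EuclideanSpace.single i 1

theorem alternating_map_stdVec {W : Type*} [AddCommGroup W] [Module ℝ W]
    (f : W [⋀^Fin n]→ₗ[ℝ] ℝ) (L : EuclideanSpace ℝ (Fin n) →ₗ[ℝ] W)
    (A : EuclideanSpace ℝ (Fin n) →L[ℝ] EuclideanSpace ℝ (Fin n)) :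
    f (fun i => L (A (stdVec n i))) = A.det * f fun i => L (stdVec n i) := by
  let b := (EuclideanSpace.basisFun (Fin n) ℝ).toBasis
  have hb : ∀ i, b i = stdVec n i := fun i => by simp [b, stdVec]
  have h := (f.compLinearMap L).eq_smul_basis_det b
  have h1 : ∀ w : Fin n → EuclideanSpace ℝ (Fin n), f (fun i => L (w i)) =
      f (fun i => L (stdVec n i)) * b.det w := fun w => by
    have := congrArg (fun g => g w) h
    simpa [hb, Function.comp_def] using this
  rw [h1 fun i => A (stdVec n i)]
  have h2 := b.det_comp (A : EuclideanSpace ℝ (Fin n) →ₗ[ℝ] EuclideanSpace ℝ (Fin n)) b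
  rw [b.det_self, mul_one] at h2
  have h3 : (⇑(A : EuclideanSpace ℝ (Fin n) →ₗ[ℝ] EuclideanSpace ℝ (Fin n)) ∘ ⇑b) =
      fun i => A (stdVec n i) := funext fun i => congrArg _ (hb i)
  rw [← h3, h2, mul_comm]

theorem chartRep_top_trans (α : ∀ p : N, TangentSpace (𝓡 n) p [⋀^Fin n]→ₗ[ℝ] ℝ)
    (hy : y ∈ overlap c c') : chartRep (𝓡 n) (fun p => α p) c y (stdVec n) =
      (fderiv ℝ (trans c c') y).det * chartRep (𝓡 n) (fun p => α p) c' (trans c c' y) (stdVec n) := by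
  rw [chartRep_trans (fun p => α p) hy]
  exact alternating_map_stdVec (α _) (mfderivWithin 𝓘(ℝ, EuclideanSpace ℝ (Fin n)) (𝓡 n)
    (extChartAt (𝓡 n) c').symm (range (𝓡 n)) (trans c c' y)).toLinearMap _

/-- The sign of a form in a chart. -/
def chartSign (o : ∀ p : N, TangentSpace (𝓡 n) p [⋀^Fin n]→ₗ[ℝ] ℝ) (c : N)
    (y : EuclideanSpace ℝ (Fin n)) : ℝ :=
  (SignType.sign (chartRep (𝓡 n) (fun p => o p) c y (stdVec n)) : ℝ)

/-- The form has a locally constant sign in charts. -/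
def IsOrienting (o : ∀ p : N, TangentSpace (𝓡 n) p [⋀^Fin n]→ₗ[ℝ] ℝ) : Prop :=
  ∀ (c : N), ∀ y ∈ (extChartAt (𝓡 n) c).target, ∀ᶠ y' in 𝓝 y, chartSign o c y' = chartSign o c y

/-- The integral of a form over the domain of a chart. -/
def chartIntegral (o α : ∀ p : N, TangentSpace (𝓡 n) p [⋀^Fin n]→ₗ[ℝ] ℝ) (c : N) : ℝ :=
  ∫ y in (extChartAt (𝓡 n) c).target,
    chartSign o c y * chartRep (𝓡 n) (fun p => α p) c y (stdVec n)

theorem chartIntegral_eq_overlap {o α : ∀ p : N, TangentSpace (𝓡 n) p [⋀^Fin n]→ₗ[ℝ] ℝ}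
    (h : ∀ p ∉ (extChartAt (𝓡 n) c').source, α p = 0) :
    chartIntegral o α c = ∫ y in overlap c c',
      chartSign o c y * chartRep (𝓡 n) (fun p => α p) c y (stdVec n) := by
  have hm : MeasurableSet (extChartAt (𝓡 n) c).target := (isOpen_extChartAt_target c).measurableSet
  unfold chartIntegral
  refine setIntegral_eq_of_subset_of_forall_sdiff_eq_zero hm inter_subset_left fun y hy => ?_
  have hp : (extChartAt (𝓡 n) c).symm y ∉ (extChartAt (𝓡 n) c').source :=
    fun hp => hy.2 ⟨hy.1, hp⟩
  exact mul_eq_zero_of_right _ (chartRep_eq_zero (h _ hp) _)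

/-- The integral of a form supported in the domains of two charts can be computed in either. -/
theorem chartIntegral_trans {o α : ∀ p : N, TangentSpace (𝓡 n) p [⋀^Fin n]→ₗ[ℝ] ℝ}
    (h : ∀ p ∉ (extChartAt (𝓡 n) c).source, α p = 0)
    (h' : ∀ p ∉ (extChartAt (𝓡 n) c').source, α p = 0) :
    chartIntegral o α c = chartIntegral o α c' := by
  rw [chartIntegral_eq_overlap h', chartIntegral_eq_overlap h]
  have himg : overlap (n := n) c' c = trans c c' '' overlap c c' := by
    ext z
    constructor
    · intro hz
      exact ⟨trans c' c z, trans_mem hz, trans_trans hz⟩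
    · rintro ⟨y, hy, rfl⟩
      exact trans_mem hy
  rw [himg, integral_image_eq_integral_abs_det_fderiv_smul volume
    (isOpen_overlap c c').measurableSet
    (fun y hy => (differentiableAt_trans hy).hasFDerivAt.hasFDerivWithinAt)
    (fun y hy y' hy' he => by rw [← trans_trans hy, he, trans_trans hy'])]
  refine setIntegral_congr_fun (isOpen_overlap c c').measurableSet fun y hy => ?_
  simp only [chartSign]
  -- The form contributes the Jacobian determinant and the orientation its sign. Their product is
  -- the absolute value in the change of variables formula, so no compatibility of the charts with
  -- the orientation is required.
  rw [chartRep_top_trans o hy, chartRep_top_trans α hy, sign_mul, smul_eq_mul, SignType.coe_mul]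
  have : (fderiv ℝ (trans c c') y).det * (SignType.sign (fderiv ℝ (trans c c') y).det : ℝ) =
      |(fderiv ℝ (trans c c') y).det| := self_mul_sign _
  rw [← this]
  ring

variable [CompactSpace N] [T2Space N]

theorem finite_chartPartition : {c : N | (Function.support (chartPartition (𝓡 n) N c)).Nonempty}.Finite :=
  (chartPartition (𝓡 n) N).locallyFinite.finite_nonempty_of_compact

variable (n N) in
/-- The charts that occur in the partition of unity. -/
def activeCharts : Finset N := (finite_chartPartition (n := n) (N := N)).toFinset

theorem chartPartition_eq_zero (hc : c ∉ activeCharts n N) (p : N) :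
    chartPartition (𝓡 n) N c p = 0 := by
  by_contra h
  exact hc ((finite_chartPartition (n := n)).mem_toFinset.2 ⟨p, h⟩)

theorem sum_chartPartition (p : N) : ∑ c ∈ activeCharts n N, chartPartition (𝓡 n) N c p = 1 := by
  rw [← (chartPartition (𝓡 n) N).sum_eq_one (mem_univ p)]
  refine (finsum_eq_sum_of_support_subset _ fun c hc => ?_).symm
  by_contra h
  exact hc (chartPartition_eq_zero (fun h' => h (Finset.mem_coe.2 h')) p)

theorem tsupport_chartPartition (c : N) :
    tsupport (chartPartition (𝓡 n) N c) ⊆ (extChartAt (𝓡 n) c).source := by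
  rw [extChartAt_source]
  exact Classical.choose_spec (SmoothPartitionOfUnity.exists_isSubordinate_chartAt_source (𝓡 n) N) c

/-- The coordinates of the support of a function of the partition of unity. -/
def coordSupport (c : N) : Set (EuclideanSpace ℝ (Fin n)) :=
  extChartAt (𝓡 n) c '' tsupport (chartPartition (𝓡 n) N c)

theorem isCompact_coordSupport (c : N) : IsCompact (coordSupport (n := n) c) :=
  (isClosed_tsupport _).isCompact.image_of_continuousOn
    ((continuousOn_extChartAt c).mono (tsupport_chartPartition c))

theorem coordSupport_subset (c : N) : coordSupport (n := n) c ⊆ (extChartAt (𝓡 n) c).target := by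
  rintro _ ⟨p, hp, rfl⟩
  exact (extChartAt (𝓡 n) c).map_source (tsupport_chartPartition c hp)

theorem notMem_tsupport (hy : y ∈ (extChartAt (𝓡 n) c).target) (h : y ∉ coordSupport c) :
    (extChartAt (𝓡 n) c).symm y ∉ tsupport (chartPartition (𝓡 n) N c) := fun hp =>
  h ⟨_, hp, (extChartAt (𝓡 n) c).right_inv hy⟩

/-- By compactness only finitely many functions of the partition are nonzero, so the sum over all
charts is finite, and the weight may be absorbed in the form. -/
theorem integral_eq_sum (o α : ∀ p : N, TangentSpace (𝓡 n) p [⋀^Fin n]→ₗ[ℝ] ℝ) :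
    integral (𝓡 n) (fun p v => o p v) (fun p v => α p v) =
      ∑ c ∈ activeCharts n N, chartIntegral o (fun p => chartPartition (𝓡 n) N c p • α p) c := by
  have h : ∀ c : N, (∫ y in (extChartAt (𝓡 n) c).target,
      chartPartition (𝓡 n) N c ((extChartAt (𝓡 n) c).symm y) *
      (SignType.sign (chartRep (𝓡 n) (fun p v => o p v) c y fun i => EuclideanSpace.single i 1) : ℝ) *
      chartRep (𝓡 n) (fun p v => α p v) c y fun i => EuclideanSpace.single i 1) =
      chartIntegral o (fun p => chartPartition (𝓡 n) N c p • α p) c := by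
    intro c
    refine setIntegral_congr_fun (isOpen_extChartAt_target c).measurableSet fun y _ => ?_
    change _ * chartSign o c y * chartRep (𝓡 n) (fun p => α p) c y (stdVec n) = chartSign o c y *
      (_ * chartRep (𝓡 n) (fun p => α p) c y (stdVec n))
    ring
  refine (finsum_congr h).trans (finsum_eq_sum_of_support_subset _ fun c hc => ?_)
  by_contra h'
  refine hc ?_
  have h0 : ∀ p, chartPartition (𝓡 n) N c p = 0 :=
    chartPartition_eq_zero fun h'' => h' (Finset.mem_coe.2 h'')
  refine (setIntegral_congr_fun (g := fun _ => (0 : ℝ))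
    (isOpen_extChartAt_target c).measurableSet fun y _ => ?_).trans (by simp)
  simp only [chartRep, h0, zero_smul, AlternatingMap.zero_apply, mul_zero]

variable {o α β : ∀ p : N, TangentSpace (𝓡 n) p [⋀^Fin n]→ₗ[ℝ] ℝ}

theorem continuousOn_chartPartition (c c' : N) :
    ContinuousOn (fun y => chartPartition (𝓡 n) N c ((extChartAt (𝓡 n) c').symm y))
      (extChartAt (𝓡 n) c').target :=
  (chartPartition (𝓡 n) N c).contMDiff.continuous.comp_continuousOn (continuousOn_extChartAt_symm c')

theorem integrableOn_chart (ho : IsOrienting o)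
    (hα : ContinuousOn (fun y => chartRep (𝓡 n) (fun p => α p) c y (stdVec n))
      (extChartAt (𝓡 n) c).target)
    (h0 : ∀ p ∉ tsupport (chartPartition (𝓡 n) N c), α p = 0) :
    IntegrableOn (fun y => chartSign o c y * chartRep (𝓡 n) (fun p => α p) c y (stdVec n))
      (extChartAt (𝓡 n) c).target := by
  refine integrableOn_of_compact (isOpen_extChartAt_target c) (isCompact_coordSupport c)
    (coordSupport_subset c) ((continuousOn_of_eventually_const (ho c)).mul hα) fun y hy hyK => ?_
  exact mul_eq_zero_of_right _ (chartRep_eq_zero (h0 _ (notMem_tsupport hy hyK)) _)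

/-- Additivity of the integral needs integrability of each summand. It holds because every integrand
is continuous in the chart and supported in the compact coordinate support of its cut-off function.
-/
theorem integral_lin (ho : IsOrienting o)
    (hα : ∀ c, ContinuousOn (fun y => chartRep (𝓡 n) (fun p => α p) c y (stdVec n))
      (extChartAt (𝓡 n) c).target)
    (hβ : ∀ c, ContinuousOn (fun y => chartRep (𝓡 n) (fun p => β p) c y (stdVec n))
      (extChartAt (𝓡 n) c).target) (r s : ℝ) :
    integral (𝓡 n) (fun p v => o p v) (fun p v => (r • α p + s • β p) v) =
      r * integral (𝓡 n) (fun p v => o p v) (fun p v => α p v) +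
      s * integral (𝓡 n) (fun p v => o p v) (fun p v => β p v) := by
  rw [integral_eq_sum o fun p => r • α p + s • β p, integral_eq_sum o α, integral_eq_sum o β,
    Finset.mul_sum, Finset.mul_sum, ← Finset.sum_add_distrib]
  refine Finset.sum_congr rfl fun c _ => ?_
  have hint : ∀ {γ : ∀ p : N, TangentSpace (𝓡 n) p [⋀^Fin n]→ₗ[ℝ] ℝ},
      ContinuousOn (fun y => chartRep (𝓡 n) (fun p => γ p) c y (stdVec n))
        (extChartAt (𝓡 n) c).target → IntegrableOn (fun y => chartSign o c y *
        chartRep (𝓡 n) (fun p => (chartPartition (𝓡 n) N c p • γ p :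
          TangentSpace (𝓡 n) p [⋀^Fin n]→ₗ[ℝ] ℝ)) c y (stdVec n)) (extChartAt (𝓡 n) c).target := by
    intro γ hγ
    refine integrableOn_chart ho ((continuousOn_chartPartition c c).mul hγ) fun p hp => ?_
    rw [image_eq_zero_of_notMem_tsupport hp, zero_smul]
  unfold chartIntegral
  rw [← integral_const_mul, ← integral_const_mul,
    ← integral_add ((hint (hα c)).const_mul r) ((hint (hβ c)).const_mul s)]
  refine setIntegral_congr_fun (isOpen_extChartAt_target c).measurableSet fun y _ => ?_
  simp only [chartRep, AlternatingMap.smul_apply, AlternatingMap.add_apply, smul_eq_mul]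
  ring

end Closed

/-! ### Stokes' theorem on a closed 3-manifold. -/

section StokesClosed

open MeasureTheory

/-- The model tangent space of a 3-manifold. -/
abbrev E3 : Type := EuclideanSpace ℝ (Fin 3)

variable {N : Type*} [TopologicalSpace N] [ChartedSpace E3 N] [IsManifold (𝓡 3) ∞ N]

/-- The differential of a function. -/
def dual (χ : N → ℝ) (p : N) : TangentSpace (𝓡 3) p →ₗ[ℝ] ℝ :=
  (mfderiv (𝓡 3) 𝓘(ℝ, ℝ) χ p : E3 →L[ℝ] ℝ).toLinearMap

/-- The exterior product of the differential of a function with a 2-form. -/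
def wedgeD (χ : N → ℝ) (w : ∀ p : N, TangentSpace (𝓡 3) p [⋀^Fin 2]→ₗ[ℝ] ℝ) (p : N) :
    TangentSpace (𝓡 3) p [⋀^Fin 3]→ₗ[ℝ] ℝ :=
  AlternatingMap.alternatizeUncurryFin
    ((dual χ p).smulRight (w p) :
      TangentSpace (𝓡 3) p →ₗ[ℝ] TangentSpace (𝓡 3) p [⋀^Fin 2]→ₗ[ℝ] ℝ)

/-- The exterior derivative of a 2-form in a chart, evaluated on the coordinate vector fields. -/
def chartExtDer (w : ∀ p : N, TangentSpace (𝓡 3) p [⋀^Fin 2]→ₗ[ℝ] ℝ) (c : N) (y : E3) : ℝ :=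
  ∑ i : Fin 3, (-1 : ℝ) ^ (i : ℕ) * fderiv ℝ (fun y => chartRep (𝓡 3) (fun p => w p) c y
    fun j => stdVec 3 (i.succAbove j)) y (stdVec 3 i)

variable {χ : N → ℝ} {w : ∀ p : N, TangentSpace (𝓡 3) p [⋀^Fin 2]→ₗ[ℝ] ℝ} {c : N} {y : E3}

theorem contDiffOn_chart (hχ : ContMDiff (𝓡 3) 𝓘(ℝ, ℝ) ∞ χ) (c : N) :
    ContDiffOn ℝ ∞ (fun y => χ ((extChartAt (𝓡 3) c).symm y)) (extChartAt (𝓡 3) c).target :=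
  contMDiffOn_iff_contDiffOn.1 (hχ.comp_contMDiffOn (contMDiffOn_extChartAt_symm c))

theorem mfderiv_symm_chart (hχ : ContMDiff (𝓡 3) 𝓘(ℝ, ℝ) ∞ χ)
    (hy : y ∈ (extChartAt (𝓡 3) c).target) (v : E3) :
    (mfderiv (𝓡 3) 𝓘(ℝ, ℝ) χ ((extChartAt (𝓡 3) c).symm y)
      (mfderivWithin 𝓘(ℝ, E3) (𝓡 3) (extChartAt (𝓡 3) c).symm (range (𝓡 3)) y v) : ℝ) =
    fderiv ℝ (fun y => χ ((extChartAt (𝓡 3) c).symm y)) y v := by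
  have h1 : MDifferentiableAt 𝓘(ℝ, E3) (𝓡 3) (extChartAt (𝓡 3) c).symm y := by
    have := mdifferentiableWithinAt_extChartAt_symm (I := 𝓡 3) hy
    rwa [ModelWithCorners.range_eq_univ, mdifferentiableWithinAt_univ] at this
  have h2 : MDifferentiableAt (𝓡 3) 𝓘(ℝ, ℝ) χ ((extChartAt (𝓡 3) c).symm y) :=
    (hχ.mdifferentiable (by simp)) _
  have h3 := mfderiv_comp y h2 h1
  rw [mfderiv_eq_fderiv] at h3
  rw [ModelWithCorners.range_eq_univ, mfderivWithin_univ]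
  exact (congrArg (fun L : E3 →L[ℝ] ℝ => L v) h3).symm

theorem chartRep_wedgeD (hχ : ContMDiff (𝓡 3) 𝓘(ℝ, ℝ) ∞ χ)
    (hy : y ∈ (extChartAt (𝓡 3) c).target) :
    chartRep (𝓡 3) (fun p => wedgeD χ w p) c y (stdVec 3) =
      ∑ i : Fin 3, (-1 : ℝ) ^ (i : ℕ) *
        (fderiv ℝ (fun y => χ ((extChartAt (𝓡 3) c).symm y)) y (stdVec 3 i) *
        chartRep (𝓡 3) (fun p => w p) c y fun j => stdVec 3 (i.succAbove j)) := by
  refine (AlternatingMap.alternatizeUncurryFin_apply _ _).trans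
    (Finset.sum_congr rfl fun i _ => ?_)
  rw [← mfderiv_symm_chart hχ hy, zsmul_eq_mul]
  push_cast
  rfl

theorem wedgeD_eq_zero {p : N} (hp : p ∉ tsupport χ) : wedgeD χ w p = 0 := by
  have h0 : mfderiv (𝓡 3) 𝓘(ℝ, ℝ) χ p = 0 := by
    have he : χ =ᶠ[𝓝 p] fun _ => (0 : ℝ) := notMem_tsupport_iff_eventuallyEq.1 hp
    exact he.mfderiv_eq.trans mfderiv_const
  have h1 : ((dual χ p).smulRight (w p) :
      TangentSpace (𝓡 3) p →ₗ[ℝ] TangentSpace (𝓡 3) p [⋀^Fin 2]→ₗ[ℝ] ℝ) = 0 := by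
    have h2 : dual χ p = 0 := LinearMap.ext fun v => congrArg (fun L : E3 →L[ℝ] ℝ => L v) h0
    rw [h2]
    exact LinearMap.ext fun v => zero_smul ℝ (w p)
  unfold wedgeD
  rw [h1]
  refine AlternatingMap.ext fun v => (AlternatingMap.alternatizeUncurryFin_apply _ _).trans ?_
  simp

variable [CompactSpace N] [T2Space N]

theorem contMDiff_chartPartition (c : N) :
    ContMDiff (𝓡 3) 𝓘(ℝ, ℝ) ∞ (chartPartition (𝓡 3) N c) := (chartPartition (𝓡 3) N c).contMDiff

variable {o α : ∀ p : N, TangentSpace (𝓡 3) p [⋀^Fin 3]→ₗ[ℝ] ℝ}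

theorem continuousOn_fderiv_apply {U : Set E3} {g : E3 → ℝ} (hU : IsOpen U)
    (hg : ContDiffOn ℝ ∞ g U) (v : E3) : ContinuousOn (fun y => fderiv ℝ g y v) U :=
  (hg.continuousOn_fderiv_of_isOpen hU (by simp)).clm_apply continuousOn_const

section

variable (hw : ∀ c v, ContDiffOn ℝ ∞ (fun y => chartRep (𝓡 3) (fun p => w p) c y v)
  (extChartAt (𝓡 3) c).target)

include hw

theorem continuousOn_wedgeD (hχ : ContMDiff (𝓡 3) 𝓘(ℝ, ℝ) ∞ χ) (c : N) :
    ContinuousOn (fun y => chartRep (𝓡 3) (fun p => wedgeD χ w p) c y (stdVec 3))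
      (extChartAt (𝓡 3) c).target := by
  refine ContinuousOn.congr ?_ fun y hy => chartRep_wedgeD hχ hy
  exact continuousOn_finsetSum _ fun i _ => continuousOn_const.mul
    ((continuousOn_fderiv_apply (isOpen_extChartAt_target c) (contDiffOn_chart hχ c) _).mul
      (hw c _).continuousOn)

/-- The sum of integrands is χ dw + dχ ∧ w = d(χw), and χw has compact support in the chart. Each
partial derivative integrates to zero, the sign of the orientation being locally constant. -/
theorem chartIntegral_add_wedgeD (ho : IsOrienting o)
    (hα : ∀ c, ∀ y ∈ (extChartAt (𝓡 3) c).target,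
      chartRep (𝓡 3) (fun p => α p) c y (stdVec 3) = chartExtDer w c y) (c : N) :
    chartIntegral o (fun p => chartPartition (𝓡 3) N c p • α p) c +
      chartIntegral o (wedgeD (chartPartition (𝓡 3) N c) w) c = 0 := by
  have hU : IsOpen (extChartAt (𝓡 3) c).target := isOpen_extChartAt_target c
  set χ := chartPartition (𝓡 3) N c with hχd
  have hχ : ContMDiff (𝓡 3) 𝓘(ℝ, ℝ) ∞ χ := contMDiff_chartPartition c
  have hχc := contDiffOn_chart hχ c
  have hg : ∀ i : Fin 3, ContDiffOn ℝ ∞ (fun y => χ ((extChartAt (𝓡 3) c).symm y) *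
      chartRep (𝓡 3) (fun p => w p) c y fun j => stdVec 3 (i.succAbove j))
      (extChartAt (𝓡 3) c).target := fun i => hχc.mul (hw c _)
  have hαc : ContinuousOn (fun y => chartRep (𝓡 3) (fun p => α p) c y (stdVec 3))
      (extChartAt (𝓡 3) c).target := by
    refine ContinuousOn.congr ?_ fun y hy => hα c y hy
    exact continuousOn_finsetSum _ fun i _ => continuousOn_const.mul
      (continuousOn_fderiv_apply hU (hw c _) _)
  have i1 : IntegrableOn (fun y => chartSign o c y * chartRep (𝓡 3)
      (fun p => (χ p • α p : TangentSpace (𝓡 3) p [⋀^Fin 3]→ₗ[ℝ] ℝ)) c y (stdVec 3))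
      (extChartAt (𝓡 3) c).target := by
    refine integrableOn_chart ho ((continuousOn_chartPartition c c).mul hαc) fun p hp => ?_
    rw [hχd, image_eq_zero_of_notMem_tsupport hp, zero_smul]
  have hzero : ∀ p ∉ tsupport χ, wedgeD χ w p = 0 := fun p hp => wedgeD_eq_zero hp
  have i2 := integrableOn_chart ho (continuousOn_wedgeD hw hχ c) hzero
  unfold chartIntegral
  rw [← integral_add i1 i2]
  have hpt : ∀ y ∈ (extChartAt (𝓡 3) c).target,
      chartSign o c y * chartRep (𝓡 3)
      (fun p => (χ p • α p : TangentSpace (𝓡 3) p [⋀^Fin 3]→ₗ[ℝ] ℝ)) c y (stdVec 3) +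
      chartSign o c y * chartRep (𝓡 3) (fun p => wedgeD χ w p) c y (stdVec 3) =
      ∑ i : Fin 3, (-1 : ℝ) ^ (i : ℕ) * (chartSign o c y * fderiv ℝ (fun y =>
        χ ((extChartAt (𝓡 3) c).symm y) * chartRep (𝓡 3) (fun p => w p) c y fun j =>
          stdVec 3 (i.succAbove j)) y (stdVec 3 i)) := by
    intro y hy
    have h1 : chartRep (𝓡 3)
      (fun p => (χ p • α p : TangentSpace (𝓡 3) p [⋀^Fin 3]→ₗ[ℝ] ℝ)) c y (stdVec 3) =
      χ ((extChartAt (𝓡 3) c).symm y) * chartExtDer w c y := by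
      rw [← hα c y hy]; rfl
    rw [h1, chartRep_wedgeD hχ hy, chartExtDer, Finset.mul_sum, ← mul_add,
      ← Finset.sum_add_distrib, Finset.mul_sum]
    refine Finset.sum_congr rfl fun i _ => ?_
    have h2 := (hχc.differentiableOn (by simp)).differentiableAt (hU.mem_nhds hy)
    have h3 := ((hw c fun j => stdVec 3 (i.succAbove j)).differentiableOn
      (by simp)).differentiableAt (hU.mem_nhds hy)
    rw [fderiv_fun_mul h2 h3]
    simp only [add_apply, smul_apply, smul_eq_mul]
    ring
  rw [setIntegral_congr_fun hU.measurableSet hpt, integral_finsetSum]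
  · refine Finset.sum_eq_zero fun i _ => ?_
    rw [integral_const_mul, setIntegral_mul_fderiv_eq_zero hU (isCompact_coordSupport c)
      (coordSupport_subset c) (ho c) ((hg i).of_le (by simp)), mul_zero]
    intro y hy hyK
    rw [hχd, image_eq_zero_of_notMem_tsupport (notMem_tsupport hy hyK), zero_mul]
  · intro i _
    refine Integrable.const_mul ?_ _
    refine integrableOn_of_compact hU (isCompact_coordSupport c) (coordSupport_subset c)
      ((continuousOn_of_eventually_const (ho c)).mul
        (continuousOn_fderiv_apply hU (hg i) _)) fun y hy hyK => ?_
    have he : (fun y => χ ((extChartAt (𝓡 3) c).symm y) * chartRep (𝓡 3) (fun p => w p) c y fun j =>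
          stdVec 3 (i.succAbove j)) =ᶠ[𝓝 y] fun _ => (0 : ℝ) := by
      filter_upwards [hU.mem_nhds hy, (isCompact_coordSupport c).isClosed.isOpen_compl.mem_nhds hyK]
        with y' hy' hyK'
      rw [hχd, image_eq_zero_of_notMem_tsupport (notMem_tsupport hy' hyK'), zero_mul]
    rw [he.fderiv_eq]
    simp

/-- Stokes' theorem on a closed 3-manifold. -/
theorem integral_eq_zero_of_exact (ho : IsOrienting o)
    (hα : ∀ c, ∀ y ∈ (extChartAt (𝓡 3) c).target,
      chartRep (𝓡 3) (fun p => α p) c y (stdVec 3) = chartExtDer w c y) :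
    integral (𝓡 3) (fun p v => o p v) (fun p v => α p v) = 0 := by
  set S := activeCharts 3 N
  -- `β c c'` is χ_{c'} dχ_c ∧ w. It is supported in both charts, so its integral can be computed in
  -- either.
  let β : N → N → ∀ p : N, TangentSpace (𝓡 3) p [⋀^Fin 3]→ₗ[ℝ] ℝ := fun c c' p =>
    chartPartition (𝓡 3) N c' p • wedgeD (chartPartition (𝓡 3) N c) w p
  have hβ0 : ∀ c c', ∀ p ∉ tsupport (chartPartition (𝓡 3) N c), β c c' p = 0 := fun c c' p hp => by
    simp only [β, wedgeD_eq_zero hp, smul_zero]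
  have hβ0' : ∀ c c', ∀ p ∉ tsupport (chartPartition (𝓡 3) N c'), β c c' p = 0 :=
    fun c c' p hp => by simp only [β, image_eq_zero_of_notMem_tsupport hp, zero_smul]
  have hβc : ∀ c c' c'', ContinuousOn (fun y => chartRep (𝓡 3) (fun p => β c c' p) c'' y (stdVec 3))
      (extChartAt (𝓡 3) c'').target := fun c c' c'' =>
    (continuousOn_chartPartition c' c'').mul (continuousOn_wedgeD hw (contMDiff_chartPartition c) c'')
  -- Insert the identity that the functions χ_{c'} sum to 1.
  have h1 : ∀ c, chartIntegral o (wedgeD (chartPartition (𝓡 3) N c) w) c =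
      ∑ c' ∈ S, chartIntegral o (β c c') c := by
    intro c
    unfold chartIntegral
    rw [← integral_finsetSum _ fun c' _ => integrableOn_chart ho (hβc c c' c) (hβ0 c c')]
    refine setIntegral_congr_fun (isOpen_extChartAt_target c).measurableSet fun y _ => ?_
    rw [← Finset.mul_sum]
    congr 1
    have h2 := sum_chartPartition (n := 3) ((extChartAt (𝓡 3) c).symm y)
    change _ = ∑ c' ∈ S, chartPartition (𝓡 3) N c' ((extChartAt (𝓡 3) c).symm y) *
      chartRep (𝓡 3) (fun p => wedgeD (chartPartition (𝓡 3) N c) w p) c y (stdVec 3)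
    rw [← Finset.sum_mul, h2, one_mul]
  have h2 : ∀ c c', chartIntegral o (β c c') c = chartIntegral o (β c c') c' := fun c c' =>
    chartIntegral_trans (fun p hp => hβ0 c c' p fun h => hp (tsupport_chartPartition c h))
      fun p hp => hβ0' c c' p fun h => hp (tsupport_chartPartition c' h)
  -- In a fixed chart the sum over c contains the sum of the dχ_c, which is the differential of the
  -- constant 1.
  have h3 : ∀ c', ∑ c ∈ S, chartIntegral o (β c c') c' = 0 := by
    intro c'
    have hU : IsOpen (extChartAt (𝓡 3) c').target := isOpen_extChartAt_target c'
    unfold chartIntegral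
    rw [← integral_finsetSum _ fun c _ => integrableOn_chart ho (hβc c c' c') (hβ0' c c')]
    refine (setIntegral_congr_fun (g := fun _ => (0 : ℝ)) hU.measurableSet
      fun y hy => ?_).trans (by simp)
    simp only
    rw [← Finset.mul_sum]
    refine mul_eq_zero_of_right _ ?_
    have hd : ∀ v, ∑ c ∈ S, fderiv ℝ (fun y => chartPartition (𝓡 3) N c
        ((extChartAt (𝓡 3) c').symm y)) y v = 0 := by
      intro v
      have hs : (fun y => ∑ c ∈ S, chartPartition (𝓡 3) N c ((extChartAt (𝓡 3) c').symm y)) =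
          fun _ => (1 : ℝ) := funext fun y => sum_chartPartition _
      have hf := fderiv_fun_sum (u := S) (x := y) (𝕜 := ℝ) fun c (_ : c ∈ S) =>
        ((contDiffOn_chart (contMDiff_chartPartition c) c').differentiableOn
          (by simp)).differentiableAt (hU.mem_nhds hy)
      rw [hs] at hf
      have := congrArg (fun L : E3 →L[ℝ] ℝ => L v) hf
      simpa [sum_apply] using this.symm
    have e1 : ∀ c, chartRep (𝓡 3) (fun p => β c c' p) c' y (stdVec 3) =
        chartPartition (𝓡 3) N c' ((extChartAt (𝓡 3) c').symm y) *
        chartRep (𝓡 3) (fun p => wedgeD (chartPartition (𝓡 3) N c) w p) c' y (stdVec 3) :=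
      fun c => rfl
    simp only [e1, chartRep_wedgeD (contMDiff_chartPartition _) hy]
    rw [← Finset.mul_sum, Finset.sum_comm]
    refine mul_eq_zero_of_right _ (Finset.sum_eq_zero fun i _ => ?_)
    rw [← Finset.mul_sum, ← Finset.sum_mul, hd, zero_mul, mul_zero]
  rw [integral_eq_sum o α]
  have h4 : ∀ c, chartIntegral o (fun p => chartPartition (𝓡 3) N c p • α p) c =
      -∑ c' ∈ S, chartIntegral o (β c c') c' := fun c => by
    rw [← Finset.sum_congr rfl fun c' _ => h2 c c', ← h1 c]
    exact eq_neg_of_add_eq_zero_left (chartIntegral_add_wedgeD hw ho hα c)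
  rw [Finset.sum_congr rfl fun c _ => h4 c, Finset.sum_neg_distrib, Finset.sum_comm,
    Finset.sum_eq_zero fun c' _ => h3 c', neg_zero]

end

end StokesClosed

/-! ### Boundary points in charts, and pull-back of forms to the boundary. -/

section BoundaryCharts

variable {M : Type*} [TopologicalSpace M] [ChartedSpace (EuclideanHalfSpace 4) M]
  [IsManifold (𝓡∂ 4) ∞ M]

theorem mem_halfSpace_iff {z : E4} : z ∈ halfSpace ↔ 0 ≤ z 0 := by
  rw [halfSpace, range_modelWithCornersEuclideanHalfSpace]; rfl

variable {c x : M}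

/-- The differential of the chart at `c`. -/
def dchart (c x : M) : E4 →L[ℝ] E4 := mfderiv (𝓡∂ 4) 𝓘(ℝ, E4) (extChartAt (𝓡∂ 4) c) x

theorem tv_dchart (hx : x ∈ (chartAt (EuclideanHalfSpace 4) c).source) (u : E4) :
    (tv c x (dchart c x u) : E4) = u := by
  have h := TangentBundle.continuousLinearMapAt_trivializationAt (I := 𝓡∂ 4) hx
  have h2 := (trivializationAt E4 (TangentSpace (𝓡∂ 4) : M → Type _) c).symmL_continuousLinearMapAt
    (R := ℝ) (mem_baseSet_iff.2 hx) (u : TangentSpace (𝓡∂ 4) x)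
  rw [h] at h2
  exact h2

theorem dchart_injective (hx : x ∈ (chartAt (EuclideanHalfSpace 4) c).source) :
    Function.Injective (dchart c x) := fun u v h => by
  rw [← tv_dchart hx u, h, tv_dchart hx v]

theorem dchart_surjective (hx : x ∈ (chartAt (EuclideanHalfSpace 4) c).source) :
    Function.Surjective (dchart c x) :=
  (LinearMap.injective_iff_surjective (f := (dchart c x).toLinearMap)).1 (dchart_injective hx)

/-- Being a boundary point does not depend on the chart. If the coordinate were positive, the image
of the chart would be a full neighbourhood of the point in the model space. -/
theorem coord_zero_of_boundary (hx : x ∈ (chartAt (EuclideanHalfSpace 4) c).source)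
    (hb : x ∈ (𝓡∂ 4).boundary M) : extChartAt (𝓡∂ 4) c x 0 = 0 := by
  have h := ((𝓡∂ 4).isBoundaryPoint_iff_of_mem_atlas (n := ∞) (by simp)
    (chart_mem_atlas (EuclideanHalfSpace 4) c) hx).1 hb
  have h1 := mem_halfSpace_iff.1 (extChartAt_mem_halfSpace c x)
  by_contra h0
  have h2 : 0 < extChartAt (𝓡∂ 4) c x 0 := lt_of_le_of_ne h1 (Ne.symm h0)
  have h3 : halfSpace ∈ 𝓝 (extChartAt (𝓡∂ 4) c x) := by
    rw [← mem_interior_iff_mem_nhds, interior_range_modelWithCornersEuclideanHalfSpace]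
    exact h2
  have h4 : (extChartAt (𝓡∂ 4) c).target ∈ 𝓝 (extChartAt (𝓡∂ 4) c x) := by
    have := extChartAt_target_mem_nhdsWithin' (I := 𝓡∂ 4) (x := c) (y := x)
      (by rwa [extChartAt_source])
    rwa [nhdsWithin_eq_nhds.2 h3] at this
  exact h.2 (mem_interior_iff_mem_nhds.2 h4)

theorem dchart_eq_fderivWithin (hx : x ∈ (chartAt (EuclideanHalfSpace 4) c).source) (u : E4) :
    dchart c x u = fderivWithin ℝ (fun y => extChartAt (𝓡∂ 4) c (pt x y)) halfSpace
      (extChartAt (𝓡∂ 4) x x) u := by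
  have h := mfderiv_tv (g := extChartAt (𝓡∂ 4) c) (mem_chart_source _ x)
    (mdifferentiableAt_extChartAt hx) u
  have h1 := tv_self x u
  refine Eq.trans ?_ h
  exact congrArg (dchart c x) h1.symm

/-- Changes of coordinates preserve the outward direction. -/
theorem dchart_pos (hx : x ∈ (chartAt (EuclideanHalfSpace 4) c).source)
    (hb : x ∈ (𝓡∂ 4).boundary M) : 0 < dchart c x (EuclideanSpace.single 0 1) 0 := by
  let y := extChartAt (𝓡∂ 4) x x
  have hy : y ∈ halfSpace := extChartAt_mem_halfSpace x x
  have hy0 : y 0 = 0 := coord_zero_of_boundary (mem_chart_source _ x) hb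
  let g : E4 → E4 := fun y => extChartAt (𝓡∂ 4) c (pt x y)
  have hg0 : g y 0 = 0 := by
    have : g y = extChartAt (𝓡∂ 4) c x := congrArg (extChartAt (𝓡∂ 4) c) (pt_self x)
    rw [this, coord_zero_of_boundary hx hb]
  have hgd : DifferentiableWithinAt ℝ g halfSpace y := by
    have h1 : MDifferentiableWithinAt 𝓘(ℝ, E4) (𝓡∂ 4) (pt x) halfSpace y :=
      (pt_contMDiffWithinAt contDiffWithinAt_id (mapsTo_id _)
        (mem_extChartAt_target x)).mdifferentiableWithinAt (by simp)
    have h2 : MDifferentiableAt (𝓡∂ 4) 𝓘(ℝ, E4) (extChartAt (𝓡∂ 4) c) (pt x y) := by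
      rw [pt_self]; exact mdifferentiableAt_extChartAt hx
    exact (h2.comp_mdifferentiableWithinAt y h1).differentiableWithinAt
  -- The zeroth component of the coordinate change is nonnegative on the half space and zero at the
  -- boundary point. So its derivative is nonnegative in inward directions.
  have hmin : IsLocalMinOn (fun z => g z 0) halfSpace y := by
    refine Filter.Eventually.of_forall fun z => ?_
    change g y 0 ≤ g z 0
    rw [hg0]
    exact mem_halfSpace_iff.1 (extChartAt_mem_halfSpace c _)
  have hder : ∀ u, fderivWithin ℝ (fun z => g z 0) halfSpace y u = dchart c x u 0 := by
    intro u
    have h1 := ((EuclideanSpace.proj (0 : Fin 4) : E4 →L[ℝ] ℝ).hasFDerivAt.comp_hasFDerivWithinAt y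
      hgd.hasFDerivWithinAt).fderivWithin (unique_halfSpace hy)
    rw [dchart_eq_fderivWithin hx]
    exact congrArg (fun L : E4 →L[ℝ] ℝ => L u) h1
  have hpos : ∀ u : E4, 0 ≤ u 0 → 0 ≤ dchart c x u 0 := by
    intro u hu
    rw [← hder]
    refine hmin.fderivWithin_nonneg (mem_posTangentConeAt_of_segment_subset ?_)
    rintro _ ⟨a, b, ha, hb', hab, rfl⟩
    rw [mem_halfSpace_iff]
    simp only [smul_add, PiLp.add_apply, PiLp.smul_apply, smul_eq_mul, hy0]
    have := mul_nonneg hb' hu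
    linarith
  -- Both u and -u are admissible directions when u is tangential.
  have htan : ∀ u : E4, u 0 = 0 → dchart c x u 0 = 0 := by
    intro u hu
    have h1 := hpos u hu.ge
    have h2 := hpos (-u) (by simp [hu])
    rw [map_neg, PiLp.neg_apply] at h2
    linarith
  -- If the normal derivative were zero too, the zeroth component of the differential would vanish
  -- identically, contrary to surjectivity.
  refine lt_of_le_of_ne (hpos _ (by simp)) fun h => ?_
  obtain ⟨u, hu⟩ := dchart_surjective hx (EuclideanSpace.single 0 1)
  have h1 : dchart c x u 0 = u 0 * dchart c x (EuclideanSpace.single 0 1) 0 +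
      dchart c x (u - u 0 • EuclideanSpace.single 0 1) 0 := by
    rw [map_sub, map_smul, PiLp.sub_apply, PiLp.smul_apply, smul_eq_mul]
    ring
  rw [htan (u - u 0 • EuclideanSpace.single 0 1) (by simp), ← h, hu] at h1
  simp at h1

variable {N : Type*} [TopologicalSpace N] [ChartedSpace E3 N] [IsManifold (𝓡 3) ∞ N]

variable (b : BoundaryInclusion M N)

/-- The inclusion of the boundary in coordinates. -/
def inclC (c : N) (C : M) (y : E3) : E4 :=
  extChartAt (𝓡∂ 4) C (b.incl ((extChartAt (𝓡 3) c).symm y))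

/-- The coordinates in the chart at `c` of the boundary points in the domain of the chart at `C`. -/
def inclDom (c : N) (C : M) : Set E3 :=
  (extChartAt (𝓡 3) c).target ∩ (fun y => b.incl ((extChartAt (𝓡 3) c).symm y)) ⁻¹'
    (chartAt (EuclideanHalfSpace 4) C).source

theorem isOpen_inclDom (c : N) (C : M) : IsOpen (inclDom b c C) :=
  (b.contMDiff.continuous.comp_continuousOn (continuousOn_extChartAt_symm c)).isOpen_inter_preimage
    (isOpen_extChartAt_target c) (chartAt (EuclideanHalfSpace 4) C).open_source

/-- The pull-back of a form to the boundary. -/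
def pullback {k : ℕ} (α : ∀ x : M, TangentSpace (𝓡∂ 4) x [⋀^Fin k]→ₗ[ℝ] ℝ) (p : N) :
    TangentSpace (𝓡 3) p [⋀^Fin k]→ₗ[ℝ] ℝ :=
  (α (b.incl p)).compLinearMap (mfderiv (𝓡 3) (𝓡∂ 4) b.incl p).toLinearMap

variable {b} {c : N} {C : M} {y : E3}

theorem self_mem_inclDom (hy : y ∈ (extChartAt (𝓡 3) c).target) :
    y ∈ inclDom b c (b.incl ((extChartAt (𝓡 3) c).symm y)) := ⟨hy, mem_chart_source _ _⟩

theorem inclC_mem_halfSpace : inclC b c C y ∈ halfSpace := extChartAt_mem_halfSpace _ _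

theorem inclC_mem_target (hy : y ∈ inclDom b c C) :
    inclC b c C y ∈ (extChartAt (𝓡∂ 4) C).target :=
  (extChartAt (𝓡∂ 4) C).map_source (by rw [extChartAt_source]; exact hy.2)

theorem pt_inclC (hy : y ∈ inclDom b c C) :
    pt C (inclC b c C y) = b.incl ((extChartAt (𝓡 3) c).symm y) := pt_extChartAt hy.2

theorem inclC_zero (hy : y ∈ inclDom b c C) : inclC b c C y 0 = 0 :=
  coord_zero_of_boundary hy.2 (b.range_eq ▸ mem_range_self _)

theorem contMDiffAt_symm_chart (hy : y ∈ (extChartAt (𝓡 3) c).target) :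
    ContMDiffAt 𝓘(ℝ, E3) (𝓡 3) ∞ (extChartAt (𝓡 3) c).symm y :=
  (contMDiffOn_extChartAt_symm c).contMDiffAt ((isOpen_extChartAt_target c).mem_nhds hy)

theorem inclC_contDiffAt (hy : y ∈ inclDom b c C) : ContDiffAt ℝ ∞ (inclC b c C) y := by
  rw [← contMDiffAt_iff_contDiffAt]
  exact ((contMDiffAt_extChartAt' hy.2).comp y
    (b.contMDiff.contMDiffAt.comp y (contMDiffAt_symm_chart hy.1)))

theorem fderiv_inclC_eq (hy : y ∈ inclDom b c C) (v : E3) :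
    fderiv ℝ (inclC b c C) y v = dchart C (b.incl ((extChartAt (𝓡 3) c).symm y))
      (mfderiv (𝓡 3) (𝓡∂ 4) b.incl ((extChartAt (𝓡 3) c).symm y)
        (mfderivWithin 𝓘(ℝ, E3) (𝓡 3) (extChartAt (𝓡 3) c).symm (range (𝓡 3)) y v)) := by
  have h1 : MDifferentiableAt 𝓘(ℝ, E3) (𝓡 3) (extChartAt (𝓡 3) c).symm y :=
    (contMDiffAt_symm_chart hy.1).mdifferentiableAt (by simp)
  have h2 : MDifferentiableAt (𝓡 3) (𝓡∂ 4) b.incl ((extChartAt (𝓡 3) c).symm y) :=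
    b.contMDiff.contMDiffAt.mdifferentiableAt (by simp)
  have h3 : MDifferentiableAt (𝓡∂ 4) 𝓘(ℝ, E4) (extChartAt (𝓡∂ 4) C)
    (b.incl ((extChartAt (𝓡 3) c).symm y)) := mdifferentiableAt_extChartAt hy.2
  have h4 := mfderiv_comp y (h3.comp _ h2) h1
  rw [mfderiv_comp _ h3 h2, mfderiv_eq_fderiv] at h4
  rw [ModelWithCorners.range_eq_univ, mfderivWithin_univ]
  exact congrArg (fun L : E3 →L[ℝ] E4 => L v) h4

theorem tv_fderiv_inclC (hy : y ∈ inclDom b c C) (v : E3) :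
    (tv C (b.incl ((extChartAt (𝓡 3) c).symm y)) (fderiv ℝ (inclC b c C) y v) : E4) =
      mfderiv (𝓡 3) (𝓡∂ 4) b.incl ((extChartAt (𝓡 3) c).symm y)
        (mfderivWithin 𝓘(ℝ, E3) (𝓡 3) (extChartAt (𝓡 3) c).symm (range (𝓡 3)) y v) := by
  rw [fderiv_inclC_eq hy]
  exact tv_dchart hy.2 _

theorem fderiv_inclC_injective (hy : y ∈ inclDom b c C) :
    Function.Injective (fderiv ℝ (inclC b c C) y) := by
  intro u v h
  rw [fderiv_inclC_eq hy, fderiv_inclC_eq hy] at h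
  have h1 := b.immersion _ (dchart_injective hy.2 h)
  have ho : y ∈ overlap (n := 3) c c := ⟨hy.1, (extChartAt (𝓡 3) c).map_target hy.1⟩
  have h2 := isInvertible_mfderivWithin_extChartAt_symm (I := 𝓡 3) hy.1
  exact h2.injective h1

theorem fderiv_inclC_zero (hy : y ∈ inclDom b c C) (v : E3) :
    fderiv ℝ (inclC b c C) y v 0 = 0 := by
  have h1 : (fun y => inclC b c C y 0) =ᶠ[𝓝 y] fun _ => (0 : ℝ) :=
    Filter.eventually_of_mem ((isOpen_inclDom b c C).mem_nhds hy) fun y' hy' => inclC_zero hy'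
  have h2 := ((EuclideanSpace.proj (0 : Fin 4) : E4 →L[ℝ] ℝ).hasFDerivAt.comp y
    ((inclC_contDiffAt hy).differentiableAt (by simp)).hasFDerivAt).fderiv
  have h3 : fderiv ℝ (fun y => inclC b c C y 0) y v = 0 := by
    rw [h1.fderiv_eq]; simp
  rw [← h3]
  exact (congrArg (fun L : E3 →L[ℝ] ℝ => L v) h2).symm

theorem chartRep_congr {k : ℕ} {α : ∀ x : M, (Fin k → TangentSpace (𝓡∂ 4) x) → ℝ} {x x' : M}
    (h : x = x') {u u' : Fin k → E4} (hu : u = u') : α x u = α x' u' := by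
  subst h; subst hu; rfl

theorem chartRep_pullback {k : ℕ} (α : ∀ x : M, TangentSpace (𝓡∂ 4) x [⋀^Fin k]→ₗ[ℝ] ℝ)
    (hy : y ∈ inclDom b c C) (v : Fin k → E3) :
    chartRep (𝓡 3) (fun p => pullback b α p) c y v =
      chartRep (𝓡∂ 4) (fun x => α x) C (inclC b c C y)
        fun i => fderiv ℝ (inclC b c C) y (v i) := by
  rw [chartRep_eq _ (inclC_mem_target hy)]
  refine chartRep_congr (α := fun x => α x) (pt_inclC hy).symm (funext fun i => ?_)
  rw [pt_inclC hy]
  exact (tv_fderiv_inclC hy (v i)).symm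

/-- A form in a chart as a multilinear map. -/
def chartMulti {k : ℕ} (α : ∀ x : M, TangentSpace (𝓡∂ 4) x [⋀^Fin k]→ₗ[ℝ] ℝ) (C : M) (z : E4) :
    E4 [⋀^Fin k]→ₗ[ℝ] ℝ := (α (pt C z)).compLinearMap (tv C (pt C z)).toLinearMap

theorem chartRep_eq_chartMulti {k : ℕ} (α : ∀ x : M, TangentSpace (𝓡∂ 4) x [⋀^Fin k]→ₗ[ℝ] ℝ)
    {z : E4} (hz : z ∈ (extChartAt (𝓡∂ 4) C).target) (w : Fin k → E4) :
    chartRep (𝓡∂ 4) (fun x => α x) C z w = chartMulti α C z w := chartRep_eq _ hz w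

theorem multilinear_expand {k n : ℕ}
    (m : MultilinearMap ℝ (fun _ : Fin k => EuclideanSpace ℝ (Fin n)) ℝ)
    (w : Fin k → EuclideanSpace ℝ (Fin n)) :
    m w = ∑ r : Fin k → Fin n, (∏ i, w i (r i)) * m fun i => stdVec n (r i) := by
  have h : w = fun i => ∑ j, w i j • stdVec n j := by
    funext i
    ext l
    simp [stdVec, Pi.single_apply]
  conv_lhs => rw [h, m.map_sum]
  exact Finset.sum_congr rfl fun r _ => m.map_smul_univ _ _

/-- The pulled-back form is evaluated on vectors that move with the point. Expanding these in the
standard basis leaves products of partial derivatives of the inclusion and coefficients of the form,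
all of them smooth. -/
theorem contDiffOn_pullback {k : ℕ} {α : ∀ x : M, TangentSpace (𝓡∂ 4) x [⋀^Fin k]→ₗ[ℝ] ℝ}
    (hα : IsSmoothForm (𝓡∂ 4) α) (c : N) (v : Fin k → E3) :
    ContDiffOn ℝ ∞ (fun y => chartRep (𝓡 3) (fun p => pullback b α p) c y v)
      (extChartAt (𝓡 3) c).target := by
  intro y hy
  set C := b.incl ((extChartAt (𝓡 3) c).symm y)
  have hy' : y ∈ inclDom b c C := self_mem_inclDom hy
  have hW := (isOpen_inclDom b c C).mem_nhds hy'
  have hG := inclC_contDiffAt hy'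
  have h1 : ContDiffAt ℝ ∞ (fun y => ∑ r : Fin k → Fin 4,
      (∏ i, (fderiv ℝ (inclC b c C) y (v i)) (r i)) *
        chartRep (𝓡∂ 4) (fun x => α x) C (inclC b c C y) fun i => stdVec 4 (r i)) y := by
    refine ContDiffAt.sum fun r _ => ContDiffAt.mul (contDiffAt_prod fun i _ => ?_) ?_
    · have h2 : ContDiffAt ℝ ∞ (fun y => fderiv ℝ (inclC b c C) y (v i)) y :=
        (hG.fderiv_right (m := ∞) (by simp)).clm_apply contDiffAt_const
      exact (EuclideanSpace.proj (r i) : E4 →L[ℝ] ℝ).contDiff.contDiffAt.comp y h2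
    · have h3 := (hα C fun i => stdVec 4 (r i)) _ (inclC_mem_target hy')
      exact (h3.comp y (hG.contDiffWithinAt (s := inclDom b c C))
        fun y' hy' => inclC_mem_target hy').contDiffAt hW
  refine (h1.congr_of_eventuallyEq ?_).contDiffWithinAt
  filter_upwards [hW] with y' hy''
  rw [chartRep_pullback α hy'', chartRep_eq_chartMulti α (inclC_mem_target hy'')]
  refine (multilinear_expand (chartMulti α C (inclC b c C y')).toMultilinearMap _).trans
    (Finset.sum_congr rfl fun r _ => ?_)
  rw [chartRep_eq_chartMulti α (inclC_mem_target hy'')]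
  rfl

end BoundaryCharts

/-! ### The boundary orientation and Stokes' theorem for the boundary integral. -/

section BoundaryStokes

variable {M : Type*} [TopologicalSpace M] [ChartedSpace (EuclideanHalfSpace 4) M]
  [IsManifold (𝓡∂ 4) ∞ M]
  {N : Type*} [TopologicalSpace N] [ChartedSpace E3 N] [IsManifold (𝓡 3) ∞ N]
  {o : OrientationForm M} {b : BoundaryInclusion M N} {c : N} {C : M} {y : E3}

/-! ### The boundary orientation -/

/-- The outward pointing vector. -/
def outward : E4 := -EuclideanSpace.single 0 1

variable (o b) in
/-- The boundary orientation as an alternating form. -/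
def boundaryForm (p : N) : TangentSpace (𝓡 3) p [⋀^Fin 3]→ₗ[ℝ] ℝ :=
  ((o.form (b.incl p)).curryLeft (outward : E4)).compLinearMap
    (mfderiv (𝓡 3) (𝓡∂ 4) b.incl p).toLinearMap

/-- The tangential components of the coordinate vector fields of the boundary. -/
def tangMatrix (b : BoundaryInclusion M N) (c : N) (C : M) (y : E3) : Matrix (Fin 3) (Fin 3) ℝ :=
  fun i j => fderiv ℝ (inclC b c C) y (stdVec 3 i) j.succ

/-- The differential of the inclusion is injective and its zeroth components vanish, so all its rank
is in the tangential block. -/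
theorem det_tangMatrix_ne_zero (hy : y ∈ inclDom b c C) : (tangMatrix b c C y).det ≠ 0 := by
  intro h0
  obtain ⟨v, hv, hv0⟩ := Matrix.exists_vecMul_eq_zero_iff.2 h0
  have h1 : fderiv ℝ (inclC b c C) y (∑ i, v i • stdVec 3 i) = 0 := by
    ext j
    refine Fin.cases (fderiv_inclC_zero hy _) (fun j => ?_) j
    have := congrFun hv0 j
    simpa [Matrix.vecMul, dotProduct, tangMatrix] using this
  have h2 := fderiv_inclC_injective hy (h1.trans (map_zero _).symm)
  apply hv
  ext i
  have := congrArg (fun w : E3 => w i) h2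
  simpa [stdVec, Pi.single_apply] using this

theorem chartMulti_ne_zero {z : E4} (hz : z ∈ (extChartAt (𝓡∂ 4) C).target) :
    chartMulti o.form C z (stdVec 4) ≠ 0 := by
  intro h0
  have h1 := (chartMulti o.form C z).eq_smul_basis_det (EuclideanSpace.basisFun (Fin 4) ℝ).toBasis
  have h2 : chartMulti o.form C z = 0 := by
    rw [h1]
    have : (⇑(EuclideanSpace.basisFun (Fin 4) ℝ).toBasis : Fin 4 → E4) = stdVec 4 := by
      funext i
      simp [stdVec]
    rw [this, h0, zero_smul]
  refine o.ne_zero (pt C z) (AlternatingMap.ext fun v => ?_)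
  have h3 := DFunLike.congr_fun h2 fun i => dchart C (pt C z) (v i)
  refine Eq.trans ?_ h3
  refine congrArg (o.form (pt C z)) (funext fun i => ?_)
  exact (tv_dchart (pt_mem_source hz) (v i)).symm

/-- The last three vectors lie in the hyperplane, so only one entry of the zeroth column survives in
the Laplace expansion. -/
theorem det_cons_hyperplane {n : E4} {w : Fin 3 → E4} (hw : ∀ i, w i 0 = 0) :
    (EuclideanSpace.basisFun (Fin 4) ℝ).toBasis.det (Fin.cons n w) =
      n 0 * Matrix.det fun i j : Fin 3 => w i j.succ := by
  rw [Module.Basis.det_apply, ← Matrix.det_transpose, Matrix.det_succ_column_zero,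
    Finset.sum_eq_single (0 : Fin 4)]
  · simp only [Fin.val_zero, pow_zero, one_mul]
    congr 1
  · intro i _ hi
    obtain ⟨j, rfl⟩ := Fin.exists_succ_eq.2 hi
    have : ((EuclideanSpace.basisFun (Fin 4) ℝ).toBasis.toMatrix
        (Fin.cons n w : Fin 4 → E4)).transpose j.succ 0 = 0 := hw j
    rw [this]
    ring
  · simp

/-- The coefficient splits into the ambient coefficient, the normal component of the outward vector
and the tangential minor. None vanishes, and each has locally constant sign. -/
theorem boundaryForm_chartRep (hy : y ∈ inclDom b c C) :
    chartRep (𝓡 3) (fun p => boundaryForm o b p) c y (stdVec 3) =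
      chartRep (𝓡∂ 4) (fun x => o.form x) C (inclC b c C y) (stdVec 4) *
        (dchart C (b.incl ((extChartAt (𝓡 3) c).symm y)) outward 0 * (tangMatrix b c C y).det) := by
  set p := (extChartAt (𝓡 3) c).symm y with hp
  set x := b.incl p with hx
  have hz := inclC_mem_target hy
  let n := dchart C x outward
  let w : Fin 3 → E4 := fun i => fderiv ℝ (inclC b c C) y (stdVec 3 i)
  have h1 : chartRep (𝓡 3) (fun p => boundaryForm o b p) c y (stdVec 3) =
      chartMulti o.form C (inclC b c C y) (Fin.cons n w) := by
    refine chartRep_congr (α := fun x => o.form x) (pt_inclC hy).symm (funext fun i => ?_)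
    rw [pt_inclC hy]
    refine Fin.cases ?_ (fun i => ?_) i
    · exact (tv_dchart hy.2 outward).symm
    · exact (tv_fderiv_inclC hy _).symm
  have h2 := (chartMulti o.form C (inclC b c C y)).eq_smul_basis_det
    (EuclideanSpace.basisFun (Fin 4) ℝ).toBasis
  have h3 : (⇑(EuclideanSpace.basisFun (Fin 4) ℝ).toBasis : Fin 4 → E4) = stdVec 4 := by
    funext i
    simp [stdVec]
  rw [h3] at h2
  rw [h1, h2, chartRep_eq_chartMulti _ hz, AlternatingMap.smul_apply, smul_eq_mul,
    det_cons_hyperplane fun i => fderiv_inclC_zero hy _]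
  rfl

theorem continuousAt_det_tangMatrix (hy : y ∈ inclDom b c C) :
    ContinuousAt (fun y => (tangMatrix b c C y).det) y := by
  have h2 : ∀ i, ContinuousAt (fun y => fderiv ℝ (inclC b c C) y (stdVec 3 i)) y := fun i =>
    (((inclC_contDiffAt hy).fderiv_right (m := 0) (by simp)).clm_apply
      contDiffAt_const).continuousAt
  have h3 : ContinuousAt (fun y => tangMatrix b c C y) y :=
    continuousAt_pi.2 fun i => continuousAt_pi.2 fun j =>
      (EuclideanSpace.proj j.succ : E4 →L[ℝ] ℝ).continuous.continuousAt.comp (h2 i)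
  exact (Continuous.matrix_det continuous_id).continuousAt.comp h3

theorem eventually_sign_eq {X : Type*} [TopologicalSpace X] {g : X → ℝ} {q : X}
    (hg : ContinuousAt g q) (h0 : g q ≠ 0) :
    ∀ᶠ q' in 𝓝 q, SignType.sign (g q') = SignType.sign (g q) := by
  rcases lt_or_gt_of_ne h0 with h | h
  · filter_upwards [hg.eventually (gt_mem_nhds h)] with q' hq'
    rw [sign_neg hq', sign_neg h]
  · filter_upwards [hg.eventually (lt_mem_nhds h)] with q' hq'
    rw [sign_pos hq', sign_pos h]

/-- The boundary orientation is an orientation. -/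
theorem isOrienting_boundaryForm : IsOrienting (n := 3) (boundaryForm o b) := by
  intro c y hy
  set C := b.incl ((extChartAt (𝓡 3) c).symm y)
  have hy' : y ∈ inclDom b c C := self_mem_inclDom hy
  have hform := o.smooth C (stdVec 4) _ (inclC_mem_target hy')
  have hc1 : ContinuousAt (fun y => chartRep (𝓡∂ 4) (fun x => o.form x) C (inclC b c C y)
      (stdVec 4)) y :=
    (hform.continuousWithinAt.comp ((inclC_contDiffAt hy').continuousAt.continuousWithinAt
      (s := inclDom b c C)) fun y' hy' => inclC_mem_target hy').continuousAt
      ((isOpen_inclDom b c C).mem_nhds hy')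
  have hn1 : chartRep (𝓡∂ 4) (fun x => o.form x) C (inclC b c C y) (stdVec 4) ≠ 0 := by
    rw [chartRep_eq_chartMulti _ (inclC_mem_target hy')]
    exact chartMulti_ne_zero (inclC_mem_target hy')
  -- The outward vector is a coordinate vector of the chart at each point separately, so in the
  -- fixed chart C it need not vary continuously. The sign of its normal component is nevertheless
  -- always -1, by `dchart_pos`.
  have hneg : ∀ y' ∈ inclDom b c C,
      SignType.sign (dchart C (b.incl ((extChartAt (𝓡 3) c).symm y')) outward 0) = -1 := by
    intro y' hy'
    have := dchart_pos hy'.2 (b.range_eq ▸ mem_range_self _)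
    refine sign_neg ?_
    rw [outward, map_neg, PiLp.neg_apply]
    linarith
  filter_upwards [(isOpen_inclDom b c C).mem_nhds hy', eventually_sign_eq hc1 hn1,
    eventually_sign_eq (continuousAt_det_tangMatrix hy') (det_tangMatrix_ne_zero hy')]
    with y'' h1 h2 h3
  unfold chartSign
  rw [boundaryForm_chartRep h1, boundaryForm_chartRep hy', sign_mul, sign_mul, sign_mul, sign_mul,
    h2, h3, hneg _ h1, hneg _ hy']

/-! ### Naturality of the exterior derivative -/

theorem chartRep_two {β : ∀ x : M, TangentSpace (𝓡∂ 4) x [⋀^Fin 2]→ₗ[ℝ] ℝ} (z : E4)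
    (v : Fin 2 → E4) : chartMulti β C z v = chartMulti β C z ![v 0, v 1] := by
  congr 1
  funext i
  fin_cases i <;> rfl

/-- A 2-form in a chart as a bilinear map. -/
def chartBilin (β : ∀ x : M, TangentSpace (𝓡∂ 4) x [⋀^Fin 2]→ₗ[ℝ] ℝ) (C : M) (z : E4) :
    E4 →L[ℝ] E4 →L[ℝ] ℝ :=
  toCLM₂ (LinearMap.mk₂ ℝ (fun u w => chartMulti β C z ![u, w])
    (fun u u' w => (chartMulti β C z).map_vecCons_add ![w] u u')
    (fun r u w => (chartMulti β C z).map_vecCons_smul ![w] r u)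
    (fun u w w' => ((chartMulti β C z).curryLeft u).map_vecCons_add ![] w w')
    (fun r u w => ((chartMulti β C z).curryLeft u).map_vecCons_smul ![] r w))

theorem chartBilin_apply (β : ∀ x : M, TangentSpace (𝓡∂ 4) x [⋀^Fin 2]→ₗ[ℝ] ℝ) (z u w : E4) :
    chartBilin β C z u w = chartMulti β C z ![u, w] := rfl

theorem chartBilin_swap (β : ∀ x : M, TangentSpace (𝓡∂ 4) x [⋀^Fin 2]→ₗ[ℝ] ℝ) (z u w : E4) :
    chartBilin β C z u w = -chartBilin β C z w u := by
  rw [chartBilin_apply, chartBilin_apply, ← (chartMulti β C z).map_swap _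
    (show (0 : Fin 2) ≠ 1 by decide)]
  congr 1
  funext i
  fin_cases i <;> rfl

theorem chartBilin_contDiff {β : ∀ x : M, TangentSpace (𝓡∂ 4) x [⋀^Fin 2]→ₗ[ℝ] ℝ}
    (hβ : IsSmoothForm (𝓡∂ 4) β) {z : E4} (hz : z ∈ (extChartAt (𝓡∂ 4) C).target) :
    ContDiffWithinAt ℝ ∞ (chartBilin β C) halfSpace z := by
  refine contDiffWithinAt_clm_of_apply fun u => contDiffWithinAt_clm_of_apply fun w => ?_
  have h := hβ C ![u, w] z hz
  have h1 : (extChartAt (𝓡∂ 4) C).target ∈ 𝓝[halfSpace] z :=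
    extChartAt_target_mem_nhdsWithin_of_mem hz
  refine ((h.mono_of_mem_nhdsWithin h1)).congr_of_eventuallyEq ?_ ?_
  · filter_upwards [h1] with z' hz'
    rw [chartBilin_apply, chartRep_eq_chartMulti β hz']
  · rw [chartBilin_apply, chartRep_eq_chartMulti β hz]

/-- The exterior derivative commutes with the pull-back to the boundary. -/
theorem chartExtDer_pullback {β : ∀ x : M, TangentSpace (𝓡∂ 4) x [⋀^Fin 2]→ₗ[ℝ] ℝ}
    (hβ : IsSmoothForm (𝓡∂ 4) β) (hy : y ∈ (extChartAt (𝓡 3) c).target)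
    (hC : C = b.incl ((extChartAt (𝓡 3) c).symm y)) :
    chartExtDer (pullback b β) c y =
      extDer (𝓡∂ 4) β C fun i => (fderiv ℝ (inclC b c C) y (stdVec 3 i) : E4) := by
  have hy' : y ∈ inclDom b c C := hC ▸ self_mem_inclDom hy
  set G := inclC b c C with hGd
  have hG : ContDiffAt ℝ ∞ G y := inclC_contDiffAt hy'
  have hz : G y ∈ (extChartAt (𝓡∂ 4) C).target := inclC_mem_target hy'
  have hzC : extChartAt (𝓡∂ 4) C C = G y := by rw [hGd, inclC, ← hC]
  have hzm : G y ∈ halfSpace := inclC_mem_halfSpace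
  have hB := (chartBilin_contDiff hβ hz).differentiableWithinAt (by simp)
  set B := chartBilin β C with hBd
  set B' := fderivWithin ℝ B halfSpace (G y) with hB'
  have hBG : HasFDerivAt (fun y => B (G y)) (B'.comp (fderiv ℝ G y)) y :=
    hB.hasFDerivWithinAt.comp_hasFDerivAt y (hG.differentiableAt (by simp)).hasFDerivAt
      (Filter.Eventually.of_forall fun _ => inclC_mem_halfSpace)
  have hDG : HasFDerivAt (fderiv ℝ G) (fderiv ℝ (fderiv ℝ G) y) y :=
    ((hG.fderiv_right (m := ∞) (by simp)).differentiableAt (by simp)).hasFDerivAt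
  -- Pulling back differentiates the vectors dG(v) as well. After alternation the second derivatives
  -- of G cancel by symmetry, one pair needing also the antisymmetry of the 2-form.
  have hsymm : ∀ u v, fderiv ℝ (fderiv ℝ G) y u v = fderiv ℝ (fderiv ℝ G) y v u := fun u v =>
    (hG.isSymmSndFDerivAt (by simp only [minSmoothness_of_isRCLikeNormedField]; exact WithTop.coe_le_coe.2 le_top)) u v
  have hDGv : ∀ v, HasFDerivAt (fun y => fderiv ℝ G y v) ((fderiv ℝ (fderiv ℝ G) y).flip v) y :=
    fun v => (hDG.clm_apply (hasFDerivAt_const v y)).congr_fderiv (by ext; simp)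
  have hfd : ∀ t v w : E3, fderiv ℝ (fun y => chartRep (𝓡 3) (fun p => pullback b β p) c y ![v, w])
      y t = B' (fderiv ℝ G y t) (fderiv ℝ G y v) (fderiv ℝ G y w) +
        B (G y) (fderiv ℝ (fderiv ℝ G) y t v) (fderiv ℝ G y w) +
        B (G y) (fderiv ℝ G y v) (fderiv ℝ (fderiv ℝ G) y t w) := by
    intro t v w
    have he : (fun y => chartRep (𝓡 3) (fun p => pullback b β p) c y ![v, w]) =ᶠ[𝓝 y]
        fun y => B (G y) (fderiv ℝ G y v) (fderiv ℝ G y w) := by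
      filter_upwards [(isOpen_inclDom b c C).mem_nhds hy'] with y' hy''
      rw [chartRep_pullback β hy'', chartRep_eq_chartMulti β (inclC_mem_target hy''), chartRep_two]
      rfl
    have h1 := ((hBG.clm_apply (hDGv v)).clm_apply (hDGv w)).fderiv
    rw [he.fderiv_eq, h1]
    simp
    ring
  have hext : ∀ t v w : E4, fderivWithin ℝ (fun z => chartRep (𝓡∂ 4) (fun x => β x) C z ![v, w])
      (range (𝓡∂ 4)) (extChartAt (𝓡∂ 4) C C) t = B' t v w := by
    intro t v w
    have h1 : (fun z => chartRep (𝓡∂ 4) (fun x => β x) C z ![v, w]) =ᶠ[𝓝[halfSpace] (G y)]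
        fun z => B z v w := by
      filter_upwards [extChartAt_target_mem_nhdsWithin_of_mem (I := 𝓡∂ 4) hz] with z hz
      rw [chartRep_eq_chartMulti β hz]
      rfl
    rw [hzC, h1.fderivWithin_eq_of_mem hzm]
    have hu := unique_halfSpace hzm
    rw [fderivWithin_apply_const (hB.clm_apply (differentiableWithinAt_const v)) hu,
      fderivWithin_apply_const hB hu]
  have hL : chartExtDer (pullback b β) c y =
      fderiv ℝ (fun y => chartRep (𝓡 3) (fun p => pullback b β p) c y ![stdVec 3 1, stdVec 3 2])
        y (stdVec 3 0) -
      fderiv ℝ (fun y => chartRep (𝓡 3) (fun p => pullback b β p) c y ![stdVec 3 0, stdVec 3 2])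
        y (stdVec 3 1) +
      fderiv ℝ (fun y => chartRep (𝓡 3) (fun p => pullback b β p) c y ![stdVec 3 0, stdVec 3 1])
        y (stdVec 3 2) := by
    have e0 : (fun j => stdVec 3 ((0 : Fin 3).succAbove j)) = ![stdVec 3 1, stdVec 3 2] := by
      funext j; fin_cases j <;> rfl
    have e1 : (fun j => stdVec 3 ((1 : Fin 3).succAbove j)) = ![stdVec 3 0, stdVec 3 2] := by
      funext j; fin_cases j <;> rfl
    have e2 : (fun j => stdVec 3 ((2 : Fin 3).succAbove j)) = ![stdVec 3 0, stdVec 3 1] := by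
      funext j; fin_cases j <;> rfl
    rw [chartExtDer, Fin.sum_univ_three, e0, e1, e2]
    simp
    ring
  have hR : ∀ u : Fin 3 → E4, extDer (𝓡∂ 4) β C u =
      B' (u 0) (u 1) (u 2) - B' (u 1) (u 0) (u 2) + B' (u 2) (u 0) (u 1) := by
    intro u
    have e0 : (fun j => u ((0 : Fin 3).succAbove j)) = ![u 1, u 2] := by
      funext j; fin_cases j <;> rfl
    have e1 : (fun j => u ((1 : Fin 3).succAbove j)) = ![u 0, u 2] := by
      funext j; fin_cases j <;> rfl
    have e2 : (fun j => u ((2 : Fin 3).succAbove j)) = ![u 0, u 1] := by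
      funext j; fin_cases j <;> rfl
    have hdef : extDer (𝓡∂ 4) β C u = ∑ i : Fin 3, (-1 : ℝ) ^ (i : ℕ) *
      (fderivWithin ℝ (fun z => chartRep (𝓡∂ 4) (fun x => β x) C z fun j => u (i.succAbove j))
        (range (𝓡∂ 4)) (extChartAt (𝓡∂ 4) C C) : E4 →L[ℝ] ℝ) (u i) := rfl
    rw [hdef, Fin.sum_univ_three, e0, e1, e2, hext, hext, hext]
    simp
    ring
  refine Eq.trans ?_ (hR fun i => fderiv ℝ G y (stdVec 3 i)).symm
  rw [hL, hfd, hfd, hfd, hsymm (stdVec 3 1) (stdVec 3 0), hsymm (stdVec 3 2) (stdVec 3 0),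
    hsymm (stdVec 3 2) (stdVec 3 1)]
  have h1 := chartBilin_swap (C := C) β (G y) (fderiv ℝ (fderiv ℝ G) y (stdVec 3 0) (stdVec 3 2))
    (fderiv ℝ G y (stdVec 3 1))
  linear_combination h1

variable [CompactSpace N] [T2Space N]

/-! ### The boundary integral -/

theorem boundaryIntegral_lin {α β : ∀ x : M, TangentSpace (𝓡∂ 4) x [⋀^Fin 3]→ₗ[ℝ] ℝ}
    (hα : IsSmoothForm (𝓡∂ 4) α) (hβ : IsSmoothForm (𝓡∂ 4) β) (r s : ℝ) :
    boundaryIntegral o b (fun x => r • α x + s • β x) =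
      r * boundaryIntegral o b α + s * boundaryIntegral o b β :=
  integral_lin isOrienting_boundaryForm (fun c => (contDiffOn_pullback hα c _).continuousOn)
    (fun c => (contDiffOn_pullback hβ c _).continuousOn) r s

/-- The integral of an exact form over the boundary vanishes. -/
theorem boundaryIntegral_eq_zero {α : ∀ x : M, TangentSpace (𝓡∂ 4) x [⋀^Fin 3]→ₗ[ℝ] ℝ}
    {β : ∀ x : M, TangentSpace (𝓡∂ 4) x [⋀^Fin 2]→ₗ[ℝ] ℝ} (hβ : IsSmoothForm (𝓡∂ 4) β)
    (h : ∀ x v, α x v = extDer (𝓡∂ 4) β x v) : boundaryIntegral o b α = 0 := by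
  refine integral_eq_zero_of_exact (α := pullback b α) (w := pullback b β) (contDiffOn_pullback hβ)
    (isOrienting_boundaryForm (o := o) (b := b)) fun c y hy => ?_
  -- The exterior derivative on M is computed in the chart at the point itself, so C is the image
  -- point, where coordinate vectors and tangent vectors coincide.
  rw [chartExtDer_pullback hβ hy rfl]
  refine (h _ _).trans (congrArg (extDer (𝓡∂ 4) β _) (funext fun i => ?_))
  have h1 := tv_fderiv_inclC (self_mem_inclDom (b := b) hy) (stdVec 3 i)
  rw [tv_self] at h1
  exact h1.symm

end BoundaryStokes

/-! ### The pre-boundary two-form. -/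

section TwoForm

variable {M : Type*} [TopologicalSpace M] [ChartedSpace (EuclideanHalfSpace 4) M]
  [IsManifold (𝓡∂ 4) ∞ M]

theorem IsSmoothForm.lin {k : ℕ} {α β : ∀ x : M, TangentSpace (𝓡∂ 4) x [⋀^Fin k]→ₗ[ℝ] ℝ}
    (hα : IsSmoothForm (𝓡∂ 4) α) (hβ : IsSmoothForm (𝓡∂ 4) β) (r s : ℝ) :
    IsSmoothForm (𝓡∂ 4) fun x => r • α x + s • β x := fun c v =>
  (contDiffOn_const.mul (hα c v)).add (contDiffOn_const.mul (hβ c v))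

variable {V : M → Type*} [TopologicalSpace (TotalSpace Mink V)] [∀ x, AddCommGroup (V x)]
  [∀ x, Module ℝ (V x)] [∀ x, TopologicalSpace (V x)] [∀ x, IsTopologicalAddGroup (V x)]
  [∀ x, ContinuousSMul ℝ (V x)] [FiberBundle Mink V] [VectorBundle ℝ Mink V]
  [ContMDiffVectorBundle ∞ Mink V (𝓡∂ 4)] {P : MinkowskiBundle V} [T2Space M]
  {N : Type*} [TopologicalSpace N] [ChartedSpace (EuclideanSpace ℝ (Fin 3)) N]
  [IsManifold (𝓡 3) ∞ N] [CompactSpace N] [T2Space N]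
  (o : OrientationForm M) (b : BoundaryInclusion M N)
  {A₀ : Connection P} {r s : ℝ}

/-- The derivative of the boundary form `θ_φ(Y)` with respect to `φ` in the direction `X`. -/
def thetaDeriv (r s : ℝ) (φ X Y : FieldSpace P) (x : M) :
    TangentSpace (𝓡∂ 4) x [⋀^Fin 3]→ₗ[ℝ] ℝ :=
  (1 : ℝ) • kForm r s Y φ X x + (-(1 / 2) : ℝ) • hForm X Y x

theorem isSmoothForm_thetaDeriv (φ X Y : FieldSpace P) :
    IsSmoothForm (𝓡∂ 4) (thetaDeriv r s φ X Y) :=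
  isSmoothForm_kForm.lin isSmoothForm_hForm 1 (-(1 / 2))

/-- The integrand `δθ_φ(X, Y)` of the pre-boundary two-form. -/
def symplForm (r s : ℝ) (φ X Y : FieldSpace P) (x : M) :
    TangentSpace (𝓡∂ 4) x [⋀^Fin 3]→ₗ[ℝ] ℝ :=
  (1 : ℝ) • thetaDeriv r s φ X Y x + (-1 : ℝ) • thetaDeriv r s φ Y X x

theorem isSmoothForm_symplForm (φ X Y : FieldSpace P) :
    IsSmoothForm (𝓡∂ 4) (symplForm r s φ X Y) :=
  (isSmoothForm_thetaDeriv φ X Y).lin (isSmoothForm_thetaDeriv φ Y X) 1 (-1)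

/-- The boundary form is a quadratic polynomial in the field. The two slots of e contribute equally,
which turns the coefficient 1/2 of `thetaForm` into the 1 of `thetaDeriv`. -/
theorem thetaForm_add_smul (φ X Y : FieldSpace P) (t : ℝ) (x : M) :
    thetaForm r s (φ + t • X) Y x =
      (1 : ℝ) • ((1 : ℝ) • thetaForm r s φ Y x + t • thetaDeriv r s φ X Y x) +
        (t ^ 2 / 2) • kForm r s Y X X x := by
  have h : φ + t • X = (1 : ℝ) • φ + t • X := by rw [one_smul]
  rw [h, thetaForm, kForm_lin_middle, kForm_lin_right, kForm_lin_right, hForm_lin_left, thetaForm,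
    thetaDeriv, kForm_swap Y X φ]
  module

/-- After integration one has a polynomial in t with constant coefficients, so no differentiation
under the integral sign is involved. -/
theorem deriv_boundaryIntegral_thetaForm (φ X Y : FieldSpace P) :
    deriv (fun t : ℝ => boundaryIntegral o b (thetaForm r s (φ + t • X) Y)) 0 =
      boundaryIntegral o b (thetaDeriv r s φ X Y) := by
  have h : (fun t : ℝ => boundaryIntegral o b (thetaForm r s (φ + t • X) Y)) = fun t =>
      boundaryIntegral o b (thetaForm r s φ Y) + t * boundaryIntegral o b (thetaDeriv r s φ X Y) +
        t ^ 2 * (boundaryIntegral o b (kForm r s Y X X) / 2) := by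
    funext t
    rw [show thetaForm r s (φ + t • X) Y = _ from funext fun x => thetaForm_add_smul φ X Y t x,
      boundaryIntegral_lin
        (isSmoothForm_thetaForm.lin (isSmoothForm_thetaDeriv φ X Y) 1 t) isSmoothForm_kForm,
      boundaryIntegral_lin isSmoothForm_thetaForm (isSmoothForm_thetaDeriv φ X Y)]
    ring
  rw [h]
  have h1 := (((hasDerivAt_id (0 : ℝ)).mul_const
    (boundaryIntegral o b (thetaDeriv r s φ X Y))).const_add
    (boundaryIntegral o b (thetaForm r s φ Y))).add ((hasDerivAt_pow 2 (0 : ℝ)).mul_const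
      (boundaryIntegral o b (kForm r s Y X X) / 2))
  exact (h1.congr_deriv (by simp)).deriv

theorem twoForm_variationalData
    {L : FieldSpace P → ∀ x : M, (Fin 4 → TangentSpace (𝓡∂ 4) x) → ℝ} (hL : L = holst r s A₀)
    (φ X Y : FieldSpace P) : (variationalData A₀ r s hL).twoForm o b φ X Y =
      boundaryIntegral o b (symplForm r s φ X Y) := by
  have h := boundaryIntegral_lin (o := o) (b := b) (isSmoothForm_thetaDeriv (r := r) (s := s) φ X Y)
    (isSmoothForm_thetaDeriv (r := r) (s := s) φ Y X) 1 (-1)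
  refine Eq.trans ?_ h.symm
  rw [← deriv_boundaryIntegral_thetaForm, ← deriv_boundaryIntegral_thetaForm, one_mul, neg_one_mul,
    ← sub_eq_add_neg]
  rfl

end TwoForm

/-! ## Fields with given components -/

/-- The fibres of V and of TM are only topological vector spaces, without a chosen norm; hence the
formulation without norms. -/
theorem hasDerivAt_clm_comp {F G : Type*} [AddCommGroup F] [Module ℝ F] [TopologicalSpace F]
    [ContinuousSMul ℝ F] [AddCommGroup G] [Module ℝ G] [TopologicalSpace G] [ContinuousSMul ℝ G]
    (L : F →L[ℝ] G) {v : ℝ → F} {v' : F} {t : ℝ}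
    (h : HasDerivAt v v' t) : HasDerivAt (fun r => L (v r)) (L v') t := by
  refine HasFDerivAtFilter.of_isLittleOTVS ?_
  have h1 := (L.isBigOTVS_comp (f := fun p : ℝ × ℝ => v p.1 - v p.2 -
    (ContinuousLinearMap.toSpanSingleton ℝ v') (p.1 - p.2)) (l := 𝓝 t ×ˢ pure t)).trans_isLittleOTVS
    (HasFDerivAtFilter.isLittleOTVS h)
  refine h1.congr_left fun p => ?_
  simp

theorem hasDerivAt_clm_of_apply {F G : Type*} [NormedAddCommGroup F] [NormedSpace ℝ F]
    [FiniteDimensional ℝ F] [NormedAddCommGroup G] [NormedSpace ℝ G] {v : ℝ → F →L[ℝ] G}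
    {v' : F →L[ℝ] G} {t : ℝ} (h : ∀ w, HasDerivAt (fun r => v r w) (v' w) t) :
    HasDerivAt v v' t := by
  let b := Module.finBasis ℝ F
  let r : Fin (Module.finrank ℝ F) → G →L[ℝ] F →L[ℝ] G := fun i =>
    ContinuousLinearMap.smulRightL ℝ F G (LinearMap.toContinuousLinearMap (b.coord i))
  have hf : ∀ L : F →L[ℝ] G, L = ∑ i, r i (L (b i)) := by
    intro L
    ext w
    simp only [sum_apply, r, ContinuousLinearMap.smulRightL_apply_apply]
    conv_lhs => rw [← b.sum_repr w, map_sum]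
    simp
  rw [hf v', show v = fun s => ∑ i, r i (v s (b i)) from funext fun s => hf _]
  exact HasDerivAt.fun_sum fun i _ => hasDerivAt_clm_comp (r i) (h (b i))

theorem hasDerivAt_clm_apply_const {F G : Type*} [NormedAddCommGroup F] [NormedSpace ℝ F]
    [NormedAddCommGroup G] [NormedSpace ℝ G] {v : ℝ → F →L[ℝ] G} {v' : F →L[ℝ] G} {t : ℝ}
    (h : HasDerivAt v v' t) (w : F) : HasDerivAt (fun r => v r w) (v' w) t :=
  hasDerivAt_clm_comp (ContinuousLinearMap.apply ℝ G w) h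

section

variable {M : Type*} [TopologicalSpace M] [ChartedSpace (EuclideanHalfSpace 4) M]
  [IsManifold (𝓡∂ 4) ∞ M]
  {V : M → Type*} [TopologicalSpace (TotalSpace Mink V)] [∀ x, AddCommGroup (V x)]
  [∀ x, Module ℝ (V x)] [∀ x, TopologicalSpace (V x)] [∀ x, IsTopologicalAddGroup (V x)]
  [∀ x, ContinuousSMul ℝ (V x)] [FiberBundle Mink V] [VectorBundle ℝ Mink V]
  [ContMDiffVectorBundle ∞ Mink V (𝓡∂ 4)] {P : MinkowskiBundle V} {f : LocalFrame P} {c x : M}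

/-- Linear maps on the fibres are continuous. -/
theorem continuous_of_fibre {F : Type*} [AddCommGroup F] [Module ℝ F] [TopologicalSpace F]
    [IsTopologicalAddGroup F] [ContinuousSMul ℝ F] (x : M) (L : V x →ₗ[ℝ] F) : Continuous L := by
  let e := (trivializationAt Mink V x).continuousLinearEquivAt ℝ x
    (FiberBundle.mem_baseSet_trivializationAt' x)
  have h : Continuous (L ∘ₗ e.symm.toLinearMap) := LinearMap.continuous_of_finiteDimensional _
  refine (h.comp e.continuous).congr fun v => ?_
  simp

theorem hasDerivAt_iff_coord (hx : x ∈ f.U) {v : ℝ → V x} {v' : V x} {t : ℝ} :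
    HasDerivAt v v' t ↔ HasDerivAt (fun r => f.coord x (v r)) (f.coord x v') t := by
  constructor
  · exact fun h => hasDerivAt_clm_comp ⟨f.coord x, continuous_of_fibre x _⟩ h
  · intro h
    have h1 := hasDerivAt_clm_comp
      (⟨f.lift x, LinearMap.continuous_of_finiteDimensional _⟩ : Mink →L[ℝ] V x) h
    simpa [LocalFrame.lift_coord hx] using h1

section Velocity

variable {γ : ℝ → FieldSpace P} {t : ℝ} {X : FieldSpace P}

theorem HasVelocity.eC (h : HasVelocity γ t X) (hx : x ∈ f.U) :
    HasDerivAt (fun r => (γ r).eC f c x) (X.eC f c x) t :=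
  hasDerivAt_clm_of_apply fun _ => (hasDerivAt_iff_coord hx).1 (h x _ 0 0).1

theorem HasVelocity.aC (h : HasVelocity γ t X) (hx : x ∈ f.U) :
    HasDerivAt (fun r => (γ r).aC f c x) (X.aC f c x) t :=
  hasDerivAt_clm_of_apply fun u => hasDerivAt_clm_of_apply fun s =>
    (hasDerivAt_iff_coord hx).1 (h x (tv c x u) 0 (f.lift x s)).2.1

theorem HasVelocity.τC (h : HasVelocity γ t X) (hx : x ∈ f.U) :
    HasDerivAt (fun r => (γ r).τC f c x) (X.τC f c x) t :=
  hasDerivAt_clm_of_apply fun u => hasDerivAt_clm_of_apply fun v =>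
    (hasDerivAt_iff_coord hx).1 (h x (tv c x u) (tv c x v) 0).2.2

theorem hasVelocity_of_components [T2Space M]
    (he : ∀ x, HasDerivAt (fun r => (γ r).eC (frameAt P x) x x) (X.eC (frameAt P x) x x) t)
    (ha : ∀ x, HasDerivAt (fun r => (γ r).aC (frameAt P x) x x) (X.aC (frameAt P x) x x) t)
    (hτ : ∀ x, HasDerivAt (fun r => (γ r).τC (frameAt P x) x x) (X.τC (frameAt P x) x x) t) :
    HasVelocity γ t X := by
  intro x u v s
  have hx := mem_frameAt (P := P) x
  refine ⟨(hasDerivAt_iff_coord hx).2 ?_, (hasDerivAt_iff_coord hx).2 ?_,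
    (hasDerivAt_iff_coord hx).2 ?_⟩
  · have h := hasDerivAt_clm_apply_const (F := E4) (he x) u
    simpa only [eC_self] using h
  · have h := hasDerivAt_clm_apply_const (hasDerivAt_clm_apply_const (F := E4) (ha x) u)
      ((frameAt P x).coord x s)
    simpa only [aC_self, LocalFrame.lift_coord hx] using h
  · have h := hasDerivAt_clm_apply_const (F := E4) (hasDerivAt_clm_apply_const (F := E4) (hτ x) u) v
    simpa only [τC_self] using h

end Velocity

section Smooth

variable {EQ HQ Q : Type*} [NormedAddCommGroup EQ] [NormedSpace ℝ EQ]
    [TopologicalSpace HQ] {IQ : ModelWithCorners ℝ EQ HQ} [TopologicalSpace Q] [ChartedSpace HQ Q]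
    {p : Q → M} {s : Set Q} {q : Q} (hp : ContMDiffWithinAt IQ (𝓡∂ 4) ∞ p s q)
include hp

theorem contMDiffWithinAt_two_form (hU : p q ∈ f.U)
    {β : ∀ q, TangentSpace (𝓡∂ 4) (p q) →L[ℝ] TangentSpace (𝓡∂ 4) (p q) →L[ℝ] V (p q)}
    (h : ∀ u v : E4, ContMDiffWithinAt IQ 𝓘(ℝ, Mink) ∞ (fun q' => f.coord (p q')
      (β q' (tv (p q) (p q') u) (tv (p q) (p q') v))) s q) :
    ContMDiffWithinAt IQ ((𝓡∂ 4).prod 𝓘(ℝ, E4 →L[ℝ] E4 →L[ℝ] Mink)) ∞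
      (fun q => (⟨p q, β q⟩ : TotalSpace (E4 →L[ℝ] E4 →L[ℝ] Mink)
        fun x : M => TangentSpace (𝓡∂ 4) x →L[ℝ] TangentSpace (𝓡∂ 4) x →L[ℝ] V x)) s q := by
  have hc : ContinuousWithinAt p (insert q s) q := hp.continuousWithinAt.insert
  have hs := hc ((chartAt (EuclideanHalfSpace 4) (p q)).open_source.mem_nhds (mem_chart_source _ _))
  refine contMDiffWithinAt_hom_of_apply hp fun u => contMDiffWithinAt_hom_of_apply hp fun v =>
    contMDiffWithinAt_of_coord f hU hp ((h u v).congr_of_eventuallyEq_insert ?_)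
  filter_upwards [hs] with q' hq'
  have e1 := tv_eq_symm hq' u
  have e2 := tv_eq_symm hq' v
  rw [e1, e2]

/-- Smoothness of a bundle map is tested on constant sections of a trivialisation. These have smooth
components in the local frame, so frame sections may be used instead. -/
theorem contMDiffWithinAt_end_form (hU : p q ∈ f.U)
    {β : ∀ q, V (p q) →L[ℝ] TangentSpace (𝓡∂ 4) (p q) →L[ℝ] V (p q)}
    (h : ∀ (w : Mink) (u : E4), ContMDiffWithinAt IQ 𝓘(ℝ, Mink) ∞ (fun q' => f.coord (p q')
      (β q' (f.lift (p q') w) (tv (p q) (p q') u))) s q) :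
    ContMDiffWithinAt IQ ((𝓡∂ 4).prod 𝓘(ℝ, Mink →L[ℝ] E4 →L[ℝ] Mink)) ∞
      (fun q => (⟨p q, β q⟩ : TotalSpace (Mink →L[ℝ] E4 →L[ℝ] Mink)
        fun x : M => V x →L[ℝ] TangentSpace (𝓡∂ 4) x →L[ℝ] V x)) s q := by
  have hc : ContinuousWithinAt p (insert q s) q := hp.continuousWithinAt.insert
  have hs := hc ((chartAt (EuclideanHalfSpace 4) (p q)).open_source.mem_nhds (mem_chart_source _ _))
  refine contMDiffWithinAt_hom_of_apply hp fun w => contMDiffWithinAt_hom_of_apply hp fun u =>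
    contMDiffWithinAt_of_coord f hU hp ?_
  have h1 := contMDiffWithinAt_coord f hU ((symm_contMDiffAt (V := V) (x₀ := p q)
    (FiberBundle.mem_baseSet_trivializationAt' (p q)) w).comp_contMDiffWithinAt q hp)
  have h2 : ∀ i, ContMDiffWithinAt IQ 𝓘(ℝ, ℝ) ∞ (fun q' => f.coord (p q')
      ((trivializationAt Mink V (p q)).symm (p q') w) i) s q := fun i =>
    (ContinuousLinearMap.proj (R := ℝ) (φ := fun _ : Fin 4 => ℝ)
      i).contMDiff.contMDiffAt.comp_contMDiffWithinAt q h1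
  have h3 := ContMDiffWithinAt.sum (t := Finset.univ) fun i _ => (h2 i).smul (h (Pi.single i 1) u)
  refine h3.congr_of_eventuallyEq_insert ?_
  filter_upwards [hs, hc (f.isOpen.mem_nhds hU)] with q' hq' hf
  have e1 := tv_eq_symm hq' u
  rw [← e1]
  have e2 := LocalFrame.lift_coord hf ((trivializationAt Mink V (p q)).symm (p q') w)
  conv_lhs => rw [← e2, LocalFrame.lift_apply]
  simp [LocalFrame.lift_single]

end Smooth

end

/-! ## The internal Hodge star on fields -/

/-- The Hodge star as a linear map. -/
def starC : (Mink →L[ℝ] Mink) →L[ℝ] (Mink →L[ℝ] Mink) :=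
  LinearMap.toContinuousLinearMap
    { toFun := fun α => LinearMap.toContinuousLinearMap (starEnd (α : Module.End ℝ Mink))
      map_add' := fun α β => by
        ext v j
        simp [starEnd, traceModel_add]
        ring
      map_smul' := fun r α => by
        ext v j
        simp [starEnd, traceModel_smul]
        ring }

theorem isSkew_starC (α : Mink →L[ℝ] Mink) : IsSkew (starC α) := starEnd_mem _

theorem starC_starC {α : Mink →L[ℝ] Mink} (h : IsSkew α) : starC (starC α) = -α := by
  have h1 := congrArg (fun S : Module.End ℝ so31 => ((S ⟨α, h⟩ : so31) : Module.End ℝ Mink))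
    star_mul_star
  have h2 : starEnd (starEnd (α : Module.End ℝ Mink)) = (-1 : ℝ) • (α : Module.End ℝ Mink) := h1
  ext1 v
  have h3 := LinearMap.congr_fun h2 v
  refine Eq.trans h3 ?_
  simp

theorem ηC_starC (α : Mink →L[ℝ] Mink) (v w : Mink) : ηC (starC α v) w = -pairC 0 1 α v w := by
  have h := killingModel_starEnd (α : Module.End ℝ Mink) v w
  rw [pairC_apply, pairing, ← h, ηC_apply]
  simp only [killingModel]
  change minkowskiForm (starEnd (α : Module.End ℝ Mink) v) w = _
  ring

/-- From tr[⋆α ∧ v ∧ w] = ⟨⋆⋆α, v ∧ w⟩ = -⟨α, v ∧ w⟩, the summand -c⋆α contributes the Killing term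
with coefficient c. -/
theorem pairC_mix (c d : ℝ) {α : Mink →L[ℝ] Mink} (h : IsSkew α) (v w : Mink) :
    pairC 0 1 (d • α + (-c) • starC α) v w = pairC c d α v w := by
  have h1 : pairC 0 1 (starC α) v w = ηC (α v) w := by
    have := ηC_starC (starC α) v w
    rw [starC_starC h, neg_apply, map_neg, neg_apply] at this
    linarith
  have h2 : pairC c d α v w = -c * ηC (α v) w + d * pairC 0 1 α v w := by
    rw [pairC_apply, pairC_apply, pairing, pairing, killingModel, ηC_apply]
    change c * -minkowskiForm (α v) w + _ = _
    ring
  simp only [map_add, map_smul, add_apply, smul_apply, smul_eq_mul, h1, h2]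
  ring

section

variable {M : Type*} [TopologicalSpace M] [ChartedSpace (EuclideanHalfSpace 4) M]
  [IsManifold (𝓡∂ 4) ∞ M]
  {V : M → Type*} [TopologicalSpace (TotalSpace Mink V)] [∀ x, AddCommGroup (V x)]
  [∀ x, Module ℝ (V x)] [∀ x, TopologicalSpace (V x)] [∀ x, IsTopologicalAddGroup (V x)]
  [∀ x, ContinuousSMul ℝ (V x)] [FiberBundle Mink V] [VectorBundle ℝ Mink V]
  [ContMDiffVectorBundle ∞ Mink V (𝓡∂ 4)] {P : MinkowskiBundle V} {f : LocalFrame P} {c x : M}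
  [T2Space M]

/-- A bilinear map with given components at a point. -/
def endOfComponents (f : LocalFrame P) (x : M) (B : E4 →L[ℝ] Mink →L[ℝ] Mink) :
    V x →L[ℝ] TangentSpace (𝓡∂ 4) x →L[ℝ] V x :=
  let L : V x →ₗ[ℝ] E4 →L[ℝ] V x :=
    { toFun := fun s => (⟨f.lift x, LinearMap.continuous_of_finiteDimensional _⟩ : Mink →L[ℝ] V x) ∘L
        (B.flip (f.coord x s))
      map_add' := fun s t => by ext u; simp
      map_smul' := fun r s => by ext u; simp }
  ⟨L, continuous_of_fibre x L⟩

/-- The internal Hodge star of the 1-form `A - A₀`. -/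
def starA (φ : FieldSpace P) (x : M) : V x →L[ℝ] TangentSpace (𝓡∂ 4) x →L[ℝ] V x :=
  endOfComponents (frameAt P x) x (starC ∘L φ.aC (frameAt P x) x x)

/-- The star is characterised by its η-products with all vectors, and these are values of an
invariant pairing. So the definition in a chosen frame gives the same result in every frame. -/
theorem coord_starA (φ : FieldSpace P) (hx : x ∈ f.U) (s : V x)
    (u : TangentSpace (𝓡∂ 4) x) :
    f.coord x (starA φ x s u) = starC (φ.aC f x x u) (f.coord x s) := by
  set F := frameAt P x
  have hF : x ∈ F.U := mem_frameAt x
  have h1 : starA φ x s u = F.lift x (starC (φ.aC F x x u) (F.coord x s)) := rfl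
  have h2 : ∀ t : V x, P.η x (starA φ x s u) t =
      P.η x (f.lift x (starC (φ.aC f x x u) (f.coord x s))) t := by
    intro t
    rw [LocalFrame.η_eq_coord hx (f.lift x _), LocalFrame.coord_lift hx, ← ηC_apply, ηC_starC, h1,
      LocalFrame.η_eq_coord hF, LocalFrame.coord_lift hF, ← ηC_apply, ηC_starC]
    exact congrArg Neg.neg (pairC_frames hF hx 0 1
      (L := { toFun := fun w => φ.a x w u
              map_add' := fun w w' => by simp
              map_smul' := fun r w => by simp }) (fun w => aC_self _ w) (fun w => aC_self _ w) _ _)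
  have h3 : ∀ v w : V x, P.η x v w = P.η x w v := fun v w => by
    rw [LocalFrame.η_eq_coord hx, LocalFrame.η_eq_coord hx, minkowskiForm_symm]
  ext i
  rw [LocalFrame.coord_apply, h3, h2, h3, ← LocalFrame.coord_apply, LocalFrame.coord_lift hx]

theorem aC_eq_tv (φ : FieldSpace P) (u : E4) : φ.aC f c x u = φ.aC f x x (tv c x u) := by
  ext1 v
  rw [FieldSpace.aC_apply]
  exact (aC_self (f := f) (x := x) (φ := φ) (tv c x u) v).symm

section Smooth

variable {EQ HQ Q : Type*} [NormedAddCommGroup EQ] [NormedSpace ℝ EQ]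
    [TopologicalSpace HQ] {IQ : ModelWithCorners ℝ EQ HQ} [TopologicalSpace Q] [ChartedSpace HQ Q]
    {p : Q → M} {t : Q → ℝ} {s : Set Q} {q : Q} {γ : ℝ → FieldSpace P} 

theorem mix_contMDiffWithinAt (hγ : IsSmoothCurve γ) (ht : ContMDiffWithinAt IQ 𝓘(ℝ, ℝ) ∞ t s q)
    (hp : ContMDiffWithinAt IQ (𝓡∂ 4) ∞ p s q) (m n : ℝ) :
    ContMDiffWithinAt IQ ((𝓡∂ 4).prod 𝓘(ℝ, Mink →L[ℝ] E4 →L[ℝ] Mink)) ∞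
      (fun q => (⟨p q, m • (γ (t q)).a (p q) + n • starA (γ (t q)) (p q)⟩ :
        TotalSpace (Mink →L[ℝ] E4 →L[ℝ] Mink)
        fun x : M => V x →L[ℝ] TangentSpace (𝓡∂ 4) x →L[ℝ] V x)) s q := by
  have hU := mem_frameAt (P := P) (p q)
  have hc : ContinuousWithinAt p (insert q s) q := hp.continuousWithinAt.insert
  refine contMDiffWithinAt_end_form hp hU fun w u => ?_
  have h1 := (aC_contMDiffWithinAt (c := p q) hγ ht hp hU (mem_chart_source _ _)).clm_apply
    (contMDiffWithinAt_const (c := u))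
  have h2 := starC.contMDiff.contMDiffAt.comp_contMDiffWithinAt q h1
  have h3 := (contMDiffWithinAt_const (I' := 𝓘(ℝ, ℝ)) (c := m)).smul
    (h1.clm_apply (contMDiffWithinAt_const (c := w)))
  have h4 := (contMDiffWithinAt_const (I' := 𝓘(ℝ, ℝ)) (c := n)).smul
    (h2.clm_apply (contMDiffWithinAt_const (c := w)))
  refine (h3.add h4).congr_of_eventuallyEq_insert ?_
  filter_upwards [hc ((frameAt P (p q)).isOpen.mem_nhds hU)] with q' hq'
  have e1 := coord_starA (γ (t q')) hq' ((frameAt P (p q)).lift (p q') w) (tv (p q) (p q') u)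
  rw [LocalFrame.coord_lift hq', ← aC_eq_tv] at e1
  have e2 := FieldSpace.aC_apply (frameAt P (p q)) (p q) (γ (t q')) (p q') u w
  have key : ∀ (A B : V (p q')), (frameAt P (p q)).coord (p q') (m • A + n • B) =
    m • (frameAt P (p q)).coord (p q') A + n • (frameAt P (p q)).coord (p q') B := fun A B => by
      rw [map_add, map_smul, map_smul]
  exact (key _ _).trans (congrArg₂ (fun A B : Mink => m • A + n • B) e2.symm e1)

end Smooth

/-- The field `(e, m a + n ⋆a, τ)`. -/
def mix (m n : ℝ) (φ : FieldSpace P) : FieldSpace P :=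
  ⟨(φ.1.1, ⟨fun x => m • φ.a x + n • starA φ x, fun x => mix_contMDiffWithinAt
    (isSmoothCurve_const φ) (t := fun _ => 0) (p := id) contMDiffWithinAt_const
    contMDiffWithinAt_id m n⟩, φ.1.2.2), by
    refine ⟨fun x s t u => ?_, φ.2.2⟩
    have hx := mem_frameAt (P := P) x
    have h1 := φ.2.1 x s t u
    have h2 : P.η x (starA φ x s u) t + P.η x s (starA φ x t u) = 0 := by
      rw [LocalFrame.η_eq_coord hx, LocalFrame.η_eq_coord hx, coord_starA _ hx, coord_starA _ hx,
        ← ηC_apply, ← ηC_apply, (isSkew_starC _).η]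
      ring
    change P.η x (m • φ.a x s u + n • starA φ x s u) t + P.η x s (m • φ.a x t u + n • starA φ x t u) = 0
    simp only [map_add, map_smul, LinearMap.add_apply, LinearMap.smul_apply, smul_eq_mul]
    change P.η x (φ.a x s u) t + P.η x s (φ.a x t u) = 0 at h1
    linear_combination m * h1 + n * h2⟩

variable {m n : ℝ} {φ X : FieldSpace P}

theorem mix_eC : (mix m n φ).eC f c x = φ.eC f c x := rfl

theorem mix_aC (hx : x ∈ f.U) (u : E4) :
    (mix m n φ).aC f c x u = m • φ.aC f c x u + n • starC (φ.aC f c x u) := by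
  ext1 w
  have e1 := coord_starA φ hx (f.lift x w) (tv c x u)
  rw [LocalFrame.coord_lift hx, ← aC_eq_tv] at e1
  have e2 := FieldSpace.aC_apply f c φ x u w
  have key : ∀ (A B : V x), f.coord x (m • A + n • B) = m • f.coord x A + n • f.coord x B :=
    fun A B => by rw [map_add, map_smul, map_smul]
  exact (key _ _).trans (congrArg₂ (fun A B : Mink => m • A + n • B) e2.symm e1)

theorem fieldSpace_ext {φ ψ : FieldSpace P} (he : ∀ x, φ.e x = ψ.e x) (ha : ∀ x, φ.a x = ψ.a x)
    (hτ : ∀ x, φ.τ x = ψ.τ x) : φ = ψ :=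
  Subtype.ext (Prod.ext (ContMDiffSection.ext he)
    (Prod.ext (ContMDiffSection.ext ha) (ContMDiffSection.ext hτ)))

theorem a_eq_of_aC {φ ψ : FieldSpace P} (hx : x ∈ f.U) (h : ∀ u, φ.aC f x x u = ψ.aC f x x u) :
    φ.a x = ψ.a x := by
  ext s u
  refine LocalFrame.coord_injective hx ?_
  have h1 := congrArg (fun L : Mink →L[ℝ] Mink => L (f.coord x s)) (h u)
  simpa only [aC_self, LocalFrame.lift_coord hx] using h1

/-- On skew endomorphisms ⋆² = -1, so m + n⋆ composes like m + ni. The hypotheses say that the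
product of the two complex numbers is 1. -/
theorem mix_mix {m' n' : ℝ} (h1 : m' * m - n' * n = 1) (h2 : m' * n + n' * m = 0) :
    mix m' n' (mix m n φ) = φ := by
  refine fieldSpace_ext (fun x => rfl) (fun x => a_eq_of_aC (mem_frameAt x) fun u => ?_)
    (fun x => rfl)
  have hx := mem_frameAt (P := P) x
  rw [mix_aC hx, mix_aC hx, map_add, map_smul, map_smul, starC_starC (φ.aC_mem_so31 hx u)]
  have h3 : m' • (m • φ.aC (frameAt P x) x x u + n • starC (φ.aC (frameAt P x) x x u)) +
      n' • (m • starC (φ.aC (frameAt P x) x x u) + n • -φ.aC (frameAt P x) x x u) =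
      (m' * m - n' * n) • φ.aC (frameAt P x) x x u +
        (m' * n + n' * m) • starC (φ.aC (frameAt P x) x x u) := by module
  rw [h3, h1, h2, one_smul, zero_smul, add_zero]

theorem isSmoothMap_mix (m n : ℝ) : IsSmoothMap (mix (P := P) m n) := fun _ h =>
  ⟨h.1, fun _ => mix_contMDiffWithinAt h contMDiffWithinAt_fst contMDiffWithinAt_snd m n, h.2.2⟩

theorem isTangentMap_mix (m n : ℝ) : IsTangentMap (mix (P := P) m n) fun _ X => mix m n X := by
  intro γ t X hγ hX
  refine hasVelocity_of_components (fun x => hX.eC (mem_frameAt x)) (fun x => ?_)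
    fun x => hX.τC (mem_frameAt x)
  have hx := mem_frameAt (P := P) x
  refine hasDerivAt_clm_of_apply fun u => ?_
  have h1 := hasDerivAt_clm_apply_const (hX.aC (c := x) hx) u
  have h2 := (h1.const_smul m).add ((hasDerivAt_clm_comp starC h1).const_smul n)
  rw [mix_aC hx]
  refine h2.congr_of_eventuallyEq (Filter.Eventually.of_forall fun r => ?_)
  exact mix_aC hx u

end

/-! ## The torsion as a field -/

/-- The torsion as a bilinear map. -/
def Jet.torB (j : Jet) : E4 →L[ℝ] E4 →L[ℝ] Mink :=
  toCLM₂ (LinearMap.mk₂ ℝ j.tor j.tor_add_left j.tor_smul_left j.tor_add_right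
    fun r u v => j.tor_smul_right r u v)

theorem Jet.torB_apply (j : Jet) (u v : E4) : j.torB u v = j.tor u v := rfl

section

variable {M : Type*} [TopologicalSpace M] [ChartedSpace (EuclideanHalfSpace 4) M]
  [IsManifold (𝓡∂ 4) ∞ M] {c x : M}

theorem dchart_tv (hc : x ∈ (chartAt (EuclideanHalfSpace 4) c).source) (u : E4) :
    dchart c x (tv c x u : E4) = u := by
  obtain ⟨w, rfl⟩ := dchart_surjective hc u
  exact congrArg (dchart c x) (tv_dchart hc w)

/-- Coordinate vectors of two charts are related by the derivative of the transition map. -/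
theorem tv_eq_tv_fderivWithin {z : M} (hz : z ∈ (chartAt (EuclideanHalfSpace 4) x).source)
    (hc : z ∈ (chartAt (EuclideanHalfSpace 4) c).source) (u : E4) :
    tv x z u = tv c z (fderivWithin ℝ (fun y => extChartAt (𝓡∂ 4) c (pt x y)) halfSpace
      (extChartAt (𝓡∂ 4) x z) u) := by
  have h := mfderiv_tv (g := extChartAt (𝓡∂ 4) c) hz (mdifferentiableAt_extChartAt hc) u
  exact (tv_dchart hc (tv x z u)).symm.trans (congrArg (tv c z) h)

theorem transition_contDiffWithinAt {y : E4} (hy : y ∈ (extChartAt (𝓡∂ 4) x).target)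
    (hc : pt x y ∈ (chartAt (EuclideanHalfSpace 4) c).source) :
    ContDiffWithinAt ℝ ∞ (fun y => extChartAt (𝓡∂ 4) c (pt x y)) halfSpace y := by
  have h1 := pt_contMDiffWithinAt (c := x) contDiffWithinAt_id (mapsTo_id halfSpace) hy
  exact ((contMDiffAt_extChartAt' (I := 𝓡∂ 4) (n := ∞) hc).comp_contMDiffWithinAt y
    h1).contDiffWithinAt

variable {V : M → Type*} [TopologicalSpace (TotalSpace Mink V)] [∀ x, AddCommGroup (V x)]
  [∀ x, Module ℝ (V x)] [∀ x, TopologicalSpace (V x)] [∀ x, IsTopologicalAddGroup (V x)]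
  [∀ x, ContinuousSMul ℝ (V x)] [FiberBundle Mink V] [VectorBundle ℝ Mink V]
  [ContMDiffVectorBundle ∞ Mink V (𝓡∂ 4)] {P : MinkowskiBundle V} {f : LocalFrame P}
  {A₀ : Connection P} {φ : FieldSpace P}

theorem connC_eq_of_tv {z c' : M} {u u' : E4} (h : (tv c z u : E4) = tv c' z u') :
    connC A₀ φ f c z u = connC A₀ φ f c' z u' := by
  ext1 s
  rw [connC_apply, connC_apply, baseC_apply, baseC_apply, FieldSpace.aC_apply, FieldSpace.aC_apply]
  have h' : tv c z u = tv c' z u' := h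
  rw [h']

/-- The components of the torsion in two charts. -/
theorem torC_transition (hx : x ∈ f.U) (hc : x ∈ (chartAt (EuclideanHalfSpace 4) c).source)
    (a b : E4) : torC A₀ φ f x (extChartAt (𝓡∂ 4) x x) a b =
      torC A₀ φ f c (extChartAt (𝓡∂ 4) c x) (dchart c x a) (dchart c x b) := by
  set y₀ := extChartAt (𝓡∂ 4) x x with hy₀
  have hy : IsGood f x y₀ := isGood_self hx
  have hxp : pt x y₀ = x := pt_self x
  have hg0 := IsGood.of_mem (c := c) hx hc
  set G : E4 → E4 := fun y => extChartAt (𝓡∂ 4) c (pt x y) with hG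
  have hG0 : G y₀ = extChartAt (𝓡∂ 4) c x := congrArg (extChartAt (𝓡∂ 4) c) hxp
  have hu := unique_halfSpace hy.mem
  have hGs : ContDiffWithinAt ℝ ∞ G halfSpace y₀ := transition_contDiffWithinAt hy.1 (by rwa [hxp])
  have hGm : MapsTo G halfSpace halfSpace := fun y _ => extChartAt_mem_halfSpace c _
  set E : E4 → E4 →L[ℝ] Mink := fun z => φ.eC f c (pt c z) with hE
  have hEd : HasFDerivWithinAt E (deC φ f c (extChartAt (𝓡∂ 4) c x)) halfSpace (G y₀) := by
    rw [hG0]; exact hg0.eC_diff.hasFDerivWithinAt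
  have hGd : HasFDerivWithinAt G (fderivWithin ℝ G halfSpace y₀) halfSpace y₀ :=
    (hGs.differentiableWithinAt (by simp)).hasFDerivWithinAt
  have hDG : HasFDerivWithinAt (fderivWithin ℝ G halfSpace)
      (fderivWithin ℝ (fderivWithin ℝ G halfSpace) halfSpace y₀) halfSpace y₀ :=
    ((hGs.fderivWithin_right (m := ∞) uniqueDiffOn_halfSpace (by simp)
      hy.mem).differentiableWithinAt (by simp)).hasFDerivWithinAt
  have hD : ∀ u, fderivWithin ℝ G halfSpace y₀ u = dchart c x u := fun u =>
    (dchart_eq_fderivWithin hc u).symm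
  -- The product rule produces a second derivative of the coordinate change. It is symmetric and
  -- disappears from the antisymmetrised expression.
  have hde : ∀ a b, deC φ f x y₀ a b =
      deC φ f c (extChartAt (𝓡∂ 4) c x) (dchart c x a) (dchart c x b) +
        E (G y₀) (fderivWithin ℝ (fderivWithin ℝ G halfSpace) halfSpace y₀ a b) := by
    intro a b
    have hev : (fun y => φ.eC f x (pt x y) b) =ᶠ[𝓝[halfSpace] y₀]
        fun y => E (G y) (fderivWithin ℝ G halfSpace y b) := by
      filter_upwards [eventually_pt hy.1 (chartAt (EuclideanHalfSpace 4) c).open_source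
        (by rwa [hxp])] with y hy'
      have h1 := tv_eq_tv_fderivWithin (pt_mem_source hy'.1) hy'.2 b
      rw [extChartAt_pt hy'.1] at h1
      have h2 : pt c (G y) = pt x y := pt_extChartAt hy'.2
      rw [hE]
      simp only [h2]
      rw [FieldSpace.eC_apply, FieldSpace.eC_apply]
      exact congrArg (fun w => f.coord (pt x y) (φ.e (pt x y) w)) h1
    have h1 := (hEd.comp y₀ hGd hGm).clm_apply (hDG.clm_apply (hasFDerivWithinAt_const b y₀ halfSpace))
    have h2 := (h1.congr_of_eventuallyEq hev (hev.self_of_nhdsWithin hy.mem)).fderivWithin hu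
    rw [← hy.deC_eq, h2]
    simp only [add_apply, ContinuousLinearMap.comp_apply, ContinuousLinearMap.flip_apply, hD,
      zero_apply, map_zero, Function.comp_apply, zero_add]
    rw [add_comm]
  have he : ∀ b, φ.eC f x (pt x y₀) b = φ.eC f c (pt c (extChartAt (𝓡∂ 4) c x)) (dchart c x b) := by
    intro b
    rw [hxp, pt_extChartAt hc, FieldSpace.eC_apply, FieldSpace.eC_apply]
    have h1 : tv x x b = tv c x (dchart c x b) := (tv_self x b).trans (tv_dchart hc b).symm
    rw [h1]
  have hA : ∀ a, connC A₀ φ f x (pt x y₀) a =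
      connC A₀ φ f c (pt c (extChartAt (𝓡∂ 4) c x)) (dchart c x a) := by
    intro a
    rw [hxp, pt_extChartAt hc]
    exact connC_eq_of_tv ((tv_self x a).trans (tv_dchart hc a).symm)
  rw [torC, torC, hde, hde, he, he, hA, hA, sndDeriv_symm hy.mem hGs b a]
  abel

/-- The torsion at each point is defined with the chart at that point. Computing it at all nearby
points in one fixed chart is what makes its smoothness accessible. -/
theorem coord_torsion_tv (hx : x ∈ f.U) (hc : x ∈ (chartAt (EuclideanHalfSpace 4) c).source)
    (u v : E4) : f.coord x (torsion A₀ φ x (tv c x u) (tv c x v)) =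
      torC A₀ φ f c (extChartAt (𝓡∂ 4) c x) u v := by
  rw [coord_torsion hx]
  refine (torC_transition hx hc _ _).trans ?_
  have h1 := dchart_tv hc u
  have h2 := dchart_tv hc v
  exact congrArg₂ (torC A₀ φ f c (extChartAt (𝓡∂ 4) c x)) h1 h2

/-! ### Smoothness in a parameter -/

section Curve

variable {γ : ℝ → FieldSpace P} {y : E4} {t : ℝ} {X : FieldSpace P}

theorem IsGood.eC_joint (hγ : IsSmoothCurve γ) (h : IsGood f c y) :
    ContDiffWithinAt ℝ ∞ (fun p : ℝ × E4 => (γ p.1).eC f c (pt c p.2)) (univ ×ˢ halfSpace)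
      (t, y) :=
  (eC_contMDiffWithinAt (IQ := 𝓘(ℝ, ℝ × E4)) hγ (t := fun p : ℝ × E4 => p.1)
    (p := fun p : ℝ × E4 => pt c p.2) contDiffWithinAt_fst.contMDiffWithinAt
    (pt_contMDiffWithinAt (s := univ ×ˢ halfSpace) contDiffWithinAt_snd (fun _ hp => hp.2) h.1) h.2
    h.mem_source).contDiffWithinAt

theorem IsGood.aC_joint (hγ : IsSmoothCurve γ) (h : IsGood f c y) :
    ContDiffWithinAt ℝ ∞ (fun p : ℝ × E4 => (γ p.1).aC f c (pt c p.2)) (univ ×ˢ halfSpace)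
      (t, y) :=
  (aC_contMDiffWithinAt (IQ := 𝓘(ℝ, ℝ × E4)) hγ (t := fun p : ℝ × E4 => p.1)
    (p := fun p : ℝ × E4 => pt c p.2) contDiffWithinAt_fst.contMDiffWithinAt
    (pt_contMDiffWithinAt (s := univ ×ˢ halfSpace) contDiffWithinAt_snd (fun _ hp => hp.2) h.1) h.2
    h.mem_source).contDiffWithinAt

theorem IsGood.connC_joint (hγ : IsSmoothCurve γ) (h : IsGood f c y) :
    ContDiffWithinAt ℝ ∞ (fun p : ℝ × E4 => connC A₀ (γ p.1) f c (pt c p.2)) (univ ×ˢ halfSpace)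
      (t, y) := by
  have h1 : ContDiffWithinAt ℝ ∞ (fun p : ℝ × E4 => baseC A₀ f c (pt c p.2)) (univ ×ˢ halfSpace)
      (t, y) :=
    ContDiffWithinAt.comp (g := fun z => baseC A₀ f c (pt c z)) (t := halfSpace) (t, y)
      h.baseC_contDiffWithinAt contDiffWithinAt_snd fun p hp => hp.2
  exact h1.add (h.aC_joint hγ)

theorem IsGood.deC_joint (hγ : IsSmoothCurve γ) (h : IsGood f c y) :
    ContDiffWithinAt ℝ ∞ (fun p : ℝ × E4 => deC (γ p.1) f c p.2) (univ ×ˢ halfSpace) (t, y) := by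
  refine ContDiffWithinAt.fderivWithin (n := ∞) (f := fun (p : ℝ × E4) z => (γ p.1).eC f c (pt c z))
    (g := Prod.snd) ?_ contDiffWithinAt_snd uniqueDiffOn_halfSpace (by simp) ⟨mem_univ _, h.mem⟩
    fun p hp => hp.2
  have h1 : ContDiffWithinAt ℝ ∞ (fun p : (ℝ × E4) × E4 => (p.1.1, p.2))
      ((univ ×ˢ halfSpace) ×ˢ halfSpace) ((t, y), y) :=
    (contDiff_fst.fst.prodMk contDiff_snd).contDiffWithinAt
  have h2 : MapsTo (fun p : (ℝ × E4) × E4 => (p.1.1, p.2))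
      ((univ ×ˢ halfSpace) ×ˢ halfSpace) (univ ×ˢ halfSpace) := fun p hp => ⟨mem_univ _, hp.2⟩
  have h3 := h.eC_joint (t := t) hγ
  have h4 := ContDiffWithinAt.comp (g := fun p : ℝ × E4 => (γ p.1).eC f c (pt c p.2))
    (f := fun p : (ℝ × E4) × E4 => (p.1.1, p.2)) ((t, y), y) h3 h1 h2
  exact h4

theorem IsGood.torC_joint (hγ : IsSmoothCurve γ) (h : IsGood f c y) (u v : E4) :
    ContDiffWithinAt ℝ ∞ (fun p : ℝ × E4 => torC A₀ (γ p.1) f c p.2 u v) (univ ×ˢ halfSpace)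
      (t, y) := by
  have hc : ∀ w : E4, ContDiffWithinAt ℝ ∞ (fun _ : ℝ × E4 => w) (univ ×ˢ halfSpace) (t, y) :=
    fun w => contDiffWithinAt_const
  have h1 := h.deC_joint (t := t) hγ
  have h2 := h.eC_joint (t := t) hγ
  have h3 := h.connC_joint (A₀ := A₀) (t := t) hγ
  exact ((((h1.clm_apply (hc u)).clm_apply (hc v)).sub
    ((h1.clm_apply (hc v)).clm_apply (hc u))).add
    ((h3.clm_apply (hc u)).clm_apply (h2.clm_apply (hc v)))).sub
    ((h3.clm_apply (hc v)).clm_apply (h2.clm_apply (hc u)))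

/-- Differentiation with respect to the parameter commutes with differentiation in `M`. -/
theorem IsGood.hasDerivAt_deC (hγ : IsSmoothCurve γ) (hX : HasVelocity γ t X)
    (h : IsGood f c y) : HasDerivAt (fun r => deC (γ r) f c y) (deC X f c y) t := by
  set S : Set (ℝ × E4) := univ ×ˢ halfSpace with hS
  set F : ℝ × E4 → E4 →L[ℝ] Mink := fun p => (γ p.1).eC f c (pt c p.2) with hF
  have hSu : UniqueDiffOn ℝ S := uniqueDiffOn_univ.prod uniqueDiffOn_halfSpace
  have hm : (t, y) ∈ S := ⟨mem_univ _, h.mem⟩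
  have hFs : ∀ {r z}, IsGood f c z → ContDiffWithinAt ℝ ∞ F S (r, z) := fun hz => hz.eC_joint hγ
  have hFd : ∀ {r z}, IsGood f c z → HasFDerivWithinAt F (fderivWithin ℝ F S (r, z)) S (r, z) :=
    fun hz => ((hFs hz).differentiableWithinAt (by simp)).hasFDerivWithinAt
  have hDF : HasFDerivWithinAt (fderivWithin ℝ F S) (fderivWithin ℝ (fderivWithin ℝ F S) S (t, y)) S
      (t, y) := (((hFs h).fderivWithin_right (m := ∞) hSu (by simp) hm).differentiableWithinAt
        (by simp)).hasFDerivWithinAt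
  -- The curve is regarded as one function on ℝ times the half space; exchanging the two derivatives
  -- is the symmetry of its second derivative.
  have hsymm := (hFs (r := t) h).isSymmSndFDerivWithinAt (by
    simp only [minSmoothness_of_isRCLikeNormedField]; exact WithTop.coe_le_coe.2 le_top) hSu (by
      rw [hS, interior_prod_eq, closure_prod_eq, interior_univ, closure_univ]
      exact ⟨mem_univ _, mem_closure_interior_halfSpace h.mem⟩) hm
  have i1 : ∀ z : E4, HasFDerivAt (fun r : ℝ => (r, z)) (ContinuousLinearMap.inl ℝ ℝ E4) t :=
    fun z => hasFDerivAt_prodMk_left t z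
  have i2 : ∀ (r : ℝ) (z : E4), HasFDerivWithinAt (fun z : E4 => (r, z))
      (ContinuousLinearMap.inr ℝ ℝ E4) halfSpace z :=
    fun r z => (hasFDerivAt_prodMk_right r z).hasFDerivWithinAt
  have e1 : ∀ r u, deC (γ r) f c y u = fderivWithin ℝ F S (r, y) (0, u) := by
    intro r u
    have h1 := ((hFd (r := r) h).comp y (i2 r y)
      fun z (hz : z ∈ halfSpace) => (⟨mem_univ _, hz⟩ : (r, z) ∈ S)).fderivWithin
      (unique_halfSpace h.mem)
    exact congrArg (fun L : E4 →L[ℝ] E4 →L[ℝ] Mink => L u) h1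
  have e2 : ∀ z, IsGood f c z → X.eC f c (pt c z) = fderivWithin ℝ F S (t, z) (1, 0) := by
    intro z hz
    have h1 := (hFd (r := t) hz).comp_hasFDerivAt t (i1 z)
      (Filter.Eventually.of_forall fun r => (⟨mem_univ _, hz.mem⟩ : (r, z) ∈ S))
    exact (hX.eC hz.2).unique h1.hasDerivAt
  refine hasDerivAt_clm_of_apply fun u => ?_
  have h1 := (hDF.comp_hasFDerivAt t (i1 y)
    (Filter.Eventually.of_forall fun r => (⟨mem_univ _, h.mem⟩ : (r, y) ∈ S))).hasDerivAt
  have h2 := hasDerivAt_clm_apply_const h1 ((0, u) : ℝ × E4)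
  have h3 : deC X f c y u = fderivWithin ℝ (fderivWithin ℝ F S) S (t, y) (1, 0) (0, u) := by
    rw [hsymm]
    have h4 := (hDF.clm_apply (hasFDerivWithinAt_const ((1, 0) : ℝ × E4) (t, y) S)).comp y (i2 t y)
      fun z (hz : z ∈ halfSpace) => (⟨mem_univ _, hz⟩ : (t, z) ∈ S)
    have h5 : (fun z => X.eC f c (pt c z)) =ᶠ[𝓝[halfSpace] y]
        fun z => fderivWithin ℝ F S (t, z) (1, 0) := h.eventually.mono e2
    have h6 := (h4.congr_of_eventuallyEq h5 (e2 y h)).fderivWithin (unique_halfSpace h.mem)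
    refine (congrArg (fun L : E4 →L[ℝ] E4 →L[ℝ] Mink => L u) h6).trans ?_
    simp
  rw [h3, show (fun r => deC (γ r) f c y u) = _ from funext fun r => e1 r u]
  exact h2

end Curve

end

/-- The torsion is a quadratic polynomial in the jet, so a central difference with step 1 gives its
derivative exactly. This allows `dshift` to be written with torsion fields only, whose smoothness is
already known. -/
theorem Jet.tor_line_sub (j X : Jet) (u v : E4) :
    (j.line X 1).tor u v - (j.line X (-1)).tor u v = (2 : ℝ) • j.dtor X u v := by
  simp only [Jet.tor, Jet.line, Jet.dtor, add_apply, smul_apply, map_add, map_smul]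
  module

/-! ### The torsion field, and the shift of τ along it. -/

section

variable {M : Type*} [TopologicalSpace M] [ChartedSpace (EuclideanHalfSpace 4) M]
  [IsManifold (𝓡∂ 4) ∞ M]
  {V : M → Type*} [TopologicalSpace (TotalSpace Mink V)] [∀ x, AddCommGroup (V x)]
  [∀ x, Module ℝ (V x)] [∀ x, TopologicalSpace (V x)] [∀ x, IsTopologicalAddGroup (V x)]
  [∀ x, ContinuousSMul ℝ (V x)] [FiberBundle Mink V] [VectorBundle ℝ Mink V]
  [ContMDiffVectorBundle ∞ Mink V (𝓡∂ 4)] {P : MinkowskiBundle V} {f : LocalFrame P} {c x : M}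
  {A₀ : Connection P} {φ X : FieldSpace P} {γ : ℝ → FieldSpace P} [T2Space M]

theorem isSmoothCurve_of_components
    (he : ∀ t x, ContMDiffAt (𝓘(ℝ, ℝ).prod (𝓡∂ 4)) 𝓘(ℝ, E4 →L[ℝ] Mink) ∞
      (fun q : ℝ × M => (γ q.1).eC (frameAt P x) x q.2) (t, x))
    (ha : ∀ t x, ContMDiffAt (𝓘(ℝ, ℝ).prod (𝓡∂ 4)) 𝓘(ℝ, E4 →L[ℝ] Mink →L[ℝ] Mink) ∞
      (fun q : ℝ × M => (γ q.1).aC (frameAt P x) x q.2) (t, x))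
    (hτ : ∀ t x, ContMDiffAt (𝓘(ℝ, ℝ).prod (𝓡∂ 4)) 𝓘(ℝ, E4 →L[ℝ] E4 →L[ℝ] Mink) ∞
      (fun q : ℝ × M => (γ q.1).τC (frameAt P x) x q.2) (t, x)) : IsSmoothCurve γ := by
  refine ⟨fun q => ?_, fun q => ?_, fun q => ?_⟩
  · have hp : ContMDiffAt (𝓘(ℝ, ℝ).prod (𝓡∂ 4)) (𝓡∂ 4) ∞ (fun q : ℝ × M => q.2) q :=
      contMDiffAt_snd
    refine contMDiffWithinAt_hom_of_apply hp fun u => contMDiffWithinAt_of_coord (frameAt P q.2)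
      (mem_frameAt _) hp (((he q.1 q.2).clm_apply
        (contMDiffAt_const (c := u))).congr_of_eventuallyEq_insert ?_)
    have hs := hp.continuousAt.preimage_mem_nhds
      ((chartAt (EuclideanHalfSpace 4) q.2).open_source.mem_nhds (mem_chart_source _ _))
    filter_upwards [mem_nhdsWithin_of_mem_nhds hs] with q' hq'
    have e1 := tv_eq_symm hq' u
    rw [← e1]
    rfl
  · have hp : ContMDiffAt (𝓘(ℝ, ℝ).prod (𝓡∂ 4)) (𝓡∂ 4) ∞ (fun q : ℝ × M => q.2) q :=
      contMDiffAt_snd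
    exact contMDiffWithinAt_end_form hp (mem_frameAt _) fun w u =>
      ((ha q.1 q.2).clm_apply (contMDiffAt_const (c := u))).clm_apply
        (contMDiffAt_const (c := w))
  · have hp : ContMDiffAt (𝓘(ℝ, ℝ).prod (𝓡∂ 4)) (𝓡∂ 4) ∞ (fun q : ℝ × M => q.2) q :=
      contMDiffAt_snd
    exact contMDiffWithinAt_two_form hp (mem_frameAt _) fun u v =>
      ((hτ q.1 q.2).clm_apply (contMDiffAt_const (c := u))).clm_apply
        (contMDiffAt_const (c := v))

section

variable (hγ : IsSmoothCurve γ) (t : ℝ) (hx : x ∈ f.U)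
  (hc : x ∈ (chartAt (EuclideanHalfSpace 4) c).source)
include hγ hx hc

theorem IsSmoothCurve.eC : ContMDiffAt (𝓘(ℝ, ℝ).prod (𝓡∂ 4)) 𝓘(ℝ, E4 →L[ℝ] Mink) ∞
    (fun q : ℝ × M => (γ q.1).eC f c q.2) (t, x) :=
  eC_contMDiffWithinAt (p := Prod.snd) (t := Prod.fst) hγ contMDiffWithinAt_fst
    contMDiffWithinAt_snd hx hc

theorem IsSmoothCurve.aC : ContMDiffAt (𝓘(ℝ, ℝ).prod (𝓡∂ 4)) 𝓘(ℝ, E4 →L[ℝ] Mink →L[ℝ] Mink) ∞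
    (fun q : ℝ × M => (γ q.1).aC f c q.2) (t, x) :=
  aC_contMDiffWithinAt (p := Prod.snd) (t := Prod.fst) hγ contMDiffWithinAt_fst
    contMDiffWithinAt_snd hx hc

theorem IsSmoothCurve.τC : ContMDiffAt (𝓘(ℝ, ℝ).prod (𝓡∂ 4)) 𝓘(ℝ, E4 →L[ℝ] E4 →L[ℝ] Mink) ∞
    (fun q : ℝ × M => (γ q.1).τC f c q.2) (t, x) :=
  τC_contMDiffWithinAt (p := Prod.snd) (t := Prod.fst) hγ contMDiffWithinAt_fst
    contMDiffWithinAt_snd hx hc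

end

theorem IsSmoothCurve.add_smul {γ' : ℝ → FieldSpace P} (h : IsSmoothCurve γ)
    (h' : IsSmoothCurve γ') (r : ℝ) : IsSmoothCurve fun t => γ t + r • γ' t := by
  refine isSmoothCurve_of_components (fun t x => ?_) (fun t x => ?_) fun t x => ?_
  · simp only [FieldSpace.eC_add, FieldSpace.eC_smul]
    exact (h.eC t (mem_frameAt x) (mem_chart_source _ x)).add
      ((contMDiffAt_const (I' := 𝓘(ℝ, ℝ)) (c := r)).smul
        (h'.eC t (mem_frameAt x) (mem_chart_source _ x)))
  · simp only [FieldSpace.aC_add, FieldSpace.aC_smul]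
    exact (h.aC t (mem_frameAt x) (mem_chart_source _ x)).add
      ((contMDiffAt_const (I' := 𝓘(ℝ, ℝ)) (c := r)).smul
        (h'.aC t (mem_frameAt x) (mem_chart_source _ x)))
  · simp only [FieldSpace.τC_add, FieldSpace.τC_smul]
    exact (h.τC t (mem_frameAt x) (mem_chart_source _ x)).add
      ((contMDiffAt_const (I' := 𝓘(ℝ, ℝ)) (c := r)).smul
        (h'.τC t (mem_frameAt x) (mem_chart_source _ x)))

/-! ### The torsion field -/

/-- A `V`-valued bilinear form with given components at a point. -/
def formOfComponents (f : LocalFrame P) (x : M) (B : E4 →L[ℝ] E4 →L[ℝ] Mink) :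
    TangentSpace (𝓡∂ 4) x →L[ℝ] TangentSpace (𝓡∂ 4) x →L[ℝ] V x :=
  let L : E4 →ₗ[ℝ] E4 →L[ℝ] V x :=
    { toFun := fun u => (⟨f.lift x, LinearMap.continuous_of_finiteDimensional _⟩ : Mink →L[ℝ] V x) ∘L
        (B u)
      map_add' := fun s t => by ext u; simp
      map_smul' := fun r s => by ext u; simp }
  (⟨L, LinearMap.continuous_of_finiteDimensional L⟩ : E4 →L[ℝ] E4 →L[ℝ] V x)

theorem formOfComponents_apply (f : LocalFrame P) (x : M) (B : E4 →L[ℝ] E4 →L[ℝ] Mink)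
    (u v : TangentSpace (𝓡∂ 4) x) : formOfComponents f x B u v = f.lift x (B u v) := rfl

/-- The torsion as a `V`-valued bilinear form. -/
def torA (A₀ : Connection P) (φ : FieldSpace P) (x : M) :
    TangentSpace (𝓡∂ 4) x →L[ℝ] TangentSpace (𝓡∂ 4) x →L[ℝ] V x :=
  formOfComponents (frameAt P x) x (jet A₀ φ (frameAt P x) x (extChartAt (𝓡∂ 4) x x)).torB

theorem torA_apply (u v : TangentSpace (𝓡∂ 4) x) : torA A₀ φ x u v = torsion A₀ φ x u v := by
  have hx := mem_frameAt (P := P) x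
  rw [torA, formOfComponents_apply]
  refine LocalFrame.coord_injective hx ?_
  rw [LocalFrame.coord_lift hx, coord_torsion hx]
  rfl

theorem torA_contMDiffWithinAt {EQ HQ Q : Type*} [NormedAddCommGroup EQ] [NormedSpace ℝ EQ]
    [TopologicalSpace HQ] {IQ : ModelWithCorners ℝ EQ HQ} [TopologicalSpace Q] [ChartedSpace HQ Q]
    {p : Q → M} {t : Q → ℝ} {s : Set Q} {q : Q}
    (hγ : IsSmoothCurve γ) (ht : ContMDiffWithinAt IQ 𝓘(ℝ, ℝ) ∞ t s q)
    (hp : ContMDiffWithinAt IQ (𝓡∂ 4) ∞ p s q) :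
    ContMDiffWithinAt IQ ((𝓡∂ 4).prod 𝓘(ℝ, E4 →L[ℝ] E4 →L[ℝ] Mink)) ∞
      (fun q => (⟨p q, torA A₀ (γ (t q)) (p q)⟩ : TotalSpace (E4 →L[ℝ] E4 →L[ℝ] Mink)
        fun x : M => TangentSpace (𝓡∂ 4) x →L[ℝ] TangentSpace (𝓡∂ 4) x →L[ℝ] V x)) s q := by
  have hU := mem_frameAt (P := P) (p q)
  have hc : ContinuousWithinAt p (insert q s) q := hp.continuousWithinAt.insert
  refine contMDiffWithinAt_two_form hp hU fun u v => ?_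
  have h1 := ((isGood_self hU).torC_joint (A₀ := A₀) (t := t q) hγ u v).contMDiffWithinAt
  have h2 : ContMDiffWithinAt IQ 𝓘(ℝ, ℝ × E4) ∞ (fun q' => (t q', extChartAt (𝓡∂ 4) (p q) (p q')))
      s q := ht.prodMk_space
        ((contMDiffAt_extChartAt (I := 𝓡∂ 4) (n := ∞)).comp_contMDiffWithinAt q hp)
  have h3 := ContMDiffWithinAt.comp (g := fun z : ℝ × E4 => torC A₀ (γ z.1) (frameAt P (p q))
    (p q) z.2 u v) (f := fun q' => (t q', extChartAt (𝓡∂ 4) (p q) (p q'))) q h1 h2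
    fun q' _ => ⟨mem_univ _, extChartAt_mem_halfSpace _ _⟩
  refine h3.congr_of_eventuallyEq_insert ?_
  filter_upwards [hc ((frameAt P (p q)).isOpen.mem_nhds hU),
    hc ((chartAt (EuclideanHalfSpace 4) (p q)).open_source.mem_nhds (mem_chart_source _ _))]
    with q' hf hs
  rw [torA_apply]
  exact coord_torsion_tv hf hs u v

theorem contMDiff_torA : ContMDiff (𝓡∂ 4) ((𝓡∂ 4).prod 𝓘(ℝ, E4 →L[ℝ] E4 →L[ℝ] Mink)) ∞
    (fun x => (⟨x, torA A₀ φ x⟩ : TotalSpace (E4 →L[ℝ] E4 →L[ℝ] Mink)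
        fun x : M => TangentSpace (𝓡∂ 4) x →L[ℝ] TangentSpace (𝓡∂ 4) x →L[ℝ] V x)) := by
  intro x
  have h := torA_contMDiffWithinAt (A₀ := A₀) (IQ := 𝓡∂ 4) (s := univ) (q := x)
    (isSmoothCurve_const φ) (t := fun _ => 0) (p := fun x => x)
    contMDiffWithinAt_const contMDiffWithinAt_id
  exact h

/-- The torsion as a smooth section. -/
def torSection (A₀ : Connection P) (φ : FieldSpace P) : Cₛ^∞⟮𝓡∂ 4; E4 →L[ℝ] E4 →L[ℝ] Mink,
    fun x : M => TangentSpace (𝓡∂ 4) x →L[ℝ] TangentSpace (𝓡∂ 4) x →L[ℝ] V x⟯ where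
  toFun := torA A₀ φ
  contMDiff_toFun := contMDiff_torA

theorem torA_self (u : TangentSpace (𝓡∂ 4) x) : torA A₀ φ x u u = 0 := by
  have h1 := (jet A₀ φ (frameAt P x) x (extChartAt (𝓡∂ 4) x x)).tor_swap u u
  have h2 : (jet A₀ φ (frameAt P x) x (extChartAt (𝓡∂ 4) x x)).torB u u = 0 := self_eq_neg.1 h1
  exact (congrArg ((frameAt P x).lift x) h2).trans (map_zero _)

/-- The torsion as a field. -/
def torField (A₀ : Connection P) (φ : FieldSpace P) : FieldSpace P :=
  ⟨(0, 0, torSection A₀ φ), (fieldSubmodule P).zero_mem.1, fun _ u => torA_self u⟩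

theorem torField_eC : (torField A₀ φ).eC f c x = 0 := by
  ext1 u
  exact map_zero (f.coord x)

theorem torField_aC : (torField A₀ φ).aC f c x = 0 := by
  ext1 u; ext1 v
  exact map_zero (f.coord x)

theorem torField_τC (hx : x ∈ f.U) (hc : x ∈ (chartAt (EuclideanHalfSpace 4) c).source) :
    (torField A₀ φ).τC f c x = (jet A₀ φ f c (extChartAt (𝓡∂ 4) c x)).torB := by
  ext1 u; ext1 v
  have h := coord_torsion_tv (A₀ := A₀) (φ := φ) hx hc u v
  rw [← torA_apply] at h
  exact h

theorem torField_e : (torField A₀ φ).e x = 0 := rfl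

theorem torField_a : (torField A₀ φ).a x = 0 := rfl

theorem torField_τ : (torField A₀ φ).τ x = torA A₀ φ x := rfl

/-- The torsion does not see τ, and therefore maps that change only τ leave it alone. -/
theorem torsion_congr {ψ : FieldSpace P} (he : ∀ x, φ.e x = ψ.e x) (ha : ∀ x, φ.a x = ψ.a x)
    (u v : TangentSpace (𝓡∂ 4) x) : torsion A₀ φ x u v = torsion A₀ ψ x u v := by
  have h1 : φ.cov A₀ = ψ.cov A₀ := congrArg A₀.cov.addOneForm (funext ha)
  have h2 : φ.e = ψ.e := funext he
  unfold torsion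
  rw [h1, h2]

theorem torA_congr {ψ : FieldSpace P} (he : ∀ x, φ.e x = ψ.e x) (ha : ∀ x, φ.a x = ψ.a x) :
    torA A₀ φ x = torA A₀ ψ x := by
  ext u v
  rw [torA_apply, torA_apply, torsion_congr he ha]

theorem torField_congr {ψ : FieldSpace P} (he : ∀ x, φ.e x = ψ.e x) (ha : ∀ x, φ.a x = ψ.a x) :
    torField A₀ φ = torField A₀ ψ :=
  fieldSpace_ext (fun _ => by rw [torField_e, torField_e]) (fun _ => by rw [torField_a, torField_a])
    fun _ => by rw [torField_τ, torField_τ, torA_congr he ha]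

theorem isSmoothMap_torField : IsSmoothMap (torField A₀) := by
  intro γ h
  have h0 := isSmoothCurve_const (0 : FieldSpace P)
  have e1 : ∀ p : ℝ × M, ((torField A₀ ∘ γ) p.1).e p.2 = (0 : FieldSpace P).e p.2 := fun _ =>
    torField_e
  have e2 : ∀ p : ℝ × M, ((torField A₀ ∘ γ) p.1).a p.2 = (0 : FieldSpace P).a p.2 := fun _ =>
    torField_a
  refine ⟨?_, ?_, fun _ => torA_contMDiffWithinAt h contMDiffWithinAt_fst contMDiffWithinAt_snd⟩
  · simpa only [e1] using h0.1
  · simpa only [e2] using h0.2.1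

/-- The field `(e, a, r τ)`. -/
def scale (r : ℝ) (φ : FieldSpace P) : FieldSpace P :=
  ⟨(φ.1.1, φ.1.2.1, r • φ.1.2.2), φ.2.1, fun x u => by
    have h : φ.1.2.2 x u u = 0 := φ.2.2 x u
    change r • φ.1.2.2 x u u = 0
    rw [h, smul_zero]⟩

theorem scale_e (r : ℝ) : (scale r φ).e x = φ.e x := rfl

theorem scale_a (r : ℝ) : (scale r φ).a x = φ.a x := rfl

theorem scale_τ (r : ℝ) : (scale r φ).τ x = r • φ.τ x := rfl

theorem scale_eC (r : ℝ) : (scale r φ).eC f c x = φ.eC f c x := rfl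

theorem scale_aC (r : ℝ) : (scale r φ).aC f c x = φ.aC f c x := rfl

theorem scale_τC (r : ℝ) : (scale r φ).τC f c x = r • φ.τC f c x :=
  FieldSpace.τC_smul f c φ r x

theorem isSmoothMap_scale (r : ℝ) : IsSmoothMap (scale (P := P) r) := by
  intro γ h
  refine ⟨h.1, h.2.1, ?_⟩
  have h0 : IsSmoothCurve fun t => r • γ t := by
    simpa only [zero_add] using (isSmoothCurve_const (0 : FieldSpace P)).add_smul h r
  exact h0.2.2

/-- The field `(e, a, r τ + w d_A e)`. -/
def shift (A₀ : Connection P) (r w : ℝ) (φ : FieldSpace P) : FieldSpace P :=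
  scale r φ + w • torField A₀ φ

/-- The tangent map of `shift`. -/
def dshift (A₀ : Connection P) (r w : ℝ) (φ X : FieldSpace P) : FieldSpace P :=
  scale r X + (w / 2) • torField A₀ (φ + (1 : ℝ) • X) + (-(w / 2)) • torField A₀ (φ + (-1 : ℝ) • X)

variable {r w : ℝ}

theorem shift_e : (shift A₀ r w φ).e x = φ.e x := by
  rw [shift, FieldSpace.add_e, FieldSpace.smul_e, torField_e, smul_zero, add_zero, scale_e]

theorem shift_a : (shift A₀ r w φ).a x = φ.a x := by
  rw [shift, FieldSpace.add_a, FieldSpace.smul_a, torField_a, smul_zero, add_zero, scale_a]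

theorem shift_τ : (shift A₀ r w φ).τ x = r • φ.τ x + w • (torField A₀ φ).τ x := by
  rw [shift, FieldSpace.add_τ, FieldSpace.smul_τ, scale_τ]

theorem shift_eC : (shift A₀ r w φ).eC f c x = φ.eC f c x := by
  rw [shift, FieldSpace.eC_add, FieldSpace.eC_smul, torField_eC, smul_zero, add_zero, scale_eC]

theorem shift_aC : (shift A₀ r w φ).aC f c x = φ.aC f c x := by
  rw [shift, FieldSpace.aC_add, FieldSpace.aC_smul, torField_aC, smul_zero, add_zero, scale_aC]

theorem shift_τC (hx : x ∈ f.U) (hc : x ∈ (chartAt (EuclideanHalfSpace 4) c).source) :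
    (shift A₀ r w φ).τC f c x =
      r • φ.τC f c x + w • (jet A₀ φ f c (extChartAt (𝓡∂ 4) c x)).torB := by
  rw [shift, FieldSpace.τC_add, FieldSpace.τC_smul, torField_τC hx hc, scale_τC]

theorem dshift_eC : (dshift A₀ r w φ X).eC f c x = X.eC f c x := by
  simp only [dshift, FieldSpace.eC_add, FieldSpace.eC_smul, torField_eC, smul_zero, add_zero,
    scale_eC]

theorem dshift_aC : (dshift A₀ r w φ X).aC f c x = X.aC f c x := by
  simp only [dshift, FieldSpace.aC_add, FieldSpace.aC_smul, torField_aC, smul_zero, add_zero,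
    scale_aC]

theorem dshift_τC (hx : x ∈ f.U) (hc : x ∈ (chartAt (EuclideanHalfSpace 4) c).source) (u v : E4) :
    (dshift A₀ r w φ X).τC f c x u v = r • X.τC f c x u v +
      w • (jet A₀ φ f c (extChartAt (𝓡∂ 4) c x)).dtor (vjet X f c (extChartAt (𝓡∂ 4) c x)) u v := by
  have hg := IsGood.of_mem hx hc
  have h := Jet.tor_line_sub (jet A₀ φ f c (extChartAt (𝓡∂ 4) c x))
    (vjet X f c (extChartAt (𝓡∂ 4) c x)) u v
  rw [dshift, FieldSpace.τC_add, FieldSpace.τC_add, FieldSpace.τC_smul, FieldSpace.τC_smul,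
    torField_τC hx hc, torField_τC hx hc, scale_τC, hg.jet_add_smul, hg.jet_add_smul]
  simp only [add_apply, smul_apply, Jet.torB_apply]
  have h2 : w • (jet A₀ φ f c (extChartAt (𝓡∂ 4) c x)).dtor
      (vjet X f c (extChartAt (𝓡∂ 4) c x)) u v = (w / 2) • ((2 : ℝ) •
        (jet A₀ φ f c (extChartAt (𝓡∂ 4) c x)).dtor (vjet X f c (extChartAt (𝓡∂ 4) c x)) u v) := by
    rw [smul_smul]; congr 1; ring
  rw [h2, ← h]
  module

theorem isSmoothMap_shift : IsSmoothMap (shift A₀ r w) := fun γ h =>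
  (isSmoothMap_scale r γ h).add_smul (isSmoothMap_torField γ h) w

/-- Since the torsion is unaffected by the shift, such maps compose like the affine maps τ ↦ rτ + w
t with t fixed. -/
theorem shift_shift {r' w' : ℝ} (h1 : r' * r = 1) (h2 : r' * w + w' = 0) :
    shift A₀ r' w' (shift A₀ r w φ) = φ := by
  refine fieldSpace_ext (fun x => by rw [shift_e, shift_e]) (fun x => by rw [shift_a, shift_a])
    fun x => ?_
  have h3 : torField A₀ (shift A₀ r w φ) = torField A₀ φ :=
    torField_congr (fun x => shift_e) fun x => shift_a
  rw [shift_τ, shift_τ, h3, show r' • (r • φ.τ x + w • (torField A₀ φ).τ x) + w' • (torField A₀ φ).τ x =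
    (r' * r) • φ.τ x + (r' * w + w') • (torField A₀ φ).τ x by module, h1, h2, one_smul, zero_smul,
    add_zero]

theorem isTangentMap_shift : IsTangentMap (shift A₀ r w) (dshift A₀ r w) := by
  intro γ t X hγ hX
  refine hasVelocity_of_components (fun x => ?_) (fun x => ?_) fun x => ?_
  · simp only [Function.comp_apply, shift_eC, dshift_eC]
    exact hX.eC (mem_frameAt x)
  · simp only [Function.comp_apply, shift_aC, dshift_aC]
    exact hX.aC (mem_frameAt x)
  · have hx := mem_frameAt (P := P) x
    have hs := mem_chart_source (EuclideanHalfSpace 4) x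
    have hg := isGood_self hx
    simp only [Function.comp_apply, shift_τC hx hs]
    refine hasDerivAt_clm_of_apply fun u => hasDerivAt_clm_of_apply fun v => ?_
    rw [dshift_τC hx hs]
    -- The torsion contains first derivatives of e, so its velocity requires exchanging the
    -- derivative along the curve with derivatives on M.
    have h1 := hg.hasDerivAt_deC hγ hX
    have h2 := hX.eC (c := x) (f := frameAt P x) hg.2
    have h3 : HasDerivAt (fun r => connC A₀ (γ r) (frameAt P x) x (pt x (extChartAt (𝓡∂ 4) x x)))
      (X.aC (frameAt P x) x (pt x (extChartAt (𝓡∂ 4) x x))) t := (hX.aC hg.2).const_add _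
    have h4 := fun u v => hasDerivAt_clm_apply_const (hasDerivAt_clm_apply_const h1 u) v
    have h5 := fun u v => (hasDerivAt_clm_apply_const h3 u).clm_apply
      (hasDerivAt_clm_apply_const h2 v)
    have h6 := ((((h4 u v).sub (h4 v u)).add (h5 u v)).sub (h5 v u)).const_smul w
    have h7 := (hasDerivAt_clm_apply_const (hasDerivAt_clm_apply_const
      (hX.τC (c := x) hx) u) v).const_smul r
    refine (h7.add h6).congr_deriv ?_
    congr 2
    exact congrArg₂ (· - ·) (congrArg₂ (· + ·) rfl (add_comm _ _)) (add_comm _ _)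

end

/-! ## Isomorphisms of phase spaces -/

section

variable {M : Type*} [TopologicalSpace M] [ChartedSpace (EuclideanHalfSpace 4) M]
  [IsManifold (𝓡∂ 4) ∞ M]
  {V : M → Type*} [TopologicalSpace (TotalSpace Mink V)] [∀ x, AddCommGroup (V x)]
  [∀ x, Module ℝ (V x)] [∀ x, TopologicalSpace (V x)] [∀ x, IsTopologicalAddGroup (V x)]
  [∀ x, ContinuousSMul ℝ (V x)] [FiberBundle Mink V] [VectorBundle ℝ Mink V]
  [ContMDiffVectorBundle ∞ Mink V (𝓡∂ 4)] {P : MinkowskiBundle V}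

/-- A curve tangent to the kernel is mapped to such a curve: its velocity goes to D X, and D X is
tested against an arbitrary Y by writing Y as D of a vector, which `hD` provides. The factor k drops
out as it is nonzero. The same holds for the inverse, so the generating relations correspond and so
do the quotients. -/
theorem exists_phaseSpaceIso {ϖ ϖ' : FieldSpace P → FieldSpace P → FieldSpace P → ℝ} {k : ℝ}
    (hk : k ≠ 0) {Ψ Ψ' : FieldSpace P → FieldSpace P}
    {D D' : FieldSpace P → FieldSpace P → FieldSpace P}
    (hl : ∀ φ, Ψ' (Ψ φ) = φ) (hr : ∀ φ, Ψ (Ψ' φ) = φ) (hs : IsSmoothMap Ψ) (hs' : IsSmoothMap Ψ')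
    (ht : IsTangentMap Ψ D) (ht' : IsTangentMap Ψ' D') (he : ∀ φ x, (Ψ φ).e x = φ.e x)
    (hD : ∀ φ X, D φ (D' (Ψ φ) X) = X)
    (hϖ : ∀ φ X Y, ϖ φ X Y = k * ϖ' (Ψ φ) (D φ X) (D φ Y)) :
    ∃ Φ : PhaseSpace ϖ ≃ PhaseSpace ϖ', IsPhaseSpaceIso ϖ ϖ' k Φ ∧
      ∀ φ, Φ (PhaseSpace.mk ϖ φ) = PhaseSpace.mk ϖ' (Ψ φ) := by
  let e : FieldSpace P ≃ FieldSpace P := ⟨Ψ, Ψ', hl, hr⟩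
  have h1 : ∀ φ φ', LeafRel ϖ φ φ' → LeafRel ϖ' (Ψ φ) (Ψ φ') := by
    rintro φ φ' ⟨γ, hγ, h0, h1, h⟩
    refine ⟨Ψ ∘ γ, hs γ hγ, congrArg Ψ h0, congrArg Ψ h1, fun s => ?_⟩
    obtain ⟨X, hX, hker⟩ := h s
    refine ⟨D (γ s) X, ht γ s X hγ hX, fun Y => ?_⟩
    have h2 := hker (D' (Ψ (γ s)) Y)
    rw [hϖ, hD] at h2
    exact (mul_eq_zero.1 h2).resolve_left hk
  have h2 : ∀ ψ ψ', LeafRel ϖ' ψ ψ' → LeafRel ϖ (Ψ' ψ) (Ψ' ψ') := by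
    rintro ψ ψ' ⟨γ, hγ, h0, h1, h⟩
    refine ⟨Ψ' ∘ γ, hs' γ hγ, congrArg Ψ' h0, congrArg Ψ' h1, fun s => ?_⟩
    obtain ⟨X, hX, hker⟩ := h s
    refine ⟨D' (γ s) X, ht' γ s X hγ hX, fun Y => ?_⟩
    have h2 := hD (Ψ' (γ s)) X
    rw [hr] at h2
    rw [hϖ, Function.comp_apply, hr, h2, hker, mul_zero]
  let Φ : PhaseSpace ϖ ≃ PhaseSpace ϖ' := Quot.congr e fun φ φ' =>
    ⟨h1 φ φ', fun h => by simpa only [e, Equiv.coe_fn_mk, hl] using h2 _ _ h⟩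
  exact ⟨Φ, ⟨e, D, hs, hs', ht, he, fun φ => rfl, hϖ⟩, fun φ => rfl⟩

variable [T2Space M] {c d : ℝ} {φ X Y : FieldSpace P} {A₀ : Connection P} {x : M}

/-! ### The deformation absorbed in the connection -/

theorem kForm_mix : kForm 0 1 (mix d (-c) Y) (mix d (-c) φ) (mix d (-c) X) x = kForm c d Y φ X x :=
  alternatization_congr fun v => by
    have hx := mem_frameAt (P := P) x
    change pairC 0 1 ((mix d (-c) Y).aC (frameAt P x) x x (v 0)) _ _ = _
    rw [mix_aC hx, mix_eC, mix_eC]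
    exact pairC_mix c d (Y.aC_mem_so31 hx (v 0)) _ _

/-- The integrand contains the connection only through its variations, in ⟨δa, e ∧ δe⟩. So a linear
change of a acts on the variations alone, and the identity holds before integration. -/
theorem symplForm_mix : symplForm 0 1 (mix d (-c) φ) (mix d (-c) X) (mix d (-c) Y) x =
    symplForm c d φ X Y x := by
  simp only [symplForm, thetaDeriv, kForm_mix]
  rfl

/-! ### The deformation absorbed in `τ` -/

/-- This supplies the preimages under the tangent map that `exists_phaseSpaceIso` asks for. Torsion
fields depend on e and a only, which neither map changes, so only the coefficients have to match. -/
theorem dshift_dshift {r w r' w' : ℝ} (h1 : r * r' = 1) (h2 : r * w' + w = 0) :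
    dshift A₀ r w φ (dshift A₀ r' w' (shift A₀ r w φ) X) = X := by
  have ee : ∀ (φ X : FieldSpace P) (x : M) (r w : ℝ), (dshift A₀ r w φ X).e x = X.e x := by
    intro φ X x r w
    simp only [dshift, FieldSpace.add_e, FieldSpace.smul_e, torField_e, scale_e, smul_zero, add_zero]
  have ea : ∀ (φ X : FieldSpace P) (x : M) (r w : ℝ), (dshift A₀ r w φ X).a x = X.a x := by
    intro φ X x r w
    simp only [dshift, FieldSpace.add_a, FieldSpace.smul_a, torField_a, scale_a, smul_zero, add_zero]
  have h3 : ∀ s : ℝ, torField A₀ (φ + s • dshift A₀ r' w' (shift A₀ r w φ) X) =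
      torField A₀ (φ + s • X) := fun s => torField_congr
    (fun x => by rw [FieldSpace.add_e, FieldSpace.add_e, FieldSpace.smul_e, FieldSpace.smul_e, ee])
    fun x => by rw [FieldSpace.add_a, FieldSpace.add_a, FieldSpace.smul_a, FieldSpace.smul_a, ea]
  have h4 : ∀ s : ℝ, torField A₀ (shift A₀ r w φ + s • X) = torField A₀ (φ + s • X) := fun s =>
    torField_congr (fun x => by rw [FieldSpace.add_e, FieldSpace.add_e, shift_e])
      fun x => by rw [FieldSpace.add_a, FieldSpace.add_a, shift_a]
  refine fieldSpace_ext (fun x => by rw [ee, ee]) (fun x => by rw [ea, ea]) fun x => ?_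
  rw [dshift, h3, h3, dshift, h4, h4]
  simp only [FieldSpace.add_τ, FieldSpace.smul_τ, scale_τ]
  set T₁ := (torField A₀ (φ + (1 : ℝ) • X)).τ x
  set T₂ := (torField A₀ (φ + (-1 : ℝ) • X)).τ x
  rw [show r • (r' • X.τ x + (w' / 2) • T₁ + -(w' / 2) • T₂) + (w / 2) • T₁ + -(w / 2) • T₂ =
    (r * r') • X.τ x + ((r * w' + w) / 2) • T₁ + (-((r * w' + w) / 2)) • T₂ by module, h1, h2]
  simp

end

/-- The bilinear form `s η(e(u), e'(v))`. -/
def bM (s : ℝ) (e e' : E4 →L[ℝ] Mink) : MultilinearMap ℝ (fun _ : Fin 2 => E4) ℝ where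
  toFun v := s * ηC (e (v 0)) (e' (v 1))
  map_update_add' := by
    intro inst v i x y
    obtain rfl : inst = instDecidableEqFin 2 := Subsingleton.elim _ _
    fin_cases i <;> simp [Function.update, mul_add]
  map_update_smul' := by
    intro inst v i r x
    obtain rfl : inst = instDecidableEqFin 2 := Subsingleton.elim _ _
    fin_cases i <;> simp [Function.update, mul_left_comm]

/-- The Killing part becomes η(αv, w), the expression that also occurs in the variation of d_A e. -/
theorem pairC_split (c d : ℝ) (α : Mink →L[ℝ] Mink) (v w : Mink) :
    pairC c d α v w = -c * ηC (α v) w + d * pairC 0 1 α v w := by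
  simp only [pairC_apply, pairing, killingModel, ηC_apply]
  change _ = -c * minkowskiForm ((α : Module.End ℝ Mink) v) w + _
  ring

namespace Jet

variable {c d : ℝ} {j X Y : Jet}

theorem alt3_dtor (v : Fin 3 → E4) :
    alt3 (fun a b e => ηC (j.dtor X a b) (Y.e e)) v =
      2 * alt3 (fun a b e => ηC (X.de a b) (Y.e e)) v +
      2 * alt3 (fun a b e => ηC (j.A a (X.e b)) (Y.e e)) v +
      2 * alt3 (fun a b e => ηC (X.A a (j.e b)) (Y.e e)) v := by
  have h1 := alt3_swap01 (fun a b e => ηC (X.de a b) (Y.e e)) v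
  have h2 := alt3_swap01 (fun a b e => ηC (j.A a (X.e b)) (Y.e e)) v
  have h3 := alt3_swap01 (fun a b e => ηC (X.A a (j.e b)) (Y.e e)) v
  have h : (fun a b e => ηC (j.dtor X a b) (Y.e e)) = fun a b e =>
      (ηC (X.de a b) (Y.e e) - ηC (X.de b a) (Y.e e)) +
      ((ηC (j.A a (X.e b)) (Y.e e) - ηC (j.A b (X.e a)) (Y.e e)) +
      (ηC (X.A a (j.e b)) (Y.e e) - ηC (X.A b (j.e a)) (Y.e e))) := by
    funext a b e
    simp only [dtor, map_add, map_sub, add_apply, sub_apply]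
    ring
  rw [h, alt3_add, alt3_add, alt3_sub, alt3_sub, alt3_sub, h1, h2, h3]
  ring

/-- Skewness of A and the exchange of two arguments each give a sign. This symmetry in X and Y
removes the connection from the defect in `alt3_sympl`. -/
theorem alt3_skew (hj : ∀ u, IsSkew (j.A u)) (v : Fin 3 → E4) :
    alt3 (fun a b e => ηC (j.A a (Y.e b)) (X.e e)) v =
      alt3 (fun a b e => ηC (j.A a (X.e b)) (Y.e e)) v := by
  have h := alt3_swap12 (fun a b e => ηC (j.A a (X.e b)) (Y.e e)) v
  rw [← neg_inj, ← h, ← alt3_neg]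
  congr 1
  funext a b e
  rw [(hj a).η, neg_neg, ηC_symm]

/-- The integrand of the pre-boundary two-form. -/
def sympl (c d : ℝ) (j X Y : Jet) (a b e : E4) : ℝ :=
  (pairC c d (Y.A a) (j.e b) (X.e e) - 1 / 2 * ηC (X.τ a b) (Y.e e)) -
    (pairC c d (X.A a) (j.e b) (Y.e e) - 1 / 2 * ηC (Y.τ a b) (X.e e))

/-- The torsion variation inside the new τ cancels the terms c η(δa e, δe). The terms with the
background connection are symmetric in X and Y and cancel too. Only derivatives of the variations of
e remain, and they combine to the exterior derivative of -c η(δ₁e, δ₂e). -/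
theorem alt3_sympl {X' Y' : Jet} (hj : ∀ u, IsSkew (j.A u)) (hd : d ≠ 0)
    (he : ∀ u, X'.e u = X.e u) (hA : ∀ u, X'.A u = X.A u)
    (hτ : ∀ u v, X'.τ u v = (1 / d) • X.τ u v + (-c / d) • j.dtor X u v)
    (he' : ∀ u, Y'.e u = Y.e u) (hA' : ∀ u, Y'.A u = Y.A u)
    (hτ' : ∀ u v, Y'.τ u v = (1 / d) • Y.τ u v + (-c / d) • j.dtor Y u v) {j' : Jet}
    (hj' : ∀ u, j'.e u = j.e u) (v : Fin 3 → E4) :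
    alt3 (sympl c d j X Y) v = d * alt3 (sympl 0 1 j' X' Y') v +
      alt3 (fun a b e => -c * (ηC (X.de a b) (Y.e e) + ηC (X.e b) (Y.de a e))) v := by
  have h1 : (sympl c d j X Y) = fun a b e => (d * sympl 0 1 j' X' Y' a b e) +
      (c * (-ηC (Y.A a (j.e b)) (X.e e) + ηC (X.A a (j.e b)) (Y.e e)) +
      c / 2 * (-ηC (j.dtor X a b) (Y.e e) + ηC (j.dtor Y a b) (X.e e))) := by
    funext a b e
    simp only [sympl, he, hA, hτ, he', hA', hτ', hj', pairC_split c d, map_add, map_smul, add_apply,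
      smul_apply, smul_eq_mul]
    field_simp
    ring
  have h2 := alt3_swap12 (fun a b e => ηC (Y.de a b) (X.e e)) v
  have h3 : (fun a b e => ηC (X.e b) (Y.de a e)) = fun a b e => ηC (Y.de a e) (X.e b) := by
    funext a b e
    exact ηC_symm _ _
  rw [h1, alt3_add, alt3_mul, alt3_add, alt3_mul, alt3_mul, alt3_mul, alt3_add, alt3_add, alt3_add,
    alt3_neg, alt3_neg, alt3_dtor, alt3_dtor, h3, h2, alt3_skew (X := X) (Y := Y) hj]
  ring

end Jet

/-! ### The two-form under the shift of τ. -/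

section

variable {M : Type*} [TopologicalSpace M] [ChartedSpace (EuclideanHalfSpace 4) M]
  [IsManifold (𝓡∂ 4) ∞ M]
  {V : M → Type*} [TopologicalSpace (TotalSpace Mink V)] [∀ x, AddCommGroup (V x)]
  [∀ x, Module ℝ (V x)] [∀ x, TopologicalSpace (V x)] [∀ x, IsTopologicalAddGroup (V x)]
  [∀ x, ContinuousSMul ℝ (V x)] [FiberBundle Mink V] [VectorBundle ℝ Mink V]
  [ContMDiffVectorBundle ∞ Mink V (𝓡∂ 4)] {P : MinkowskiBundle V} [T2Space M]
  {N : Type*} [TopologicalSpace N] [ChartedSpace (EuclideanSpace ℝ (Fin 3)) N]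
  [IsManifold (𝓡 3) ∞ N] [CompactSpace N] [T2Space N]
  {o : OrientationForm M} {b : BoundaryInclusion M N}
  {c d s : ℝ} {φ X Y : FieldSpace P} {A₀ : Connection P} {f : LocalFrame P} {C x : M} {y : E4}

/-- The 2-form `s η(e_X, e_Y)`. -/
def eForm (s : ℝ) (X Y : FieldSpace P) (x : M) : TangentSpace (𝓡∂ 4) x [⋀^Fin 2]→ₗ[ℝ] ℝ :=
  (MultilinearMap.alternatization (bM s (X.eC (frameAt P x) x x) (Y.eC (frameAt P x) x x)) :
    E4 [⋀^Fin 2]→ₗ[ℝ] ℝ)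

theorem eForm_tv (hx : x ∈ f.U) (v : Fin 2 → E4) :
    eForm s X Y x (fun i => tv C x (v i)) =
      altSum (fun v => s * ηC (X.eC f C x (v 0)) (Y.eC f C x (v 1))) v := by
  refine (alternatization_eq_altSum _ _).trans (altSum_congr fun σ => ?_)
  change s * ηC (X.eC (frameAt P x) x x (tv C x (v (σ 0))))
    (Y.eC (frameAt P x) x x (tv C x (v (σ 1)))) = _
  rw [eC_self, eC_self]
  exact congrArg (s * ·) (ηC_frames (mem_frameAt x) hx _ _)

theorem IsGood.chartRep_eForm (h : IsGood f C y) (v : Fin 2 → E4) :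
    chartRep (𝓡∂ 4) (fun x => eForm s X Y x) C y v =
      altSum (fun v => s * ηC (X.eC f C (pt C y) (v 0)) (Y.eC f C (pt C y) (v 1))) v := by
  rw [chartRep_eq _ h.1]
  exact eForm_tv h.2 v

theorem IsGood.contDiff_b (h : IsGood f C y) (u v : E4) :
    ContDiffWithinAt ℝ ∞ (fun y => ηC (X.eC f C (pt C y) u) (Y.eC f C (pt C y) v)) halfSpace y := by
  have h1 := (eC_contDiffWithinAt X h.1 h.2).clm_apply (contDiffWithinAt_const (c := u))
  have h3 := (eC_contDiffWithinAt Y h.1 h.2).clm_apply (contDiffWithinAt_const (c := v))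
  exact (ηC.contDiff.comp_contDiffWithinAt h1).clm_apply h3

theorem isSmoothForm_eForm : IsSmoothForm (𝓡∂ 4) (eForm (P := P) s X Y) := by
  refine isSmoothForm_of_eventually fun c y hy v => ?_
  have hg : IsGood (frameAt P (pt c y)) c y := ⟨hy, mem_frameAt _⟩
  refine ⟨_, ?_, hg.eventually.mono fun y' hy' => hy'.chartRep_eForm v⟩
  exact ContDiffWithinAt.sum fun σ _ => contDiffWithinAt_const.mul
    (contDiffWithinAt_const.mul (hg.contDiff_b _ _))

theorem IsGood.fderivWithin_b (h : IsGood f C y) (v w t : E4) :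
    fderivWithin ℝ (fun y => ηC (X.eC f C (pt C y) v) (Y.eC f C (pt C y) w)) halfSpace y t =
    ηC (deC X f C y t v) (Y.eC f C (pt C y) w) + ηC (X.eC f C (pt C y) v) (deC Y f C y t w) := by
  have hu := unique_halfSpace h.mem
  have h1 := (h.eC_diff (φ := X)).hasFDerivWithinAt.clm_apply
    (hasFDerivWithinAt_const v y halfSpace)
  have h3 := (h.eC_diff (φ := Y)).hasFDerivWithinAt.clm_apply
    (hasFDerivWithinAt_const w y halfSpace)
  have h4 := ((ηC.hasFDerivAt.comp_hasFDerivWithinAt y h1).clm_apply h3).fderivWithin hu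
  refine (congrArg (fun L : E4 →L[ℝ] ℝ => L t) h4).trans ?_
  simp [deC]
  ring

theorem extDer_eForm (hx : x ∈ f.U) (v : Fin 3 → E4) :
    extDer (𝓡∂ 4) (eForm s X Y) x v =
      alt3 (fun a b e => s * (ηC ((vjet X f x (extChartAt (𝓡∂ 4) x x)).de a b)
        ((vjet Y f x (extChartAt (𝓡∂ 4) x x)).e e) + ηC ((vjet X f x (extChartAt (𝓡∂ 4) x x)).e b)
        ((vjet Y f x (extChartAt (𝓡∂ 4) x x)).de a e))) v := by
  have hg := isGood_self hx
  have hd := fun u v => (hg.contDiff_b (X := X) (Y := Y) u v).differentiableWithinAt (by simp)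
  rw [extDer_eq_altSum (hg.eventually.mono fun y hy v => hy.chartRep_eForm v)
    (fun v => (hd _ _).const_mul _)]
  refine altSum_congr fun σ => ?_
  have hu := unique_halfSpace hg.mem
  rw [fderivWithin_const_mul hu (hd _ _), smul_apply, hg.fderivWithin_b]
  rfl

theorem symplForm_apply (hx : x ∈ f.U) (v : Fin 3 → E4) :
    symplForm c d φ X Y x v = alt3 (Jet.sympl c d (jet A₀ φ f x (extChartAt (𝓡∂ 4) x x))
      (vjet X f x (extChartAt (𝓡∂ 4) x x)) (vjet Y f x (extChartAt (𝓡∂ 4) x x))) v := by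
  have h1 : ∀ X Y : FieldSpace P, kForm c d Y φ X x v = alt3 (fun a b e =>
      pairC c d ((vjet Y f x (extChartAt (𝓡∂ 4) x x)).A a)
        ((jet A₀ φ f x (extChartAt (𝓡∂ 4) x x)).e b)
        ((vjet X f x (extChartAt (𝓡∂ 4) x x)).e e)) v := by
    intro X Y
    have h := kForm_tv (c := x) (r := c) (s := d) (X := Y) (φ := φ) (ψ := X) hx v
    simp only [tv_self] at h
    refine h.trans (congrArg (fun g => alt3 g v) ?_)
    funext a b e
    have e1 : (jet A₀ φ f x (extChartAt (𝓡∂ 4) x x)).e = φ.eC f x x :=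
      congrArg (φ.eC f x) (pt_self x)
    have e2 : (vjet X f x (extChartAt (𝓡∂ 4) x x)).e = X.eC f x x :=
      congrArg (X.eC f x) (pt_self x)
    have e3 : (vjet Y f x (extChartAt (𝓡∂ 4) x x)).A = Y.aC f x x :=
      congrArg (Y.aC f x) (pt_self x)
    rw [e1, e2, e3]
  have h2 : ∀ X Y : FieldSpace P, hForm X Y x v = alt3 (fun a b e =>
      ηC ((vjet X f x (extChartAt (𝓡∂ 4) x x)).τ a b)
        ((vjet Y f x (extChartAt (𝓡∂ 4) x x)).e e)) v := by
    intro X Y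
    have h := hForm_tv (c := x) (φ := X) (X := Y) hx v
    simp only [tv_self] at h
    refine h.trans (congrArg (fun g => alt3 g v) ?_)
    funext a b e
    have e1 : (vjet X f x (extChartAt (𝓡∂ 4) x x)).τ = X.τC f x x :=
      congrArg (X.τC f x) (pt_self x)
    have e2 : (vjet Y f x (extChartAt (𝓡∂ 4) x x)).e = Y.eC f x x :=
      congrArg (Y.eC f x) (pt_self x)
    rw [e1, e2]
  have h3 : symplForm c d φ X Y x v =
      1 * (1 * kForm c d Y φ X x v + (-(1 / 2)) * hForm X Y x v) +
      (-1) * (1 * kForm c d X φ Y x v + (-(1 / 2)) * hForm Y X x v) := rfl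
  rw [h3, h1, h1, h2, h2]
  unfold Jet.sympl
  rw [alt3_sub, alt3_sub, alt3_sub, alt3_mul, alt3_mul]
  ring

theorem symplForm_shift (hd : d ≠ 0) (v : Fin 3 → E4) :
    symplForm c d φ X Y x v =
      d * symplForm 0 1 (shift A₀ (1 / d) (-c / d) φ) (dshift A₀ (1 / d) (-c / d) φ X)
        (dshift A₀ (1 / d) (-c / d) φ Y) x v + extDer (𝓡∂ 4) (eForm (-c) X Y) x v := by
  have hx := mem_frameAt (P := P) x
  have hg := isGood_self hx
  have hτ : ∀ (X : FieldSpace P) (u v : E4),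
      (vjet (dshift A₀ (1 / d) (-c / d) φ X) (frameAt P x) x (extChartAt (𝓡∂ 4) x x)).τ u v =
      (1 / d) • (vjet X (frameAt P x) x (extChartAt (𝓡∂ 4) x x)).τ u v +
      (-c / d) • (jet A₀ φ (frameAt P x) x (extChartAt (𝓡∂ 4) x x)).dtor
        (vjet X (frameAt P x) x (extChartAt (𝓡∂ 4) x x)) u v := by
    intro X u v
    have e1 : ∀ X : FieldSpace P, (vjet X (frameAt P x) x (extChartAt (𝓡∂ 4) x x)).τ =
      X.τC (frameAt P x) x x := fun X => congrArg (X.τC (frameAt P x) x) (pt_self x)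
    rw [e1, e1]
    exact dshift_τC hx (mem_chart_source _ x) u v
  rw [symplForm_apply (A₀ := A₀) hx, symplForm_apply (A₀ := A₀) hx, extDer_eForm hx]
  exact Jet.alt3_sympl hg.isSkew_conn hd (fun u => congrArg (fun L : E4 →L[ℝ] Mink => L u) dshift_eC)
    (fun u => congrArg (fun L : E4 →L[ℝ] Mink →L[ℝ] Mink => L u) dshift_aC) (hτ X)
    (fun u => congrArg (fun L : E4 →L[ℝ] Mink => L u) dshift_eC)
    (fun u => congrArg (fun L : E4 →L[ℝ] Mink →L[ℝ] Mink => L u) dshift_aC) (hτ Y)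
    (fun u => congrArg (fun L : E4 →L[ℝ] Mink => L u) shift_eC) v

/-- The pointwise defect is exact, with a globally defined smooth potential `eForm`, and the
boundary is closed. -/
theorem boundaryIntegral_symplForm_shift (A₀ : Connection P) (hd : d ≠ 0) :
    boundaryIntegral o b (symplForm c d φ X Y) = d * boundaryIntegral o b
      (symplForm 0 1 (shift A₀ (1 / d) (-c / d) φ) (dshift A₀ (1 / d) (-c / d) φ X)
        (dshift A₀ (1 / d) (-c / d) φ Y)) := by
  have h := boundaryIntegral_eq_zero (o := o) (b := b) (α := fun x => (1 : ℝ) • symplForm c d φ X Y x +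
    (-d) • symplForm 0 1 (shift A₀ (1 / d) (-c / d) φ) (dshift A₀ (1 / d) (-c / d) φ X)
        (dshift A₀ (1 / d) (-c / d) φ Y) x) (isSmoothForm_eForm (s := -c) (X := X) (Y := Y))
    fun x v => by
      rw [AlternatingMap.add_apply, AlternatingMap.smul_apply, AlternatingMap.smul_apply, smul_eq_mul,
        smul_eq_mul]
      have h := symplForm_shift (A₀ := A₀) (c := c) (φ := φ) (X := X) (Y := Y) (x := x) hd v
      linarith
  rw [boundaryIntegral_lin (isSmoothForm_symplForm φ X Y) (isSmoothForm_symplForm _ _ _)] at h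
  linarith

end

/-- Cyclic permutations of the first three arguments do not change the alternating sum, so three
times the sum is the alternation of the Bianchi expression. -/
theorem Jet.alt4_bianchi {j X : Jet} (h : ∀ u v w : E4,
      j.cur u v (j.e w) + j.cur v w (j.e u) + j.cur w u (j.e v) = 0) (v : Fin 4 → E4) :
    alt4 (fun a b c d => ηC (j.cur a b (j.e c)) (X.e d)) v = 0 := by
  have h1 := alt4_cycle (fun a b c d => ηC (j.cur a b (j.e c)) (X.e d)) v
  have h2 := alt4_cycle (fun a b c d => ηC (j.cur b c (j.e a)) (X.e d)) v
  have h3 : alt4 (fun a b c d => ηC (j.cur a b (j.e c)) (X.e d) +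
      ηC (j.cur b c (j.e a)) (X.e d) + ηC (j.cur c a (j.e b)) (X.e d)) v = 0 := by
    refine alt4_eq_zero (fun a b c d => ?_) v
    have := congrArg (fun t => ηC t (X.e d)) (h a b c)
    simpa only [map_add, add_apply, map_zero, zero_apply] using this
  rw [alt4_add, alt4_add] at h3
  linarith

/-- The Euler–Lagrange forms of the two theories agree in the absence of torsion. -/
theorem Jet.alt4_el {c d r : ℝ} {j j' X : Jet} (hd : d * r = 1) (he : j'.e = j.e) (hA : j'.A = j.A)
    (hτ : j'.τ = r • j.τ) (hde : j'.de = j.de) (hdA : j'.dA = j.dA) (hdτ : j'.dτ = r • j.dτ)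
    (ht : ∀ u v, j.tor u v = 0) (h : ∀ u v w : E4,
      j.cur u v (j.e w) + j.cur v w (j.e u) + j.cur w u (j.e v) = 0) (v : Fin 4 → E4) :
    alt4 (Jet.el c d j X) v = d * alt4 (Jet.el 0 1 j' X) v := by
  -- Without torsion the equations of A and τ no longer contain c. The Killing part of the equation
  -- of e survives, and it is the term F ∧ e.
  have h1 : Jet.el c d j X = fun u₁ u₂ u₃ u₄ => d * Jet.el 0 1 j' X u₁ u₂ u₃ u₄ +
      (-c / 2) * ηC (j.cur u₁ u₂ (j.e u₃)) (X.e u₄) := by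
    funext u₁ u₂ u₃ u₄
    have ht' : ∀ u v, j'.tor u v = 0 := fun u v => by
      rw [← ht u v, Jet.tor, Jet.tor, he, hA, hde]
    have hc : ∀ u v, j'.cur u v = j.cur u v := fun u v => by rw [Jet.cur, Jet.cur, hA, hdA]
    simp only [Jet.el, ht, ht', hc, he, hA, hτ, hdτ, pairC_split c d, map_add, map_smul, add_apply,
      smul_apply, smul_eq_mul, map_zero, zero_apply]
    linear_combination ((1 / 2) * ηC (j.τ u₁ u₂) (X.A u₃ (j.e u₄)) -
      1 / 2 * (ηC (j.dτ u₁ u₂ u₃) (X.e u₄) + ηC (j.A u₁ (j.τ u₂ u₃)) (X.e u₄))) * hd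
  rw [h1, alt4_add, alt4_mul, alt4_mul, Jet.alt4_bianchi h]
  ring

/-! ### The first Bianchi identity and comparison of the field equations. -/

section

variable {M : Type*} [TopologicalSpace M] [ChartedSpace (EuclideanHalfSpace 4) M]
  [IsManifold (𝓡∂ 4) ∞ M]
  {V : M → Type*} [TopologicalSpace (TotalSpace Mink V)] [∀ x, AddCommGroup (V x)]
  [∀ x, Module ℝ (V x)] [∀ x, TopologicalSpace (V x)] [∀ x, IsTopologicalAddGroup (V x)]
  [∀ x, ContinuousSMul ℝ (V x)] [FiberBundle Mink V] [VectorBundle ℝ Mink V]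
  [ContMDiffVectorBundle ∞ Mink V (𝓡∂ 4)] {P : MinkowskiBundle V} [T2Space M]
  {c d r w : ℝ} {φ X Y : FieldSpace P} {A₀ : Connection P} {f : LocalFrame P} {C x : M} {y : E4}

theorem IsGood.fderivWithin_torC (h : IsGood f C y) (t u v : E4) :
    fderivWithin ℝ (fun y => torC A₀ φ f C y u v) halfSpace y t =
      (fderivWithin ℝ (deC φ f C) halfSpace y t u v - fderivWithin ℝ (deC φ f C) halfSpace y t v u) +
      (dconnC A₀ φ f C y t u (φ.eC f C (pt C y) v) +
        connC A₀ φ f C (pt C y) u (deC φ f C y t v)) -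
      (dconnC A₀ φ f C y t v (φ.eC f C (pt C y) u) +
        connC A₀ φ f C (pt C y) v (deC φ f C y t u)) := by
  have hu := unique_halfSpace h.mem
  have hde : DifferentiableWithinAt ℝ (deC φ f C) halfSpace y :=
    ((eC_contDiffWithinAt φ h.1 h.2).fderivWithin_right (m := ∞) uniqueDiffOn_halfSpace (by simp)
      h.mem).differentiableWithinAt (by simp)
  have h0 := fun u v : E4 => (hde.hasFDerivWithinAt.clm_apply
    (hasFDerivWithinAt_const u y halfSpace)).clm_apply (hasFDerivWithinAt_const v y halfSpace)
  have h1 := fun u v : E4 => ((h.differentiable_connC (A₀ := A₀) (φ := φ)).hasFDerivWithinAt.clm_apply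
    (hasFDerivWithinAt_const u y halfSpace)).clm_apply
    ((h.eC_diff (φ := φ)).hasFDerivWithinAt.clm_apply (hasFDerivWithinAt_const v y halfSpace))
  have h4 := ((((h0 u v).sub (h0 v u)).add (h1 u v)).sub (h1 v u)).fderivWithin hu
  refine (congrArg (fun L : E4 →L[ℝ] Mink => L t) h4).trans ?_
  simp [deC, dconnC]
  abel

/-- This is d_A d_A e = F_A ∧ e for vanishing torsion. The cyclic sum of the derivatives of the
torsion plus the connection applied to the torsion equals the curvature term, as second derivatives
of e cancel. The torsion must vanish near the point because it is differentiated. -/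
theorem IsGood.bianchi (h : IsGood f C y)
    (h0 : ∀ᶠ y in 𝓝[halfSpace] y, ∀ u v, torC A₀ φ f C y u v = 0) (u v w : E4) :
    (jet A₀ φ f C y).cur u v ((jet A₀ φ f C y).e w) + (jet A₀ φ f C y).cur v w
      ((jet A₀ φ f C y).e u) + (jet A₀ φ f C y).cur w u ((jet A₀ φ f C y).e v) = 0 := by
  have hd : ∀ t u v, fderivWithin ℝ (fun y => torC A₀ φ f C y u v) halfSpace y t = 0 := by
    intro t u v
    have h1 : fderivWithin ℝ (fun y => torC A₀ φ f C y u v) halfSpace y =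
        fderivWithin ℝ (fun _ => (0 : Mink)) halfSpace y :=
      Filter.EventuallyEq.fderivWithin_eq_of_mem (h0.mono fun y hy => hy u v) h.mem
    rw [h1, fderivWithin_fun_const]
    rfl
  have ht : ∀ u v, torC A₀ φ f C y u v = 0 := h0.self_of_nhdsWithin h.mem
  have hs := fun a b e : E4 => congrArg (fun L : E4 →L[ℝ] Mink => L e)
    (sndDeriv_symm h.mem (eC_contDiffWithinAt φ h.1 h.2) a b)
  have hs' : ∀ a b e : E4, fderivWithin ℝ (deC φ f C) halfSpace y a b e =
    fderivWithin ℝ (deC φ f C) halfSpace y b a e := hs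
  have k1 := hd u v w
  have k2 := hd v w u
  have k3 := hd w u v
  rw [h.fderivWithin_torC] at k1 k2 k3
  have l1 := congrArg (connC A₀ φ f C (pt C y) u) (ht v w)
  have l2 := congrArg (connC A₀ φ f C (pt C y) v) (ht w u)
  have l3 := congrArg (connC A₀ φ f C (pt C y) w) (ht u v)
  simp only [torC, map_add, map_sub, map_zero] at l1 l2 l3
  rw [hs' v u w] at k2
  rw [hs' w u v, hs' w v u] at k3
  have goal : (jet A₀ φ f C y).cur u v ((jet A₀ φ f C y).e w) + (jet A₀ φ f C y).cur v w
      ((jet A₀ φ f C y).e u) + (jet A₀ φ f C y).cur w u ((jet A₀ φ f C y).e v) =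
      (curC A₀ φ f C y u v (φ.eC f C (pt C y) w) + curC A₀ φ f C y v w (φ.eC f C (pt C y) u) +
      curC A₀ φ f C y w u (φ.eC f C (pt C y) v)) := rfl
  rw [goal]
  simp only [curC, add_apply, sub_apply, mul_apply_eq_comp]
  linear_combination (exp := 1) k1 + k2 + k3 + l1 + l2 + l3

/-- Vanishing torsion is required in a neighbourhood: the form contains derivatives of τ, and only
there is the shift a mere rescaling of τ by 1/d; the Bianchi identity has the same requirement. -/
theorem elForm_shift (hd : d ≠ 0) (h : ∀ᶠ x' in 𝓝 x, ∀ u v, torsion A₀ φ x' u v = 0) :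
    elForm c d A₀ φ X x = d • elForm 0 1 A₀ (shift A₀ (1 / d) (-c / d) φ) X x := by
  have hx := mem_frameAt (P := P) x
  have hg := isGood_self hx
  obtain ⟨W, hW, hWo, hxW⟩ := eventually_nhds_iff.1 h
  have h0 : ∀ᶠ y in 𝓝[halfSpace] (extChartAt (𝓡∂ 4) x x), ∀ u v,
      torC A₀ φ (frameAt P x) x y u v = 0 := by
    filter_upwards [hg.eventually, eventually_pt hg.1 hWo (by rwa [pt_self])] with y hy hy' u v
    have h1 := coord_torsion_tv (A₀ := A₀) (φ := φ) hy.2 hy.mem_source u v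
    rw [extChartAt_pt hy.1] at h1
    rw [← h1, hW _ hy'.2, map_zero]
  have hτ : ∀ᶠ y in 𝓝[halfSpace] (extChartAt (𝓡∂ 4) x x),
      (shift A₀ (1 / d) (-c / d) φ).τC (frameAt P x) x (pt x y) =
        (1 / d) • φ.τC (frameAt P x) x (pt x y) := by
    filter_upwards [hg.eventually, h0] with y hy hy'
    rw [shift_τC hy.2 hy.mem_source, extChartAt_pt hy.1]
    have h1 : (jet A₀ φ (frameAt P x) x y).torB = 0 := by
      ext1 u; ext1 v
      exact hy' u v
    rw [h1, smul_zero, add_zero]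
  refine AlternatingMap.ext fun v => ?_
  rw [AlternatingMap.smul_apply, smul_eq_mul]
  refine (elForm_apply v).trans (Eq.trans ?_ (congrArg (d * ·) (elForm_apply v)).symm)
  refine Jet.alt4_el (r := 1 / d)
    (j := jet A₀ φ (frameAt P x) x (extChartAt (𝓡∂ 4) x x))
    (j' := jet A₀ (shift A₀ (1 / d) (-c / d) φ) (frameAt P x) x (extChartAt (𝓡∂ 4) x x))
    (mul_one_div_cancel hd) shift_eC ?_ (hτ.self_of_nhdsWithin hg.mem)
    ?_ ?_ ?_ (h0.self_of_nhdsWithin hg.mem) (hg.bianchi h0) v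
  · change connC _ _ _ _ _ = connC _ _ _ _ _
    rw [connC, connC, shift_aC]
  · change deC _ _ _ _ = deC _ _ _ _
    simp only [deC, shift_eC]
  · change dconnC _ _ _ _ _ = dconnC _ _ _ _ _
    simp only [dconnC, connC, shift_aC]
  · change dτC _ _ _ _ = (1 / d) • dτC _ _ _ _
    rw [dτC, dτC, Filter.EventuallyEq.fderivWithin_eq_of_mem hτ hg.mem]
    exact fderivWithin_fun_const_smul (unique_halfSpace hg.mem) hg.τC_diff _

end

/-- Only the identity and the transposition of 2 and 3 fix both 0 and 1. -/
theorem sum_perm_dual (t : Fin 4 → Fin 4 → ℝ) :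
    ∑ σ : Equiv.Perm (Fin 4), ((Equiv.Perm.sign σ : ℤ) : ℝ) *
      (if σ 0 = 0 ∧ σ 1 = 1 then t (σ 2) (σ 3) else 0) = t 2 3 - t 3 2 := by
  have h1 : (Finset.univ.filter fun σ : Equiv.Perm (Fin 4) => σ 0 = 0 ∧ σ 1 = 1) =
      {1, Equiv.swap 2 3} := by decide
  simp only [mul_ite, mul_zero]
  rw [← Finset.sum_filter, h1, Finset.sum_pair (by decide)]
  have h2 : Equiv.Perm.sign (Equiv.swap (2 : Fin 4) 3) = -1 := Equiv.Perm.sign_swap (by decide)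
  have h3 : Equiv.swap (2 : Fin 4) 3 2 = 3 := by decide
  have h4 : Equiv.swap (2 : Fin 4) 3 3 = 2 := by decide
  simp [h2, h3, h4]
  ring

theorem exists_perm_two {i j : Fin 4} (h : i ≠ j) : ∃ ρ : Equiv.Perm (Fin 4), ρ 2 = i ∧ ρ 3 = j := by
  revert i j
  decide

/-- The vector-valued 2-form `(dxᵏ ∧ dxˡ) z`. -/
def coordForm (k l : Fin 4) (z : Mink) : E4 →L[ℝ] E4 →L[ℝ] Mink :=
  toCLM₂ (LinearMap.mk₂ ℝ (fun u v : E4 => (u k * v l - u l * v k) • z)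
    (fun u u' v => by rw [← add_smul]; congr 1; simp; ring)
    (fun r u v => by rw [smul_smul]; congr 1; simp; ring)
    (fun u v v' => by rw [← add_smul]; congr 1; simp; ring)
    (fun r u v => by rw [smul_smul]; congr 1; simp; ring))

theorem coordForm_apply (k l : Fin 4) (z : Mink) (u v : E4) :
    coordForm k l z u v = (u k * v l - u l * v k) • z := rfl

theorem ηC_eq_zero {w : Mink} (h : ∀ z, ηC z w = 0) : w = 0 := by
  ext i
  have h1 := h (Pi.single i 1)
  rw [ηC_apply, minkowskiForm_apply] at h1
  simp only [Pi.single_apply, mul_ite, mul_one, mul_zero, ite_mul, zero_mul, Finset.sum_ite_eq',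
    Finset.mem_univ, if_true] at h1
  have h2 := sgn_mul_self i
  have h3 : w i = sgn i * (sgn i * w i) := by rw [← mul_assoc, h2, one_mul]
  rw [h3, h1, mul_zero]
  rfl

/-- Nondegeneracy of the pairing of vector-valued 2-forms. -/
theorem eq_zero_of_alt4 {T : E4 →L[ℝ] E4 →L[ℝ] Mink} (hT : ∀ u v, T u v = -T v u)
    (h : ∀ k l z v, alt4 (fun a b c d => ηC (coordForm k l z a b) (T c d)) v = 0) : T = 0 := by
  have key : ∀ i j : Fin 4, i ≠ j → T (stdVec 4 i) (stdVec 4 j) = 0 := by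
    intro i j hij
    obtain ⟨ρ, rfl, rfl⟩ := exists_perm_two hij
    refine ηC_eq_zero fun z => ?_
    -- The permutation ρ puts i and j in the last two places. The coordinate form of the
    -- complementary pair of indices then isolates the value of T on this pair of basis vectors, up
    -- to a factor.
    let t : Fin 4 → Fin 4 → ℝ := fun a b => ηC z (T (stdVec 4 (ρ a)) (stdVec 4 (ρ b)))
    have h1 : alt4 (fun a b c d => a (ρ 0) * b (ρ 1) * ηC z (T c d)) (fun i => stdVec 4 (ρ i)) =
        t 2 3 - t 3 2 := by
      rw [← sum_perm_dual t]
      unfold alt4 altSum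
      refine Finset.sum_congr rfl fun (σ : Equiv.Perm (Fin 4)) _ => congrArg (((Equiv.Perm.sign σ : ℤ) : ℝ) * ·) ?_
      have e : ∀ a b : Fin 4, stdVec 4 (ρ a) (ρ b) = if a = b then 1 else 0 := by
        intro a b
        simp [stdVec, eq_comm]
      simp only [e, t]
      by_cases h1 : σ 0 = 0 <;> by_cases h2 : σ 1 = 1 <;> simp only [h1, h2, if_true, if_false,
        and_true, and_false, one_mul, zero_mul, mul_zero]
    have h2 := h (ρ 0) (ρ 1) z fun i => stdVec 4 (ρ i)
    have h3 : (fun a b c d => ηC (coordForm (ρ 0) (ρ 1) z a b) (T c d)) = fun a b c d =>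
        a (ρ 0) * b (ρ 1) * ηC z (T c d) - b (ρ 0) * a (ρ 1) * ηC z (T c d) := by
      funext a b c d
      rw [coordForm_apply, map_smul, smul_apply, smul_eq_mul]
      ring
    have h4 := alt4_swap01 (fun a b c d => a (ρ 0) * b (ρ 1) * ηC z (T c d))
      (fun i => stdVec 4 (ρ i))
    rw [h3, alt4_sub, h4, h1] at h2
    have h5 : t 3 2 = -t 2 3 := by
      simp only [t]
      rw [hT, map_neg]
    change t 2 3 = 0
    linarith
  have hself : ∀ u, T u u = 0 := fun u => self_eq_neg.1 (hT u u)
  have hb : ∀ i j : Fin 4, T (stdVec 4 i) (stdVec 4 j) = 0 := fun i j => by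
    by_cases hij : i = j
    · rw [hij, hself]
    · exact key i j hij
  have hs : ∀ u : E4, u = ∑ i, u i • stdVec 4 i := fun u => by
    ext j
    simp [stdVec, Pi.single_apply]
  ext1 u; ext1 v
  rw [hs u, hs v]
  simp [hb]

/-! ### Test variations of τ and the vanishing of the torsion. -/

section

variable {M : Type*} [TopologicalSpace M] [ChartedSpace (EuclideanHalfSpace 4) M]
  [IsManifold (𝓡∂ 4) ∞ M]

/-- A global function whose differential at a given point is the identity. -/
theorem exists_mfderiv_eq_id [T2Space M] (x : M) : ∃ G : M → E4, ContMDiff (𝓡∂ 4) 𝓘(ℝ, E4) ∞ G ∧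
    ∀ u : E4, (mfderiv (𝓡∂ 4) 𝓘(ℝ, E4) G x u : E4) = u := by
  let χ : SmoothBumpFunction (𝓡∂ 4) x := Classical.arbitrary _
  refine ⟨fun z => χ z • extChartAt (𝓡∂ 4) x z, χ.contMDiff_smul (contMDiffOn_extChartAt), ?_⟩
  intro u
  have h1 : (fun z => χ z • extChartAt (𝓡∂ 4) x z) =ᶠ[𝓝 x] extChartAt (𝓡∂ 4) x := by
    filter_upwards [χ.eventuallyEq_one] with z hz
    rw [hz]
    exact one_smul ℝ _
  rw [h1.mfderiv_eq]
  have h2 := dchart_tv (mem_chart_source (EuclideanHalfSpace 4) x) u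
  rw [tv_self] at h2
  exact h2

theorem contMDiffAt_mfderiv_tv {G : M → E4} (hG : ContMDiff (𝓡∂ 4) 𝓘(ℝ, E4) ∞ G) (x : M) (u : E4) :
    ContMDiffAt (𝓡∂ 4) 𝓘(ℝ, E4) ∞
      (fun z => (mfderiv (𝓡∂ 4) 𝓘(ℝ, E4) G z (tv x z u) : E4)) x := by
  have hy : extChartAt (𝓡∂ 4) x x ∈ (extChartAt (𝓡∂ 4) x).target := mem_extChartAt_target x
  have h1 : ContDiffWithinAt ℝ ∞ (fun y => G (pt x y)) halfSpace (extChartAt (𝓡∂ 4) x x) :=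
    (hG.contMDiffAt.comp_contMDiffWithinAt _
      (pt_contMDiffWithinAt contDiffWithinAt_id (mapsTo_id _) hy)).contDiffWithinAt
  have h2 : ContDiffWithinAt ℝ ∞ (fun y => fderivWithin ℝ (fun y => G (pt x y)) halfSpace y u)
      halfSpace (extChartAt (𝓡∂ 4) x x) :=
    (h1.fderivWithin_right (m := ∞) uniqueDiffOn_halfSpace (by simp)
      (extChartAt_mem_halfSpace x x)).clm_apply contDiffWithinAt_const
  have h3 := ContMDiffWithinAt.comp (I := 𝓡∂ 4) (s := univ) (g := fun y => fderivWithin ℝ (fun y => G (pt x y)) halfSpace y u)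
    (f := fun z => extChartAt (𝓡∂ 4) x z) x h2.contMDiffWithinAt
    (contMDiffAt_extChartAt (I := 𝓡∂ 4) (n := ∞)).contMDiffWithinAt
    fun z _ => extChartAt_mem_halfSpace x z
  refine (contMDiffWithinAt_univ.1 h3).congr_of_eventuallyEq ?_
  filter_upwards [(chartAt (EuclideanHalfSpace 4) x).open_source.mem_nhds (mem_chart_source _ _)]
    with z hz
  exact mfderiv_tv hz (hG.mdifferentiable (by simp) z) u

variable {V : M → Type*} [TopologicalSpace (TotalSpace Mink V)] [∀ x, AddCommGroup (V x)]
  [∀ x, Module ℝ (V x)] [∀ x, TopologicalSpace (V x)] [∀ x, IsTopologicalAddGroup (V x)]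
  [∀ x, ContinuousSMul ℝ (V x)] [FiberBundle Mink V] [VectorBundle ℝ Mink V]
  [ContMDiffVectorBundle ∞ Mink V (𝓡∂ 4)] {P : MinkowskiBundle V} [T2Space M]
  {c d : ℝ} {φ X : FieldSpace P} {A₀ : Connection P} {x : M}

/-- The variations of `τ` realise all coordinate 2-forms at a point. -/
theorem exists_testField (f : LocalFrame P) (hx : x ∈ f.U) (k l : Fin 4) (z : Mink) :
    ∃ X : FieldSpace P, X.eC f x x = 0 ∧ X.aC f x x = 0 ∧ X.τC f x x = coordForm k l z := by
  obtain ⟨G, hG, hGx⟩ := exists_mfderiv_eq_id x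
  -- The constant form is pulled back along a global map with identity differential at x and takes
  -- values in the global frame sections. This gives a smooth field on all of M with the prescribed
  -- value at x.
  let B : ∀ p : M, E4 →L[ℝ] E4 →L[ℝ] Mink := fun p =>
    ((coordForm k l z).bilinearComp (mfderiv (𝓡∂ 4) 𝓘(ℝ, E4) G p : E4 →L[ℝ] E4)
      (mfderiv (𝓡∂ 4) 𝓘(ℝ, E4) G p : E4 →L[ℝ] E4))
  have hB : ContMDiff (𝓡∂ 4) ((𝓡∂ 4).prod 𝓘(ℝ, E4 →L[ℝ] E4 →L[ℝ] Mink)) ∞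
      (fun p => (⟨p, formOfComponents f p (B p)⟩ : TotalSpace (E4 →L[ℝ] E4 →L[ℝ] Mink)
        fun x : M => TangentSpace (𝓡∂ 4) x →L[ℝ] TangentSpace (𝓡∂ 4) x →L[ℝ] V x)) := by
    intro p
    have hp := mem_frameAt (P := P) p
    refine contMDiffWithinAt_two_form (p := fun p => p) contMDiffWithinAt_id hp fun u v => ?_
    have h1 := (contMDiffAt_mfderiv_tv hG p u).contMDiffWithinAt (s := univ)
    have h2 := (contMDiffAt_mfderiv_tv hG p v).contMDiffWithinAt (s := univ)
    have h3 := (((coordForm k l z).contDiff (n := ∞)).contMDiff.contMDiffAt.comp_contMDiffWithinAt p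
      h1).clm_apply h2
    have h4 : ∀ i, ContMDiffWithinAt (𝓡∂ 4) 𝓘(ℝ, ℝ) ∞ _ univ p := fun i =>
      (ContinuousLinearMap.proj (R := ℝ) (φ := fun _ : Fin 4 => ℝ)
        i).contMDiff.contMDiffAt.comp_contMDiffWithinAt p h3
    have h5 := fun i => contMDiffWithinAt_coord (frameAt P p) (p := fun p => p) (s := univ) hp
      ((f.smooth i).contMDiffAt (x := p)).contMDiffWithinAt
    have h6 := ContMDiffWithinAt.sum (t := Finset.univ) fun i _ => (h4 i).smul (h5 i)
    refine h6.congr (fun q _ => ?_) ?_ <;>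
    · rw [formOfComponents_apply, LocalFrame.lift_apply, map_sum]
      exact Finset.sum_congr rfl fun i _ => map_smul _ _ _
  refine ⟨⟨(0, 0, ⟨fun p => formOfComponents f p (B p), hB⟩), (fieldSubmodule P).zero_mem.1,
    fun p u => ?_⟩, ?_, ?_, ?_⟩
  · have h : B p u u = 0 := by
      change coordForm k l z _ _ = 0
      rw [coordForm_apply, mul_comm, sub_self, zero_smul]
    exact (congrArg (f.lift p) h).trans (map_zero _)
  · ext1 u
    exact map_zero (f.coord x)
  · ext1 u; ext1 v
    exact map_zero (f.coord x)
  · ext1 u; ext1 v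
    refine (LocalFrame.coord_lift hx _).trans ?_
    have h := fun u : E4 => (congrArg (mfderiv (𝓡∂ 4) 𝓘(ℝ, E4) G x) (tv_self x u)).trans (hGx u)
    exact congrArg₂ (fun a b => coordForm k l z a b) (h u) (h v)

/-- The field equation of `τ`. -/
theorem torsion_eq_zero (h : ∀ X, elForm c d A₀ φ X x = 0) (u v : TangentSpace (𝓡∂ 4) x) :
    torsion A₀ φ x u v = 0 := by
  have hx := mem_frameAt (P := P) x
  have key : (jet A₀ φ (frameAt P x) x (extChartAt (𝓡∂ 4) x x)).torB = 0 := by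
    -- Variations of τ alone reduce the Euler–Lagrange form to the pairing of δτ with the torsion,
    -- which is nondegenerate.
    refine eq_zero_of_alt4 (fun u v => Jet.tor_swap _ u v) fun k l z v => ?_
    obtain ⟨X, h1, h2, h3⟩ := exists_testField (frameAt P x) hx k l z
    have e1 : (vjet X (frameAt P x) x (extChartAt (𝓡∂ 4) x x)).e = 0 :=
      (congrArg (X.eC (frameAt P x) x) (pt_self x)).trans h1
    have e2 : (vjet X (frameAt P x) x (extChartAt (𝓡∂ 4) x x)).A = 0 :=
      (congrArg (X.aC (frameAt P x) x) (pt_self x)).trans h2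
    have e3 : (vjet X (frameAt P x) x (extChartAt (𝓡∂ 4) x x)).τ = coordForm k l z :=
      (congrArg (X.τC (frameAt P x) x) (pt_self x)).trans h3
    have h4 : elForm c d A₀ φ X x v = 0 := congrArg (fun m => m v) (h X)
    have h5 := (elForm_apply (r := c) (s := d) (A₀ := A₀) (φ := φ) (X := X) (x := x) v).symm.trans h4
    have h6 : Jet.el c d (jet A₀ φ (frameAt P x) x (extChartAt (𝓡∂ 4) x x))
        (vjet X (frameAt P x) x (extChartAt (𝓡∂ 4) x x)) = fun a b e g => -(1 / 4) *
        ηC (coordForm k l z a b) ((jet A₀ φ (frameAt P x) x (extChartAt (𝓡∂ 4) x x)).torB e g) := by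
      funext a b e g
      simp only [Jet.el, e1, e2, e3, map_zero, zero_apply, mul_zero, sub_zero, add_zero,
        Jet.torB_apply]
      ring
    rw [h6, alt4_mul] at h5
    linarith
  rw [← torA_apply, torA, formOfComponents_apply, key]
  exact map_zero _

end

/-! ### The two isomorphisms of geometric phase spaces. -/

section

variable {M : Type*} [TopologicalSpace M] [ChartedSpace (EuclideanHalfSpace 4) M]
  [IsManifold (𝓡∂ 4) ∞ M]
  {V : M → Type*} [TopologicalSpace (TotalSpace Mink V)] [∀ x, AddCommGroup (V x)]
  [∀ x, Module ℝ (V x)] [∀ x, TopologicalSpace (V x)] [∀ x, IsTopologicalAddGroup (V x)]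
  [∀ x, ContinuousSMul ℝ (V x)] [FiberBundle Mink V] [VectorBundle ℝ Mink V]
  [ContMDiffVectorBundle ∞ Mink V (𝓡∂ 4)] {P : MinkowskiBundle V} [T2Space M]
  {N : Type*} [TopologicalSpace N] [ChartedSpace (EuclideanSpace ℝ (Fin 3)) N]
  [IsManifold (𝓡 3) ∞ N] [CompactSpace N] [T2Space N]
  (o : OrientationForm M) (b : BoundaryInclusion M N)
  {A₀ : Connection P} {c d : ℝ}
  {L L' : FieldSpace P → ∀ x : M, (Fin 4 → TangentSpace (𝓡∂ 4) x) → ℝ}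

/-- Rotating `A - A₀` by a combination of the identity and the Hodge star is an isomorphism of
geometric phase spaces. -/
theorem exists_symplectic (hL : L = holst c d A₀) (hL' : L' = holst 0 1 A₀)
    (h : c ≠ 0 ∨ d ≠ 0) : ∃ Φ : PhaseSpace ((variationalData A₀ c d hL).twoForm o b) ≃
      PhaseSpace ((variationalData A₀ 0 1 hL').twoForm o b),
      IsPhaseSpaceIso ((variationalData A₀ c d hL).twoForm o b)
        ((variationalData A₀ 0 1 hL').twoForm o b) 1 Φ := by
  have hq : c ^ 2 + d ^ 2 ≠ 0 := by
    rcases h with h | h <;> positivity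
  -- The map is multiplication by d - ci, with inverse (d + ci)/(c² + d²).
  set m := d / (c ^ 2 + d ^ 2) with hm
  set n := c / (c ^ 2 + d ^ 2) with hn
  have e1 : m * d - n * -c = 1 := by rw [hm, hn]; field_simp; ring
  have e2 : m * -c + n * d = 0 := by rw [hm, hn]; field_simp; ring
  have h1 : ∀ φ : FieldSpace P, mix m n (mix d (-c) φ) = φ := fun φ => mix_mix e1 e2
  have h2 : ∀ φ : FieldSpace P, mix d (-c) (mix m n φ) = φ := fun φ =>
    mix_mix (by linarith) (by linarith)
  obtain ⟨Φ, hΦ, -⟩ := exists_phaseSpaceIso (ϖ := (variationalData A₀ c d hL).twoForm o b)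
    (ϖ' := (variationalData A₀ 0 1 hL').twoForm o b) one_ne_zero h1 h2
    (isSmoothMap_mix d (-c)) (isSmoothMap_mix m n) (isTangentMap_mix d (-c)) (isTangentMap_mix m n)
    (fun _ _ => rfl) (fun _ X => h2 X) fun φ X Y => by
      rw [twoForm_variationalData, twoForm_variationalData, one_mul]
      exact congrArg (boundaryIntegral o b) (funext fun x => symplForm_mix.symm)
  exact ⟨Φ, hΦ⟩

/-- Shifting `τ` by a multiple of the torsion is an isomorphism of geometric phase spaces that
preserves the Cauchy data. -/
theorem exists_conformal (hL : L = holst c d A₀) (hL' : L' = holst 0 1 A₀) (hd : d ≠ 0) :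
    ∃ Φ : PhaseSpace ((variationalData A₀ c d hL).twoForm o b) ≃
      PhaseSpace ((variationalData A₀ 0 1 hL').twoForm o b),
      IsPhaseSpaceIso ((variationalData A₀ c d hL).twoForm o b)
        ((variationalData A₀ 0 1 hL').twoForm o b) d Φ ∧
      Φ '' (variationalData A₀ c d hL).cauchyData o b =
        (variationalData A₀ 0 1 hL').cauchyData o b := by
  have hc : 1 / d * c + -c / d = 0 := by field_simp; ring
  -- With t the torsion, the inverse of τ ↦ (τ - ct)/d is τ ↦ dτ + ct.
  have h1 : ∀ φ : FieldSpace P, shift A₀ d c (shift A₀ (1 / d) (-c / d) φ) = φ := fun φ =>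
    shift_shift (mul_one_div_cancel hd) (by field_simp; ring)
  have h2 : ∀ φ : FieldSpace P, shift A₀ (1 / d) (-c / d) (shift A₀ d c φ) = φ := fun φ =>
    shift_shift (one_div_mul_cancel hd) hc
  obtain ⟨Φ, hΦ, hmk⟩ := exists_phaseSpaceIso (ϖ := (variationalData A₀ c d hL).twoForm o b)
    (ϖ' := (variationalData A₀ 0 1 hL').twoForm o b) hd h1 h2 isSmoothMap_shift isSmoothMap_shift
    isTangentMap_shift isTangentMap_shift (fun _ _ => shift_e)
    (fun _ _ => dshift_dshift (one_div_mul_cancel hd) hc) fun φ X Y => by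
      rw [twoForm_variationalData, twoForm_variationalData]
      exact boundaryIntegral_symplForm_shift A₀ hd
  have key : ∀ (φ : FieldSpace P) {U : Set M}, IsOpen U →
      (∀ x ∈ U, ∀ u v, torsion A₀ φ x u v = 0) → ∀ x ∈ U, ∀ X,
      elForm c d A₀ φ X x = d • elForm 0 1 A₀ (shift A₀ (1 / d) (-c / d) φ) X x :=
    fun φ U hU ht x hx X => elForm_shift hd (Filter.eventually_of_mem (hU.mem_nhds hx) ht)
  refine ⟨Φ, hΦ, Subset.antisymm ?_ ?_⟩
  · rintro _ ⟨_, ⟨φ, rfl, U, hU, hbU, h⟩, rfl⟩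
    refine ⟨shift A₀ (1 / d) (-c / d) φ, (hmk φ).symm, U, hU, hbU, fun x hx X => ?_⟩
    have h3 := key φ hU (fun x hx => torsion_eq_zero (h x hx)) x hx X
    have h4 : elForm c d A₀ φ X x = 0 := h x hx X
    rw [h4] at h3
    exact (smul_eq_zero.1 h3.symm).resolve_left hd
  · rintro _ ⟨ψ, rfl, U, hU, hbU, h⟩
    refine ⟨PhaseSpace.mk _ (shift A₀ d c ψ), ⟨shift A₀ d c ψ, rfl, U, hU, hbU, fun x hx X => ?_⟩,
      (hmk _).trans (congrArg _ (h2 ψ))⟩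
    -- The equation of τ is available for ψ in the target theory. The shifted field has the same e
    -- and A, hence the same vanishing torsion, and the comparison of Euler–Lagrange forms applies
    -- to it.
    have h3 := key (shift A₀ d c ψ) hU (fun x hx u v =>
      (torsion_congr (fun _ => shift_e) (fun _ => shift_a) u v).trans
        (torsion_eq_zero (h x hx) u v)) x hx X
    have h4 : elForm 0 1 A₀ ψ X x = 0 := h x hx X
    rw [h2, h4, smul_zero] at h3
    exact h3

end

end

end QGH

theorem mainTheorem11
    {M : Type*} [TopologicalSpace M] [ChartedSpace (EuclideanHalfSpace 4) M]
    [IsManifold (𝓡∂ 4) ∞ M] [CompactSpace M] [T2Space M]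
    {N : Type*} [TopologicalSpace N] [ChartedSpace (EuclideanSpace ℝ (Fin 3)) N]
    [IsManifold (𝓡 3) ∞ N] [CompactSpace N] [T2Space N]
    {V : M → Type*} [TopologicalSpace (TotalSpace QGH.Mink V)] [∀ x, AddCommGroup (V x)]
    [∀ x, Module ℝ (V x)] [∀ x, TopologicalSpace (V x)] [∀ x, IsTopologicalAddGroup (V x)]
    [∀ x, ContinuousSMul ℝ (V x)] [FiberBundle QGH.Mink V] [VectorBundle ℝ QGH.Mink V]
    [ContMDiffVectorBundle ∞ QGH.Mink V (𝓡∂ 4)]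
    (o : QGH.OrientationForm M) (b : QGH.BoundaryInclusion M N)
    (P : QGH.MinkowskiBundle V) (A₀ : QGH.Connection P) :
    (IsUnit QGH.star ∧ QGH.IsDeformation QGH.starDeformation ∧
      ∀ φ : QGH.FieldSpace P,
        QGH.action o (QGH.qgHLagrangian A₀ QGH.starDeformation (-1)) φ =
          QGH.action o (QGH.halfShellLagrangian A₀) φ) ∧
    ∃ D' : QGH.VariationalData (QGH.halfShellLagrangian A₀),
      ∀ T : Module.End ℝ QGH.so31, QGH.IsDeformation T → T ≠ 1 →
        IsUnit ((1 : Module.End ℝ QGH.so31) + (-1 : ℝ) • T) ∧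
        ∃ D : QGH.VariationalData (QGH.qgHLagrangian A₀ T (-1)),
          (∃ Φ : QGH.PhaseSpace (D.twoForm o b) ≃ QGH.PhaseSpace (D'.twoForm o b),
            QGH.IsPhaseSpaceIso (D.twoForm o b) (D'.twoForm o b) 1 Φ) ∧
          ((∀ r : ℝ, T ≠ r • (1 : Module.End ℝ QGH.so31)) →
            ∃ k : ℝ, k ≠ 0 ∧
              ∃ Φ : QGH.PhaseSpace (D.twoForm o b) ≃ QGH.PhaseSpace (D'.twoForm o b),
                QGH.IsPhaseSpaceIso (D.twoForm o b) (D'.twoForm o b) k Φ ∧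
                Φ '' D.cauchyData o b = D'.cauchyData o b) := by
  refine ⟨⟨QGH.isUnit_star, QGH.isDeformation_starDeformation, fun φ => ?_⟩,
    QGH.variationalData A₀ 0 1 QGH.halfShellLagrangian_eq, fun T hT h1 => ?_⟩
  · have h : Ring.inverse ((1 : Module.End ℝ QGH.so31) + (-1 : ℝ) • QGH.starDeformation) =
        (0 : ℝ) • (1 : Module.End ℝ QGH.so31) + (1 : ℝ) • QGH.star := by
      rw [QGH.inverse_one_sub_starDeformation, zero_smul, one_smul, zero_add]
    rw [QGH.qgHLagrangian_eq h, QGH.halfShellLagrangian_eq]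
  · obtain ⟨hu, c, d, hcd, hinv, hd⟩ := hT.inverse_one_sub h1
    -- The same data serve both remaining claims: the rotation of a needs only (c, d) ≠ 0, while the
    -- shift of τ divides by d, which is nonzero when T is not real and is the conformal factor.
    refine ⟨hu, QGH.variationalData A₀ c d (QGH.qgHLagrangian_eq hinv),
      QGH.exists_symplectic o b _ _ hcd, fun hr => ⟨d, hd hr, ?_⟩⟩
    exact QGH.exists_conformal o b _ _ (hd hr)
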